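/- **Extract-and-Simulate Lemma.** *Conventions.* A function $\nu:\mathbb N\to\mathbb R$ is negligible if for every $c\in\mathbb N$, $|\nu(\lambda)|<\lambda^{-c}$ for all large $\lambda$; $\varepsilon:\mathbb N\to\mathbb R$ is noticeable if for some $c\in\mathbb N$, $\varepsilon(\lambda)\ge\lambda^{-c}$ for all large $\lambda$. Quantum circuits are over Hadamard, $T$, CNOT, $X$ and Toffoli gates, with ancillas initialised to $|0\rangle$, with classical outputs measured at the end and all other wires discarded. A QPT algorithm with classical and quantum input is a polynomial-time Turing machine that on the classical input writes down a quantum circuit, which is then run on the quantum input. *Setting.* For each $\lambda\in\mathbb N$ let $k,n,m,r\in\mathbb N$, let $C\subseteq\{0,1\}^k$ be a nonempty finite set, let $\mathcal H=(\mathbb C^2)^{\otimes n}$, let $\{\Pi_i\}_{i\in C}$ be orthogonal projectors on $\mathcal H$, and let $|\psi_{\mathrm{init}}\rangle\in\mathcal H$ be a unit vector (all of this depends on $\lambda$). Let there be quantum circuits, of size polynomial in $\lambda$ (as are $k,n,m,r$), such that * the circuit $\mathsf{Samp}$ outputs an element of $\{0,1\}^k$ whose distribution is within negligible statistical distance of the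 uniform distribution on $C$; * the circuit $\mathsf{M}$, on input $i\in C$ and a state in $\mathcal H$, performs the measurement $\{\Pi_i,I-\Pi_i\}$ (returning the outcome and the post-measurement state); * $\mathcal A_0$ takes $i\in\{0,1\}^k$ and a state in $\mathcal H$ to a string in $\{0,1\}^m$, and $\mathcal A_1$ takes $(i,j,s,s')\in\{0,1\}^{k+k+m+m}$ to a string in $\{0,1\}^r$. Suppose that there are sets $S\subseteq C^2$, strings $s_i\in\{0,1\}^m$ ($i\in C$) and a string $s^*\in\{0,1\}^r$ (all depending on $\lambda$) such that 1. $1-|S|/|C|^2$ is negligible in $\lambda$; 2. for all $i\in C$ and every unit vector $|\phi\rangle$ in the range of $\Pi_i$, $\Pr[\mathcal A_0(i,|\phi\rangle)=s_i]=1$; 3. for all $(i,j)\in S$, $\Pr[\mathcal A_1(i,j,s_i,s_j)=s^*]=1$. Let $\mathsf{Exp}(\lambda)$ be the (possibly inefficient) experiment that chooses $i$ uniformly from $C$, applies the measurement $\{\Pi_i,I-\Pi_i\}$ to $|\psi_{\mathrm{init}}\rangle$, and outputs $i$, the string $s^*$ if the state was projected onto $\Pi_i$ and $\bot$ if it was projected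 onto $I-\Pi_i$, and the normalised post-measurement state. *Claim.* There is a QPT algorithm $\mathcal{SE}$, the same for all such data, such that for all such data and every noticeable $\varepsilon$ there is a negligible function $\nu$ such that for all $\lambda$, every (computationally unbounded) distinguisher has advantage at most $\varepsilon(\lambda)+\nu(\lambda)$ in distinguishing the output of $\mathcal{SE}(1^\lambda,1^{\lceil1/\varepsilon(\lambda)\rceil},k,n,m,r,\mathsf{Samp},\mathsf M,\mathcal A_0,\mathcal A_1,|\psi_{\mathrm{init}}\rangle)$, which is a triple of an element of $\{0,1\}^k$, an element of $\{0,1\}^r\cup\{\bot\}$ and an $n$-qubit state, from the output of $\mathsf{Exp}(\lambda)$. Here $\mathcal{SE}$ receives $k,n,m,r$ in unary and the circuits as classical descriptions, and a single copy of $|\psi_{\mathrm{init}}\rangle$. -/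

import Mathlib

open Matrix Filter
open scoped BigOperators ComplexOrder

namespace ExtSim

/-! ### Asymptotics -/

/-- `f` is eventually smaller in absolute value than every inverse polynomial. -/
def Negligible (f : ℕ → ℝ) : Prop :=
  ∀ c : ℕ, ∀ᶠ l : ℕ in atTop, |f l| < 1 / (l : ℝ) ^ c

/-- `f` is eventually at least some inverse polynomial. -/
def Noticeable (f : ℕ → ℝ) : Prop :=
  ∃ c : ℕ, ∀ᶠ l : ℕ in atTop, 1 / (l : ℝ) ^ c ≤ f l

/-! ### Bit strings and wires -/

/-- Bit strings of length `w`, which also label the computational basis of `w` qubits. -/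
abbrev Bits (w : ℕ) : Type := Fin w → Bool

/-- The bit on wire `a` (`false` if there is no such wire). -/
def bitAt {w : ℕ} (b : Bits w) (a : ℕ) : Bool := if h : a < w then b ⟨a, h⟩ else false

def setBit {w : ℕ} (b : Bits w) (a : ℕ) (v : Bool) : Bits w :=
  fun j => if (j : ℕ) = a then v else b j

def flipBit {w : ℕ} (b : Bits w) (a : ℕ) : Bits w := setBit b a (!bitAt b a)

/-- The contents of the `len` consecutive wires that start at wire `off`. -/
def slice {w : ℕ} (b : Bits w) (off len : ℕ) : Bits len := fun j => bitAt b (off + j)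

/-! ### Quantum circuits -/

/-- The universal gate set Hadamard, `T`, CNOT, extended by `X` and Toffoli. In `CX c t` and
`CCX c d t` the target is `t`. -/
inductive Gate : Type
  | X (a : ℕ) : Gate
  | H (a : ℕ) : Gate
  | T (a : ℕ) : Gate
  | CX (c t : ℕ) : Gate
  | CCX (c d t : ℕ) : Gate

/-- Action of a gate on a vector of `w` qubits. A gate on a wire that does not exist, or whose
target is one of its controls, acts as the identity. -/
noncomputable def Gate.apply {w : ℕ} (g : Gate) (ψ : Bits w → ℂ) : Bits w → ℂ := fun b =>
  match g with
  | Gate.X a => ψ (flipBit b a)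
  | Gate.H a =>
      if a < w then
        (ψ (setBit b a false) + (if bitAt b a = true then -1 else 1) * ψ (setBit b a true))
          / (Real.sqrt 2 : ℂ)
      else ψ b
  | Gate.T a =>
      if bitAt b a = true then Complex.exp (Complex.I * (Real.pi / 4)) * ψ b else ψ b
  | Gate.CX c t => if c ≠ t ∧ bitAt b c = true then ψ (flipBit b t) else ψ b
  | Gate.CCX c d t =>
      if c ≠ t ∧ d ≠ t ∧ bitAt b c = true ∧ bitAt b d = true then ψ (flipBit b t) else ψ b

/-- A quantum circuit: the number of its ancilla qubits and its gates in order of application.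
The number of the remaining wires (input and output registers) is given by the context. -/
structure QCircuit : Type where
  anc : ℕ
  gates : List Gate

/-- The vector of `w` qubits that has the classical string `x` on its first `c` wires, the vector
`φ` on the next `q` wires and zeros on all the others. -/
def inputState {c q : ℕ} (w : ℕ) (x : Bits c) (φ : Bits q → ℂ) : Bits w → ℂ := fun b =>
  if slice b 0 c = x ∧ ∀ j : Fin w, c + q ≤ (j : ℕ) → b j = false then φ (slice b c q) else 0

/-- The final vector of a circuit with `d` register wires and `A.anc` ancilla wires behind them,
started on the classical string `x` and the quantum input `φ`, all other wires being zero. All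
measurements are deferred to the end. -/
noncomputable def QCircuit.run (A : QCircuit) (d : ℕ) {c q : ℕ} (x : Bits c) (φ : Bits q → ℂ) :
    Bits (d + A.anc) → ℂ :=
  A.gates.foldl (fun ψ g => g.apply ψ) (inputState (d + A.anc) x φ)

/-- Probability that measuring the vector `ψ` in the computational basis and reading the value
`read` off the outcome gives `y`. -/
noncomputable def prob {w : ℕ} {Y : Type} [DecidableEq Y] (ψ : Bits w → ℂ) (read : Bits w → Y)
    (y : Y) : ℝ :=
  ∑ b, if read b = y then ‖ψ b‖ ^ 2 else 0

/-- The classical-quantum output of a vector `ψ`: `cqOutput ψ read off n y` is the unnormalised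
density matrix of the `n` qubits from wire `off` on (all other wires are measured or discarded)
in the event that the classical outcome is `y`; its trace is the probability of that event.
The function `read` is meant to depend only on the other wires. -/
noncomputable def cqOutput {w : ℕ} {Y : Type} [DecidableEq Y] (ψ : Bits w → ℂ)
    (read : Bits w → Y) (off n : ℕ) (y : Y) : Matrix (Bits n) (Bits n) ℂ := fun a a' =>
  ∑ b, ∑ b',
    if read b = y ∧ read b' = y ∧ slice b off n = a ∧ slice b' off n = a' ∧
        (∀ j : Fin w, ¬ (off ≤ (j : ℕ) ∧ (j : ℕ) < off + n) → b j = b' j)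
    then ψ b * star (ψ b') else 0

/-- `|v⟩⟨v|` -/
def ketbra {n : ℕ} (v : Bits n → ℂ) : Matrix (Bits n) (Bits n) ℂ := vecMulVec v (star v)

/-! ### Uniform quantum polynomial time -/

/-- The tape alphabet for descriptions of circuits. -/
inductive Sym : Type
  | tally | comma | gX | gH | gT | gCX | gCCX | close
  deriving DecidableEq

instance : Fintype Sym where
  elems := {Sym.tally, Sym.comma, Sym.gX, Sym.gH, Sym.gT, Sym.gCX, Sym.gCCX, Sym.close}
  complete := by intro a; cases a <;> decide

def unary (a : ℕ) : List Sym := List.replicate a Sym.tally ++ [Sym.comma]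

def Gate.encode : Gate → List Sym
  | Gate.X a => Sym.gX :: unary a
  | Gate.H a => Sym.gH :: unary a
  | Gate.T a => Sym.gT :: unary a
  | Gate.CX c t => Sym.gCX :: (unary c ++ unary t)
  | Gate.CCX c d t => Sym.gCCX :: (unary c ++ unary d ++ unary t)

def QCircuit.encode (A : QCircuit) : List Sym :=
  unary A.anc ++ A.gates.flatMap Gate.encode ++ [Sym.close]

/-- A quantum algorithm with classical input in `α` (written on the tape by `enc`) and quantum
input is a map that sends the classical input to the circuit that is run on the quantum input. It
is quantum polynomial time if some Turing machine writes down that circuit in time polynomial in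
the length of the classical input. -/
def IsQPT {α : Type} (enc : α → List Sym) (f : α → QCircuit) : Prop :=
  Nonempty (Turing.TM2ComputableInPolyTime enc QCircuit.encode f)

/-! ### The extraction setting -/

/-- The classical data handed to the extractor for one value of the security parameter: the
lengths `k`, `n`, `m`, `r` of the indices `i`, of the quantum register, of the strings `s i` and
of the string `s*`, and circuits that sample an index, perform the measurements
`{Π i, 1 - Π i}`, and implement the algorithms `A₀` and `A₁`. -/
structure Desc : Type where
  k : ℕ
  n : ℕ
  m : ℕ
  r : ℕ
  sampler : QCircuit
  meas : QCircuit
  alg0 : QCircuit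
  alg1 : QCircuit

def Desc.encode (D : Desc) : List Sym :=
  unary D.k ++ unary D.n ++ unary D.m ++ unary D.r ++
    D.sampler.encode ++ D.meas.encode ++ D.alg0.encode ++ D.alg1.encode

/-- The classical input `(1^λ, 1^e, description)` of the extractor. -/
structure SEInput : Type where
  lam : ℕ
  e : ℕ
  desc : Desc

def SEInput.encode (I : SEInput) : List Sym := unary I.lam ++ unary I.e ++ I.desc.encode

/-- The descriptions have polynomial size. -/
def PolySize (D : ℕ → Desc) : Prop :=
  ∃ p : Polynomial ℕ, ∀ l, (D l).encode.length ≤ p.eval l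

/-- The probability that the sampler (no input, output on wires `0, …, k - 1`) outputs `y`. -/
noncomputable def Desc.sampleProb (D : Desc) (y : Bits D.k) : ℝ :=
  prob (D.sampler.run D.k (default : Bits 0) (fun _ : Bits 0 => 1)) (fun z => slice z 0 D.k) y

/-- The `ℓ¹` distance of the sampler's output distribution from the uniform distribution
on `C`. -/
noncomputable def Desc.sampleError (D : Desc) (C : Finset (Bits D.k)) : ℝ :=
  ∑ y, |D.sampleProb y - if y ∈ C then 1 / (C.card : ℝ) else 0|

/-- On every index `i ∈ C` (wires `0, …, k - 1`) and every state (the next `n` wires), the circuit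
`meas` performs the projective measurement `{P i, 1 - P i}`: the outcome (`true` for `P i`) is on
wire `k + n` and the post-measurement state stays in its `n` wires. -/
def Desc.Measures (D : Desc) (C : Finset (Bits D.k))
    (P : Bits D.k → Matrix (Bits D.n) (Bits D.n) ℂ) : Prop :=
  ∀ i ∈ C, ∀ φ : Bits D.n → ℂ, ∀ o : Bool,
    cqOutput (D.meas.run (D.k + D.n + 1) i φ) (fun z => bitAt z (D.k + D.n)) D.k D.n o =
      ketbra ((if o = true then P i else 1 - P i) *ᵥ φ)

/-- `Pr[A₀(i, φ) = s]`; the output register follows the two input registers. -/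
noncomputable def Desc.prob0 (D : Desc) (i : Bits D.k) (φ : Bits D.n → ℂ) (s : Bits D.m) : ℝ :=
  prob (D.alg0.run (D.k + D.n + D.m) i φ) (fun z => slice z (D.k + D.n) D.m) s

/-- `Pr[A₁(i, j, s, s') = t]`; the output register follows the input registers. -/
noncomputable def Desc.prob1 (D : Desc) (i j : Bits D.k) (s s' : Bits D.m) (t : Bits D.r) : ℝ :=
  prob
    (D.alg1.run ((D.k + D.k) + (D.m + D.m) + D.r) (Fin.append (Fin.append i j) (Fin.append s s'))
      (fun _ : Bits 0 => 1))
    (fun z => slice z ((D.k + D.k) + (D.m + D.m)) D.r) t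

/-- Ensembles over triples of an index, a string or `⊥` (`none`), and an `n`-qubit state: for each
value of the classical part, the density matrix of the state times the probability of that
value. -/
abbrev CQ (k r n : ℕ) : Type := Bits k × Option (Bits r) → Matrix (Bits n) (Bits n) ℂ

/-- The output of an extractor circuit on the state `ψ`. The state is on wires `0, …, n - 1`, the
index on the next `k` wires, then follow one wire that tells whether a string is output (`false`
stands for `⊥`), and `r` wires for that string. -/
noncomputable def extractorOutput (A : QCircuit) (k r n : ℕ) (ψ : Bits n → ℂ) : CQ k r n :=
  cqOutput (A.run (n + k + 1 + r) (default : Bits 0) ψ)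
    (fun z => (slice z n k,
      if bitAt z (n + k) = true then some (slice z (n + k + 1) r) else none))
    0 n

/-- The experiment: choose `i` uniformly from `C`, measure `{P i, 1 - P i}` on `ψ`, and output `i`,
the string `t` if the state was projected onto `P i` and `⊥` otherwise, and the post-measurement
state. (The probability of an outcome times the normalised post-measurement state is
`|v⟩⟨v| / |C|`, where `v` is the projected vector.) -/
noncomputable def experiment {k r n : ℕ} (C : Finset (Bits k))
    (P : Bits k → Matrix (Bits n) (Bits n) ℂ) (t : Bits r) (ψ : Bits n → ℂ) : CQ k r n
  | (i, some s) => if i ∈ C ∧ s = t then (1 / (C.card : ℂ)) • ketbra (P i *ᵥ ψ) else 0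
  | (i, none) => if i ∈ C then (1 / (C.card : ℂ)) • ketbra ((1 - P i) *ᵥ ψ) else 0

/-! ### Statistical indistinguishability -/

/-- An unbounded distinguisher: for each value of the classical part, the effect by which it
accepts. -/
def IsDistinguisher {k r n : ℕ} (E : CQ k r n) : Prop :=
  ∀ y, (E y).PosSemidef ∧ (1 - E y).PosSemidef

/-- The probability that the distinguisher `E` accepts the ensemble `ρ`. -/
noncomputable def acceptProb {k r n : ℕ} (E ρ : CQ k r n) : ℝ := ∑ y, ((E y * ρ y).trace).re

/-- No distinguisher has advantage more than `ε` plus a negligible function. -/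
def StatClose {k r n : ℕ → ℕ} (ε : ℕ → ℝ) (ρ σ : ∀ l, CQ (k l) (r l) (n l)) : Prop :=
  ∃ ν : ℕ → ℝ, Negligible ν ∧ ∀ l, ∀ E : CQ (k l) (r l) (n l), IsDistinguisher E →
    |acceptProb E (ρ l) - acceptProb E (σ l)| ≤ ε l + ν l

end ExtSim

open ExtSim

/-!
The extractor samples `i`, measures `{P i, 1 - P i}` on the state and, if the state was projected
onto `P i`, has to find the string `t` and to restore the state. It computes the string coherently,
copies it, and runs the computation backwards. If the computed string is `t` up to a small error,
then copying it hardly disturbs the state (`Ext.nrm_copy_sub_le`), so everything comes down to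
computing `t` with small error from the projected state `P i ψ`.

The string `s i` is computed from that state by the first algorithm, which is deterministic on the
range of `P i`, and uncomputed (`Ext.ap_first`). It remains to reach the range of `P j` for a random
`j` with `(i, j) ∈ S`; there, the two algorithms give `t` (`Ext.supp_last`). For this, the circuit
prepares the superposition of all `j` with the amplitudes of the sampler, and alternates two steps:
measure `P j`, and, if this has failed so far, reflect about the subspace in which the superposition
of the `j` is the initial one and the state is in the range of `P i`. Flags record in which round
the measurement succeeded, and a success is not touched by later rounds (`Ext.round_found`,
`Ext.round_rest`). The failed branch is described by vectors `u` of the quantum register alone: with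
`M` the average of the `P j`, a round maps `u` to `(2 P i M - 1) u` on the range of `P i` (`useq`,
`Ext.ap_rounds`).

In an eigenbasis of `P i M P i` with eigenvalues `lam`, a round multiplies by `2 lam - 1`. So after
`T` rounds the failed branch is concentrated on eigenvalues near `0`, as well as near `1`, where
however the measurement succeeds. If the failure probability is large, then there is a witness in
the range of `P i`, not orthogonal to `ψ`, whose expectation of `M` is at most `1 / (4 (T + 1))`
times the failure probability (`exists_witness`). This smallness means that the witnesses for
different `i` are nearly orthogonal, and then the unit vector `ψ` cannot have a large inner product
with many of them. Hence the failure probability is at most `√(1 / (4 (T + 1)))` on average over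
`i`, without any assumption on the projections (`sum_failure_le`). The advantage of a distinguisher
is bounded by the distance of the output state from the ideal one (`Ext.advantage_le`), which is
small when `T` is a suitable multiple of the fourth power of `1 / ε`. The pairs outside `S` and the
error of the sampler contribute a negligible amount, as `T` is polynomial (`negligible_defect`).

The measurement circuit may leave garbage on its other wires, but running it, projecting to the
outcome `true` and running it backwards is exactly `P i` (`conjMask_meas`). Nothing has to be undone
for the wires of the sampler of `i`: they are discarded at the end, and they keep the contributions
of different `i` orthogonal.

That the circuit can be written down in polynomial time is shown by means of a small language of
circuit-writing programs with arithmetic expressions, loops, and loops through the gates of a given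
circuit (`Gen`). Its programs are compiled to structured programs over stacks (`Prog`), and these to
Turing machines with several stacks, with polynomial bounds for the running time (`Gen.exec`,
`isQPT_of_gen`). The language is closed under inversion of the circuit (`Gen.inv`), which provides
all the uncomputations.
-/


/-! ### Structured stack programs and their compilation to Turing machines -/

namespace ExtSim

/-- Structured programs over stacks of symbols, indexed by `K`: push a symbol, pop a symbol and
branch on it, sequencing, and a loop guarded by a condition on the top symbol of a stack. -/
inductive Prog (K : Type) : Type
  | push (k : K) (a : Sym) : Prog K
  | pop (k : K) (f : Option Sym → Prog K) : Prog K
  | seq (p q : Prog K) : Prog K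
  | loop (k : K) (c : Option Sym → Bool) (p : Prog K) : Prog K

namespace Prog

variable {K : Type}

/-- The program points of a program, used as labels of a Turing machine. -/
def Lab : Prog K → Type
  | push _ _ => Unit
  | pop _ f => Option (Σ o, Lab (f o))
  | seq p q => Lab p ⊕ Lab q
  | loop _ _ p => Option (Lab p)

/-- The program point at which the execution starts. -/
def entry : (p : Prog K) → Lab p
  | push _ _ => ()
  | pop _ _ => none
  | seq p _ => Sum.inl (entry p)
  | loop _ _ _ => none

theorem finite_lab : ∀ p : Prog K, Finite (Lab p)
  | push _ _ => inferInstanceAs (Finite Unit)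
  | pop _ f => by
      have : ∀ o, Finite (Lab (f o)) := fun o => finite_lab (f o)
      exact inferInstanceAs (Finite (Option (Σ o, Lab (f o))))
  | seq p q => by
      have := finite_lab p
      have := finite_lab q
      exact inferInstanceAs (Finite (Lab p ⊕ Lab q))
  | loop _ _ p => by
      have := finite_lab p
      exact inferInstanceAs (Finite (Option (Lab p)))

/-- The statement of the Turing machine at each program point. The labels of the program are
embedded into those of the machine by `emb`, and control passes to `exit` at the end. The internal
state of the machine is the symbol read last. -/
def code {Λ : Type} : (p : Prog K) → (Lab p → Λ) → Λ → Lab p →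
    Turing.TM2.Stmt (fun _ : K => Sym) Λ (Option Sym)
  | push k a, _, exit, _ => .push k (fun _ => a) (.goto fun _ => exit)
  | pop k f, emb, _, none => .pop k (fun _ o => o) (.goto fun o => emb (some ⟨o, entry (f o)⟩))
  | pop _ f, emb, exit, some ⟨o, l⟩ => code (f o) (fun l => emb (some ⟨o, l⟩)) exit l
  | seq p q, emb, _, Sum.inl l =>
      code p (fun l => emb (Sum.inl l)) (emb (Sum.inr (entry q))) l
  | seq _ q, emb, exit, Sum.inr l => code q (fun l => emb (Sum.inr l)) exit l
  | loop k c p, emb, exit, none =>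
      .peek k (fun _ o => o) (.goto fun o => if c o = true then emb (some (entry p)) else exit)
  | loop _ _ p, emb, _, some l => code p (fun l => emb (some l)) (emb none) l

variable [DecidableEq K]

/-- `Run p S S' t`: started on the stacks `S`, the program `p` ends with the stacks `S'` after `t`
steps. -/
inductive Run : Prog K → (K → List Sym) → (K → List Sym) → ℕ → Prop
  | push (k a S) : Run (push k a) S (Function.update S k (a :: S k)) 1
  | pop {k f S S' t} : Run (f (S k).head?) (Function.update S k (S k).tail) S' t →
      Run (pop k f) S S' (t + 1)
  | seq {p q S S' S'' t t'} : Run p S S' t → Run q S' S'' t' → Run (seq p q) S S'' (t + t')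
  | loop_false {k c p S} : c (S k).head? = false → Run (loop k c p) S S 1
  | loop_true {k c p S S' S'' t t'} : c (S k).head? = true → Run p S S' t →
      Run (loop k c p) S' S'' t' → Run (loop k c p) S S'' (t + t' + 1)

/-- A machine that contains the code of a program simulates its runs step by step. -/
theorem Run.simulate {p : Prog K} {S S' : K → List Sym} {t : ℕ} (h : Run p S S' t) :
    ∀ {Λ : Type} (M : Λ → Turing.TM2.Stmt (fun _ : K => Sym) Λ (Option Sym)) (emb : Lab p → Λ)
      (exit : Λ), (∀ l, M (emb l) = code p emb exit l) → ∀ v : Option Sym, ∃ v' : Option Sym,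
      (flip Bind.bind (Turing.TM2.step M))^[t]
        (some (⟨some (emb (entry p)), v, S⟩ : Turing.TM2.Cfg (fun _ : K => Sym) Λ (Option Sym))) =
        some ⟨some exit, v', S'⟩ := by
  induction h with
  | push k a S =>
    intro Λ M emb exit hM v
    refine ⟨v, ?_⟩
    have := hM ()
    simp only [Function.iterate_one, flip, Option.bind_eq_bind, Option.bind_some]
    change Turing.TM2.step M ⟨some (emb ()), v, S⟩ = _
    simp [this, code]
  | @pop k f S S' t _ ih =>
    intro Λ M emb exit hM v
    obtain ⟨v', hv'⟩ := ih M (fun l => emb (some ⟨_, l⟩)) exit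
      (fun l => hM (some ⟨_, l⟩)) (S k).head?
    refine ⟨v', ?_⟩
    rw [Function.iterate_succ_apply, ← hv']
    congr 1
    have := hM none
    simp only [flip, Option.bind_eq_bind, Option.bind_some]
    change Turing.TM2.step M ⟨some (emb none), v, S⟩ = _
    simp [this, code]
  | @seq p q S S' S'' t t' _ _ ih ih' =>
    intro Λ M emb exit hM v
    obtain ⟨v', hv'⟩ := ih M (fun l => emb (Sum.inl l)) (emb (Sum.inr (entry q)))
      (fun l => hM (Sum.inl l)) v
    obtain ⟨v'', hv''⟩ := ih' M (fun l => emb (Sum.inr l)) exit (fun l => hM (Sum.inr l)) v'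
    refine ⟨v'', ?_⟩
    rw [Nat.add_comm, Function.iterate_add_apply]
    refine Eq.trans ?_ hv''
    congr 1
  | @loop_false k c p S h =>
    intro Λ M emb exit hM v
    refine ⟨(S k).head?, ?_⟩
    have := hM none
    simp only [Function.iterate_one, flip, Option.bind_eq_bind, Option.bind_some]
    change Turing.TM2.step M ⟨some (emb none), v, S⟩ = _
    simp [this, code, h]
  | @loop_true k c p S S' S'' t t' h _ _ ih ih' =>
    intro Λ M emb exit hM v
    obtain ⟨v', hv'⟩ := ih M (fun l => emb (some l)) (emb none)
      (fun l => hM (some l)) (S k).head?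
    obtain ⟨v'', hv''⟩ := ih' M emb exit hM v'
    refine ⟨v'', ?_⟩
    rw [Function.iterate_succ_apply, Nat.add_comm, Function.iterate_add_apply]
    refine Eq.trans ?_ hv''
    congr 1
    refine Eq.trans ?_ hv'
    congr 1
    have := hM none
    simp only [flip, Option.bind_eq_bind, Option.bind_some]
    change Turing.TM2.step M ⟨some (emb none), v, S⟩ = _
    simp [this, code, h]

/-- The Turing machine that runs a program and halts. -/
noncomputable def toTM [Fintype K] (p : Prog K) (k₀ k₁ : K) : Turing.FinTM2 where
  K := K
  k₀ := k₀
  k₁ := k₁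
  Γ _ := Sym
  Λ := Option (Lab p)
  main := some (entry p)
  ΛFin := by
    have := finite_lab p
    exact Fintype.ofFinite _
  σ := Option Sym
  initialState := none
  Γk₀Fin := inferInstanceAs (Fintype Sym)
  m
    | none => .load (fun _ => none) .halt
    | some l => code p some none l

/-- A map is computable in polynomial time if some program computes it within a polynomial number
of steps, clearing all stacks but the output stack. -/
theorem polyTime_of_run [Fintype K] {α β : Type} {ea : α → List Sym} {eb : β → List Sym}
    {f : α → β} (p : Prog K) (k₀ k₁ : K) (P : Polynomial ℕ)
    (h : ∀ a, ∃ t ≤ P.eval (ea a).length,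
      Run p (fun k => if k = k₀ then ea a else []) (fun k => if k = k₁ then eb (f a) else []) t) :
    Nonempty (Turing.TM2ComputableInPolyTime ea eb f) := by
  choose t ht hr using h
  refine ⟨⟨⟨toTM p k₀ k₁, Equiv.refl _, Equiv.refl _⟩, P + 1, fun a => ⟨⟨t a + 1, ?_⟩, ?_⟩⟩⟩
  · obtain ⟨v', hv'⟩ := (hr a).simulate (toTM p k₀ k₁).m some none (fun l => rfl) none
    rw [Nat.add_comm, Function.iterate_add_apply]
    have key : ∀ (k₂ : K) (l : List Sym) (k : K) (h : k = k₂ → List Sym = List Sym),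
        (if hk : k = k₂ then (h hk).mpr l else []) = if k = k₂ then l else [] := by
      intro k₂ l k h
      split_ifs <;> rfl
    have e1 : (Turing.initList (toTM p k₀ k₁) (List.map (Equiv.refl Sym).invFun (ea a))) =
        (⟨some (some (entry p)), none, fun k => if k = k₀ then ea a else []⟩ :
          Turing.TM2.Cfg (fun _ : K => Sym) (Option (Lab p)) (Option Sym)) := by
      unfold Turing.initList
      congr 1
      funext (k : K)
      exact (key k₀ _ k fun _ => rfl).trans
        (congrArg (fun l : List Sym => if (k : K) = k₀ then l else []) (List.map_id (ea a)))
    have e2 : (Turing.haltList (toTM p k₀ k₁) (List.map (Equiv.refl Sym).invFun (eb (f a)))) =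
        (⟨none, none, fun k => if k = k₁ then eb (f a) else []⟩ :
          Turing.TM2.Cfg (fun _ : K => Sym) (Option (Lab p)) (Option Sym)) := by
      unfold Turing.haltList
      congr 1
      funext (k : K)
      exact (key k₁ _ k fun _ => rfl).trans
        (congrArg (fun l : List Sym => if (k : K) = k₁ then l else []) (List.map_id (eb (f a))))
    refine Eq.trans (congrArg _ (Eq.trans ?_ hv')) ?_
    · exact congrArg _ (congrArg some e1)
    · refine Eq.trans ?_ (congrArg some e2).symm
      rfl
  · simpa using ht a

/-- `Exec p S S' B`: started on the stacks `S`, the program `p` ends with the stacks `S'` after at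
most `B` steps. -/
def Exec (p : Prog K) (S S' : K → List Sym) (B : ℕ) : Prop := ∃ t ≤ B, Run p S S' t

theorem Exec.mono {p : Prog K} {S S' : K → List Sym} {B B' : ℕ} (h : Exec p S S' B)
    (hB : B ≤ B') : Exec p S S' B' := by
  obtain ⟨t, ht, h⟩ := h
  exact ⟨t, ht.trans hB, h⟩

theorem Exec.push (k : K) (a : Sym) (S : K → List Sym) :
    Exec (push k a) S (Function.update S k (a :: S k)) 1 := ⟨1, le_rfl, Run.push _ _ _⟩

theorem Exec.pop {k : K} {f : Option Sym → Prog K} {S S' : K → List Sym} {B : ℕ} (o : Option Sym)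
    (l : List Sym) (ho : (S k).head? = o) (hl : (S k).tail = l)
    (h : Exec (f o) (Function.update S k l) S' B) : Exec (pop k f) S S' (B + 1) := by
  subst ho hl
  obtain ⟨t, ht, h⟩ := h
  exact ⟨t + 1, by omega, Run.pop h⟩

theorem Exec.seq {p q : Prog K} {S S' S'' : K → List Sym} {B B' : ℕ} (h : Exec p S S' B)
    (h' : Exec q S' S'' B') : Exec (seq p q) S S'' (B + B') := by
  obtain ⟨t, ht, h⟩ := h
  obtain ⟨t', ht', h'⟩ := h'
  exact ⟨t + t', by omega, Run.seq h h'⟩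

theorem Exec.loop_false {k : K} {c : Option Sym → Bool} {p : Prog K} {S : K → List Sym}
    (h : c (S k).head? = false) : Exec (loop k c p) S S 1 := ⟨1, le_rfl, Run.loop_false h⟩

theorem Exec.loop_true {k : K} {c : Option Sym → Bool} {p : Prog K} {S S' S'' : K → List Sym}
    {B B' : ℕ} (h : c (S k).head? = true) (h₁ : Exec p S S' B) (h₂ : Exec (loop k c p) S' S'' B') :
    Exec (loop k c p) S S'' (B + B' + 1) := by
  obtain ⟨t, ht, h₁⟩ := h₁
  obtain ⟨t', ht', h₂⟩ := h₂
  exact ⟨t + t' + 1, by omega, Run.loop_true h h₁ h₂⟩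

theorem Exec.congr {p : Prog K} {S S₁ S' S₁' : K → List Sym} {B B' : ℕ} (h : Exec p S S' B)
    (h₁ : S₁ = S) (h' : S' = S₁') (hB : B ≤ B') : Exec p S₁ S₁' B' := by
  subst h₁ h'
  exact h.mono hB

end Prog

end ExtSim

/-! ### Memory layout of the circuit-writing programs -/

namespace ExtSim

open Prog

/-- The stacks that hold words: the input, the output, a stack of intermediate numbers, a spare
stack for the gates of a circuit, and the gates of the four circuits of the input. -/
inductive LStk : Type
  | inp | out | calc | src | circ (c : Fin 4)
  deriving DecidableEq

/-- The stacks that hold a number in unary: three for temporary use and one for each of the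
variables of the circuit-writing language. -/
inductive CStk : Type
  | t1 | t2 | t3 | v (i : Fin 16)
  deriving DecidableEq

/-- The stacks of the machines that write down circuits. -/
abbrev Stk : Type := LStk ⊕ CStk

instance : Fintype LStk where
  elems := {.inp, .out, .calc, .src} ∪ Finset.univ.image .circ
  complete := by intro a; cases a <;> simp

instance : Fintype CStk where
  elems := {.t1, .t2, .t3} ∪ Finset.univ.image .v
  complete := by intro a; cases a <;> simp

/-- The contents of the stacks. -/
@[ext] structure Mem : Type where
  L : LStk → List Sym
  C : CStk → ℕ

namespace Mem

/-- The stacks as words; a number is a word of tallies. -/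
def stk (m : Mem) : Stk → List Sym
  | Sum.inl l => m.L l
  | Sum.inr c => List.replicate (m.C c) Sym.tally

/-- Replace the word on a stack. -/
def setL (m : Mem) (l : LStk) (x : List Sym) : Mem := ⟨Function.update m.L l x, m.C⟩

/-- Replace the number on a stack. -/
def setC (m : Mem) (c : CStk) (n : ℕ) : Mem := ⟨m.L, Function.update m.C c n⟩

@[simp] theorem setL_C (m : Mem) (l x) : (m.setL l x).C = m.C := rfl
@[simp] theorem setC_L (m : Mem) (c n) : (m.setC c n).L = m.L := rfl
theorem setL_L (m : Mem) (l x l') : (m.setL l x).L l' = if l' = l then x else m.L l' := by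
  simp [setL, Function.update_apply]
theorem setC_C (m : Mem) (c n c') : (m.setC c n).C c' = if c' = c then n else m.C c' := by
  simp [setC, Function.update_apply]
@[simp] theorem setL_L_self (m : Mem) (l x) : (m.setL l x).L l = x := by simp [setL]
@[simp] theorem setC_C_self (m : Mem) (c n) : (m.setC c n).C c = n := by simp [setC]

theorem stk_setL (m : Mem) (l x) : (m.setL l x).stk = Function.update m.stk (Sum.inl l) x := by
  funext k
  rcases k with k | k
  · by_cases h : k = l
    · subst h; simp [stk]
    · simp [stk, setL, h]
  · simp [stk]

theorem stk_setC (m : Mem) (c n) :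
    (m.setC c n).stk = Function.update m.stk (Sum.inr c) (List.replicate n Sym.tally) := by
  funext k
  rcases k with k | k
  · simp [stk]
  · by_cases h : k = c
    · subst h; simp [stk]
    · simp [stk, setC, h]

theorem eq_of {m m' : Mem} (hL : ∀ l, m.L l = m'.L l) (hC : ∀ c, m.C c = m'.C c) : m = m' :=
  Mem.ext (funext hL) (funext hC)

end Mem

/-- Execution of a program, in terms of memories. -/
def Ex (p : Prog Stk) (m m' : Mem) (B : ℕ) : Prop := Exec p m.stk m'.stk B

/-- Whether the symbol is a tally. -/
def isTally (o : Option Sym) : Bool := o == some Sym.tally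

/-- The program that does nothing. -/
def idle : Prog Stk := .loop (Sum.inl .inp) (fun _ => false) (.push (Sum.inl .inp) .tally)

/-- Move the tallies on top of the stack `a` to the stack `b`. -/
def movP (a b : Stk) : Prog Stk := .loop a isTally (.pop a fun _ => .push b .tally)

theorem Ex.congr {p : Prog Stk} {m m' m₁ m₁' : Mem} {B B' : ℕ} (h : Ex p m m' B) (h₁ : m₁ = m)
    (h' : m' = m₁') (hB : B ≤ B') : Ex p m₁ m₁' B' := by
  subst h₁ h'
  exact Exec.mono h hB

theorem Ex.mono {p : Prog Stk} {m m' : Mem} {B B' : ℕ} (h : Ex p m m' B) (hB : B ≤ B') :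
    Ex p m m' B' := Exec.mono h hB

theorem Ex.seq {p q : Prog Stk} {m m' m'' : Mem} {B B' : ℕ} (h : Ex p m m' B)
    (h' : Ex q m' m'' B') : Ex (.seq p q) m m'' (B + B') := Exec.seq h h'

theorem Ex.of_idle (m : Mem) : Ex idle m m 1 := Exec.loop_false rfl

theorem Ex.pushL (m : Mem) (l : LStk) (a : Sym) :
    Ex (.push (Sum.inl l) a) m (m.setL l (a :: m.L l)) 1 :=
  (Exec.push _ _ _).congr rfl (m.stk_setL _ _).symm le_rfl

theorem Ex.pushC (m : Mem) (c : CStk) :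
    Ex (.push (Sum.inr c) .tally) m (m.setC c (m.C c + 1)) 1 :=
  (Exec.push _ _ _).congr rfl (by rw [m.stk_setC]; rfl) le_rfl

theorem Ex.popL {f : Option Sym → Prog Stk} {m m' : Mem} {l : LStk} {B : ℕ} {a : Sym}
    {r : List Sym} (hl : m.L l = a :: r) (h : Ex (f (some a)) (m.setL l r) m' B) :
    Ex (.pop (Sum.inl l) f) m m' (B + 1) :=
  Exec.pop (some a) r (by simp [Mem.stk, hl]) (by simp [Mem.stk, hl]) (by rwa [← m.stk_setL])

theorem Ex.popC {f : Option Sym → Prog Stk} {m m' : Mem} {c : CStk} {B n : ℕ}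
    (hc : m.C c = n + 1) (h : Ex (f (some .tally)) (m.setC c n) m' B) :
    Ex (.pop (Sum.inr c) f) m m' (B + 1) :=
  Exec.pop (some .tally) (List.replicate n .tally) (by simp [Mem.stk, hc, List.replicate_succ])
    (by simp [Mem.stk, hc]) (by rwa [← m.stk_setC])

/-- A loop of `N` rounds; `M n` is the memory when `n` rounds remain. -/
theorem Ex.loop {k : Stk} {c : Option Sym → Bool} {p : Prog Stk} {b N : ℕ} (M : ℕ → Mem)
    (h : ∀ n < N, c ((M (n + 1)).stk k).head? = true ∧ Ex p (M (n + 1)) (M n) b)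
    (h₀ : c ((M 0).stk k).head? = false) : Ex (.loop k c p) (M N) (M 0) (N * (b + 1) + 1) := by
  induction N with
  | zero => exact (Exec.loop_false h₀).mono (by simp)
  | succ N ih =>
    refine (Exec.loop_true (h N (by omega)).1 (h N (by omega)).2
      (ih fun n hn => h n (by omega))).mono ?_
    ring_nf
    omega

theorem isTally_stk_C (m : Mem) (c : CStk) :
    isTally (m.stk (Sum.inr c)).head? = decide (m.C c ≠ 0) := by
  rcases h : m.C c with _ | n <;> simp [Mem.stk, isTally, h, List.replicate_succ]

theorem Ex.movLC (m : Mem) (l : LStk) (c : CStk) (N : ℕ) (r : List Sym)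
    (hl : m.L l = List.replicate N .tally ++ r) (hr : isTally r.head? = false) :
    Ex (movP (Sum.inl l) (Sum.inr c)) m ((m.setL l r).setC c (m.C c + N)) (3 * N + 1) := by
  have := Ex.loop (k := Sum.inl l) (c := isTally) (b := 2) (N := N)
    (p := .pop (Sum.inl l) fun _ => .push (Sum.inr c) .tally)
    (fun n => (m.setL l (List.replicate n .tally ++ r)).setC c (m.C c + (N - n)))
    (fun n hn => ⟨by simp [Mem.stk, isTally, List.replicate_succ],
      Ex.popL (a := .tally) (r := List.replicate n .tally ++ r)
        (by simp [List.replicate_succ]) ((Ex.pushC _ _).congr rfl ?_ le_rfl)⟩)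
    (by simpa [Mem.stk] using hr)
  · refine this.congr ?_ ?_ (by omega)
    · refine Mem.eq_of (fun k => ?_) (fun k => ?_)
      · simp only [Mem.setC_L, Mem.setL_L]; split_ifs with h <;> simp_all
      · simp only [Mem.setC_C, Mem.setL_C]; split_ifs with h <;> simp_all
    · simp
  · refine Mem.eq_of (fun k => ?_) (fun k => ?_)
    · simp only [Mem.setC_L, Mem.setL_L]; split_ifs with h <;> simp_all
    · simp only [Mem.setC_C, Mem.setL_C, if_true]; split_ifs with h <;> omega

theorem Ex.movCL (m : Mem) (c : CStk) (l : LStk) :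
    Ex (movP (Sum.inr c) (Sum.inl l)) m
      ((m.setL l (List.replicate (m.C c) .tally ++ m.L l)).setC c 0) (3 * m.C c + 1) := by
  have := Ex.loop (k := Sum.inr c) (c := isTally) (b := 2) (N := m.C c)
    (p := .pop (Sum.inr c) fun _ => .push (Sum.inl l) .tally)
    (fun n => (m.setL l (List.replicate (m.C c - n) .tally ++ m.L l)).setC c n)
    (fun n hn => ⟨by simp [isTally_stk_C],
      Ex.popC (n := n) (by simp) ((Ex.pushL _ _ _).congr rfl ?_ le_rfl)⟩)
    (by simp [isTally_stk_C])
  · refine this.congr ?_ ?_ (by omega)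
    · refine Mem.eq_of (fun k => ?_) (fun k => ?_)
      · simp only [Mem.setC_L, Mem.setL_L]; split_ifs with h <;> simp_all
      · simp only [Mem.setC_C, Mem.setL_C]; split_ifs with h <;> simp_all
    · simp
  · refine Mem.eq_of (fun k => ?_) (fun k => ?_)
    · have : m.C c - n = (m.C c - (n + 1)) + 1 := by omega
      simp only [Mem.setC_L, Mem.setL_L, this]; split_ifs with h <;> simp_all [List.replicate_succ]
    · simp only [Mem.setC_C, Mem.setL_C]; split_ifs with h <;> simp_all

theorem Ex.movCC (m : Mem) (c d : CStk) (hcd : c ≠ d) :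
    Ex (movP (Sum.inr c) (Sum.inr d)) m ((m.setC d (m.C d + m.C c)).setC c 0)
      (3 * m.C c + 1) := by
  have := Ex.loop (k := Sum.inr c) (c := isTally) (b := 2) (N := m.C c)
    (p := .pop (Sum.inr c) fun _ => .push (Sum.inr d) .tally)
    (fun n => (m.setC d (m.C d + (m.C c - n))).setC c n)
    (fun n hn => ⟨by simp [isTally_stk_C],
      Ex.popC (n := n) (by simp) ((Ex.pushC _ _).congr rfl ?_ le_rfl)⟩)
    (by simp [isTally_stk_C])
  · refine this.congr ?_ ?_ (by omega)
    · refine Mem.eq_of (fun k => rfl) (fun k => ?_)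
      simp only [Mem.setC_C]; split_ifs with h <;> simp_all
    · simp
  · refine Mem.eq_of (fun k => rfl) (fun k => ?_)
    simp only [Mem.setC_C]; split_ifs with h <;> simp_all; omega

end ExtSim

/-! ### Arithmetic expressions -/

namespace ExtSim

open Prog

/-- Arithmetic expressions over sixteen variables; subtraction is truncated. -/
inductive Expr : Type
  | const (c : ℕ) : Expr
  | var (i : Fin 16) : Expr
  | add (a b : Expr) : Expr
  | sub (a b : Expr) : Expr
  | mul (a b : Expr) : Expr

/-- The value of an expression. -/
def Expr.eval (env : Fin 16 → ℕ) : Expr → ℕ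
  | const c => c
  | var i => env i
  | add a b => a.eval env + b.eval env
  | sub a b => a.eval env - b.eval env
  | mul a b => a.eval env * b.eval env

/-- A polynomial that bounds the value of an expression in terms of a bound for the variables. -/
noncomputable def Expr.bound : Expr → Polynomial ℕ
  | const c => Polynomial.C c
  | var _ => Polynomial.X
  | add a b => a.bound + b.bound
  | sub a _ => a.bound
  | mul a b => a.bound * b.bound

theorem Expr.eval_le_bound {env : Fin 16 → ℕ} {B : ℕ} (h : ∀ i, env i ≤ B) :
    ∀ e : Expr, e.eval env ≤ e.bound.eval B
  | const c => by simp [eval, bound]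
  | var i => by simpa [eval, bound] using h i
  | add a b => by
      simpa [eval, bound] using add_le_add (a.eval_le_bound h) (b.eval_le_bound h)
  | sub a b => (Nat.sub_le _ _).trans (a.eval_le_bound h)
  | mul a b => by
      simpa [eval, bound] using mul_le_mul' (a.eval_le_bound h) (b.eval_le_bound h)

/-- The values of the variables. -/
def Mem.env (m : Mem) : Fin 16 → ℕ := fun i => m.C (.v i)

@[simp] theorem Mem.env_setL (m : Mem) (l x) : (m.setL l x).env = m.env := rfl

theorem Mem.env_setC (m : Mem) (i : Fin 16) (n : ℕ) :
    (m.setC (.v i) n).env = Function.update m.env i n := by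
  funext j
  simp [Mem.env, Mem.setC_C, Function.update_apply]

/-- Pop a symbol and go on. -/
def popP (k : Stk) (p : Prog Stk) : Prog Stk := .pop k fun _ => p

/-- Push a fixed number of tallies. -/
def pushTallies (l : LStk) : ℕ → Prog Stk
  | 0 => idle
  | c + 1 => .seq (.push (Sum.inl l) .tally) (pushTallies l c)

/-- The program that writes the value of an expression, in unary, on the stack `calc`. -/
def Expr.comp : Expr → Prog Stk
  | const c => .seq (.push (Sum.inl .calc) .comma) (pushTallies .calc c)
  | var i =>
      .seq (.push (Sum.inl .calc) .comma) <|
      .seq (.loop (Sum.inr (.v i)) isTally <| popP (Sum.inr (.v i)) <|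
        .seq (.push (Sum.inr .t1) .tally) (.push (Sum.inl .calc) .tally)) <|
      movP (Sum.inr .t1) (Sum.inr (.v i))
  | add a b =>
      .seq a.comp <| .seq b.comp <| .seq (movP (Sum.inl .calc) (Sum.inr .t1)) <|
      .seq (popP (Sum.inl .calc) idle) <| movP (Sum.inr .t1) (Sum.inl .calc)
  | sub a b =>
      .seq a.comp <| .seq b.comp <| .seq (movP (Sum.inl .calc) (Sum.inr .t1)) <|
      .seq (popP (Sum.inl .calc) idle) <|
      .loop (Sum.inr .t1) isTally <| popP (Sum.inr .t1) <| .pop (Sum.inl .calc) fun o =>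
        if isTally o = true then idle else .push (Sum.inl .calc) .comma
  | mul a b =>
      .seq a.comp <| .seq b.comp <| .seq (movP (Sum.inl .calc) (Sum.inr .t1)) <|
      .seq (popP (Sum.inl .calc) idle) <| .seq (movP (Sum.inl .calc) (Sum.inr .t2)) <|
      .seq (.loop (Sum.inr .t1) isTally <| popP (Sum.inr .t1) <|
        .seq (.loop (Sum.inr .t2) isTally <| popP (Sum.inr .t2) <|
          .seq (.push (Sum.inr .t3) .tally) (.push (Sum.inl .calc) .tally)) <|
        movP (Sum.inr .t3) (Sum.inr .t2)) <|
      .loop (Sum.inr .t2) isTally <| popP (Sum.inr .t2) idle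

theorem Ex.popL' {p : Prog Stk} {m m' : Mem} {l : LStk} {B : ℕ} {a : Sym} {r : List Sym}
    (hl : m.L l = a :: r) (h : Ex p (m.setL l r) m' B) :
    Ex (popP (Sum.inl l) p) m m' (B + 1) := Ex.popL hl h

theorem Ex.popC' {p : Prog Stk} {m m' : Mem} {c : CStk} {B n : ℕ} (hc : m.C c = n + 1)
    (h : Ex p (m.setC c n) m' B) : Ex (popP (Sum.inr c) p) m m' (B + 1) := Ex.popC hc h

theorem Ex.pushTallies (l : LStk) : ∀ (c : ℕ) (m : Mem),
    Ex (pushTallies l c) m (m.setL l (List.replicate c .tally ++ m.L l)) (c + 1)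
  | 0, m => (Ex.of_idle m).congr rfl (Mem.eq_of (fun k => by
      simp only [Mem.setL_L]; split_ifs with h <;> simp [h]) fun _ => rfl) le_rfl
  | c + 1, m => ((Ex.pushL m l .tally).seq (Ex.pushTallies l c _)).congr rfl (Mem.eq_of (fun k => by
      simp only [Mem.setL_L, if_true]; split_ifs with h <;> simp [List.replicate_succ'])
        fun _ => rfl) (by omega)

/-- Clearing a number. -/
theorem Ex.clearC (m : Mem) (c : CStk) :
    Ex (.loop (Sum.inr c) isTally <| popP (Sum.inr c) idle) m (m.setC c 0)
      (2 * m.C c + 1 + m.C c) := by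
  refine (Ex.loop (k := Sum.inr c) (c := isTally) (b := 2) (N := m.C c) (fun n => m.setC c n)
    (fun n hn => ⟨by simp [isTally_stk_C], (Ex.popC' (n := n) (by simp) (Ex.of_idle _)).congr rfl
      ?_ le_rfl⟩)
    (by simp [isTally_stk_C])).congr ?_ rfl (by omega)
  · exact Mem.eq_of (fun _ => rfl) fun k => by simp only [Mem.setC_C]; split_ifs <;> rfl
  · exact Mem.eq_of (fun _ => rfl) fun k => by simp only [Mem.setC_C]; split_ifs <;> simp_all

/-- Copying a number to another number and to a word, while clearing it. -/
theorem Ex.dup (m : Mem) (c d : CStk) (l : LStk) (hcd : c ≠ d) :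
    Ex (.loop (Sum.inr c) isTally <| popP (Sum.inr c) <|
        .seq (.push (Sum.inr d) .tally) (.push (Sum.inl l) .tally)) m
      (((m.setL l (List.replicate (m.C c) .tally ++ m.L l)).setC d (m.C d + m.C c)).setC c 0)
      (4 * m.C c + 1) := by
  refine (Ex.loop (k := Sum.inr c) (c := isTally) (b := 3) (N := m.C c) (fun n =>
    ((m.setL l (List.replicate (m.C c - n) .tally ++ m.L l)).setC d (m.C d + (m.C c - n))).setC c n)
    (fun n hn => ⟨by simp [isTally_stk_C], (Ex.popC' (n := n) (by simp)
      ((Ex.pushC _ _).seq (Ex.pushL _ _ _))).congr rfl ?_ le_rfl⟩)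
    (by simp [isTally_stk_C])).congr ?_ ?_ (by omega)
  · refine Mem.eq_of (fun k => ?_) fun k => ?_
    · have : m.C c - n = (m.C c - (n + 1)) + 1 := by omega
      simp only [Mem.setC_L, Mem.setL_L, this]; split_ifs <;> simp_all [List.replicate_succ]
    · simp only [Mem.setC_C, Mem.setL_C]; split_ifs <;> first | omega | simp_all
  · refine Mem.eq_of (fun k => ?_) fun k => ?_
    · simp only [Mem.setC_L, Mem.setL_L]; split_ifs <;> simp_all
    · simp only [Mem.setC_C, Mem.setL_C]; split_ifs <;> simp_all
  · simp

theorem unary_append (a : ℕ) (l : List Sym) :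
    unary a ++ l = List.replicate a Sym.tally ++ Sym.comma :: l := by simp [unary]

theorem Expr.exec_const (c : ℕ) (m : Mem) :
    Ex (const c).comp m (m.setL .calc (unary c ++ m.L .calc)) (c + 2) := by
  refine ((Ex.pushL m .calc .comma).seq (Ex.pushTallies .calc c _)).congr rfl
    (Mem.eq_of (fun k => ?_) fun k => rfl) (by omega)
  simp only [Mem.setL_L, if_true, unary_append]; split_ifs <;> rfl

theorem Expr.exec_var (i : Fin 16) (m : Mem) (h1 : m.C .t1 = 0) :
    Ex (var i).comp m (m.setL .calc (unary (m.env i) ++ m.L .calc)) (7 * m.env i + 3) := by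
  refine ((Ex.pushL m .calc .comma).seq ((Ex.dup _ (.v i) .t1 .calc (by simp)).seq
    (Ex.movCC _ .t1 (.v i) (by simp)))).congr rfl (Mem.eq_of (fun k => ?_) fun k => ?_) ?_
  · simp only [Mem.setC_L, Mem.setL_L, Mem.setL_C, if_true, unary_append, Mem.env]
    split_ifs <;> rfl
  · simp only [Mem.setC_C, Mem.setL_C]; split_ifs <;> simp_all
  · simp [Mem.setC_C, h1, Mem.env]; omega

/-- The first step of the arithmetic operations: the second operand is moved away. -/
theorem Ex.split (m : Mem) (y : ℕ) (r : List Sym) (h1 : m.C .t1 = 0)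
    (hc : m.L .calc = unary y ++ r) :
    Ex (.seq (movP (Sum.inl .calc) (Sum.inr .t1)) (popP (Sum.inl .calc) idle)) m
      ((m.setL .calc r).setC .t1 y) (3 * y + 3) := by
  refine ((Ex.movLC m .calc .t1 y (.comma :: r) (by simp [hc, unary_append]) rfl).seq
    (Ex.popL' (a := .comma) (r := r) (by simp) (Ex.of_idle _))).congr rfl
    (Mem.eq_of (fun k => ?_) fun k => ?_) ?_
  · simp only [Mem.setC_L, Mem.setL_L]; split_ifs <;> rfl
  · simp only [Mem.setC_C, Mem.setL_C]; split_ifs <;> simp_all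
  · omega

theorem Ex.assoc {p q r : Prog Stk} {m m' : Mem} {B : ℕ} (h : Ex (.seq (.seq p q) r) m m' B) :
    Ex (.seq p (.seq q r)) m m' B := by
  obtain ⟨t, ht, h⟩ := h
  cases h with
  | seq h₁ h₂ =>
    cases h₁ with
    | seq h₁ h₃ => exact ⟨_, by omega, Run.seq h₁ (Run.seq h₃ h₂)⟩

theorem Ex.add_tail (m : Mem) (x y : ℕ) (r : List Sym) (h1 : m.C .t1 = 0)
    (hc : m.L .calc = unary y ++ (unary x ++ r)) :
    Ex (.seq (movP (Sum.inl .calc) (Sum.inr .t1)) <|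
      .seq (popP (Sum.inl .calc) idle) <| movP (Sum.inr .t1) (Sum.inl .calc)) m
      (m.setL .calc (unary (x + y) ++ r)) (6 * y + 4) := by
  refine ((Ex.split m y _ h1 hc).seq (Ex.movCL _ .t1 .calc)).assoc.congr rfl
    (Mem.eq_of (fun k => ?_) fun k => ?_) ?_
  · simp only [Mem.setC_L, Mem.setL_L, if_true, Mem.setC_C]; split_ifs
    · rw [unary_append, unary_append, ← List.append_assoc, List.replicate_append_replicate,
        Nat.add_comm]
    · rfl
  · simp only [Mem.setC_C, Mem.setL_C]; split_ifs <;> simp_all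
  · simp; omega

theorem Ex.sub_tail (m : Mem) (x y : ℕ) (r : List Sym) (h1 : m.C .t1 = 0)
    (hc : m.L .calc = unary y ++ (unary x ++ r)) :
    Ex (.seq (movP (Sum.inl .calc) (Sum.inr .t1)) <|
      .seq (popP (Sum.inl .calc) idle) <|
      .loop (Sum.inr .t1) isTally <| popP (Sum.inr .t1) <| .pop (Sum.inl .calc) fun o =>
        if isTally o = true then idle else .push (Sum.inl .calc) .comma) m
      (m.setL .calc (unary (x - y) ++ r)) (7 * y + 4) := by
  have hloop := Ex.loop (k := Sum.inr .t1) (c := isTally) (b := 3) (N := y)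
    (p := popP (Sum.inr .t1) <| .pop (Sum.inl .calc) fun o =>
        if isTally o = true then idle else .push (Sum.inl .calc) .comma)
    (fun n => (m.setL .calc (unary (x - (y - n)) ++ r)).setC .t1 n)
    (fun n hn => ⟨by simp [isTally_stk_C], Ex.popC' (n := n) (by simp) ?_⟩)
    (by simp [isTally_stk_C])
  · refine ((Ex.split m y _ h1 hc).seq (hloop.congr (by simp) rfl le_rfl)).assoc.congr rfl ?_ ?_
    · refine Mem.eq_of (fun k => ?_) fun k => ?_
      · simp only [Mem.setC_L, Mem.setL_L, Nat.sub_zero]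
      · simp only [Mem.setC_C, Mem.setL_C]; split_ifs <;> simp_all
    · omega
  · rcases hz : x - (y - (n + 1)) with _ | z
    · refine Ex.popL (a := .comma) (r := r) (by simp [unary]) ?_
      refine (Ex.pushL _ .calc .comma).congr rfl (Mem.eq_of (fun k => ?_) fun k => ?_) le_rfl
      · have : x - (y - n) = 0 := by omega
        simp only [Mem.setC_L, Mem.setL_L, this, if_true]; split_ifs <;> simp [unary]
      · simp only [Mem.setC_C, Mem.setL_C]; split_ifs <;> simp_all
    · refine Ex.popL (a := .tally) (r := unary z ++ r)
        (by simp [unary, List.replicate_succ]) ?_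
      refine (Ex.of_idle _).congr rfl (Mem.eq_of (fun k => ?_) fun k => ?_) le_rfl
      · have : x - (y - n) = z := by omega
        simp only [Mem.setC_L, Mem.setL_L, this]; split_ifs <;> simp
      · simp only [Mem.setC_C, Mem.setL_C]; split_ifs <;> simp_all

theorem Ex.mul_tail (m : Mem) (x y : ℕ) (r : List Sym) (h1 : m.C .t1 = 0) (h2 : m.C .t2 = 0)
    (h3 : m.C .t3 = 0) (hc : m.L .calc = unary y ++ (unary x ++ r)) :
    Ex (.seq (movP (Sum.inl .calc) (Sum.inr .t1)) <|
      .seq (popP (Sum.inl .calc) idle) <| .seq (movP (Sum.inl .calc) (Sum.inr .t2)) <|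
      .seq (.loop (Sum.inr .t1) isTally <| popP (Sum.inr .t1) <|
        .seq (.loop (Sum.inr .t2) isTally <| popP (Sum.inr .t2) <|
          .seq (.push (Sum.inr .t3) .tally) (.push (Sum.inl .calc) .tally)) <|
        movP (Sum.inr .t3) (Sum.inr .t2)) <|
      .loop (Sum.inr .t2) isTally <| popP (Sum.inr .t2) idle) m
      (m.setL .calc (unary (x * y) ++ r)) (7 * (x * y) + 10 * y + 6 * x + 10) := by
  have hloop := Ex.loop (k := Sum.inr .t1) (c := isTally) (b := 7 * x + 3) (N := y)
    (p := popP (Sum.inr .t1) <|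
        .seq (.loop (Sum.inr .t2) isTally <| popP (Sum.inr .t2) <|
          .seq (.push (Sum.inr .t3) .tally) (.push (Sum.inl .calc) .tally)) <|
        movP (Sum.inr .t3) (Sum.inr .t2))
    (fun n => ((m.setL .calc (unary (x * (y - n)) ++ r)).setC .t1 n).setC .t2 x)
    (fun n hn => ⟨by simp [isTally_stk_C, Mem.setC_C],
      (Ex.popC' (n := n) (by simp [Mem.setC_C]) ((Ex.dup _ .t2 .t3 .calc (by simp)).seq
        (Ex.movCC _ .t3 .t2 (by simp)))).congr rfl ?_ ?_⟩)
    (by simp [isTally_stk_C, Mem.setC_C])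
  · refine ((Ex.split m y _ h1 hc).seq ((Ex.movLC _ .calc .t2 x (.comma :: r)
      (by simp [unary_append]) rfl).seq ((hloop.congr ?_ rfl le_rfl).seq (Ex.clearC _
        .t2)))).assoc.congr
      rfl ?_ ?_
    · refine Mem.eq_of (fun k => ?_) fun k => ?_
      · simp only [Mem.setC_L, Mem.setL_L, Nat.sub_self, Nat.mul_zero]; split_ifs <;> simp [unary]
      · simp only [Mem.setC_C, Mem.setL_C]; split_ifs <;> simp_all
    · refine Mem.eq_of (fun k => ?_) fun k => ?_
      · simp only [Mem.setC_L, Mem.setL_L, Nat.sub_zero]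
      · simp only [Mem.setC_C, Mem.setL_C]; split_ifs <;> simp_all
    · simp; ring_nf; omega
  · refine Mem.eq_of (fun k => ?_) fun k => ?_
    · have : x * (y - n) = x + x * (y - (n + 1)) := by
        have : y - n = (y - (n + 1)) + 1 := by omega
        rw [this]; ring
      simp only [Mem.setC_L, Mem.setL_L, reduceIte, reduceCtorEq, Mem.setC_C, Mem.setL_C, this,
        unary_append]
      split_ifs
      · rw [List.replicate_add, List.append_assoc]
      · rfl
    · simp only [Mem.setC_C, Mem.setL_C]; split_ifs <;> simp_all
  · simp [Mem.setC_C, h3]; omega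

/-- The value of an expression is computed in polynomial time. -/
theorem Expr.exec : ∀ e : Expr, ∃ P : Polynomial ℕ, ∀ (m : Mem) (B : ℕ), (∀ i, m.env i ≤ B) →
    m.C .t1 = 0 → m.C .t2 = 0 → m.C .t3 = 0 →
    Ex e.comp m (m.setL .calc (unary (e.eval m.env) ++ m.L .calc)) (P.eval B)
  | const c => ⟨Polynomial.C (c + 2), fun m B _ _ _ _ =>
      (exec_const c m).mono (by simp)⟩
  | var i => ⟨7 * Polynomial.X + 3, fun m B hB h1 _ _ =>
      (exec_var i m h1).mono (by simpa using hB i)⟩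
  | add a b => by
      obtain ⟨P, hP⟩ := a.exec
      obtain ⟨Q, hQ⟩ := b.exec
      refine ⟨P + Q + 6 * b.bound + 4, fun m B hB h1 h2 h3 => ?_⟩
      have hb := b.eval_le_bound hB
      refine ((hP m B hB h1 h2 h3).seq ((hQ (m.setL .calc (unary (a.eval m.env) ++ m.L .calc)) B hB
        h1 h2 h3).seq (Ex.add_tail _ (a.eval m.env)
        (b.eval m.env) (m.L .calc) h1 (by simp)))).congr rfl ?_ ?_
      · exact Mem.eq_of (fun k => by simp only [Mem.setL_L]; split_ifs <;> rfl) fun k => rfl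
      · simp; omega
  | sub a b => by
      obtain ⟨P, hP⟩ := a.exec
      obtain ⟨Q, hQ⟩ := b.exec
      refine ⟨P + Q + 7 * b.bound + 4, fun m B hB h1 h2 h3 => ?_⟩
      have hb := b.eval_le_bound hB
      refine ((hP m B hB h1 h2 h3).seq ((hQ (m.setL .calc (unary (a.eval m.env) ++ m.L .calc)) B hB
        h1 h2 h3).seq (Ex.sub_tail _ (a.eval m.env)
        (b.eval m.env) (m.L .calc) h1 (by simp)))).congr rfl ?_ ?_
      · exact Mem.eq_of (fun k => by simp only [Mem.setL_L]; split_ifs <;> rfl) fun k => rfl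
      · simp; omega
  | mul a b => by
      obtain ⟨P, hP⟩ := a.exec
      obtain ⟨Q, hQ⟩ := b.exec
      refine ⟨P + Q + 7 * (a.bound * b.bound) + 10 * b.bound + 6 * a.bound + 10,
        fun m B hB h1 h2 h3 => ?_⟩
      have ha := a.eval_le_bound hB
      have hb := b.eval_le_bound hB
      have hab := mul_le_mul' ha hb
      refine ((hP m B hB h1 h2 h3).seq ((hQ (m.setL .calc (unary (a.eval m.env) ++ m.L .calc)) B hB
        h1 h2 h3).seq (Ex.mul_tail _ (a.eval m.env)
        (b.eval m.env) (m.L .calc) h1 h2 h3 (by simp)))).congr rfl ?_ ?_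
      · exact Mem.eq_of (fun k => by simp only [Mem.setL_L]; split_ifs <;> rfl) fun k => rfl
      · simp; omega

end ExtSim

/-! ### A language for writing down circuits in polynomial time -/

namespace ExtSim

open Prog

/-- The gates without their wires. -/
inductive GateKind : Type
  | X | H | T | CX | CCX

/-- The gate of the given kind on the given wires, of which it uses the first ones. -/
def GateKind.gate : GateKind → ℕ → ℕ → ℕ → Gate
  | X, a, _, _ => .X a
  | H, a, _, _ => .H a
  | T, a, _, _ => .T a
  | CX, a, b, _ => .CX a b
  | CCX, a, b, c => .CCX a b c

/-- The kind of a gate. -/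
def Gate.kind : Gate → GateKind
  | X _ => .X
  | H _ => .H
  | T _ => .T
  | CX _ _ => .CX
  | CCX _ _ _ => .CCX

/-- The first wire of a gate. -/
def Gate.wire1 : Gate → ℕ
  | X a | H a | T a | CX a _ | CCX a _ _ => a

/-- The second wire of a gate, `0` if it has none. -/
def Gate.wire2 : Gate → ℕ
  | CX _ b | CCX _ b _ => b
  | _ => 0

/-- The third wire of a gate, `0` if it has none. -/
def Gate.wire3 : Gate → ℕ
  | CCX _ _ c => c
  | _ => 0

/-- A gate whose wires are given by expressions. -/
abbrev Emit : Type := GateKind × Expr × Expr × Expr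

/-- The gate for given values of the variables. -/
def Emit.gate (env : Fin 16 → ℕ) (e : Emit) : Gate :=
  e.1.gate (e.2.1.eval env) (e.2.2.1.eval env) (e.2.2.2.eval env)

/-- Programs that write down circuits: gates, concatenation, loops in which the variable `x` runs
through the numbers below `e` upwards or downwards, and loops through the gates of one of four
given circuits forwards or backwards. In the latter the variables `0`, `1`, `2` hold the wires of
the gate. -/
inductive Gen : Type
  | emit (l : List Emit) : Gen
  | seq (p q : Gen) : Gen
  | loop (up : Bool) (x : Fin 16) (e : Expr) (body : Gen) : Gen
  | each (c : Fin 4) (rev : Bool) (body : GateKind → List Emit) : Gen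

/-- The values of the variables while a gate is processed. -/
def Gate.env (env : Fin 16 → ℕ) (g : Gate) : Fin 16 → ℕ :=
  Function.update (Function.update (Function.update env 0 g.wire1) 1 g.wire2) 2 g.wire3

/-- The circuit that a program writes down, given the four circuits and the values of the
variables. -/
def Gen.eval (cs : Fin 4 → List Gate) : Gen → (Fin 16 → ℕ) → List Gate
  | emit l, env => l.map (Emit.gate env)
  | seq p q, env => p.eval cs env ++ q.eval cs env
  | loop up x e body, env =>
      (if up = true then List.range (e.eval env) else (List.range (e.eval env)).reverse).flatMap
        fun i => body.eval cs (Function.update env x i)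
  | each c rev body, env =>
      (if rev = true then (cs c).reverse else cs c).flatMap
        fun g => (body g.kind).map (Emit.gate (g.env env))

/-- Write the value of an expression on the output. The output is written from its end, so that
the top of the stack is its beginning. -/
def emitNum (e : Expr) : Prog Stk :=
  .seq e.comp <| .seq (.push (Sum.inl .out) .comma) <|
  .seq (movP (Sum.inl .calc) (Sum.inl .out)) <| popP (Sum.inl .calc) idle

/-- Write a gate on the output. -/
def Emit.comp : Emit → Prog Stk
  | (.X, a, _, _) => .seq (emitNum a) (.push (Sum.inl .out) .gX)
  | (.H, a, _, _) => .seq (emitNum a) (.push (Sum.inl .out) .gH)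
  | (.T, a, _, _) => .seq (emitNum a) (.push (Sum.inl .out) .gT)
  | (.CX, a, b, _) => .seq (emitNum b) <| .seq (emitNum a) (.push (Sum.inl .out) .gCX)
  | (.CCX, a, b, c) =>
      .seq (emitNum c) <| .seq (emitNum b) <| .seq (emitNum a) (.push (Sum.inl .out) .gCCX)

/-- Write a list of gates on the output, the last one first. -/
def emitsP : List Emit → Prog Stk
  | [] => idle
  | e :: l => .seq (emitsP l) e.comp

/-- Move a number from a stack of words to a variable. -/
def readNum (l : LStk) (i : Fin 16) : Prog Stk :=
  .seq (movP (Sum.inl l) (Sum.inr (.v i))) (popP (Sum.inl l) idle)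

/-- Move a variable to a stack of words. -/
def writeNum (l : LStk) (i : Fin 16) : Prog Stk :=
  .seq (.push (Sum.inl l) .comma) (movP (Sum.inr (.v i)) (Sum.inl l))

/-- Move one gate, the first symbol of which has been read, and run `p` in between. -/
def gateP (a b : LStk) (p : GateKind → Prog Stk) : Option Sym → Prog Stk
  | some .gX => .seq (readNum a 0) <| .seq (p .X) <| .seq (writeNum b 0) (.push (Sum.inl b) .gX)
  | some .gH => .seq (readNum a 0) <| .seq (p .H) <| .seq (writeNum b 0) (.push (Sum.inl b) .gH)
  | some .gT => .seq (readNum a 0) <| .seq (p .T) <| .seq (writeNum b 0) (.push (Sum.inl b) .gT)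
  | some .gCX => .seq (readNum a 0) <| .seq (readNum a 1) <| .seq (p .CX) <|
      .seq (writeNum b 1) <| .seq (writeNum b 0) (.push (Sum.inl b) .gCX)
  | some .gCCX => .seq (readNum a 0) <| .seq (readNum a 1) <| .seq (readNum a 2) <|
      .seq (p .CCX) <| .seq (writeNum b 2) <| .seq (writeNum b 1) <| .seq (writeNum b 0)
        (.push (Sum.inl b) .gCCX)
  | _ => idle

/-- Move the gates of a circuit one by one from the stack `a` to the stack `b`, which reverses
their order, and run `p` for each of them. -/
def eachP (a b : LStk) (p : GateKind → Prog Stk) : Prog Stk :=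
  .loop (Sum.inl a) (fun o => o.isSome) (.pop (Sum.inl a) (gateP a b p))

/-- The stack program of a circuit-writing program. As the output is written from its end,
everything runs in reverse order: a loop upwards counts its variable down, and a circuit is
processed backwards to write down its gates forwards. The bound and the saved value of a loop
variable, and the variables `0`, `1`, `2` during a loop through the gates of a circuit, are kept on
the stack `calc`. -/
def Gen.comp : Gen → Prog Stk
  | emit l => emitsP l
  | seq p q => .seq q.comp p.comp
  | loop true x e body =>
      .seq e.comp <| .seq (movP (Sum.inl .calc) (Sum.inr .t1)) <|
      .seq (movP (Sum.inr (.v x)) (Sum.inl .calc)) <|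
      .seq (movP (Sum.inr .t1) (Sum.inr (.v x))) <|
      .seq (.loop (Sum.inr (.v x)) isTally <| popP (Sum.inr (.v x)) body.comp) <|
      readNum .calc x
  | loop false x e body =>
      .seq e.comp <| .seq (movP (Sum.inl .calc) (Sum.inr .t1)) <|
      .seq (movP (Sum.inr (.v x)) (Sum.inl .calc)) <|
      .seq (.push (Sum.inl .calc) .comma) <| .seq (movP (Sum.inr .t1) (Sum.inl .calc)) <|
      .seq (.loop (Sum.inl .calc) isTally <| popP (Sum.inl .calc) <|
        .seq body.comp (.push (Sum.inr (.v x)) .tally)) <|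
      .seq (popP (Sum.inl .calc) idle) <|
      .seq (.loop (Sum.inr (.v x)) isTally <| popP (Sum.inr (.v x)) idle) <|
      readNum .calc x
  | each c rev body =>
      .seq (writeNum .calc 0) <| .seq (writeNum .calc 1) <| .seq (writeNum .calc 2) <|
      .seq (if rev = true then
          .seq (eachP (.circ c) .src fun k => emitsP (body k)) (eachP .src (.circ c) fun _ => idle)
        else
          .seq (eachP (.circ c) .src fun _ => idle) (eachP .src (.circ c) fun k => emitsP (body
            k))) <|
      .seq (readNum .calc 2) <| .seq (readNum .calc 1) <| readNum .calc 0

theorem Ex.movLL (m : Mem) (l l' : LStk) (hl' : l ≠ l') (N : ℕ) (r : List Sym)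
    (hl : m.L l = List.replicate N .tally ++ r) (hr : isTally r.head? = false) :
    Ex (movP (Sum.inl l) (Sum.inl l')) m
      ((m.setL l' (List.replicate N .tally ++ m.L l')).setL l r) (3 * N + 1) := by
  have := Ex.loop (k := Sum.inl l) (c := isTally) (b := 2) (N := N)
    (p := .pop (Sum.inl l) fun _ => .push (Sum.inl l') .tally)
    (fun n => (m.setL l' (List.replicate (N - n) .tally ++ m.L l')).setL l
      (List.replicate n .tally ++ r))
    (fun n hn => ⟨by simp [Mem.stk, isTally, List.replicate_succ],
      Ex.popL (a := .tally) (r := List.replicate n .tally ++ r)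
        (by simp [List.replicate_succ]) ((Ex.pushL _ _ _).congr rfl ?_ le_rfl)⟩)
    (by simpa [Mem.stk] using hr)
  · refine this.congr ?_ ?_ (by omega)
    · refine Mem.eq_of (fun k => ?_) (fun k => rfl)
      simp only [Mem.setL_L]; split_ifs with h <;> simp_all
    · simp
  · refine Mem.eq_of (fun k => ?_) (fun k => rfl)
    have : N - n = (N - (n + 1)) + 1 := by omega
    simp only [Mem.setL_L, this]; split_ifs with h <;> simp_all [List.replicate_succ]

theorem Ex.readNum (m : Mem) (l : LStk) (i : Fin 16) (N : ℕ) (r : List Sym)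
    (hl : m.L l = unary N ++ r) :
    Ex (readNum l i) m ((m.setL l r).setC (.v i) (m.C (.v i) + N)) (3 * N + 3) := by
  refine ((Ex.movLC m l (.v i) N (.comma :: r) (by simp [hl, unary_append]) rfl).seq
    (Ex.popL' (a := .comma) (r := r) (by simp) (Ex.of_idle _))).congr rfl
    (Mem.eq_of (fun k => ?_) fun k => ?_) (by omega)
  · simp only [Mem.setC_L, Mem.setL_L]; split_ifs <;> rfl
  · simp only [Mem.setC_C, Mem.setL_C]

theorem Ex.writeNum (m : Mem) (l : LStk) (i : Fin 16) :
    Ex (writeNum l i) m ((m.setL l (unary (m.C (.v i)) ++ m.L l)).setC (.v i) 0)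
      (3 * m.C (.v i) + 2) := by
  refine ((Ex.pushL m l .comma).seq (Ex.movCL _ (.v i) l)).congr rfl
    (Mem.eq_of (fun k => ?_) fun k => rfl) (by simp; omega)
  simp only [Mem.setC_L, Mem.setL_L, Mem.setL_C, if_true, unary_append]; split_ifs <;> rfl

theorem emitNum_exec (e : Expr) : ∃ P : Polynomial ℕ, ∀ (m : Mem) (B : ℕ), (∀ i, m.env i ≤ B) →
    m.C .t1 = 0 → m.C .t2 = 0 → m.C .t3 = 0 →
    Ex (emitNum e) m (m.setL .out (unary (e.eval m.env) ++ m.L .out)) (P.eval B) := by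
  obtain ⟨P, hP⟩ := e.exec
  refine ⟨P + 3 * e.bound + 4, fun m B hB h1 h2 h3 => ?_⟩
  have hb := e.eval_le_bound hB
  refine ((hP m B hB h1 h2 h3).seq ((Ex.pushL _ .out .comma).seq
    ((Ex.movLL _ .calc .out (by simp) (e.eval m.env) (.comma :: m.L .calc)
      (by simp [Mem.setL_L, unary_append]) rfl).seq
    (Ex.popL' (a := .comma) (r := m.L .calc) (by simp) (Ex.of_idle _))))).congr rfl
    (Mem.eq_of (fun k => ?_) fun k => rfl) ?_
  · simp only [Mem.setL_L, unary_append, reduceIte, reduceCtorEq]; split_ifs <;> simp_all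
  · simp; omega

theorem Emit.exec (e : Emit) : ∃ P : Polynomial ℕ, ∀ (m : Mem) (B : ℕ), (∀ i, m.env i ≤ B) →
    m.C .t1 = 0 → m.C .t2 = 0 → m.C .t3 = 0 →
    Ex e.comp m (m.setL .out ((e.gate m.env).encode ++ m.L .out)) (P.eval B) := by
  obtain ⟨k, a, b, c⟩ := e
  obtain ⟨P, hP⟩ := emitNum_exec a
  obtain ⟨Q, hQ⟩ := emitNum_exec b
  obtain ⟨R, hR⟩ := emitNum_exec c
  refine ⟨P + Q + R + 1, fun m B hB h1 h2 h3 => ?_⟩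
  cases k
  case CX =>
    refine ((hQ m B hB h1 h2 h3).seq ((hP (m.setL .out _) B hB h1 h2 h3).seq
      (Ex.pushL _ .out .gCX))).congr rfl (Mem.eq_of (fun k => ?_) fun k => rfl) ?_
    · simp only [Mem.setL_L, if_true, Emit.gate, GateKind.gate, Gate.encode]
      split_ifs <;> simp [unary]
    · simp; omega
  case CCX =>
    refine ((hR m B hB h1 h2 h3).seq ((hQ (m.setL .out _) B hB h1 h2 h3).seq
      ((hP ((m.setL .out _).setL .out _) B hB h1 h2 h3).seq
      (Ex.pushL _ .out .gCCX)))).congr rfl (Mem.eq_of (fun k => ?_) fun k => rfl) ?_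
    · simp only [Mem.setL_L, if_true, Emit.gate, GateKind.gate, Gate.encode]
      split_ifs <;> simp [unary]
    · simp; omega
  all_goals
    refine ((hP m B hB h1 h2 h3).seq (Ex.pushL _ .out _)).congr rfl
      (Mem.eq_of (fun k => ?_) fun k => rfl) (by simp; omega)
    simp only [Mem.setL_L, if_true, Emit.gate, GateKind.gate, Gate.encode]
    split_ifs <;> simp

theorem emitsP_exec : ∀ l : List Emit, ∃ P : Polynomial ℕ, ∀ (m : Mem) (B : ℕ),
    (∀ i, m.env i ≤ B) → m.C .t1 = 0 → m.C .t2 = 0 → m.C .t3 = 0 →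
    Ex (emitsP l) m (m.setL .out ((l.map (Emit.gate m.env)).flatMap Gate.encode ++ m.L .out))
      (P.eval B)
  | [] => ⟨1, fun m B _ _ _ _ => (Ex.of_idle m).congr rfl (Mem.eq_of (fun k => by
      simp only [Mem.setL_L]; split_ifs with h <;> simp [h]) fun _ => rfl) (by simp)⟩
  | e :: l => by
      obtain ⟨P, hP⟩ := e.exec
      obtain ⟨Q, hQ⟩ := emitsP_exec l
      refine ⟨Q + P, fun m B hB h1 h2 h3 => ?_⟩
      refine ((hQ m B hB h1 h2 h3).seq (hP (m.setL .out _) B hB h1 h2 h3)).congr rfl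
        (Mem.eq_of (fun k => ?_) fun k => rfl) (by simp)
      simp only [Mem.setL_L, if_true]
      split_ifs <;> simp

end ExtSim

namespace ExtSim

open Prog

/-- The memory while a gate is processed: the variables `0`, `1`, `2` hold its wires. -/
def Mem.load (m : Mem) (g : Gate) : Mem :=
  ((m.setC (.v 0) g.wire1).setC (.v 1) g.wire2).setC (.v 2) g.wire3

theorem Mem.env_load (m : Mem) (g : Gate) : (m.load g).env = g.env m.env := by
  simp [load, env_setC, Gate.env]

/-- Processing one gate, where `f` is what `p` writes on the output. -/
theorem gateP_exec {a b : LStk} (hab : a ≠ b) (hao : a ≠ .out) (hbo : b ≠ .out)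
    (p : GateKind → Prog Stk) (f : List Sym) (g : Gate) (tb B : ℕ) (m : Mem)
    (h0 : m.C (.v 0) = 0) (h1 : m.C (.v 1) = 0) (h2 : m.C (.v 2) = 0) (r : List Sym)
    (hB : g.wire1 ≤ B ∧ g.wire2 ≤ B ∧ g.wire3 ≤ B) (ha : m.L a = g.encode ++ r)
    (hp : ∀ m' : Mem, m'.C = (m.load g).C → Ex (p g.kind) m' (m'.setL .out (f ++ m'.L .out)) tb) :
    Ex (.pop (Sum.inl a) (gateP a b p)) m
      (((m.setL b (g.encode ++ m.L b)).setL a r).setL .out (f ++ m.L .out))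
      (tb + 18 * B + 30) := by
  have one : ∀ (s : Sym) (k : GateKind) (x : ℕ), gateP a b p (some s) = .seq (readNum a 0)
      (.seq (p k) (.seq (writeNum b 0) (.push (Sum.inl b) s))) → g.encode = s :: unary x →
      g.wire1 = x → g.wire2 = 0 → g.wire3 = 0 → g.kind = k →
      Ex (.pop (Sum.inl a) (gateP a b p)) m
        (((m.setL b (g.encode ++ m.L b)).setL a r).setL .out (f ++ m.L .out))
        (tb + 18 * B + 30) := by
    intro s k x hs hg w1 w2 w3 hk
    refine Ex.popL (a := s) (r := unary x ++ r) (by simp [ha, hg]) ?_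
    rw [hs]
    subst hk
    refine ((Ex.readNum _ a 0 x r (by simp)).seq ((hp _ ?_).seq
      ((Ex.writeNum _ b 0).seq (Ex.pushL _ b _)))).congr
      rfl (Mem.eq_of (fun k => ?_) fun k => ?_) ?_
    · funext k
      simp only [Mem.load, Mem.setC_C, Mem.setL_C, w1, w2, w3]
      grind
    · simp only [Mem.setC_L, Mem.setL_L, Mem.setC_C, Mem.setL_C, hg]
      grind
    · simp only [Mem.setC_C, Mem.setL_C]
      grind
    · simp [h0, w1] at hB ⊢
      omega
  cases g with
  | X x => exact one .gX .X x rfl rfl rfl rfl rfl rfl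
  | H x => exact one .gH .H x rfl rfl rfl rfl rfl rfl
  | T x => exact one .gT .T x rfl rfl rfl rfl rfl rfl
  | CX x y =>
    refine (Ex.popL (a := .gCX) (r := unary x ++ (unary y ++ r)) (by simp [ha, Gate.encode])
      ((Ex.readNum _ a 0 x (unary y ++ r) (by simp)).seq
      ((Ex.readNum _ a 1 y r (by simp)).seq ((hp _ ?_).seq
      ((Ex.writeNum _ b 1).seq ((Ex.writeNum _ b 0).seq (Ex.pushL _ b .gCX))))))).congr
      rfl (Mem.eq_of (fun k => ?_) fun k => ?_) ?_
    · funext k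
      simp only [Mem.load, Mem.setC_C, Mem.setL_C, Gate.wire1, Gate.wire2, Gate.wire3]
      grind
    · simp only [Mem.setC_L, Mem.setL_L, Mem.setC_C, Mem.setL_C, Gate.encode]
      grind
    · simp only [Mem.setC_C, Mem.setL_C]
      grind
    · simp [Mem.setC_C, h0, h1, Gate.wire1, Gate.wire2, Gate.wire3] at hB ⊢
      omega
  | CCX x y z =>
    refine (Ex.popL (a := .gCCX) (r := unary x ++ (unary y ++ (unary z ++ r)))
      (by simp [ha, Gate.encode]) ((Ex.readNum _ a 0 x (unary y ++ (unary z ++ r)) (by simp)).seq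
      ((Ex.readNum _ a 1 y (unary z ++ r) (by simp)).seq
      ((Ex.readNum _ a 2 z r (by simp)).seq ((hp _ ?_).seq
      ((Ex.writeNum _ b 2).seq ((Ex.writeNum _ b 1).seq ((Ex.writeNum _ b 0).seq
        (Ex.pushL _ b .gCCX))))))))).congr
      rfl (Mem.eq_of (fun k => ?_) fun k => ?_) ?_
    · funext k
      simp only [Mem.load, Mem.setC_C, Mem.setL_C, Gate.wire1, Gate.wire2, Gate.wire3]
      grind
    · simp [Mem.setL_L, Mem.setC_C, h0, h1, h2, hab.symm, hbo, hao.symm, Gate.encode]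
      grind
    · simp only [Mem.setC_C, Mem.setL_C]
      grind
    · simp [Mem.setC_C, h0, h1, h2, Gate.wire1, Gate.wire2, Gate.wire3] at hB ⊢
      omega

/-- Processing all gates of a circuit, where `F g` is what `p` writes on the output for `g`. -/
theorem eachP_exec {a b : LStk} (hab : a ≠ b) (hao : a ≠ .out) (hbo : b ≠ .out)
    (p : GateKind → Prog Stk) (F : Gate → List Sym) (tb B : ℕ) : ∀ (gs : List Gate) (m : Mem),
    m.C (.v 0) = 0 → m.C (.v 1) = 0 → m.C (.v 2) = 0 →
    (∀ g ∈ gs, g.wire1 ≤ B ∧ g.wire2 ≤ B ∧ g.wire3 ≤ B) → m.L a = gs.flatMap Gate.encode →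
    (∀ g ∈ gs, ∀ m' : Mem, m'.C = (m.load g).C →
      Ex (p g.kind) m' (m'.setL .out (F g ++ m'.L .out)) tb) →
    Ex (eachP a b p) m
      (((m.setL b (gs.reverse.flatMap Gate.encode ++ m.L b)).setL a []).setL .out
        (gs.reverse.flatMap F ++ m.L .out))
      (gs.length * (tb + 18 * B + 31) + 1)
  | [], m, h0, h1, h2, hB, ha, hp => by
    refine Ex.congr (m := m) (m' := m) (B := 1) (Exec.loop_false ?_) rfl
      (Mem.eq_of (fun k => ?_) fun k => rfl) (by simp)
    · simp [Mem.stk, ha]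
    · simp only [Mem.setL_L]; split_ifs <;> simp_all
  | g :: gs, m, h0, h1, h2, hB, ha, hp => by
    have hba := hab.symm
    have hoa := hao.symm
    have hob := hbo.symm
    have h := gateP_exec hab hao hbo p (F g) g tb B m h0 h1 h2 (gs.flatMap Gate.encode)
      (hB g (by simp)) (by simpa using ha) (hp g (by simp))
    have h' := eachP_exec hab hao hbo p F tb B gs
      (((m.setL b (g.encode ++ m.L b)).setL a (gs.flatMap Gate.encode)).setL .out
        (F g ++ m.L .out)) h0 h1 h2 (fun g hg => hB g (by simp [hg]))
      (by simp [Mem.setL_L, hao]) (fun g hg m' hm' => hp g (by simp [hg]) m' hm')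
    refine Ex.congr (Exec.loop_true ?_ h h') rfl (Mem.eq_of (fun k => ?_) fun k => rfl) ?_
    · simp only [Mem.stk, ha]
      cases g <;> rfl
    · simp only [Mem.setL_L]; split_ifs <;> simp_all
    · simp only [List.length_cons]; ring_nf; omega

theorem wires_le_length (g : Gate) : g.wire1 ≤ g.encode.length ∧ g.wire2 ≤ g.encode.length ∧
    g.wire3 ≤ g.encode.length ∧ 1 ≤ g.encode.length := by
  cases g <;> simp [Gate.wire1, Gate.wire2, Gate.wire3, Gate.encode, unary] <;> omega

theorem encode_length_le {g : Gate} {gs : List Gate} (hg : g ∈ gs) :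
    g.encode.length ≤ (gs.flatMap Gate.encode).length := by
  induction gs with
  | nil => simp at hg
  | cons h gs ih =>
    simp only [List.flatMap_cons, List.length_append]
    rcases List.mem_cons.1 hg with rfl | hg
    · omega
    · have := ih hg; omega

theorem length_le_encode (gs : List Gate) : gs.length ≤ (gs.flatMap Gate.encode).length := by
  induction gs with
  | nil => simp
  | cons h gs ih =>
    have := (wires_le_length h).2.2.2
    simp only [List.flatMap_cons, List.length_append, List.length_cons]; omega

theorem load_env_le {g : Gate} {env : Fin 16 → ℕ} {B : ℕ} (h : ∀ i, env i ≤ B)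
    (hg : g.wire1 ≤ B ∧ g.wire2 ≤ B ∧ g.wire3 ≤ B) (i : Fin 16) : g.env env i ≤ B := by
  simp only [Gate.env, Function.update_apply]
  split_ifs <;> simp_all

theorem Gate.env_of_eq {g : Gate} {e e' : Fin 16 → ℕ}
    (h : ∀ i, i ≠ 0 → i ≠ 1 → i ≠ 2 → e i = e' i) :
    g.env e = g.env e' := by
  funext i
  simp only [Gate.env, Function.update_apply]
  split_ifs <;> simp_all

theorem flatMap_encode_flatMap {α : Type} (l : List α) (F : α → List Gate) :
    (l.flatMap F).flatMap Gate.encode = l.flatMap fun a => (F a).flatMap Gate.encode := by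
  rw [List.flatMap_assoc]

theorem each_exec (c : Fin 4) (rev : Bool) (body : GateKind → List Emit) :
    ∃ P : Polynomial ℕ, ∀ (cs : Fin 4 → List Gate) (m : Mem) (B : ℕ), (∀ i, m.env i ≤ B) →
    m.C .t1 = 0 → m.C .t2 = 0 → m.C .t3 = 0 → m.L .src = [] →
    (∀ c, m.L (.circ c) = (cs c).flatMap Gate.encode) →
    (∀ c, ((cs c).flatMap Gate.encode).length ≤ B) →
    Ex (Gen.each c rev body).comp m
      (m.setL .out (((Gen.each c rev body).eval cs m.env).flatMap Gate.encode ++ m.L .out))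
      (P.eval B) := by
  choose P hP using fun k => emitsP_exec (body k)
  let R : Polynomial ℕ := P .X + P .H + P .T + P .CX + P .CCX
  refine ⟨9 * Polynomial.X + 6 + (Polynomial.X * (R + 18 * Polynomial.X + 31) + 1) +
    (Polynomial.X * (18 * Polynomial.X + 32) + 1) + 9 * Polynomial.X + 9,
    fun cs m B hB h1 h2 h3 hsrc hcs hlen => ?_⟩
  -- The three variables that will hold the wires are saved on the stack of numbers.
  set m₁ : Mem := (((m.setL .calc (unary (m.env 2) ++ (unary (m.env 1) ++ (unary (m.env 0) ++
    m.L .calc)))).setC (.v 0) 0).setC (.v 1) 0).setC (.v 2) 0 with hm₁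
  have hsave : ∀ q m' B', Ex q m₁ m' B' → Ex (.seq (writeNum .calc 0) <| .seq (writeNum .calc 1) <|
      .seq (writeNum .calc 2) q) m m' (9 * B + 6 + B') := by
    intro q m' B' hq
    refine ((Ex.writeNum m .calc 0).seq ((Ex.writeNum _ .calc 1).seq ((Ex.writeNum _ .calc 2).seq
      (hq.congr (Mem.eq_of (fun k => ?_) fun k => rfl) rfl le_rfl)))).congr rfl rfl ?_
    · simp only [hm₁, Mem.setC_L, Mem.setL_L, Mem.setC_C, Mem.setL_C, Mem.env]
      split_ifs <;> simp_all
    · have e0 := hB 0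
      have e1 := hB 1
      have e2 := hB 2
      simp [Mem.setC_C, Mem.env] at e0 e1 e2 ⊢
      omega
  have hrest : ∀ (o : List Sym), Ex (.seq (readNum .calc 2) <| .seq (readNum .calc 1) <|
      readNum .calc 0) (m₁.setL .out o) (m.setL .out o) (9 * B + 9) := by
    intro o
    refine ((Ex.readNum _ .calc 2 (m.env 2) (unary (m.env 1) ++ (unary (m.env 0) ++ m.L .calc))
      (by simp [hm₁, Mem.setL_L])).seq ((Ex.readNum _ .calc 1 (m.env 1)
      (unary (m.env 0) ++ m.L .calc) (by simp)).seq
      (Ex.readNum _ .calc 0 (m.env 0) (m.L .calc) (by simp)))).congr rfl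
      (Mem.eq_of (fun k => ?_) fun k => ?_) ?_
    · simp only [hm₁, Mem.setC_L, Mem.setL_L]
      split_ifs <;> simp_all
    · simp only [hm₁, Mem.setC_C, Mem.setL_C, Mem.env]
      split_ifs <;> simp_all
    · have e0 := hB 0
      have e1 := hB 1
      have e2 := hB 2
      omega
  have hw : ∀ g ∈ cs c, g.wire1 ≤ B ∧ g.wire2 ≤ B ∧ g.wire3 ≤ B := by
    intro g hg
    have h := wires_le_length g
    have h' := encode_length_le hg
    have h'' := hlen c
    omega
  have hn : (cs c).length ≤ B := (length_le_encode _).trans (hlen c)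
  have hbody : ∀ g ∈ cs c, ∀ m' : Mem, m'.C = (m₁.load g).C → Ex (emitsP (body g.kind)) m'
      (m'.setL .out (((body g.kind).map (Emit.gate (g.env m.env))).flatMap Gate.encode ++
        m'.L .out)) (R.eval B) := by
    intro g hg m' hm'
    have henv : m'.env = g.env m.env := by
      have : m'.env = (m₁.load g).env := by
        funext i; simp [Mem.env, hm']
      rw [this, Mem.env_load]
      refine Gate.env_of_eq fun i h0 h1 h2 => ?_
      simp [hm₁, Mem.env_setC, h0, h1, h2]
    have ht : ∀ t : CStk, (∀ i, t ≠ .v i) → m'.C t = m.C t := by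
      intro t ht
      simp [hm', hm₁, Mem.load, Mem.setC_C, ht]
    rw [← henv]
    refine (hP g.kind m' B (by rw [henv]; exact load_env_le hB (hw g hg)) (by rw [ht _ (by simp),
      h1])
      (by rw [ht _ (by simp), h2]) (by rw [ht _ (by simp), h3])).mono ?_
    simp only [R, Polynomial.eval_add]
    cases g.kind <;> omega
  have hid : ∀ (gs : List Gate) (g : Gate), g ∈ gs → ∀ (m' m'' : Mem), m'.C = (m''.load g).C →
      Ex idle m' (m'.setL .out ([] ++ m'.L .out)) 1 := by
    intro gs g _ m' m'' _
    refine (Ex.of_idle m').congr rfl (Mem.eq_of (fun k => ?_) fun _ => rfl) le_rfl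
    simp only [Mem.setL_L]; split_ifs with h <;> simp [h]
  have z0 : m₁.C (.v 0) = 0 := by simp [hm₁, Mem.setC_C]
  have z1 : m₁.C (.v 1) = 0 := by simp [hm₁, Mem.setC_C]
  have z2 : m₁.C (.v 2) = 0 := by simp [hm₁]
  have hmul : (cs c).length * (R.eval B + 18 * B + 31) ≤ B * (R.eval B + 18 * B + 31) :=
    Nat.mul_le_mul_right _ hn
  have hmul' : (cs c).length * (18 * B + 32) ≤ B * (18 * B + 32) := Nat.mul_le_mul_right _ hn
  have hmul'' : (cs c).length * (1 + 18 * B + 31) ≤ B * (18 * B + 32) := by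
    rw [show 1 + 18 * B + 31 = 18 * B + 32 by ring]; exact hmul'
  cases rev with
  | true =>
    have e₁ := eachP_exec (a := .circ c) (b := .src) (by simp) (by simp) (by simp)
      (fun k => emitsP (body k))
      (fun g => ((body g.kind).map (Emit.gate (g.env m.env))).flatMap Gate.encode) (R.eval B) B
      (cs c) m₁ z0 z1 z2 hw (by simp [hm₁, Mem.setL_L, hcs]) hbody
    have e₂ := eachP_exec (a := .src) (b := .circ c) (by simp) (by simp) (by simp)
      (fun _ => idle) (fun _ => []) 1 B (cs c).reverse
      (((m₁.setL .src ((cs c).reverse.flatMap Gate.encode ++ m₁.L .src)).setL (.circ c) []).setL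
        .out
        ((cs c).reverse.flatMap (fun g => ((body g.kind).map (Emit.gate (g.env m.env))).flatMap
          Gate.encode) ++ m₁.L .out)) z0 z1 z2
      (fun g hg => hw g (List.mem_reverse.1 hg)) (by simp [Mem.setL_L, hm₁, hsrc]) (fun g hg m' hm'
        => hid _ g hg m' _ hm')
    refine (hsave _ _ _ ((e₁.seq e₂).seq ((hrest _).congr ?_ rfl le_rfl))).congr rfl rfl ?_
    · refine Mem.eq_of (fun k => ?_) fun _ => rfl
      simp only [hm₁, Mem.setC_L, Mem.setL_L, Gen.eval, flatMap_encode_flatMap]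
      split_ifs <;> simp_all
    · simp only [Polynomial.eval_add, Polynomial.eval_mul, Polynomial.eval_X, Polynomial.eval_ofNat,
        Polynomial.eval_one, List.length_reverse]
      omega
  | false =>
    have e₁ := eachP_exec (a := .circ c) (b := .src) (by simp) (by simp) (by simp)
      (fun _ => idle) (fun _ => []) 1 B
      (cs c) m₁ z0 z1 z2 hw (by simp [hm₁, Mem.setL_L, hcs])
      (fun g hg m' hm' => hid _ g hg m' _ hm')
    have e₂ := eachP_exec (a := .src) (b := .circ c) (by simp) (by simp) (by simp)
      (fun k => emitsP (body k))
      (fun g => ((body g.kind).map (Emit.gate (g.env m.env))).flatMap Gate.encode) (R.eval B) B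
      (cs c).reverse
      (((m₁.setL .src ((cs c).reverse.flatMap Gate.encode ++ m₁.L .src)).setL (.circ c) []).setL
        .out
        ((cs c).reverse.flatMap (fun _ => []) ++ m₁.L .out)) z0 z1 z2
      (fun g hg => hw g (List.mem_reverse.1 hg)) (by simp [Mem.setL_L, hm₁, hsrc])
      (fun g hg m' hm' => hbody g (List.mem_reverse.1 hg) m' hm')
    refine (hsave _ _ _ ((e₁.seq e₂).seq ((hrest _).congr ?_ rfl le_rfl))).congr rfl rfl ?_
    · refine Mem.eq_of (fun k => ?_) fun _ => rfl
      simp only [hm₁, Mem.setC_L, Mem.setL_L, Gen.eval, flatMap_encode_flatMap]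
      split_ifs <;> simp_all
    · simp only [Polynomial.eval_add, Polynomial.eval_mul, Polynomial.eval_X, Polynomial.eval_ofNat,
        Polynomial.eval_one, List.length_reverse]
      omega

end ExtSim

namespace ExtSim

open Prog

theorem range'_succ_flatMap (F : ℕ → List Sym) (n N : ℕ) (h : n < N) :
    (List.range' n (N - n)).flatMap F = F n ++ (List.range' (n + 1) (N - (n + 1))).flatMap F := by
  rw [show N - n = (N - (n + 1)) + 1 by omega, List.range'_succ, List.flatMap_cons]

/-- A loop that counts its variable down writes the output of an upward loop. -/
theorem loop_up_exec (x : Fin 16) (p : Prog Stk) (F : ℕ → List Sym) (tb N : ℕ) (m : Mem)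
    (hx : m.C (.v x) = N)
    (hp : ∀ n < N, ∀ o, Ex p ((m.setL .out o).setC (.v x) n)
      ((m.setL .out (F n ++ o)).setC (.v x) n) tb) :
    Ex (.loop (Sum.inr (.v x)) isTally <| popP (Sum.inr (.v x)) p) m
      ((m.setL .out ((List.range N).flatMap F ++ m.L .out)).setC (.v x) 0)
      (N * (tb + 2) + 1) := by
  refine (Ex.loop (k := Sum.inr (.v x)) (c := isTally) (b := tb + 1) (N := N)
    (fun n => (m.setL .out ((List.range' n (N - n)).flatMap F ++ m.L .out)).setC (.v x) n)
    (fun n hn => ⟨by simp [isTally_stk_C], Ex.popC' (n := n) (by simp)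
      ((hp n hn ((List.range' (n + 1) (N - (n + 1))).flatMap F ++ m.L .out)).congr ?_ ?_ le_rfl)⟩)
    (by simp [isTally_stk_C])).congr ?_ ?_ le_rfl
  · refine Mem.eq_of (fun k => rfl) fun k => ?_
    simp only [Mem.setC_C]; split_ifs <;> rfl
  · simp only [range'_succ_flatMap F n N hn, List.append_assoc]
  · refine Mem.eq_of (fun k => ?_) fun k => ?_
    · simp only [Mem.setC_L, Mem.setL_L]; split_ifs <;> simp_all
    · simp only [Mem.setC_C, Mem.setL_C]; split_ifs <;> simp_all
  · simp [List.range_eq_range']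

/-- A loop that counts its variable up, with the number of the remaining rounds on the stack `calc`,
writes the output of a downward loop. -/
theorem loop_down_exec (x : Fin 16) (p : Prog Stk) (F : ℕ → List Sym) (tb N : ℕ) (m : Mem)
    (r : List Sym) (hx : m.C (.v x) = 0) (hc : m.L .calc = unary N ++ r)
    (hp : ∀ n < N, ∀ o c, Ex p (((m.setL .calc c).setL .out o).setC (.v x) n)
      (((m.setL .calc c).setL .out (F n ++ o)).setC (.v x) n) tb) :
    Ex (.loop (Sum.inl .calc) isTally <| popP (Sum.inl .calc) <|
        .seq p (.push (Sum.inr (.v x)) .tally)) m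
      (((m.setL .calc (.comma :: r)).setL .out ((List.range N).reverse.flatMap F ++ m.L .out)).setC
        (.v x) N) (N * (tb + 3) + 1) := by
  refine (Ex.loop (k := Sum.inl .calc) (c := isTally) (b := tb + 1 + 1) (N := N)
    (fun n => (((m.setL .calc (unary n ++ r)).setL .out
      ((List.range (N - n)).reverse.flatMap F ++ m.L .out)).setC (.v x) (N - n)))
    (fun n hn => ⟨by simp [Mem.stk, Mem.setL_L, unary, List.replicate_succ, isTally],
      (Ex.popL' (a := .tally) (r := unary n ++ r)
        (by simp [Mem.setL_L, unary, List.replicate_succ])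
      (((hp (N - (n + 1)) (by omega) ((List.range (N - (n + 1))).reverse.flatMap F ++ m.L .out)
        (unary n ++ r)).congr ?_ rfl le_rfl).seq (Ex.pushC _ (.v x)))).congr rfl ?_ le_rfl⟩)
    (by simp [Mem.stk, Mem.setL_L, unary, isTally])).congr ?_ ?_ le_rfl
  · refine Mem.eq_of (fun k => ?_) fun k => rfl
    simp only [Mem.setC_L, Mem.setL_L]; split_ifs <;> simp_all
  · refine Mem.eq_of (fun k => ?_) fun k => ?_
    · have : N - n = (N - (n + 1)) + 1 := by omega
      simp only [Mem.setC_L, Mem.setL_L, this]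
      split_ifs
      · simp [List.range_succ]
      · rfl
      · rfl
    · simp only [Mem.setC_C, Mem.setL_C]; split_ifs <;> first | rfl | omega
  · refine Mem.eq_of (fun k => ?_) fun k => ?_
    · simp only [Mem.setC_L, Mem.setL_L]; split_ifs <;> simp_all
    · simp only [Mem.setC_C, Mem.setL_C]; split_ifs <;> simp_all
  · refine Mem.eq_of (fun k => ?_) fun k => ?_
    · simp only [Mem.setC_L, Mem.setL_L]; split_ifs <;> simp_all [unary]
    · simp only [Mem.setC_C, Mem.setL_C]; split_ifs <;> simp_all

/-- The memory during a loop with the variable `x`: its former value is saved on the stack of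
numbers. -/
def Mem.inLoop (m : Mem) (x : Fin 16) (n : ℕ) : Mem :=
  (m.setL .calc (unary (m.env x) ++ m.L .calc)).setC (.v x) n

theorem Ex.enter_loop (e : Expr) (x : Fin 16) (m : Mem) (N te : ℕ) (h1 : m.C .t1 = 0)
    (he : Ex e.comp m (m.setL .calc (unary N ++ m.L .calc)) te) :
    Ex (.seq (.seq e.comp (movP (Sum.inl .calc) (Sum.inr .t1)))
      (movP (Sum.inr (.v x)) (Sum.inl .calc))) m ((m.inLoop x 0).setC .t1 N)
      (te + 3 * N + 3 * m.env x + 2) := by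
  refine ((he.seq (Ex.movLC _ .calc .t1 N (.comma :: m.L .calc)
    (by simp [unary_append]) rfl)).seq (Ex.movCL _ (.v x) .calc)).congr rfl
    (Mem.eq_of (fun k => ?_) fun k => ?_) ?_
  · simp only [Mem.inLoop, Mem.setC_L, Mem.setL_L, if_true, Mem.setC_C, Mem.setL_C, unary_append,
      Mem.env]
    split_ifs <;> simp_all
  · simp only [Mem.inLoop, Mem.setC_C, Mem.setL_C]; split_ifs <;> simp_all
  · simp [Mem.setC_C, Mem.env]; omega

theorem loop_up_comp (e : Expr) (x : Fin 16) (m : Mem) (p : Prog Stk) (F : ℕ → List Sym)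
    (N te tb : ℕ) (h1 : m.C .t1 = 0) (he : Ex e.comp m (m.setL .calc (unary N ++ m.L .calc)) te)
    (hp : ∀ n < N, ∀ o c, Ex p (((m.setL .calc c).setL .out o).setC (.v x) n)
      (((m.setL .calc c).setL .out (F n ++ o)).setC (.v x) n) tb) :
    Ex (.seq e.comp <| .seq (movP (Sum.inl .calc) (Sum.inr .t1)) <|
      .seq (movP (Sum.inr (.v x)) (Sum.inl .calc)) <|
      .seq (movP (Sum.inr .t1) (Sum.inr (.v x))) <|
      .seq (.loop (Sum.inr (.v x)) isTally <| popP (Sum.inr (.v x)) p) <|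
      readNum .calc x) m (m.setL .out ((List.range N).flatMap F ++ m.L .out))
      (te + 6 * N + 6 * m.env x + N * (tb + 2) + 20) := by
  have hl := loop_up_exec x p F tb N (m.inLoop x N) (by simp [Mem.inLoop]) (fun n hn o =>
    (hp n hn o (unary (m.env x) ++ m.L .calc)).congr
      (Mem.eq_of (fun k => rfl) fun k => by
        simp only [Mem.inLoop, Mem.setC_C, Mem.setL_C]; split_ifs <;> rfl)
      (Mem.eq_of (fun k => rfl) fun k => by
        simp only [Mem.inLoop, Mem.setC_C, Mem.setL_C]; split_ifs <;> rfl) le_rfl)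
  refine ((Ex.enter_loop e x m N te h1 he).seq
    (((Ex.movCC _ .t1 (.v x) (by simp)).congr rfl (m₁' := m.inLoop x N) ?_ le_rfl).seq
    (hl.seq (Ex.readNum _ .calc x (m.env x) (m.L .calc) ?_)))).assoc.assoc.congr rfl ?_ ?_
  · refine Mem.eq_of (fun k => rfl) fun k => ?_
    simp only [Mem.inLoop, Mem.setC_C, Mem.setL_C]; split_ifs <;> simp_all
  · simp [Mem.inLoop, Mem.setL_L]
  · refine Mem.eq_of (fun k => ?_) fun k => ?_
    · simp only [Mem.inLoop, Mem.setC_L, Mem.setL_L]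
      split_ifs <;> simp_all
    · simp only [Mem.inLoop, Mem.setC_C, Mem.setL_C, Mem.env]; split_ifs <;> simp_all
  · simp only [Mem.setC_C_self]; omega

theorem loop_down_comp (e : Expr) (x : Fin 16) (m : Mem) (p : Prog Stk) (F : ℕ → List Sym)
    (N te tb : ℕ) (h1 : m.C .t1 = 0) (he : Ex e.comp m (m.setL .calc (unary N ++ m.L .calc)) te)
    (hp : ∀ n < N, ∀ o c, Ex p (((m.setL .calc c).setL .out o).setC (.v x) n)
      (((m.setL .calc c).setL .out (F n ++ o)).setC (.v x) n) tb) :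
    Ex (.seq e.comp <| .seq (movP (Sum.inl .calc) (Sum.inr .t1)) <|
      .seq (movP (Sum.inr (.v x)) (Sum.inl .calc)) <|
      .seq (.push (Sum.inl .calc) .comma) <| .seq (movP (Sum.inr .t1) (Sum.inl .calc)) <|
      .seq (.loop (Sum.inl .calc) isTally <| popP (Sum.inl .calc) <|
        .seq p (.push (Sum.inr (.v x)) .tally)) <|
      .seq (popP (Sum.inl .calc) idle) <|
      .seq (.loop (Sum.inr (.v x)) isTally <| popP (Sum.inr (.v x)) idle) <|
      readNum .calc x) m (m.setL .out ((List.range N).reverse.flatMap F ++ m.L .out))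
      (te + 12 * N + 6 * m.env x + N * (tb + 3) + 30) := by
  have hl := loop_down_exec x p F tb N
    ((m.inLoop x 0).setL .calc (unary N ++ (m.inLoop x 0).L .calc)) ((m.inLoop x 0).L .calc)
    (by simp [Mem.inLoop]) (by simp) (fun n hn o c =>
      (hp n hn o c).congr
        (Mem.eq_of (fun k => by
          simp only [Mem.inLoop, Mem.setC_L, Mem.setL_L]; split_ifs <;> rfl) fun k => by
          simp only [Mem.inLoop, Mem.setC_C, Mem.setL_C]; split_ifs <;> rfl)
        (Mem.eq_of (fun k => by
          simp only [Mem.inLoop, Mem.setC_L, Mem.setL_L]; split_ifs <;> rfl) fun k => by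
          simp only [Mem.inLoop, Mem.setC_C, Mem.setL_C]; split_ifs <;> rfl) le_rfl)
  refine ((Ex.enter_loop e x m N te h1 he).seq
    ((Ex.pushL _ .calc .comma).seq (((Ex.movCL _ .t1 .calc).congr rfl
    (m₁' := (m.inLoop x 0).setL .calc (unary N ++ (m.inLoop x 0).L .calc)) ?_ le_rfl).seq
    (hl.seq ((Ex.popL' (a := .comma) (r := (m.inLoop x 0).L .calc) ?_ (Ex.of_idle _)).seq
    ((Ex.clearC _ (.v x)).seq
      (Ex.readNum _ .calc x (m.env x) (m.L .calc) ?_))))))).assoc.assoc.congr rfl ?_ ?_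
  · refine Mem.eq_of (fun k => ?_) fun k => ?_
    · simp only [Mem.inLoop, Mem.setC_L, Mem.setL_L, Mem.setC_C_self, if_true, unary_append,
        Mem.setL_C]
      split_ifs <;> simp_all
    · simp only [Mem.inLoop, Mem.setC_C, Mem.setL_C]; split_ifs <;> simp_all
  · simp [Mem.setL_L]
  · simp [Mem.inLoop, Mem.setL_L]
  · refine Mem.eq_of (fun k => ?_) fun k => ?_
    · simp only [Mem.inLoop, Mem.setC_L, Mem.setL_L]
      split_ifs <;> simp_all
    · simp only [Mem.inLoop, Mem.setC_C, Mem.setL_C, Mem.env]; split_ifs <;> simp_all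
  · simp only [Mem.setC_C_self, Mem.setL_C]; omega

/-- Every program of the language runs in polynomial time. -/
theorem Gen.exec : ∀ g : Gen, ∃ P : Polynomial ℕ, ∀ (cs : Fin 4 → List Gate) (m : Mem) (B : ℕ),
    (∀ i, m.env i ≤ B) → m.C .t1 = 0 → m.C .t2 = 0 → m.C .t3 = 0 → m.L .src = [] →
    (∀ c, m.L (.circ c) = (cs c).flatMap Gate.encode) →
    (∀ c, ((cs c).flatMap Gate.encode).length ≤ B) →
    Ex g.comp m (m.setL .out ((g.eval cs m.env).flatMap Gate.encode ++ m.L .out)) (P.eval B)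
  | emit l => by
      obtain ⟨P, hP⟩ := emitsP_exec l
      exact ⟨P, fun cs m B hB h1 h2 h3 _ _ _ => hP m B hB h1 h2 h3⟩
  | each c rev body => each_exec c rev body
  | seq p q => by
      obtain ⟨P, hP⟩ := p.exec
      obtain ⟨Q, hQ⟩ := q.exec
      refine ⟨Q + P, fun cs m B hB h1 h2 h3 h4 h5 h6 => ?_⟩
      refine ((hQ cs m B hB h1 h2 h3 h4 h5 h6).seq (hP cs (m.setL .out _) B hB h1 h2 h3
        (by simpa [Mem.setL_L] using h4) (by simpa [Mem.setL_L] using h5) h6)).congr rfl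
        (Mem.eq_of (fun k => ?_) fun _ => rfl) (by simp)
      simp only [Mem.setL_L, if_true, Gen.eval]; split_ifs <;> simp
  | loop up x e body => by
      obtain ⟨P, hP⟩ := body.exec
      obtain ⟨E, hE⟩ := e.exec
      refine ⟨E + 12 * e.bound + 6 * Polynomial.X +
        e.bound * (P.comp (Polynomial.X + e.bound) + 3) + 30,
        fun cs m B hB h1 h2 h3 h4 h5 h6 => ?_⟩
      have he := e.eval_le_bound hB
      have hx := hB x
      have hE' := hE m B hB h1 h2 h3
      have hbody : ∀ n < e.eval m.env, ∀ o c,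
          Ex body.comp (((m.setL .calc c).setL .out o).setC (.v x) n)
          (((m.setL .calc c).setL .out ((body.eval cs (Function.update m.env x n)).flatMap
            Gate.encode ++ o)).setC (.v x) n) (P.eval (B + e.bound.eval B)) := by
        intro n hn o c
        have henv : (((m.setL .calc c).setL .out o).setC (.v x) n).env =
            Function.update m.env x n := by simp [Mem.env_setC]
        have := hP cs (((m.setL .calc c).setL .out o).setC (.v x) n) (B + e.bound.eval B)
          (fun i => by
            rw [henv, Function.update_apply]
            have := hB i
            split_ifs <;> omega) (by simpa [Mem.setC_C] using h1) (by simpa [Mem.setC_C] using h2)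
          (by simpa [Mem.setC_C] using h3) (by simpa [Mem.setL_L] using h4)
          (by simpa [Mem.setL_L] using h5) (fun c => (h6 c).trans (by omega))
        rw [henv] at this
        refine this.congr rfl (Mem.eq_of (fun k => ?_) fun k => rfl) le_rfl
        simp only [Mem.setC_L, Mem.setL_L]; split_ifs <;> simp_all
      have hmul : e.eval m.env * (P.eval (B + e.bound.eval B) + 3) ≤
        e.bound.eval B * (P.eval (B + e.bound.eval B) + 3) := Nat.mul_le_mul_right _ he
      have hmul' : e.eval m.env * (P.eval (B + e.bound.eval B) + 2) ≤
        e.bound.eval B * (P.eval (B + e.bound.eval B) + 3) := Nat.mul_le_mul he (by omega)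
      cases up with
      | true =>
        refine (loop_up_comp e x m _ _ _ _ _ h1 hE' hbody).congr rfl ?_ ?_
        · simp only [Gen.eval, if_true, flatMap_encode_flatMap]
        · simp only [Polynomial.eval_add, Polynomial.eval_mul, Polynomial.eval_X,
            Polynomial.eval_ofNat, Polynomial.eval_comp]
          omega
      | false =>
        refine (loop_down_comp e x m _ _ _ _ _ h1 hE' hbody).congr rfl ?_ ?_
        · simp [Gen.eval, flatMap_encode_flatMap]
        · simp only [Polynomial.eval_add, Polynomial.eval_mul, Polynomial.eval_X,
            Polynomial.eval_ofNat, Polynomial.eval_comp]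
          omega

end ExtSim

/-! ### Uniform circuit families given by circuit-writing programs -/

namespace ExtSim

open Prog

/-- Move a word, up to the first symbol that violates `c`, to another stack. -/
def moveWord (c : Option Sym → Bool) (l l' : LStk) : Prog Stk :=
  .loop (Sum.inl l) c <| .pop (Sum.inl l) fun o => match o with
    | some a => .push (Sum.inl l') a
    | none => idle

theorem moveWord_exec (c : Option Sym → Bool) (l l' : LStk) (hl : l ≠ l') (m : Mem)
    (w r : List Sym) (h : m.L l = w ++ r) (hw : ∀ a ∈ w, c (some a) = true)
    (hr : c r.head? = false) :
    Ex (moveWord c l l') m ((m.setL l r).setL l' (w.reverse ++ m.L l')) (w.length * 3 + 1) := by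
  induction w generalizing m with
  | nil =>
    refine Ex.congr (p := moveWord c l l') (m := m) (m' := m) (B := 1)
      (Exec.loop_false (by simpa [Mem.stk, h] using hr)) rfl
      (Mem.eq_of (fun k => ?_) fun _ => rfl) (by simp)
    simp only [Mem.setL_L]; split_ifs <;> simp_all
  | cons a w ih =>
    have h1 : Ex (.pop (Sum.inl l) fun o => match o with
      | some a => .push (Sum.inl l') a
      | none => idle) m ((m.setL l (w ++ r)).setL l' (a :: m.L l')) 2 := by
      refine Ex.popL (a := a) (r := w ++ r) (by simpa using h)
        ((Ex.pushL (m.setL l (w ++ r)) l' a).congr rfl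
        (Mem.eq_of (fun k => ?_) fun _ => rfl) le_rfl)
      simp only [Mem.setL_L]; split_ifs <;> simp_all
    have h2 := ih ((m.setL l (w ++ r)).setL l' (a :: m.L l')) (by simp [Mem.setL_L, hl])
        fun b hb => hw b (by simp [hb])
    refine Ex.congr (p := moveWord c l l') (m := m) (B := 2 + (w.length * 3 + 1) + 1)
      (Exec.loop_true (by simpa [Mem.stk, h] using hw a (by simp)) h1 h2) rfl
        (Mem.eq_of (fun k => ?_) fun _ => rfl) (by simp; omega)
    simp only [Mem.setL_L]; split_ifs <;> simp_all

/-- Whether there is a symbol that does not end the description of a circuit. -/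
def notClose (o : Option Sym) : Bool := o.isSome && o != some .close

theorem notClose_of_mem_encode {gs : List Gate} : ∀ a ∈ gs.flatMap Gate.encode,
    notClose (some a) = true := by
  intro a ha
  obtain ⟨g, -, hg⟩ := List.mem_flatMap.1 ha
  cases g <;> simp [Gate.encode, unary] at hg <;> (rcases a with _ | _ <;> simp_all [notClose])

/-- Read the description of a circuit. -/
def readCirc (c : Fin 4) (i : Fin 16) : Prog Stk :=
  .seq (readNum .inp i) <| .seq (moveWord notClose .inp .src) <|
  .seq (popP (Sum.inl .inp) idle) <| moveWord Option.isSome .src (.circ c)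

theorem readCirc_exec (c : Fin 4) (i : Fin 16) (m : Mem) (A : QCircuit) (r : List Sym)
    (h : m.L .inp = A.encode ++ r) (hs : m.L .src = []) (hc : m.L (.circ c) = []) :
    Ex (readCirc c i) m (((m.setL .inp r).setL (.circ c) (A.gates.flatMap Gate.encode)).setC (.v i)
      (m.C (.v i) + A.anc)) (6 * A.encode.length + 10) := by
  refine ((Ex.readNum m .inp i A.anc (A.gates.flatMap Gate.encode ++ .close :: r)
    (by simp [h, QCircuit.encode])).seq ((moveWord_exec notClose .inp .src (by simp) _
      (A.gates.flatMap Gate.encode) (.close :: r) (by simp) notClose_of_mem_encode rfl).seq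
      ((Ex.popL' (a := .close) (r := r) (by simp [Mem.setL_L]) (Ex.of_idle _)).seq
      (moveWord_exec Option.isSome .src (.circ c) (by simp) _
        (A.gates.flatMap Gate.encode).reverse [] (by simp [Mem.setL_L, hs]) (by simp) rfl)))).congr
      rfl (Mem.eq_of (fun k => ?_) fun k => ?_) ?_
  · simp only [Mem.setL_L, Mem.setC_L]; split_ifs <;> simp_all
  · simp only [Mem.setL_C, Mem.setC_C]
  · simp [QCircuit.encode, unary]; omega

/-- Clear a list of variables. -/
def clearV : List (Fin 16) → Prog Stk
  | [] => idle
  | i :: l => .seq (.loop (Sum.inr (.v i)) isTally <| popP (Sum.inr (.v i)) idle) (clearV l)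

theorem clearV_exec (B : ℕ) : ∀ (l : List (Fin 16)) (m : Mem), (∀ i, m.env i ≤ B) →
    Ex (clearV l) m ⟨m.L, fun c => if ∃ i ∈ l, c = .v i then 0 else m.C c⟩
      (l.length * (3 * B + 1) + 1)
  | [], m, _ => (Ex.of_idle m).congr rfl (Mem.eq_of (fun _ => rfl) fun _ => by simp) (by simp)
  | i :: l, m, h => by
      refine ((Ex.clearC m (.v i)).seq (clearV_exec B l _ fun j => ?_)).congr rfl
        (Mem.eq_of (fun _ => rfl) fun c => ?_) ?_
      · have := h j
        rw [Mem.env_setC, Function.update_apply]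
        split_ifs <;> omega
      · by_cases h1 : ∃ j ∈ l, c = .v j <;> by_cases h2 : c = .v i <;>
          simp [Mem.setC_C, h1, h2]
      · have : m.C (.v i) ≤ B := h i
        simp only [List.length_cons]; ring_nf; omega

/-- Clear a word. -/
def clearL (l : LStk) : Prog Stk := .loop (Sum.inl l) Option.isSome (popP (Sum.inl l) idle)

theorem clearL_exec (l : LStk) (w : List Sym) (m : Mem) (h : m.L l = w) :
    Ex (clearL l) m (m.setL l []) (w.length * 3 + 1) := by
  induction w generalizing m with
  | nil =>
    refine Ex.congr (p := clearL l) (m := m) (m' := m) (B := 1)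
      (Exec.loop_false (by simp [Mem.stk, h])) rfl
      (Mem.eq_of (fun k => ?_) fun _ => rfl) (by simp)
    simp only [Mem.setL_L]; split_ifs <;> simp_all
  | cons a w ih =>
    have h1 := Ex.popL' h (Ex.of_idle (m.setL l w))
    have h2 := ih (m.setL l w) (by simp)
    refine Ex.congr (p := clearL l) (m := m) (B := 2 + (w.length * 3 + 1) + 1)
      (Exec.loop_true (by simp [Mem.stk, h]) h1 h2) rfl
      (Mem.eq_of (fun k => ?_) fun _ => rfl) (by simp; omega)
    simp only [Mem.setL_L]; split_ifs <;> simp_all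

/-- The values of the variables: the parameters and the numbers of ancillas of the four
circuits. -/
def SEInput.env (I : SEInput) : Fin 16 → ℕ :=
  ![0, 0, 0, 0, 0, I.e, I.desc.k, I.desc.n, I.desc.m, I.desc.r, I.desc.sampler.anc,
    I.desc.meas.anc, I.desc.alg0.anc, I.desc.alg1.anc, I.lam, 0]

/-- The gates of the four circuits of the input. -/
def SEInput.circs (I : SEInput) : Fin 4 → List Gate :=
  ![I.desc.sampler.gates, I.desc.meas.gates, I.desc.alg0.gates, I.desc.alg1.gates]

/-- The memory when the input has been read. -/
def SEInput.mem (I : SEInput) : Mem where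
  L := fun l => match l with
    | .circ c => (I.circs c).flatMap Gate.encode
    | _ => []
  C := fun c => match c with
    | .v i => I.env i
    | _ => 0

/-- Read the input of the extractor. -/
def readInput : Prog Stk :=
  .seq (readNum .inp 14) <| .seq (readNum .inp 5) <| .seq (readNum .inp 6) <|
  .seq (readNum .inp 7) <| .seq (readNum .inp 8) <| .seq (readNum .inp 9) <|
  .seq (readCirc 0 10) <| .seq (readCirc 1 11) <| .seq (readCirc 2 12) <| readCirc 3 13

/-- Clear the parameters and the circuits. -/
def cleanup : Prog Stk :=
  .seq (clearV (List.finRange 16)) <|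
  .seq (clearL (.circ 0)) <| .seq (clearL (.circ 1)) <| .seq (clearL (.circ 2)) <|
  clearL (.circ 3)

/-- The memory that holds only the word `w` on the stack `l`. -/
def Mem.word (l : LStk) (w : List Sym) : Mem := ⟨fun l' => if l' = l then w else [], fun _ => 0⟩

theorem readInput_exec (I : SEInput) :
    Ex readInput (Mem.word .inp I.encode) I.mem (20 * I.encode.length + 100) := by
  set m₀ := Mem.word .inp I.encode with hm₀
  have h0 := Ex.readNum m₀ .inp 14 I.lam (unary I.e ++ I.desc.encode)
      (by simp [m₀, SEInput.encode, Mem.word])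
  have h1 := Ex.readNum _ .inp 5 I.e I.desc.encode
    (show (Mem.setC (Mem.setL m₀ .inp _) (.v 14) (m₀.C (.v 14) + I.lam)).L .inp = _ by
      simp; rfl)
  refine (h0.seq <| h1.seq <|
    (Ex.readNum _ .inp 6 I.desc.k (unary I.desc.n ++ unary I.desc.m ++ unary I.desc.r ++
      I.desc.sampler.encode ++ I.desc.meas.encode ++ I.desc.alg0.encode ++ I.desc.alg1.encode)
      (by simp [Desc.encode])).seq <|
    (Ex.readNum _ .inp 7 I.desc.n (unary I.desc.m ++ unary I.desc.r ++
      I.desc.sampler.encode ++ I.desc.meas.encode ++ I.desc.alg0.encode ++ I.desc.alg1.encode)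
      (by simp)).seq <|
    (Ex.readNum _ .inp 8 I.desc.m (unary I.desc.r ++
      I.desc.sampler.encode ++ I.desc.meas.encode ++ I.desc.alg0.encode ++ I.desc.alg1.encode)
      (by simp)).seq <|
    (Ex.readNum _ .inp 9 I.desc.r (
      I.desc.sampler.encode ++ I.desc.meas.encode ++ I.desc.alg0.encode ++ I.desc.alg1.encode)
      (by simp)).seq <|
    (readCirc_exec 0 10 _ I.desc.sampler
      (I.desc.meas.encode ++ I.desc.alg0.encode ++ I.desc.alg1.encode)
      (by simp) (by simp [Mem.setL_L, m₀, Mem.word]) (by simp [Mem.setL_L, m₀, Mem.word])).seq <|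
    (readCirc_exec 1 11 _ I.desc.meas (I.desc.alg0.encode ++ I.desc.alg1.encode)
      (by simp [Mem.setL_L]) (by simp [Mem.setL_L, m₀, Mem.word])
      (by simp [Mem.setL_L, m₀, Mem.word])).seq <|
    (readCirc_exec 2 12 _ I.desc.alg0 I.desc.alg1.encode (by simp [Mem.setL_L])
      (by simp [Mem.setL_L, m₀, Mem.word]) (by simp [Mem.setL_L, m₀, Mem.word])).seq <|
    readCirc_exec 3 13 _ I.desc.alg1 [] (by simp [Mem.setL_L])
      (by simp [Mem.setL_L, m₀, Mem.word]) (by simp [Mem.setL_L, m₀, Mem.word])).congr rfl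
    (Mem.eq_of (fun k => ?_) fun k => ?_) ?_
  · rcases k with _ | _ | _ | _ | c
    iterate 4 simp [Mem.setL_L, m₀, SEInput.mem, Mem.word]
    fin_cases c <;> simp [Mem.setL_L, SEInput.mem, SEInput.circs]
  · rcases k with _ | _ | _ | i
    iterate 3 simp [Mem.setC_C, m₀, SEInput.mem, Mem.word]
    fin_cases i <;> simp [Mem.setC_C, m₀, SEInput.mem, SEInput.env, Mem.word]
  · simp only [SEInput.encode, Desc.encode, unary, List.length_append, List.length_replicate,
      List.length_singleton]
    omega

theorem cleanup_exec (m : Mem) (B : ℕ) (hB : ∀ i, m.env i ≤ B)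
    (hc : ∀ c, (m.L (.circ c)).length ≤ B) :
    Ex cleanup m ⟨fun l => match l with
      | .circ _ => []
      | l => m.L l, fun c => match c with
      | .v _ => 0
      | c => m.C c⟩ (60 * B + 30) := by
  refine ((clearV_exec B (List.finRange 16) m hB).seq <| (clearL_exec (.circ 0) _ _ rfl).seq <|
    (clearL_exec (.circ 1) _ _ rfl).seq <| (clearL_exec (.circ 2) _ _ rfl).seq <|
    clearL_exec (.circ 3) _ _ rfl).congr rfl
    (Mem.eq_of (fun k => ?_) fun k => ?_) ?_
  · rcases k with _ | _ | _ | _ | c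
    iterate 4 simp [Mem.setL_L]
    fin_cases c <;> simp [Mem.setL_L]
  · rcases k with _ | _ | _ | i <;> simp
  · have h0 := hc 0
    have h1 := hc 1
    have h2 := hc 2
    have h3 := hc 3
    simp only [Mem.setL_L, List.length_finRange, LStk.circ.injEq, Fin.reduceEq, if_false]
    omega

/-- A map is quantum polynomial time if its circuits have `A` ancillas and are written down by a
program `G` of the circuit-writing language. -/
theorem isQPT_of_gen (A : Expr) (G : Gen) :
    IsQPT SEInput.encode fun I => ⟨A.eval I.env, G.eval I.circs I.env⟩ := by
  obtain ⟨P, hP⟩ := G.exec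
  obtain ⟨Q, hQ⟩ := emitNum_exec A
  refine Prog.polyTime_of_run
    (.seq readInput <| .seq (.push (Sum.inl .out) .close) <| .seq G.comp <|
      .seq (emitNum A) cleanup) (Sum.inl .inp) (Sum.inl .out)
    (P + Q + 80 * Polynomial.X + 200) fun I => ?_
  set N := I.encode.length with hN
  have hanc : ∀ A : QCircuit, A.encode.length = A.anc + (A.gates.flatMap Gate.encode).length + 2 :=
    by
    intro A; simp only [QCircuit.encode, unary, List.length_append, List.length_replicate,
      List.length_singleton]; omega
  have hlen : I.lam + I.e + I.desc.k + I.desc.n + I.desc.m + I.desc.r + I.desc.sampler.encode.length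
      + I.desc.meas.encode.length + I.desc.alg0.encode.length + I.desc.alg1.encode.length ≤ N := by
    simp only [hN, SEInput.encode, Desc.encode, unary, List.length_append, List.length_replicate,
      List.length_singleton]; omega
  simp only [hanc] at hlen
  have henv : ∀ i, I.env i ≤ N := by
    intro i
    fin_cases i <;> simp only [SEInput.env, Fin.isValue, Fin.reduceFinMk] <;>
      simp only [Matrix.cons_val, Fin.zero_eta, Fin.mk_one] <;> omega
  have hcs : ∀ c, ((I.circs c).flatMap Gate.encode).length ≤ N := by
    intro c
    fin_cases c <;> simp only [SEInput.circs, Fin.isValue, Fin.reduceFinMk] <;>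
      simp only [Matrix.cons_val, Fin.zero_eta, Fin.mk_one] <;> omega
  set m₁ : Mem := I.mem.setL .out ((G.eval I.circs I.env).flatMap Gate.encode ++ [.close]) with hm₁
  have hG : Ex G.comp (I.mem.setL .out [.close]) m₁ (P.eval N) := by
    refine (hP I.circs (I.mem.setL .out [.close]) N henv rfl rfl rfl (by
      simp [Mem.setL_L, SEInput.mem]) (by simp [Mem.setL_L, SEInput.mem]) hcs).congr rfl
      (Mem.eq_of (fun k => ?_) fun _ => rfl) le_rfl
    simp only [m₁, Mem.setL_L, if_true]
    split_ifs <;> rfl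
  have hA := hQ m₁ N henv rfl rfl rfl
  have hfin := cleanup_exec (m₁.setL .out (unary (A.eval m₁.env) ++ m₁.L .out)) N henv
    (by simpa [m₁, Mem.setL_L, SEInput.mem] using hcs)
  have hall := (readInput_exec I).seq <| (Ex.pushL I.mem .out .close).seq <| hG.seq <|
    hA.seq hfin
  obtain ⟨t, ht, hrun⟩ := hall.congr (m₁' := Mem.word .out
    (⟨A.eval I.env, G.eval I.circs I.env⟩ : QCircuit).encode) rfl
    (B' := P.eval N + Q.eval N + 80 * N + 200) (Mem.eq_of (fun k => by
      rcases k with _ | _ | _ | _ | c <;>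
        simp [Mem.setL_L, m₁, SEInput.mem, QCircuit.encode, Mem.word] <;> rfl) fun k => by
      rcases k with _ | _ | _ | i <;> simp [m₁, Mem.word, SEInput.mem]) (by omega)
  refine ⟨t, by simpa using ht, ?_⟩
  convert hrun using 1
  · funext k
    rcases k with k | k <;> simp [Mem.stk, Mem.word]
  · funext k
    rcases k with k | k <;> simp [Mem.stk, Mem.word]

end ExtSim

/-! ### Inner products -/

namespace ExtSim

section Inner

variable {ι : Type} [Fintype ι]

/-- The standard inner product, antilinear in the first argument. -/
def ip (φ ψ : ι → ℂ) : ℂ := star φ ⬝ᵥ ψ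

/-- The squared norm. -/
noncomputable def nsq (ψ : ι → ℂ) : ℝ := ∑ b, ‖ψ b‖ ^ 2

/-- The norm. -/
noncomputable def nrm (ψ : ι → ℂ) : ℝ := √(nsq ψ)

theorem ip_def (φ ψ : ι → ℂ) : ip φ ψ = ∑ b, star (φ b) * ψ b := rfl

theorem ip_eq_inner (φ ψ : ι → ℂ) : ip φ ψ = inner ℂ (WithLp.toLp 2 φ) (WithLp.toLp 2 ψ) := by
  simp [ip_def, PiLp.inner_apply, mul_comm]

theorem nrm_eq_norm (ψ : ι → ℂ) : nrm ψ = ‖WithLp.toLp 2 ψ‖ := by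
  simp [nrm, nsq, EuclideanSpace.norm_eq]

theorem ip_self (ψ : ι → ℂ) : ip ψ ψ = nsq ψ := by
  simp [ip_def, nsq, Complex.conj_mul']

theorem nsq_nonneg (ψ : ι → ℂ) : 0 ≤ nsq ψ := Finset.sum_nonneg fun _ _ => by positivity

theorem nrm_nonneg (ψ : ι → ℂ) : 0 ≤ nrm ψ := Real.sqrt_nonneg _

theorem nrm_sq (ψ : ι → ℂ) : nrm ψ ^ 2 = nsq ψ := Real.sq_sqrt (nsq_nonneg ψ)

theorem nsq_eq_re (ψ : ι → ℂ) : nsq ψ = (ip ψ ψ).re := by simp [ip_self]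

theorem nrm_add_le (φ ψ : ι → ℂ) : nrm (φ + ψ) ≤ nrm φ + nrm ψ := by
  simpa [nrm_eq_norm, WithLp.toLp_add] using norm_add_le (WithLp.toLp 2 φ) (WithLp.toLp 2 ψ)

theorem nrm_sub_le (φ ψ : ι → ℂ) : nrm (φ - ψ) ≤ nrm φ + nrm ψ := by
  simpa [nrm_eq_norm, WithLp.toLp_sub] using norm_sub_le (WithLp.toLp 2 φ) (WithLp.toLp 2 ψ)

theorem nrm_sum_le {κ : Type*} (s : Finset κ) (f : κ → ι → ℂ) :
    nrm (∑ i ∈ s, f i) ≤ ∑ i ∈ s, nrm (f i) := by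
  classical
  induction s using Finset.induction_on with
  | empty => simp [nrm, nsq]
  | insert a s ha ih =>
    rw [Finset.sum_insert ha, Finset.sum_insert ha]
    exact (nrm_add_le _ _).trans (by gcongr)

theorem norm_ip_le (φ ψ : ι → ℂ) : ‖ip φ ψ‖ ≤ nrm φ * nrm ψ := by
  simpa [ip_eq_inner, nrm_eq_norm] using norm_inner_le_norm (𝕜 := ℂ) (WithLp.toLp 2 φ) (WithLp.toLp
    2 ψ)

theorem nsq_smul (c : ℂ) (ψ : ι → ℂ) : nsq (c • ψ) = ‖c‖ ^ 2 * nsq ψ := by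
  simp [nsq, mul_pow, Finset.mul_sum]

theorem nsq_eq_zero {ψ : ι → ℂ} (h : nsq ψ = 0) : ψ = 0 := by
  funext b
  have := (Finset.sum_eq_zero_iff_of_nonneg fun b _ => by positivity).1 h b (Finset.mem_univ b)
  simpa using this

theorem star_ip (φ ψ : ι → ℂ) : star (ip φ ψ) = ip ψ φ := by
  simp [ip_def, mul_comm]

theorem ip_add_left (φ φ' ψ : ι → ℂ) : ip (φ + φ') ψ = ip φ ψ + ip φ' ψ := by
  simp [ip_def, add_mul, Finset.sum_add_distrib]

theorem ip_add_right (φ ψ ψ' : ι → ℂ) : ip φ (ψ + ψ') = ip φ ψ + ip φ ψ' := by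
  simp [ip_def, mul_add, Finset.sum_add_distrib]

theorem ip_sub_left (φ φ' ψ : ι → ℂ) : ip (φ - φ') ψ = ip φ ψ - ip φ' ψ := by
  simp [ip_def, sub_mul, Finset.sum_sub_distrib]

theorem ip_sub_right (φ ψ ψ' : ι → ℂ) : ip φ (ψ - ψ') = ip φ ψ - ip φ ψ' := by
  simp [ip_def, mul_sub, Finset.sum_sub_distrib]

theorem ip_smul_right (c : ℂ) (φ ψ : ι → ℂ) : ip φ (c • ψ) = c * ip φ ψ := by
  simp [ip_def, Finset.mul_sum, mul_left_comm]

theorem ip_smul_left (c : ℂ) (φ ψ : ι → ℂ) : ip (c • φ) ψ = star c * ip φ ψ := by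
  simp [ip_def, Finset.mul_sum, mul_assoc]

theorem ip_sum_right {κ : Type*} (s : Finset κ) (φ : ι → ℂ) (f : κ → ι → ℂ) :
    ip φ (∑ i ∈ s, f i) = ∑ i ∈ s, ip φ (f i) := by
  simp only [ip, dotProduct_sum]

theorem ip_sum_left {κ : Type*} (s : Finset κ) (f : κ → ι → ℂ) (φ : ι → ℂ) :
    ip (∑ i ∈ s, f i) φ = ∑ i ∈ s, ip (f i) φ := by
  simp only [ip, star_sum, sum_dotProduct]

theorem ip_mulVec (A : Matrix ι ι ℂ) (φ ψ : ι → ℂ) : ip φ (A *ᵥ ψ) = ip (Aᴴ *ᵥ φ) ψ := by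
  simp only [ip, star_mulVec, conjTranspose_conjTranspose, dotProduct_mulVec]

/-- Two vectors with the same inner products are equal. -/
theorem eq_of_ip {φ ψ : ι → ℂ} (h : ∀ χ, ip χ φ = ip χ ψ) : φ = ψ := by
  refine sub_eq_zero.1 (nsq_eq_zero ?_)
  have := h (φ - ψ)
  rw [nsq_eq_re, ip_sub_right, this, sub_self, Complex.zero_re]

end Inner

/-! ### The linear algebra of circuits -/

section Circuits

variable {w : ℕ}

theorem bits_ext {b b' : Bits w} (h : ∀ a, bitAt b a = bitAt b' a) : b = b' := by
  funext j
  simpa [bitAt] using h j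

theorem bitAt_of_le {b : Bits w} {a : ℕ} (h : w ≤ a) : bitAt b a = false := by
  simp [bitAt, not_lt.2 h]

theorem bitAt_setBit (b : Bits w) (a : ℕ) (v : Bool) (a' : ℕ) :
    bitAt (setBit b a v) a' = if a' = a ∧ a < w then v else bitAt b a' := by
  unfold bitAt setBit
  by_cases h : a' = a
  · subst h; split_ifs <;> simp_all
  · simp [h]

theorem bitAt_flipBit (b : Bits w) (a a' : ℕ) :
    bitAt (flipBit b a) a' = if a' = a ∧ a < w then !bitAt b a else bitAt b a' := by
  rw [flipBit, bitAt_setBit]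

theorem flipBit_flipBit (b : Bits w) (a : ℕ) : flipBit (flipBit b a) a = b := by
  refine bits_ext fun a' => ?_
  simp only [bitAt_flipBit]
  split_ifs <;> simp_all

theorem sum_flipBit {M : Type*} [AddCommMonoid M] (a : ℕ) (f : Bits w → M) :
    ∑ b, f (flipBit b a) = ∑ b, f b :=
  Equiv.sum_comp (Function.Involutive.toPerm (fun b : Bits w => flipBit b a)
    fun b => flipBit_flipBit b a) f

theorem flipBit_of_le {a : ℕ} (b : Bits w) (h : w ≤ a) : flipBit b a = b := by
  refine bits_ext fun a' => ?_
  rw [bitAt_flipBit, if_neg (by omega)]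

theorem setBit_false (b : Bits w) (a : ℕ) :
    setBit b a false = if bitAt b a = true then flipBit b a else b := by
  refine bits_ext fun a' => ?_
  split_ifs with h
  · rw [bitAt_setBit, bitAt_flipBit, h]; rfl
  · rw [bitAt_setBit]; split_ifs with h' <;> simp_all

theorem setBit_true (b : Bits w) (a : ℕ) :
    setBit b a true = if bitAt b a = true then b else flipBit b a := by
  refine bits_ext fun a' => ?_
  split_ifs with h
  · rw [bitAt_setBit]; split_ifs with h' <;> simp_all
  · rw [bitAt_setBit, bitAt_flipBit]; simp [h]

/-- The vector obtained by running the gates. -/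
noncomputable def ap (gs : List Gate) (ψ : Bits w → ℂ) : Bits w → ℂ :=
  gs.foldl (fun ψ g => g.apply ψ) ψ

@[simp] theorem ap_nil (ψ : Bits w → ℂ) : ap [] ψ = ψ := rfl
theorem ap_cons (g : Gate) (gs : List Gate) (ψ : Bits w → ℂ) :
    ap (g :: gs) ψ = ap gs (g.apply ψ) := rfl
theorem ap_append (gs gs' : List Gate) (ψ : Bits w → ℂ) :
    ap (gs ++ gs') ψ = ap gs' (ap gs ψ) := List.foldl_append

theorem Gate.apply_add (g : Gate) (φ ψ : Bits w → ℂ) :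
    g.apply (φ + ψ) = g.apply φ + g.apply ψ := by
  funext b
  cases g <;> simp only [Gate.apply, Pi.add_apply] <;> split_ifs <;> ring

theorem Gate.apply_smul (g : Gate) (c : ℂ) (ψ : Bits w → ℂ) :
    g.apply (c • ψ) = c • g.apply ψ := by
  funext b
  cases g <;> simp only [Gate.apply, Pi.smul_apply, smul_eq_mul] <;> split_ifs <;> ring

theorem ap_add (gs : List Gate) (φ ψ : Bits w → ℂ) : ap gs (φ + ψ) = ap gs φ + ap gs ψ := by
  induction gs generalizing φ ψ with
  | nil => rfl
  | cons g gs ih => rw [ap_cons, ap_cons, ap_cons, g.apply_add, ih]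

theorem ap_smul (gs : List Gate) (c : ℂ) (ψ : Bits w → ℂ) : ap gs (c • ψ) = c • ap gs ψ := by
  induction gs generalizing ψ with
  | nil => rfl
  | cons g gs ih => rw [ap_cons, ap_cons, g.apply_smul, ih]

theorem ap_zero (gs : List Gate) : ap gs (0 : Bits w → ℂ) = 0 := by
  simpa using ap_smul gs 0 (0 : Bits w → ℂ)

theorem ap_sub (gs : List Gate) (φ ψ : Bits w → ℂ) : ap gs (φ - ψ) = ap gs φ - ap gs ψ := by
  rw [sub_eq_add_neg, ← neg_one_smul ℂ ψ, ap_add, ap_smul, neg_one_smul, sub_eq_add_neg]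

theorem ap_sum {κ : Type*} (s : Finset κ) (gs : List Gate) (f : κ → Bits w → ℂ) :
    ap gs (∑ i ∈ s, f i) = ∑ i ∈ s, ap gs (f i) := by
  classical
  induction s using Finset.induction_on with
  | empty => simp [ap_zero]
  | insert a s ha ih => rw [Finset.sum_insert ha, Finset.sum_insert ha, ap_add, ih]

/-- The inverse of a gate as a list of gates; `T` has order eight. -/
def Gate.inv : Gate → List Gate
  | T a => List.replicate 7 (T a)
  | g => [g]

/-- The inverse of a circuit. -/
def inv (gs : List Gate) : List Gate := gs.reverse.flatMap Gate.inv

theorem inv_cons (g : Gate) (gs : List Gate) : inv (g :: gs) = inv gs ++ g.inv := by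
  simp [inv]

theorem inv_append (gs gs' : List Gate) : inv (gs ++ gs') = inv gs' ++ inv gs := by
  simp [inv]

/-- The eighth root of unity. -/
noncomputable def omega8 : ℂ := Complex.exp (Complex.I * (Real.pi / 4))

theorem omega8_pow_four : omega8 ^ 4 = -1 := by
  rw [omega8, ← Complex.exp_nat_mul, ← Complex.exp_pi_mul_I]
  congr 1
  push_cast
  ring

theorem star_omega8 : star omega8 = omega8 ^ 7 := by
  have h : star omega8 * omega8 = 1 := by
    rw [omega8, Complex.star_def, ← Complex.exp_conj, ← Complex.exp_add]
    simp [Complex.conj_ofNat]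
  calc star omega8 = star omega8 * (omega8 ^ 4) ^ 2 := by rw [omega8_pow_four]; ring
    _ = (star omega8 * omega8) * omega8 ^ 7 := by ring
    _ = _ := by rw [h, one_mul]

theorem ap_replicate_T (N a : ℕ) (ψ : Bits w → ℂ) (b : Bits w) :
    ap (List.replicate N (Gate.T a)) ψ b =
      (if bitAt b a = true then omega8 ^ N else 1) * ψ b := by
  induction N generalizing ψ with
  | zero => simp
  | succ N ih =>
    rw [List.replicate_succ, ap_cons, ih]
    simp only [Gate.apply]
    split_ifs
    · rw [← omega8]; ring
    · rfl

theorem ip_perm (f : Bits w → Bits w) (hf : ∀ b, f (f b) = b) (φ ψ : Bits w → ℂ) :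
    ip (fun b => φ (f b)) ψ = ip φ fun b => ψ (f b) := by
  have hf' : Function.Involutive f := hf
  rw [ip_def, ip_def, ← Equiv.sum_comp hf'.toPerm]
  refine Finset.sum_congr rfl fun b _ => ?_
  show star (φ (f (f b))) * ψ (f b) = _
  rw [hf]

theorem Gate.apply_X (a : ℕ) (ψ : Bits w → ℂ) :
    (Gate.X a).apply ψ = fun b => ψ (flipBit b a) := rfl

/-- The permutation of the basis vectors performed by a gate without `H` and `T`. -/
def Gate.perm (g : Gate) (b : Bits w) : Bits w := match g with
  | X a => flipBit b a
  | CX c t => if c ≠ t ∧ bitAt b c = true then flipBit b t else b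
  | CCX c d t => if c ≠ t ∧ d ≠ t ∧ bitAt b c = true ∧ bitAt b d = true then flipBit b t else b
  | _ => b

/-- The gate permutes the basis vectors. -/
def Gate.IsPerm : Gate → Prop
  | H _ | T _ => False
  | _ => True

theorem Gate.apply_perm {g : Gate} (hg : g.IsPerm) (ψ : Bits w → ℂ) :
    g.apply ψ = fun b => ψ (g.perm b) := by
  funext b
  cases g <;> simp_all only [Gate.IsPerm, Gate.apply, Gate.perm] <;> split_ifs <;> rfl

theorem Gate.perm_perm (g : Gate) (b : Bits w) : g.perm (g.perm b) = b := by
  cases g with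
  | X a => exact flipBit_flipBit b a
  | H a => rfl
  | T a => rfl
  | CX c t =>
    have e : ∀ b : Bits w, (CX c t).perm b =
      if c ≠ t ∧ bitAt b c = true then flipBit b t else b := fun _ => rfl
    by_cases h : c ≠ t ∧ bitAt b c = true
    · have : bitAt (flipBit b t) c = true := by rw [bitAt_flipBit, if_neg (by tauto), h.2]
      rw [e b, if_pos h, e, if_pos ⟨h.1, this⟩, flipBit_flipBit]
    · rw [e b, if_neg h, e, if_neg h]
  | CCX c d t =>
    have e : ∀ b : Bits w, (CCX c d t).perm b =
      if c ≠ t ∧ d ≠ t ∧ bitAt b c = true ∧ bitAt b d = true then flipBit b t else b :=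
      fun _ => rfl
    by_cases h : c ≠ t ∧ d ≠ t ∧ bitAt b c = true ∧ bitAt b d = true
    · have h1 : bitAt (flipBit b t) c = true := by rw [bitAt_flipBit, if_neg (by tauto), h.2.2.1]
      have h2 : bitAt (flipBit b t) d = true := by rw [bitAt_flipBit, if_neg (by tauto), h.2.2.2]
      rw [e b, if_pos h, e, if_pos ⟨h.1, h.2.1, h1, h2⟩, flipBit_flipBit]
    · rw [e b, if_neg h, e, if_neg h]

theorem Gate.apply_H (a : ℕ) (ha : a < w) (ψ : Bits w → ℂ) (b : Bits w) :
    (Gate.H a).apply ψ b =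
      ((if bitAt b a = true then -ψ b else ψ b) + ψ (flipBit b a)) / (√2 : ℂ) := by
  simp only [Gate.apply, if_pos ha, setBit_false, setBit_true b a]
  split_ifs <;> ring

theorem Gate.apply_H_of_le (a : ℕ) (ha : w ≤ a) (ψ : Bits w → ℂ) : (Gate.H a).apply ψ = ψ := by
  funext b
  simp [Gate.apply, not_lt.2 ha]

theorem ofReal_sqrt_two_sq : ((√2 : ℝ) : ℂ) * (√2 : ℝ) = 2 := by
  rw [← Complex.ofReal_mul, Real.mul_self_sqrt (by norm_num)]; simp

theorem Gate.ip_apply (g : Gate) (φ ψ : Bits w → ℂ) :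
    ip (g.apply φ) ψ = ip φ (ap g.inv ψ) := by
  cases g with
  | X a => exact ip_perm _ (Gate.perm_perm (Gate.X a)) φ ψ
  | CX c t =>
    rw [Gate.apply_perm (g := .CX c t) trivial]
    exact (ip_perm _ (Gate.perm_perm (Gate.CX c t)) φ ψ).trans
      (by rw [← Gate.apply_perm (g := .CX c t) trivial]; rfl)
  | CCX c d t =>
    rw [Gate.apply_perm (g := .CCX c d t) trivial]
    exact (ip_perm _ (Gate.perm_perm (Gate.CCX c d t)) φ ψ).trans
      (by rw [← Gate.apply_perm (g := .CCX c d t) trivial]; rfl)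
  | T a =>
    simp only [ip_def, Gate.inv, ap_replicate_T, ← star_omega8]
    refine Finset.sum_congr rfl fun b _ => ?_
    simp only [Gate.apply]
    split_ifs
    · rw [← omega8, star_mul']; ring
    · ring
  | H a =>
    rcases le_or_gt w a with ha | ha
    · rw [Gate.apply_H_of_le a ha]
      show _ = ip φ ((Gate.H a).apply ψ)
      rw [Gate.apply_H_of_le a ha]
    · show _ = ip φ ((Gate.H a).apply ψ)
      have hs : star ((√2 : ℝ) : ℂ) = (√2 : ℝ) := Complex.conj_ofReal _
      simp only [ip_def, Gate.apply_H a ha, star_div₀, hs, star_add, add_div, add_mul, mul_add,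
        Finset.sum_add_distrib]
      congr 1
      · refine Finset.sum_congr rfl fun b _ => ?_
        split_ifs <;> simp <;> ring
      · rw [← sum_flipBit a]
        refine Finset.sum_congr rfl fun b _ => ?_
        rw [flipBit_flipBit]; ring

theorem Gate.ap_inv (g : Gate) (ψ : Bits w → ℂ) : ap g.inv (g.apply ψ) = ψ := by
  funext b
  cases g with
  | X a => show ψ _ = ψ _; rw [flipBit_flipBit]
  | CX c t =>
    show (Gate.CX c t).apply ((Gate.CX c t).apply ψ) b = ψ b
    rw [Gate.apply_perm (g := .CX c t) trivial, Gate.apply_perm (g := .CX c t) trivial]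
    simp only [Gate.perm_perm]
  | CCX c d t =>
    show (Gate.CCX c d t).apply ((Gate.CCX c d t).apply ψ) b = ψ b
    rw [Gate.apply_perm (g := .CCX c d t) trivial, Gate.apply_perm (g := .CCX c d t) trivial]
    simp only [Gate.perm_perm]
  | T a =>
    rw [Gate.inv, ap_replicate_T, Gate.apply]
    split_ifs
    · rw [← omega8]
      calc omega8 ^ 7 * (omega8 * ψ b) = (omega8 ^ 4) ^ 2 * ψ b := by ring
        _ = ψ b := by rw [omega8_pow_four]; ring
    · simp
  | H a =>
    show (Gate.H a).apply ((Gate.H a).apply ψ) b = ψ b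
    rcases le_or_gt w a with ha | ha
    · rw [Gate.apply_H_of_le a ha, Gate.apply_H_of_le a ha]
    · have h2 : ((√2 : ℝ) : ℂ) ≠ 0 := by
        intro h; have := ofReal_sqrt_two_sq; rw [h] at this; norm_num at this
      rw [Gate.apply_H a ha, Gate.apply_H a ha, Gate.apply_H a ha, flipBit_flipBit, bitAt_flipBit]
      rcases hb : bitAt b a <;> simp only [ha, and_self, Bool.not_false, Bool.not_true, if_true,
        if_false,
        Bool.false_eq_true] <;> field_simp <;> rw [sq, ofReal_sqrt_two_sq] <;> ring

theorem ap_inv_ap (gs : List Gate) (ψ : Bits w → ℂ) : ap (inv gs) (ap gs ψ) = ψ := by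
  induction gs generalizing ψ with
  | nil => rfl
  | cons g gs ih => rw [inv_cons, ap_append, ap_cons, ih, Gate.ap_inv]

theorem ip_ap (gs : List Gate) (φ ψ : Bits w → ℂ) : ip (ap gs φ) ψ = ip φ (ap (inv gs) ψ) := by
  induction gs generalizing φ with
  | nil => rfl
  | cons g gs ih => rw [ap_cons, ih, g.ip_apply, ← ap_append, inv_cons]

theorem ap_ap_inv (gs : List Gate) (ψ : Bits w → ℂ) : ap gs (ap (inv gs) ψ) = ψ := by
  refine eq_of_ip fun χ => ?_
  have key : ∀ φ : Bits w → ℂ, ip φ (ap gs (ap (inv gs) ψ)) = ip φ ψ := by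
    -- every vector is in the range of the isometry `ap gs`, by finite dimension
    let f : (Bits w → ℂ) →ₗ[ℂ] (Bits w → ℂ) :=
      { toFun := ap gs, map_add' := ap_add gs, map_smul' := ap_smul gs }
    have hinj : Function.Injective f := fun φ φ' h => by
      simpa [ap_inv_ap] using congrArg (ap (inv gs)) (show ap gs φ = ap gs φ' from h)
    intro φ
    obtain ⟨φ', rfl⟩ := LinearMap.injective_iff_surjective.1 hinj φ
    show ip (ap gs φ') _ = ip (ap gs φ') ψ
    rw [ip_ap, ap_inv_ap, ip_ap]
  exact key χ

theorem ip_ap_right (gs : List Gate) (φ ψ : Bits w → ℂ) :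
    ip φ (ap gs ψ) = ip (ap (inv gs) φ) ψ := by
  rw [← ap_ap_inv gs φ, ip_ap, ap_inv_ap, ap_inv_ap]

theorem ip_ap_ap (gs : List Gate) (φ ψ : Bits w → ℂ) : ip (ap gs φ) (ap gs ψ) = ip φ ψ := by
  rw [ip_ap, ap_inv_ap]

theorem nsq_ap (gs : List Gate) (ψ : Bits w → ℂ) : nsq (ap gs ψ) = nsq ψ := by
  rw [nsq_eq_re, ip_ap_ap, ← nsq_eq_re]

theorem nrm_ap (gs : List Gate) (ψ : Bits w → ℂ) : nrm (ap gs ψ) = nrm ψ := by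
  rw [nrm, nsq_ap, nrm]

end Circuits

end ExtSim

/-! ### Gates that act on some of the wires -/

namespace ExtSim

variable {w : ℕ}

/-- All wires of the gate satisfy `P`. -/
def Gate.On (P : ℕ → Prop) : Gate → Prop
  | X a | H a | T a => P a
  | CX c t => P c ∧ P t
  | CCX c d t => P c ∧ P d ∧ P t

/-- All wires of the circuit satisfy `P`. -/
def On (P : ℕ → Prop) (gs : List Gate) : Prop := ∀ g ∈ gs, g.On P

/-- The basis vectors agree on the wires that satisfy `P`. -/
def Agree (P : ℕ → Prop) (b b' : Bits w) : Prop := ∀ a, P a → bitAt b a = bitAt b' a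

theorem Agree.symm {P : ℕ → Prop} {b b' : Bits w} (h : Agree P b b') : Agree P b' b :=
  fun a ha => (h a ha).symm

theorem Agree.trans {P : ℕ → Prop} {b b' b'' : Bits w} (h : Agree P b b') (h' : Agree P b' b'') :
    Agree P b b'' := fun a ha => (h a ha).trans (h' a ha)

open Classical in
/-- The projection to the basis vectors that satisfy `p`. -/
noncomputable def mask (p : Bits w → Prop) (ψ : Bits w → ℂ) : Bits w → ℂ :=
  fun b => if p b then ψ b else 0

theorem agree_flipBit {P : ℕ → Prop} {a : ℕ} (ha : P a) (b : Bits w) :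
    Agree (fun a => ¬ P a) (flipBit b a) b := fun a' ha' => by
  rw [bitAt_flipBit, if_neg]
  rintro ⟨rfl, -⟩
  exact ha' ha

/-- A circuit commutes with multiplication by functions of the other wires and with permutations
of the basis vectors that concern only the other wires. -/
theorem ap_comm {P : ℕ → Prop} {gs : List Gate} (h : On P gs) {m : Bits w → ℂ}
    {f : Bits w → Bits w} (hm : ∀ b b', Agree (fun a => ¬ P a) b b' → m b = m b')
    (hf : ∀ b, Agree P (f b) b)
    (hf' : ∀ b b', Agree (fun a => ¬ P a) b b' → Agree (fun a => ¬ P a) (f b) (f b'))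
    (ψ : Bits w → ℂ) :
    ap gs (fun b => m b * ψ (f b)) = fun b => m b * ap gs ψ (f b) := by
  have flip : ∀ b a, P a → f (flipBit b a) = flipBit (f b) a := by
    intro b a ha
    refine bits_ext fun a' => ?_
    by_cases h' : P a'
    · rw [hf _ _ h', bitAt_flipBit, bitAt_flipBit, hf _ _ ha, hf _ _ h']
    · rw [hf' _ _ (agree_flipBit ha b) _ h', bitAt_flipBit, if_neg]
      rintro ⟨rfl, -⟩
      exact h' ha
  have flipm : ∀ b a, P a → m (flipBit b a) = m b := fun b a ha => hm _ _ (agree_flipBit ha b)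
  induction gs generalizing ψ with
  | nil => rfl
  | cons g gs ih =>
    have hg : g.On P := h g (by simp)
    have key : g.apply (fun b => m b * ψ (f b)) = fun b => m b * g.apply ψ (f b) := by
      funext b
      cases g with
      | X a => simp only [Gate.apply_X, flipm b a hg, flip b a hg]
      | T a =>
        simp only [Gate.apply, hf b a hg]
        split_ifs <;> ring
      | H a =>
        rcases le_or_gt w a with ha | ha
        · simp only [Gate.apply_H_of_le a ha]
        · simp only [Gate.apply_H a ha, flipm b a hg, flip b a hg, hf b a hg]
          split_ifs <;> ring
      | CX c t =>
        simp only [Gate.apply, flipm b t hg.2, flip b t hg.2, hf b c hg.1]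
        split_ifs <;> ring
      | CCX c d t =>
        simp only [Gate.apply, flipm b t hg.2.2, flip b t hg.2.2, hf b c hg.1, hf b d hg.2.1]
        split_ifs <;> ring
    rw [ap_cons, key, ih fun g' hg' => h g' (by simp [hg'])]
    rfl

theorem ap_mask {P : ℕ → Prop} {gs : List Gate} (h : On P gs) {p : Bits w → Prop}
    (hp : ∀ b b', Agree (fun a => ¬ P a) b b' → (p b → p b')) (ψ : Bits w → ℂ) :
    ap gs (mask p ψ) = mask p (ap gs ψ) := by
  have e : ∀ φ : Bits w → ℂ, mask p φ = fun b => mask p (fun _ => 1) b * φ b := fun φ => by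
    funext b; simp [mask]
  rw [e ψ, e (ap gs ψ)]
  exact ap_comm h (f := id)
    (fun b b' hb => by
      by_cases h1 : p b
      · simp only [mask, if_pos h1, if_pos (hp b b' hb h1)]
      · simp only [mask, if_neg h1, if_neg fun h' => h1 (hp b' b hb.symm h')])
    (fun b a _ => rfl) (fun b b' hb => hb) ψ

theorem ap_comp {P : ℕ → Prop} {gs : List Gate} (h : On P gs)
    {f : Bits w → Bits w} (hf : ∀ b, Agree P (f b) b)
    (hf' : ∀ b b', Agree (fun a => ¬ P a) b b' → Agree (fun a => ¬ P a) (f b) (f b'))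
    (ψ : Bits w → ℂ) : ap gs (fun b => ψ (f b)) = fun b => ap gs ψ (f b) := by
  simpa using ap_comm h (m := fun _ => 1) (fun _ _ _ => rfl) hf hf' ψ

theorem On.append {P : ℕ → Prop} {gs gs' : List Gate} (h : On P gs) (h' : On P gs') :
    On P (gs ++ gs') := fun g hg => (List.mem_append.1 hg).elim (h g) (h' g)

theorem On.inv {P : ℕ → Prop} {gs : List Gate} (h : On P gs) : On P (inv gs) := by
  intro g hg
  obtain ⟨g', hg', hgg⟩ := List.mem_flatMap.1 hg
  have := h g' (by simpa using hg')
  cases g' <;> simp [Gate.inv] at hgg <;> subst hgg <;> exact this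

theorem On.mono {P Q : ℕ → Prop} {gs : List Gate} (h : On P gs) (hPQ : ∀ a, P a → Q a) :
    On Q gs := by
  intro g hg
  have := h g hg
  cases g <;> simp only [Gate.On] at this ⊢ <;> tauto

theorem On.flatMap {α : Type*} {P : ℕ → Prop} {l : List α} {f : α → List Gate}
    (h : ∀ x ∈ l, On P (f x)) : On P (l.flatMap f) := by
  intro g hg
  obtain ⟨x, hx, hg⟩ := List.mem_flatMap.1 hg
  exact h x hx g hg

theorem mask_add (p : Bits w → Prop) (φ ψ : Bits w → ℂ) :
    mask p (φ + ψ) = mask p φ + mask p ψ := by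
  funext b; simp only [mask, Pi.add_apply]; split_ifs <;> simp

theorem mask_sub (p : Bits w → Prop) (φ ψ : Bits w → ℂ) :
    mask p (φ - ψ) = mask p φ - mask p ψ := by
  funext b; simp only [mask, Pi.sub_apply]; split_ifs <;> simp

theorem mask_smul (p : Bits w → Prop) (c : ℂ) (ψ : Bits w → ℂ) :
    mask p (c • ψ) = c • mask p ψ := by
  funext b; simp only [mask, Pi.smul_apply]; split_ifs <;> simp

theorem mask_sum {κ : Type*} (p : Bits w → Prop) (s : Finset κ) (f : κ → Bits w → ℂ) :
    mask p (∑ i ∈ s, f i) = ∑ i ∈ s, mask p (f i) := by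
  funext b; simp only [mask, Finset.sum_apply]; split_ifs <;> simp

theorem mask_add_mask_not (p : Bits w → Prop) (ψ : Bits w → ℂ) :
    mask p ψ + mask (fun b => ¬ p b) ψ = ψ := by
  funext b; simp only [mask, Pi.add_apply]; split_ifs <;> simp

theorem mask_idem (p : Bits w → Prop) (ψ : Bits w → ℂ) : mask p (mask p ψ) = mask p ψ := by
  funext b; simp only [mask]; split_ifs <;> tauto

theorem ip_mask (p : Bits w → Prop) (φ ψ : Bits w → ℂ) : ip (mask p φ) ψ = ip φ (mask p ψ) := by
  simp only [ip_def, mask]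
  refine Finset.sum_congr rfl fun b _ => ?_
  split_ifs <;> simp

theorem nsq_mask_add (p : Bits w → Prop) (ψ : Bits w → ℂ) :
    nsq (mask p ψ) + nsq (mask (fun b => ¬ p b) ψ) = nsq ψ := by
  rw [nsq, nsq, nsq, ← Finset.sum_add_distrib]
  refine Finset.sum_congr rfl fun b _ => ?_
  simp only [mask]
  split_ifs <;> simp

theorem nsq_mask_le (p : Bits w → Prop) (ψ : Bits w → ℂ) : nsq (mask p ψ) ≤ nsq ψ := by
  rw [← nsq_mask_add p ψ]
  exact le_add_of_nonneg_right (nsq_nonneg _)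

theorem mask_eq_self {p : Bits w → Prop} {ψ : Bits w → ℂ} (h : ∀ b, ¬ p b → ψ b = 0) :
    mask p ψ = ψ := by
  funext b; simp only [mask]; split_ifs with hb
  · rfl
  · exact (h b hb).symm

theorem mask_eq_zero {p : Bits w → Prop} {ψ : Bits w → ℂ} (h : ∀ b, p b → ψ b = 0) :
    mask p ψ = 0 := by
  funext b; simp only [mask]; split_ifs with hb
  · exact h b hb
  · rfl

theorem eq_zero_of_mask_eq_self {p : Bits w → Prop} {ψ : Bits w → ℂ} (h : mask p ψ = ψ)
    (b : Bits w) (hb : ¬ p b) : ψ b = 0 := by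
  rw [← h, mask, if_neg hb]

/-! ### Permutation circuits -/

/-- All gates permute the basis vectors. -/
def IsPerm (gs : List Gate) : Prop := ∀ g ∈ gs, g.IsPerm

/-- The permutation with which a permutation circuit composes vectors. -/
def bwd (gs : List Gate) (b : Bits w) : Bits w := gs.foldr (fun g b => g.perm b) b

/-- The inverse of `bwd`: the gates act one after the other on a basis vector. -/
def fwd (gs : List Gate) (b : Bits w) : Bits w := gs.foldl (fun b g => g.perm b) b

theorem ap_isPerm {gs : List Gate} (h : IsPerm gs) (ψ : Bits w → ℂ) :
    ap gs ψ = fun b => ψ (bwd gs b) := by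
  induction gs generalizing ψ with
  | nil => rfl
  | cons g gs ih =>
    rw [ap_cons, ih (fun g' hg' => h g' (by simp [hg'])), Gate.apply_perm (h g (by simp))]
    rfl

theorem inv_of_isPerm {gs : List Gate} (h : IsPerm gs) : inv gs = gs.reverse := by
  have : ∀ l : List Gate, IsPerm l → l.flatMap Gate.inv = l := by
    intro l hl
    induction l with
    | nil => rfl
    | cons g l ih =>
      have hg := hl g (by simp)
      rw [List.flatMap_cons, ih fun g' hg' => hl g' (by simp [hg'])]
      cases g <;> first | rfl | exact hg.elim
  exact this _ fun g hg => h g (by simpa using hg)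

theorem bwd_reverse (gs : List Gate) (b : Bits w) : bwd gs.reverse b = fwd gs b := by
  simp [bwd, fwd, List.foldr_reverse]

/-- `fwd` inverts `bwd`, as every permutation gate is its own inverse. -/
theorem bwd_fwd (gs : List Gate) (b : Bits w) : bwd gs (fwd gs b) = b := by
  induction gs generalizing b with
  | nil => rfl
  | cons g gs ih =>
    show g.perm (bwd gs (fwd gs (g.perm b))) = b
    rw [ih, Gate.perm_perm]

theorem IsPerm.reverse {gs : List Gate} (h : IsPerm gs) : IsPerm gs.reverse :=
  fun g hg => h g (by simpa using hg)

/-- Computing a bit, changing the phase according to it, and uncomputing it. -/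
theorem ap_phase {gs : List Gate} (h : IsPerm gs) (q : ℕ) (ψ : Bits w → ℂ) :
    ap (gs ++ List.replicate 4 (Gate.T q) ++ inv gs) ψ =
      fun b => (if bitAt (fwd gs b) q = true then -1 else 1) * ψ b := by
  funext b
  rw [ap_append, ap_append, inv_of_isPerm h, ap_isPerm h.reverse]
  simp only [bwd_reverse, ap_replicate_T, omega8_pow_four, ap_isPerm h, bwd_fwd]

theorem bwd_append (gs gs' : List Gate) (b : Bits w) : bwd (gs ++ gs') b = bwd gs (bwd gs' b) := by
  simp [bwd, List.foldr_append]

theorem fwd_append (gs gs' : List Gate) (b : Bits w) : fwd (gs ++ gs') b = fwd gs' (fwd gs b) := by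
  simp [fwd, List.foldl_append]

theorem bitAt_perm_CX (c t : ℕ) (b : Bits w) (a : ℕ) (hct : c ≠ t) (ht : t < w) :
    bitAt ((Gate.CX c t).perm b) a = if a = t then xor (bitAt b t) (bitAt b c) else bitAt b a := by
  have e : (Gate.CX c t).perm b = if c ≠ t ∧ bitAt b c = true then flipBit b t else b := rfl
  rw [e]
  rcases h : bitAt b c <;> simp [hct, bitAt_flipBit, ht] <;> rintro rfl <;> rfl

theorem bitAt_perm_CCX (c d t : ℕ) (b : Bits w) (a : ℕ) (hct : c ≠ t) (hdt : d ≠ t) (ht : t < w) :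
    bitAt ((Gate.CCX c d t).perm b) a =
      if a = t then xor (bitAt b t) (bitAt b c && bitAt b d) else bitAt b a := by
  have e : (Gate.CCX c d t).perm b =
    if c ≠ t ∧ d ≠ t ∧ bitAt b c = true ∧ bitAt b d = true then flipBit b t else b := rfl
  rw [e]
  rcases h : bitAt b c <;> rcases h' : bitAt b d <;> simp [hct, hdt, bitAt_flipBit, ht] <;>
    rintro rfl <;> rfl

theorem bitAt_perm_X (t : ℕ) (b : Bits w) (a : ℕ) (ht : t < w) :
    bitAt ((Gate.X t).perm b) a = if a = t then !bitAt b t else bitAt b a := by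
  show bitAt (flipBit b t) a = _
  simp [bitAt_flipBit, ht]

/-- Add `N` wires to `N` other wires. -/
def cxs (o o' N : ℕ) : List Gate := (List.range N).map fun l => Gate.CX (o + l) (o' + l)

/-- Add `N` wires to `N` other wires if the control wire `c` is set. -/
def ccxs (c o o' N : ℕ) : List Gate := (List.range N).map fun l => Gate.CCX c (o + l) (o' + l)

theorem isPerm_cxs (o o' N : ℕ) : IsPerm (cxs o o' N) := by
  intro g hg
  obtain ⟨l, -, rfl⟩ := List.mem_map.1 hg
  trivial

theorem isPerm_ccxs (c o o' N : ℕ) : IsPerm (ccxs c o o' N) := by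
  intro g hg
  obtain ⟨l, -, rfl⟩ := List.mem_map.1 hg
  trivial

theorem bitAt_bwd_cxs {o o' N : ℕ} (h : o + N ≤ o' ∨ o' + N ≤ o) (hw : o' + N ≤ w) (b : Bits w)
    (a : ℕ) : bitAt (bwd (cxs o o' N) b) a =
      if o' ≤ a ∧ a < o' + N then xor (bitAt b a) (bitAt b (o + (a - o'))) else bitAt b a := by
  induction N generalizing b with
  | zero => rw [if_neg (by omega)]; rfl
  | succ N ih =>
    rw [show cxs o o' (N + 1) = cxs o o' N ++ [Gate.CX (o + N) (o' + N)] by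
      simp [cxs, List.range_succ], bwd_append, ih (by omega) (by omega)]
    simp only [show ∀ b : Bits w, bwd [Gate.CX (o + N) (o' + N)] b =
      (Gate.CX (o + N) (o' + N)).perm b from fun _ => rfl,
      bitAt_perm_CX (o + N) (o' + N) b _ (by omega) (by omega : o' + N < w)]
    by_cases h1 : a = o' + N
    · subst h1
      rw [if_neg (by omega), if_pos rfl, if_pos (by omega)]
      congr 2; omega
    · by_cases h2 : o' ≤ a ∧ a < o' + N
      · rw [if_pos h2, if_neg h1, if_neg (by omega), if_pos (by omega)]
      · rw [if_neg h2, if_neg h1, if_neg (by omega)]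

theorem bitAt_bwd_ccxs {c o o' N : ℕ} (h : o + N ≤ o' ∨ o' + N ≤ o) (hc : c < o' ∨ o' + N ≤ c)
    (hw : o' + N ≤ w) (b : Bits w) (a : ℕ) : bitAt (bwd (ccxs c o o' N) b) a =
      if o' ≤ a ∧ a < o' + N then xor (bitAt b a) (bitAt b c && bitAt b (o + (a - o')))
      else bitAt b a := by
  induction N generalizing b with
  | zero => rw [if_neg (by omega)]; rfl
  | succ N ih =>
    rw [show ccxs c o o' (N + 1) = ccxs c o o' N ++ [Gate.CCX c (o + N) (o' + N)] by
      simp [ccxs, List.range_succ], bwd_append, ih (by omega) (by omega) (by omega)]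
    simp only [show ∀ b : Bits w, bwd [Gate.CCX c (o + N) (o' + N)] b =
      (Gate.CCX c (o + N) (o' + N)).perm b from fun _ => rfl,
      bitAt_perm_CCX c (o + N) (o' + N) b _ (by omega) (by omega) (by omega : o' + N < w)]
    by_cases h1 : a = o' + N
    · subst h1
      rw [if_neg (by omega), if_pos rfl, if_pos (by omega)]
      congr 3; omega
    · by_cases h2 : o' ≤ a ∧ a < o' + N
      · rw [if_pos h2, if_neg h1, if_neg (by omega), if_neg (by omega), if_pos (by omega)]
      · rw [if_neg h2, if_neg h1, if_neg (by omega)]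

/-- Compute on the wires from `q` on the conjunctions of the wires `c`, `d` and the negations of
the first wires from `j` on. -/
def conj (c d j q N : ℕ) : List Gate :=
  Gate.CCX c d q :: (List.range N).flatMap fun a =>
    [Gate.X (j + a), Gate.CCX (q + a) (j + a) (q + a + 1), Gate.X (j + a)]

theorem isPerm_conj (c d j q N : ℕ) : IsPerm (conj c d j q N) := by
  intro g hg
  simp only [conj, List.mem_cons, List.mem_flatMap, List.not_mem_nil, or_false] at hg
  rcases hg with rfl | ⟨a, -, rfl | rfl | rfl⟩ <;> trivial

theorem bitAt_fwd_conj {c d j q N : ℕ} (hc : c < q) (hd : d < q) (hj : j + N ≤ q)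
    (hw : q + N < w) (b : Bits w) (hb : ∀ a, q ≤ a → bitAt b a = false) (a : ℕ) :
    bitAt (fwd (conj c d j q N) b) a =
      if q ≤ a ∧ a ≤ q + N then
        decide (bitAt b c = true ∧ bitAt b d = true ∧ ∀ x < a - q, bitAt b (j + x) = false)
      else bitAt b a := by
  induction N generalizing a with
  | zero =>
    show bitAt ((Gate.CCX c d q).perm b) a = _
    rw [bitAt_perm_CCX c d q b a (by omega) (by omega) (by omega), hb q le_rfl]
    by_cases h : a = q
    · subst h; simp
    · rw [if_neg h, if_neg (by omega)]
  | succ N ih =>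
    specialize ih (by omega) (by omega)
    rw [show conj c d j q (N + 1) = conj c d j q N ++ [Gate.X (j + N),
        Gate.CCX (q + N) (j + N) (q + N + 1), Gate.X (j + N)] by
      simp [conj, List.range_succ], fwd_append]
    set b' := fwd (conj c d j q N) b
    show bitAt ((Gate.X (j + N)).perm ((Gate.CCX (q + N) (j + N) (q + N + 1)).perm
      ((Gate.X (j + N)).perm b'))) a = _
    have e : ∀ a, bitAt ((Gate.X (j + N)).perm b') a =
      if a = j + N then !bitAt b' (j + N) else bitAt b' a :=
      fun a => bitAt_perm_X (j + N) b' a (by omega)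
    have i1 : bitAt b' (q + N + 1) = false := by
      rw [ih, if_neg (by omega), hb _ (by omega)]
    have i2 := ih (q + N)
    rw [if_pos (by omega), show q + N - q = N by omega] at i2
    have i3 : bitAt b' (j + N) = bitAt b (j + N) := by rw [ih, if_neg (by omega)]
    simp only [bitAt_perm_X _ _ _ (by omega : j + N < w), bitAt_perm_CCX (q + N) (j + N) (q + N +
      1) _ _
      (by omega) (by omega) (by omega : q + N + 1 < w), i1, i2, i3, if_true,
      if_neg (by omega : ¬ j + N = q + N + 1), if_neg (by omega : ¬ q + N + 1 = j + N),
      if_neg (by omega : ¬ q + N = j + N)]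
    by_cases h1 : a = q + N + 1
    · subst h1
      rw [if_neg (by omega), if_pos rfl, if_pos (by omega), show q + N + 1 - q = N + 1 by omega]
      rcases h2 : bitAt b (j + N)
      · simp only [Bool.not_false, Bool.and_true, Bool.false_bne, decide_eq_decide]
        refine ⟨fun h => ⟨h.1, h.2.1, fun x hx => ?_⟩,
          fun h => ⟨h.1, h.2.1, fun x hx => h.2.2 x (by omega)⟩⟩
        rcases Nat.lt_succ_iff_lt_or_eq.1 hx with hx | rfl
        · exact h.2.2 x hx
        · exact h2
      · simp only [Bool.not_true, Bool.and_false, Bool.false_bne]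
        symm
        rw [decide_eq_false_iff_not]
        exact fun h => by simpa [h2] using h.2.2 N (by omega)
    · by_cases h2 : a = j + N
      · subst h2
        rw [if_pos rfl, if_neg (by omega), Bool.not_not]
      · rw [if_neg h2, if_neg h1, if_neg h2, ih a]
        by_cases h3 : q ≤ a ∧ a ≤ q + N
        · rw [if_pos h3, if_pos (by omega)]
        · rw [if_neg h3, if_neg (by omega)]

end ExtSim

/-! ### Circuits on the wires of a larger circuit -/

namespace ExtSim

/-- The gate on the renamed wires. -/
def Gate.map (ρ : ℕ → ℕ) : Gate → Gate
  | X a => X (ρ a)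
  | H a => H (ρ a)
  | T a => T (ρ a)
  | CX c t => CX (ρ c) (ρ t)
  | CCX c d t => CCX (ρ c) (ρ d) (ρ t)

/-- The circuit on the renamed wires. -/
def reloc (ρ : ℕ → ℕ) (gs : List Gate) : List Gate := gs.map (Gate.map ρ)

/-- `ρ` maps the wires of a circuit with `q` wires to different wires of a circuit with `w` wires,
and wires that do not exist to wires that do not exist. -/
structure Emb (q w : ℕ) (ρ : ℕ → ℕ) : Prop where
  lt : ∀ a < q, ρ a < w
  inj : ∀ a < q, ∀ a' < q, ρ a = ρ a' → a = a'
  out : ∀ a, q ≤ a → w ≤ ρ a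

/-- The wires that are used by an embedded circuit. -/
def Ran (q : ℕ) (ρ : ℕ → ℕ) (a : ℕ) : Prop := ∃ a' < q, ρ a' = a

variable {q w : ℕ} {ρ : ℕ → ℕ}

/-- The contents of the wires of an embedded circuit. -/
def pull (q : ℕ) (ρ : ℕ → ℕ) (b : Bits w) : Bits q := fun a => bitAt b (ρ a)

open Classical in
/-- Overwrite the wires of an embedded circuit. -/
noncomputable def put (ρ : ℕ → ℕ) (b : Bits w) (x : Bits q) : Bits w := fun j =>
  if h : ∃ a : Fin q, ρ a = j then x h.choose else b j

theorem bitAt_pull (hρ : Emb q w ρ) (b : Bits w) (a : ℕ) : bitAt (pull q ρ b) a = bitAt b (ρ a) :=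
    by
  rcases lt_or_ge a q with h | h
  · simp [bitAt, pull, h]
  · rw [bitAt_of_le h, bitAt_of_le (hρ.out a h)]

theorem bitAt_put_self (hρ : Emb q w ρ) (b : Bits w) (x : Bits q) (a : ℕ) :
    bitAt (put ρ b x) (ρ a) = bitAt x a := by
  rcases lt_or_ge a q with h | h
  · have hex : ∃ a' : Fin q, ρ a' = ρ a := ⟨⟨a, h⟩, rfl⟩
    have hc : hex.choose = ⟨a, h⟩ :=
      Fin.ext (hρ.inj _ hex.choose.2 a h hex.choose_spec)
    simp only [bitAt, hρ.lt a h, h, put, dif_pos]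
    rw [dif_pos hex, hc]
  · rw [bitAt_of_le h, bitAt_of_le (hρ.out a h)]

theorem bitAt_put_of_not {b : Bits w} {x : Bits q} {a : ℕ} (h : ¬ Ran q ρ a) :
    bitAt (put ρ b x) a = bitAt b a := by
  rcases lt_or_ge a w with hw | hw
  · have : ¬ ∃ a' : Fin q, ρ a' = a := fun ⟨a', h'⟩ => h ⟨a', a'.2, h'⟩
    simp only [bitAt, hw, put, dif_pos, dif_neg this]
  · rw [bitAt_of_le hw, bitAt_of_le hw]

theorem pull_put (hρ : Emb q w ρ) (b : Bits w) (x : Bits q) : pull q ρ (put ρ b x) = x :=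
  bits_ext fun a => by rw [bitAt_pull hρ, bitAt_put_self hρ]

theorem put_pull_of_agree (hρ : Emb q w ρ) {b c : Bits w}
    (h : Agree (fun a => ¬ Ran q ρ a) b c) : put ρ c (pull q ρ b) = b := by
  refine bits_ext fun a => ?_
  by_cases ha : Ran q ρ a
  · obtain ⟨a, -, rfl⟩ := ha
    rw [bitAt_put_self hρ, bitAt_pull hρ]
  · rw [bitAt_put_of_not ha, h a ha]

theorem put_pull (hρ : Emb q w ρ) (b : Bits w) : put ρ b (pull q ρ b) = b :=
  put_pull_of_agree hρ fun _ _ => rfl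

theorem agree_put (b : Bits w) (x : Bits q) : Agree (fun a => ¬ Ran q ρ a) (put ρ b x) b :=
  fun _ ha => bitAt_put_of_not ha

theorem put_flipBit (hρ : Emb q w ρ) (b : Bits w) (x : Bits q) (a : ℕ) :
    put ρ b (flipBit x a) = flipBit (put ρ b x) (ρ a) := by
  refine bits_ext fun a' => ?_
  by_cases ha : Ran q ρ a'
  · obtain ⟨a', ha', rfl⟩ := ha
    rw [bitAt_put_self hρ, bitAt_flipBit, bitAt_flipBit, bitAt_put_self hρ, bitAt_put_self hρ]
    by_cases h : a' = a
    · subst h; rw [if_pos ⟨rfl, ha'⟩, if_pos ⟨rfl, hρ.lt a' ha'⟩]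
    · rw [if_neg (fun h' => h h'.1), if_neg]
      rintro ⟨h', hw⟩
      rcases lt_or_ge a q with hq | hq
      · exact h (hρ.inj _ ha' _ hq h')
      · exact absurd (hρ.out a hq) (by omega)
  · rw [bitAt_put_of_not ha, bitAt_flipBit, if_neg, bitAt_put_of_not ha]
    rintro ⟨rfl, hw⟩
    rcases lt_or_ge a q with hq | hq
    · exact ha ⟨a, hq, rfl⟩
    · exact absurd (hρ.out a hq) (by omega)

/-- The vector of the wires of an embedded circuit when the other wires are as in `b`. -/
noncomputable def fib (q : ℕ) (ρ : ℕ → ℕ) (b : Bits w) (ψ : Bits w → ℂ) : Bits q → ℂ :=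
  fun x => ψ (put ρ b x)

theorem fib_pull (hρ : Emb q w ρ) (b : Bits w) (ψ : Bits w → ℂ) :
    fib q ρ b ψ (pull q ρ b) = ψ b := by rw [fib, put_pull hρ]

theorem Gate.fib_apply (hρ : Emb q w ρ) (g : Gate) (b : Bits w) (ψ : Bits w → ℂ) :
    fib q ρ b ((g.map ρ).apply ψ) = g.apply (fib q ρ b ψ) := by
  funext x
  cases g with
  | X a => simp only [Gate.map, fib, Gate.apply_X, put_flipBit hρ]
  | T a => simp only [Gate.map, fib, Gate.apply, bitAt_put_self hρ]
  | H a =>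
    rcases lt_or_ge a q with ha | ha
    · simp only [Gate.map, fib, Gate.apply_H a ha, Gate.apply_H _ (hρ.lt a ha),
        bitAt_put_self hρ, put_flipBit hρ]
    · simp only [Gate.map, fib, Gate.apply_H_of_le a ha, Gate.apply_H_of_le _ (hρ.out a ha)]
  | CX c t =>
    simp only [Gate.map, fib, Gate.apply, bitAt_put_self hρ, put_flipBit hρ]
    rcases lt_or_ge t q with ht | ht
    · rcases lt_or_ge c q with hc | hc
      · simp only [show ρ c ≠ ρ t ↔ c ≠ t from
          ⟨fun h h' => h (by rw [h']), fun h h' => h (hρ.inj _ hc _ ht h')⟩]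
      · simp [bitAt_of_le hc]
    · rw [flipBit_of_le _ (hρ.out t ht), ite_self, ite_self]
  | CCX c d t =>
    simp only [Gate.map, fib, Gate.apply, bitAt_put_self hρ, put_flipBit hρ]
    rcases lt_or_ge t q with ht | ht
    · rcases lt_or_ge c q with hc | hc
      · rcases lt_or_ge d q with hd | hd
        · simp only [show ρ c ≠ ρ t ↔ c ≠ t from
            ⟨fun h h' => h (by rw [h']), fun h h' => h (hρ.inj _ hc _ ht h')⟩,
            show ρ d ≠ ρ t ↔ d ≠ t from
            ⟨fun h h' => h (by rw [h']), fun h h' => h (hρ.inj _ hd _ ht h')⟩]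
        · simp [bitAt_of_le hd]
      · simp [bitAt_of_le hc]
    · rw [flipBit_of_le _ (hρ.out t ht), ite_self, ite_self]

/-- An embedded circuit acts on its wires. -/
theorem fib_ap (hρ : Emb q w ρ) (gs : List Gate) (b : Bits w) (ψ : Bits w → ℂ) :
    fib q ρ b (ap (reloc ρ gs) ψ) = ap gs (fib q ρ b ψ) := by
  induction gs generalizing ψ with
  | nil => rfl
  | cons g gs ih =>
    show fib q ρ b (ap (reloc ρ gs) ((g.map ρ).apply ψ)) = _
    rw [ih, Gate.fib_apply hρ, ap_cons]

theorem ap_reloc (hρ : Emb q w ρ) (gs : List Gate) (b : Bits w) (ψ : Bits w → ℂ) :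
    ap (reloc ρ gs) ψ b = ap gs (fib q ρ b ψ) (pull q ρ b) := by
  rw [← fib_ap hρ, fib_pull hρ]

theorem inv_reloc (gs : List Gate) : inv (reloc ρ gs) = reloc ρ (inv gs) := by
  induction gs with
  | nil => rfl
  | cons g gs ih =>
    rw [inv_cons, show reloc ρ (g :: gs) = g.map ρ :: reloc ρ gs from rfl, inv_cons, ih, reloc,
      reloc, List.map_append]
    cases g <;> rfl

theorem on_reloc (gs : List Gate) (P : ℕ → Prop) (h : ∀ a, P (ρ a)) : On P (reloc ρ gs) := by
  intro g hg
  obtain ⟨g, -, rfl⟩ := List.mem_map.1 hg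
  cases g <;> simp [Gate.map, Gate.On, h]

open Classical in
/-- Sums over the basis vectors that agree with a given one outside an embedded circuit. -/
theorem sum_agree {M : Type*} [AddCommMonoid M] (hρ : Emb q w ρ) (c : Bits w) (f : Bits q → M) :
    ∑ b : Bits w, (if Agree (fun a => ¬ Ran q ρ a) b c then f (pull q ρ b) else 0) = ∑ x, f x := by
  rw [← Finset.sum_filter]
  refine Finset.sum_nbij' (pull q ρ) (put ρ c) (fun _ _ => Finset.mem_univ _)
    (fun x _ => by simpa using agree_put c x) (fun b hb => ?_) (fun x _ => pull_put hρ c x)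
    fun _ _ => rfl
  exact put_pull_of_agree hρ (by simpa using hb)

/-! ### Inputs of circuits -/

theorem bitAt_slice (b : Bits w) (o n a : ℕ) :
    bitAt (slice b o n) a = if a < n then bitAt b (o + a) else false := by
  simp only [bitAt, slice]; split_ifs <;> rfl

theorem slice_eq_iff {b : Bits w} {o n : ℕ} {x : Bits n} :
    slice b o n = x ↔ ∀ a < n, bitAt b (o + a) = bitAt x a := by
  constructor
  · rintro rfl a ha
    rw [bitAt_slice, if_pos ha]
  · intro h
    refine bits_ext fun a => ?_
    rw [bitAt_slice]
    split_ifs with ha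
    · exact h a ha
    · rw [bitAt_of_le (by omega)]

theorem slice_congr {w' : ℕ} {b : Bits w} {b' : Bits w'} {o o' n : ℕ}
    (h : ∀ a < n, bitAt b (o + a) = bitAt b' (o' + a)) : slice b o n = slice b' o' n :=
  slice_eq_iff.2 fun a ha => by rw [bitAt_slice, if_pos ha, h a ha]

/-- The position of the quantum input in a vector with `c` classical wires in front. -/
def shift (c q w : ℕ) (a : ℕ) : ℕ := if a < q then c + a else w

theorem shift_emb {c q w : ℕ} (h : c + q ≤ w) : Emb q w (shift c q w) where
  lt a ha := by simp only [shift, ha, if_true]; omega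
  inj a ha a' ha' h := by simp only [shift, ha, ha', if_true] at h; omega
  out a ha := by rw [shift, if_neg (by omega)]

theorem ran_shift {c q w a : ℕ} : Ran q (shift c q w) a ↔ c ≤ a ∧ a < c + q := by
  constructor
  · rintro ⟨a', h, rfl⟩
    simp only [shift, h, if_true]; omega
  · rintro ⟨h1, h2⟩
    exact ⟨a - c, by omega, by rw [shift, if_pos (by omega)]; omega⟩

theorem pull_shift {c q w : ℕ} (h : c + q ≤ w) (b : Bits w) :
    pull q (shift c q w) b = slice b c q := by
  refine bits_ext fun a => ?_
  rw [bitAt_pull (shift_emb h), bitAt_slice, shift]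
  split_ifs
  · rfl
  · rw [bitAt_of_le le_rfl]

open Classical in
/-- The vector `φ` on the first `n` wires, the other wires being as in `c`. -/
noncomputable def emb {n : ℕ} (c : Bits w) (φ : Bits n → ℂ) : Bits w → ℂ :=
  fun b => if Agree (fun a => n ≤ a) b c then φ (slice b 0 n) else 0

section Emb

variable {n : ℕ}

theorem emb_add (c : Bits w) (φ φ' : Bits n → ℂ) : emb c (φ + φ') = emb c φ + emb c φ' := by
  funext b; simp only [emb, Pi.add_apply]; split_ifs <;> simp

theorem emb_sub (c : Bits w) (φ φ' : Bits n → ℂ) : emb c (φ - φ') = emb c φ - emb c φ' := by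
  funext b; simp only [emb, Pi.sub_apply]; split_ifs <;> simp

theorem emb_smul (c : Bits w) (a : ℂ) (φ : Bits n → ℂ) : emb c (a • φ) = a • emb c φ := by
  funext b; simp only [emb, Pi.smul_apply]; split_ifs <;> simp

theorem ip_emb (hn : n ≤ w) (c : Bits w) (φ φ' : Bits n → ℂ) :
    ip (emb c φ) (emb c φ') = ip φ φ' := by
  classical
  have h0 : 0 + n ≤ w := by omega
  rw [ip_def, ip_def, ← sum_agree (shift_emb h0) c]
  refine Finset.sum_congr rfl fun b _ => ?_
  simp only [ran_shift, pull_shift h0, emb]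
  have : Agree (fun a => ¬ (0 ≤ a ∧ a < 0 + n)) b c ↔ Agree (fun a => n ≤ a) b c :=
    ⟨fun h a ha => h a (by omega), fun h a ha => h a (by omega)⟩
  by_cases h : Agree (fun a => n ≤ a) b c
  · rw [if_pos (this.2 h), if_pos h, if_pos h]
  · rw [if_neg (fun h' => h (this.1 h')), if_neg h, if_neg h]; simp

theorem ip_emb_of_ne {c c' : Bits w} (h : ¬ Agree (fun a => n ≤ a) c c') (φ φ' : Bits n → ℂ) :
    ip (emb c φ) (emb c' φ') = 0 := by
  rw [ip_def]
  refine Finset.sum_eq_zero fun b _ => ?_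
  simp only [emb]
  by_cases h1 : Agree (fun a => n ≤ a) b c
  · rw [if_neg (fun h2 => h (h1.symm.trans h2)), mul_zero]
  · rw [if_neg h1, star_zero, zero_mul]

theorem nsq_emb (hn : n ≤ w) (c : Bits w) (φ : Bits n → ℂ) : nsq (emb c φ) = nsq φ := by
  rw [nsq_eq_re, ip_emb hn, ← nsq_eq_re]

open Classical in
/-- The inner product of superpositions over orthogonal configurations of the other wires. -/
theorem ip_sum_emb {κ : Type*} (hn : n ≤ w) (s : Finset κ) (c : κ → Bits w)
    (hc : ∀ h ∈ s, ∀ h' ∈ s, Agree (fun a => n ≤ a) (c h) (c h') → h = h') (φ φ' : κ → Bits n → ℂ) :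
    ip (∑ h ∈ s, emb (c h) (φ h)) (∑ h ∈ s, emb (c h) (φ' h)) = ∑ h ∈ s, ip (φ h) (φ' h) := by
  rw [ip_sum_left]
  refine Finset.sum_congr rfl fun h hh => ?_
  rw [ip_sum_right, Finset.sum_eq_single h, ip_emb hn]
  · intro h' hh' hne
    exact ip_emb_of_ne (fun e => hne (hc h hh h' hh' e).symm) _ _
  · exact fun h' => absurd hh h'

theorem nsq_sum_emb {κ : Type*} (hn : n ≤ w) (s : Finset κ) (c : κ → Bits w)
    (hc : ∀ h ∈ s, ∀ h' ∈ s, Agree (fun a => n ≤ a) (c h) (c h') → h = h') (φ : κ → Bits n → ℂ) :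
    nsq (∑ h ∈ s, emb (c h) (φ h)) = ∑ h ∈ s, nsq (φ h) := by
  rw [nsq_eq_re, ip_sum_emb hn s c hc, Complex.re_sum]
  simp only [nsq_eq_re]

theorem mask_emb_pos {p : Bits w → Prop} {c : Bits w}
    (h : ∀ b, Agree (fun a => n ≤ a) b c → p b) (φ : Bits n → ℂ) : mask p (emb c φ) = emb c φ :=
  mask_eq_self fun b hb => by rw [emb, if_neg fun h' => hb (h b h')]

theorem emb_comp {f : Bits w → Bits w} {c c' : Bits w}
    (h : ∀ b, Agree (fun a => n ≤ a) (f b) c ↔ Agree (fun a => n ≤ a) b c')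
    (hf : ∀ b, Agree (fun a => n ≤ a) b c' → slice (f b) 0 n = slice b 0 n) (φ : Bits n → ℂ) :
    (fun b => emb c φ (f b)) = emb c' φ := by
  funext b
  by_cases hb : Agree (fun a => n ≤ a) b c'
  · rw [emb, emb, if_pos hb, if_pos ((h b).2 hb), hf b hb]
  · rw [emb, emb, if_neg hb, if_neg fun h' => hb ((h b).1 h')]

end Emb

theorem nsq_inputState {c q : ℕ} (h : c + q ≤ w) (x : Bits c) (φ : Bits q → ℂ) :
    nsq (inputState w x φ) = nsq φ := by
  classical
  let c₀ : Bits w := fun j => bitAt x j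
  have hc₀ : ∀ a, bitAt c₀ a = bitAt x a := fun a => by
    rcases lt_or_ge a w with ha | ha
    · simp [c₀, bitAt, ha]
    · rw [bitAt_of_le ha, bitAt_of_le (by omega)]
  rw [nsq, nsq, ← sum_agree (shift_emb h) c₀]
  refine Finset.sum_congr rfl fun b _ => ?_
  simp only [pull_shift h, inputState]
  have : (slice b 0 c = x ∧ ∀ j : Fin w, c + q ≤ (j : ℕ) → b j = false) ↔
      Agree (fun a => ¬ Ran q (shift c q w) a) b c₀ := by
    simp only [Agree, ran_shift, hc₀, slice_eq_iff]
    constructor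
    · rintro ⟨h1, h2⟩ a ha
      rcases lt_or_ge a c with hac | hac
      · simpa using h1 a hac
      · rw [bitAt_of_le hac]
        rcases lt_or_ge a w with haw | haw
        · simpa [bitAt, haw] using h2 ⟨a, haw⟩ (by simp; omega)
        · exact bitAt_of_le haw
    · intro h'
      refine ⟨fun a ha => by simpa using h' a (by omega), fun j hj => ?_⟩
      have := h' j (by omega)
      rw [bitAt_of_le (by omega : c ≤ (j : ℕ))] at this
      simpa [bitAt] using this
  by_cases h1 : Agree (fun a => ¬ Ran q (shift c q w) a) b c₀
  · rw [if_pos (this.2 h1), if_pos h1]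
  · rw [if_neg (fun h' => h1 (this.1 h')), if_neg h1]; simp

theorem inputState_apply {c q : ℕ} (x : Bits c) (φ : Bits q → ℂ) (b : Bits w) :
    inputState w x φ b = open Classical in
      if (∀ a < c, bitAt b a = bitAt x a) ∧ ∀ a, c + q ≤ a → bitAt b a = false
      then φ (slice b c q) else 0 := by
  have : (slice b 0 c = x ∧ ∀ j : Fin w, c + q ≤ (j : ℕ) → b j = false) ↔
      (∀ a < c, bitAt b a = bitAt x a) ∧ ∀ a, c + q ≤ a → bitAt b a = false := by
    rw [slice_eq_iff]
    refine and_congr (by simp) ⟨fun h a ha => ?_, fun h j hj => ?_⟩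
    · rcases lt_or_ge a w with haw | haw
      · simpa [bitAt, haw] using h ⟨a, haw⟩ ha
      · exact bitAt_of_le haw
    · simpa [bitAt] using h j hj
  simp only [inputState]
  by_cases h1 : (∀ a < c, bitAt b a = bitAt x a) ∧ ∀ a, c + q ≤ a → bitAt b a = false
  · rw [if_pos (this.2 h1), if_pos h1]
  · rw [if_neg (fun h' => h1 (this.1 h')), if_neg h1]

end ExtSim

/-! ### The given circuits on their own wires -/

namespace ExtSim

variable {w : ℕ}

theorem eq_of_slice_eq {b b' : Bits w} {off n : ℕ} (h : slice b off n = slice b' off n)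
    (h' : ∀ j : Fin w, ¬ (off ≤ (j : ℕ) ∧ (j : ℕ) < off + n) → b j = b' j) : b = b' := by
  funext j
  by_cases hj : off ≤ (j : ℕ) ∧ (j : ℕ) < off + n
  · have := slice_eq_iff.1 h (j - off) (by omega)
    rw [bitAt_slice, if_pos (by omega), show off + ((j : ℕ) - off) = j by omega] at this
    simpa [bitAt] using this
  · exact h' j hj

theorem trace_cqOutput {Y : Type} [DecidableEq Y] (ψ : Bits w → ℂ) (read : Bits w → Y)
    (off n : ℕ) (y : Y) :
    (cqOutput ψ read off n y).trace = (nsq (mask (fun b => read b = y) ψ) : ℂ) := by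
  simp only [Matrix.trace, Matrix.diag, cqOutput]
  rw [Finset.sum_comm, nsq, Complex.ofReal_sum]
  refine Finset.sum_congr rfl fun b _ => ?_
  rw [Finset.sum_eq_single (slice b off n), Finset.sum_eq_single b]
  · by_cases h : read b = y
    · simp [mask, h, Complex.mul_conj']
    · simp [mask, h]
  · intro b' _ hb'
    rw [if_neg]
    rintro ⟨-, -, -, h1, h2⟩
    exact hb' (eq_of_slice_eq h1 fun j hj => (h2 j hj).symm)
  · simp
  · intro a _ ha
    refine Finset.sum_eq_zero fun b' _ => if_neg ?_
    rintro ⟨-, -, h, -⟩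
    exact ha h.symm
  · simp

theorem trace_ketbra {n : ℕ} (v : Bits n → ℂ) : (ketbra v).trace = (nsq v : ℂ) := by
  simp [ketbra, Matrix.trace, Matrix.diag, vecMulVec_apply, nsq, Complex.mul_conj']

/-- The operator that runs a circuit, projects, and runs the circuit backwards. -/
noncomputable def conjMask (gs : List Gate) (p : Bits w → Prop) (ψ : Bits w → ℂ) : Bits w → ℂ :=
  ap (inv gs) (mask p (ap gs ψ))

section ConjMask

variable (gs : List Gate) (p : Bits w → Prop)

theorem conjMask_add (φ ψ : Bits w → ℂ) :
    conjMask gs p (φ + ψ) = conjMask gs p φ + conjMask gs p ψ := by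
  simp only [conjMask, ap_add, mask_add]

theorem conjMask_sub (φ ψ : Bits w → ℂ) :
    conjMask gs p (φ - ψ) = conjMask gs p φ - conjMask gs p ψ := by
  simp only [conjMask, ap_sub, mask_sub]

theorem conjMask_smul (c : ℂ) (ψ : Bits w → ℂ) :
    conjMask gs p (c • ψ) = c • conjMask gs p ψ := by
  simp only [conjMask, ap_smul, mask_smul]

theorem conjMask_sum {κ : Type*} (s : Finset κ) (f : κ → Bits w → ℂ) :
    conjMask gs p (∑ i ∈ s, f i) = ∑ i ∈ s, conjMask gs p (f i) := by
  simp only [conjMask, ap_sum, mask_sum]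

theorem conjMask_idem (ψ : Bits w → ℂ) : conjMask gs p (conjMask gs p ψ) = conjMask gs p ψ := by
  simp only [conjMask, ap_ap_inv, mask_idem]

theorem ip_conjMask (φ ψ : Bits w → ℂ) : ip (conjMask gs p φ) ψ = ip φ (conjMask gs p ψ) := by
  rw [conjMask, conjMask, ← ip_ap_right, ip_mask, ip_ap]

theorem nsq_conjMask_add (ψ : Bits w → ℂ) :
    nsq (conjMask gs p ψ) + nsq (ψ - conjMask gs p ψ) = nsq ψ := by
  have h : ψ - conjMask gs p ψ = conjMask gs (fun b => ¬ p b) ψ := by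
    rw [sub_eq_iff_eq_add, conjMask, conjMask, ← ap_add, add_comm, mask_add_mask_not, ap_inv_ap]
  rw [h, conjMask, conjMask, nsq_ap, nsq_ap, nsq_mask_add, nsq_ap]

theorem nsq_conjMask_le (ψ : Bits w → ℂ) : nsq (conjMask gs p ψ) ≤ nsq ψ := by
  rw [← nsq_conjMask_add gs p ψ]
  exact le_add_of_nonneg_right (nsq_nonneg _)

end ConjMask

theorem inputState_add {c q : ℕ} (x : Bits c) (φ φ' : Bits q → ℂ) :
    inputState w x (φ + φ') = inputState w x φ + inputState w x φ' := by
  funext b; simp only [inputState, Pi.add_apply]; split_ifs <;> simp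

theorem inputState_smul {c q : ℕ} (x : Bits c) (a : ℂ) (φ : Bits q → ℂ) :
    inputState w x (a • φ) = a • inputState w x φ := by
  funext b; simp only [inputState, Pi.smul_apply]; split_ifs <;> simp

theorem QCircuit.run_eq (A : QCircuit) (d : ℕ) {c q : ℕ} (x : Bits c) (φ : Bits q → ℂ) :
    A.run d x φ = ap A.gates (inputState (d + A.anc) x φ) := rfl

theorem prob_eq {Y : Type} [DecidableEq Y] (ψ : Bits w → ℂ) (read : Bits w → Y) (y : Y) :
    prob ψ read y = nsq (mask (fun b => read b = y) ψ) := by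
  rw [prob, nsq]
  refine Finset.sum_congr rfl fun b _ => ?_
  simp only [mask]
  split_ifs <;> simp

/-- An outcome of probability one of a unit vector. -/
theorem eq_zero_of_prob_eq_one {Y : Type} [DecidableEq Y] {ψ : Bits w → ℂ} {read : Bits w → Y}
    {y : Y} (hψ : nsq ψ = 1) (h : prob ψ read y = 1) (b : Bits w) (hb : read b ≠ y) : ψ b = 0 := by
  rw [prob_eq] at h
  have := nsq_mask_add (fun b => read b = y) ψ
  have h0 : nsq (mask (fun b => ¬ read b = y) ψ) = 0 := by linarith
  have := congrFun (nsq_eq_zero h0) b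
  simpa [mask, hb] using this

section Desc

variable {D : Desc} {C : Finset (Bits D.k)} {P : Bits D.k → Matrix (Bits D.n) (Bits D.n) ℂ}

theorem star_proj {n : ℕ} {p : Matrix (Bits n) (Bits n) ℂ} (h : IsStarProjection p) : pᴴ = p :=
  h.isSelfAdjoint

theorem proj_mul {n : ℕ} {p : Matrix (Bits n) (Bits n) ℂ} (h : IsStarProjection p) : p * p = p :=
  h.isIdempotentElem

/-- Measuring, keeping the positive outcome and undoing the computation is the projection. The
circuit may entangle the state with its other wires only where this cannot be seen: the
probabilities of the outcomes suffice. -/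
theorem conjMask_meas (hP : ∀ i ∈ C, IsStarProjection (P i)) (hM : D.Measures C P)
    {i : Bits D.k} (hi : i ∈ C) (φ : Bits D.n → ℂ) :
    conjMask D.meas.gates (fun b => bitAt b (D.k + D.n) = true)
      (inputState (D.k + D.n + 1 + D.meas.anc) i φ) =
      inputState (D.k + D.n + 1 + D.meas.anc) i (P i *ᵥ φ) := by
  set U := fun φ : Bits D.n → ℂ => D.meas.run (D.k + D.n + 1) i φ with hU
  -- the traces of the density matrices are the probabilities of the outcomes
  have key : ∀ (φ : Bits D.n → ℂ) (o : Bool), nsq (mask (fun z => bitAt z (D.k + D.n) = o) (U φ)) =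
      nsq ((if o = true then P i else 1 - P i) *ᵥ φ) := fun φ o => by
    have := congrArg Matrix.trace (hM i hi φ o)
    rw [trace_cqOutput, trace_ketbra] at this
    exact_mod_cast this
  have hidem : P i * P i = P i := proj_mul (hP i hi)
  have h1 : mask (fun z => bitAt z (D.k + D.n) = true) (U ((1 - P i) *ᵥ φ)) = 0 := by
    refine nsq_eq_zero ?_
    rw [key, if_pos rfl, mulVec_mulVec, mul_sub, hidem, mul_one, sub_self, zero_mulVec]
    simp [nsq]
  have h2 : mask (fun z => bitAt z (D.k + D.n) = true) (U (P i *ᵥ φ)) = U (P i *ᵥ φ) := by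
    have h0 : mask (fun z => bitAt z (D.k + D.n) = false) (U (P i *ᵥ φ)) = 0 := by
      refine nsq_eq_zero ?_
      rw [key, if_neg (by simp), mulVec_mulVec, sub_mul, hidem, one_mul, sub_self, zero_mulVec]
      simp [nsq]
    refine mask_eq_self fun b hb => ?_
    have := congrFun h0 b
    simpa [mask, Bool.eq_false_iff.2 hb] using this
  have hsplit : U φ = U (P i *ᵥ φ) + U ((1 - P i) *ᵥ φ) := by
    simp only [hU, QCircuit.run_eq]
    rw [← ap_add, ← inputState_add, ← add_mulVec, add_sub_cancel, one_mulVec]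
  show ap (inv D.meas.gates) (mask _ (U φ)) = _
  rw [hsplit, mask_add, h1, h2, add_zero]
  exact ap_inv_ap _ _

/-- The first algorithm never outputs anything but `s i` on the range of `P i`, where the state need
not be normalised. -/
theorem alg0_zero {s : Bits D.k → Bits D.m}
    (h0 : ∀ i ∈ C, ∀ φ : Bits D.n → ℂ, star φ ⬝ᵥ φ = 1 → P i *ᵥ φ = φ → D.prob0 i φ (s i) = 1)
    {i : Bits D.k} (hi : i ∈ C) {φ : Bits D.n → ℂ} (hφ : P i *ᵥ φ = φ)
    (b : Bits (D.k + D.n + D.m + D.alg0.anc)) (hb : slice b (D.k + D.n) D.m ≠ s i) :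
    ap D.alg0.gates (inputState _ i φ) b = 0 := by
  by_cases h : nrm φ = 0
  · have : φ = 0 := nsq_eq_zero (by rw [← nrm_sq, h]; ring)
    have h0' : inputState (D.k + D.n + D.m + D.alg0.anc) i φ = 0 := by
      simpa [this] using inputState_smul (w := D.k + D.n + D.m + D.alg0.anc) i 0 φ
    rw [h0', ap_zero]; rfl
  · set a : ℂ := (((nrm φ)⁻¹ : ℝ) : ℂ) with ha
    have hn : nsq (a • φ) = 1 := by
      rw [nsq_smul, ha, Complex.norm_real, Real.norm_of_nonneg (inv_nonneg.2 (nrm_nonneg _)),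
        ← nrm_sq]
      field_simp
    have := eq_zero_of_prob_eq_one (y := s i) (read := fun z => slice z (D.k + D.n) D.m)
      (ψ := ap D.alg0.gates (inputState (D.k + D.n + D.m + D.alg0.anc) i (a • φ)))
      (by rw [nsq_ap, nsq_inputState (by omega), hn])
      (h0 i hi (a • φ) (by
        show ip (a • φ) (a • φ) = 1
        rw [ip_self, hn, Complex.ofReal_one])
        (by rw [mulVec_smul, hφ])) b hb
    rw [inputState_smul, ap_smul] at this
    have ha0 : a ≠ 0 := by simpa [ha] using h
    simpa [ha0] using this

/-- The second algorithm never outputs anything but `t` on pairs in `S`. -/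
theorem alg1_zero {i j : Bits D.k} {s s' : Bits D.m} {t : Bits D.r}
    (h1 : D.prob1 i j s s' t = 1)
    (b : Bits ((D.k + D.k) + (D.m + D.m) + D.r + D.alg1.anc))
    (hb : slice b ((D.k + D.k) + (D.m + D.m)) D.r ≠ t) :
    ap D.alg1.gates (inputState _ (Fin.append (Fin.append i j) (Fin.append s s'))
      (fun _ : Bits 0 => 1)) b = 0 := by
  refine eq_zero_of_prob_eq_one (y := t) (read := fun z => slice z ((D.k + D.k) + (D.m + D.m)) D.r)
    ?_ h1 b hb
  rw [QCircuit.run_eq, nsq_ap, nsq_inputState (by omega)]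
  simp [nsq]

end Desc

end ExtSim

/-! ### The wires of the extractor -/

namespace ExtSim

/-- A renaming of the wires of a circuit with `q` wires: the first `n1` go to the wires from `o1`
on, the next `n2` to the wires from `o2` on and the others to the wires from `o3` on. -/
def relo (n1 n2 q o1 o2 o3 w a : ℕ) : ℕ :=
  if a < n1 then o1 + a else if a < n1 + n2 then o2 + (a - n1) else
    if a < q then o3 + (a - (n1 + n2)) else w

theorem relo_emb {n1 n2 n3 q o1 o2 o3 w : ℕ} (hq : q = n1 + n2 + n3) (h1 : o1 + n1 ≤ w)
    (h2 : o2 + n2 ≤ w) (h3 : o3 + n3 ≤ w) (h12 : o1 + n1 ≤ o2 ∨ o2 + n2 ≤ o1)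
    (h13 : o1 + n1 ≤ o3 ∨ o3 + n3 ≤ o1) (h23 : o2 + n2 ≤ o3 ∨ o3 + n3 ≤ o2) :
    Emb q w (relo n1 n2 q o1 o2 o3 w) where
  lt a ha := by unfold relo; split_ifs <;> omega
  inj a ha a' ha' h := by unfold relo at h; split_ifs at h <;> omega
  out a ha := by unfold relo; split_ifs <;> omega

theorem ran_relo {n1 n2 n3 q o1 o2 o3 w a : ℕ} (hq : q = n1 + n2 + n3) :
    Ran q (relo n1 n2 q o1 o2 o3 w) a ↔
      (o1 ≤ a ∧ a < o1 + n1) ∨ (o2 ≤ a ∧ a < o2 + n2) ∨ (o3 ≤ a ∧ a < o3 + n3) := by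
  constructor
  · rintro ⟨a', h, rfl⟩
    unfold relo
    split_ifs <;> omega
  · rintro (h | h | h)
    · exact ⟨a - o1, by omega, by rw [relo, if_pos (by omega)]; omega⟩
    · exact ⟨n1 + (a - o2), by omega, by rw [relo, if_neg (by omega), if_pos (by omega)]; omega⟩
    · exact ⟨n1 + n2 + (a - o3), by omega, by
        rw [relo, if_neg (by omega), if_neg (by omega), if_pos (by omega)]; omega⟩

theorem relo_cases (n1 n2 n3 q o1 o2 o3 w a : ℕ) (hq : q = n1 + n2 + n3) :
    relo n1 n2 q o1 o2 o3 w a = w ∨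
      (o1 ≤ relo n1 n2 q o1 o2 o3 w a ∧ relo n1 n2 q o1 o2 o3 w a < o1 + n1) ∨
      (o2 ≤ relo n1 n2 q o1 o2 o3 w a ∧ relo n1 n2 q o1 o2 o3 w a < o2 + n2) ∨
      (o3 ≤ relo n1 n2 q o1 o2 o3 w a ∧ relo n1 n2 q o1 o2 o3 w a < o3 + n3) := by
  unfold relo
  split_ifs <;> omega

section

variable {w n k q l oX oY : ℕ}

/-- The input of a circuit that acts on an index, the quantum register and some more wires. -/
theorem fib_emb_relo (hq : q = k + n + l) (hX : n ≤ oX) (hY : n ≤ oY)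
    (hXY : oX + k ≤ oY ∨ oY + l ≤ oX) (hXw : oX + k ≤ w) (hYw : oY + l ≤ w) {c : Bits w}
    {i : Bits k} (hi : slice c oX k = i) (hc : ∀ a, oY ≤ a → a < oY + l → bitAt c a = false)
    (φ : Bits n → ℂ) (b : Bits w) :
    fib q (relo k n q oX 0 oY w) b (emb c φ) = open Classical in
      if Agree (fun a => ¬ Ran q (relo k n q oX 0 oY w) a) b c
      then inputState q i φ else 0 := by
  classical
  have hρ : Emb q w (relo k n q oX 0 oY w) := relo_emb hq hXw (by omega) hYw (by omega) hXY
    (by omega)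
  have ran := fun a => ran_relo (o1 := oX) (o2 := 0) (o3 := oY) (w := w) (a := a) hq
  set ρ := relo k n q oX 0 oY w with hρdef
  have r1 : ∀ a < k, ρ a = oX + a := fun a ha => by rw [hρdef, relo, if_pos ha]
  have r2 : ∀ a < n, ρ (k + a) = a := fun a ha => by
    rw [hρdef, relo, if_neg (by omega), if_pos (by omega)]; omega
  have r3 : ∀ a < l, ρ (k + n + a) = oY + a := fun a ha => by
    rw [hρdef, relo, if_neg (by omega), if_neg (by omega), if_pos (by omega)]; omega
  funext x
  rw [fib, emb]
  by_cases hb : Agree (fun a => ¬ Ran q ρ a) b c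
  · rw [if_pos hb, inputState_apply]
    have hiff : Agree (fun a => n ≤ a) (put ρ b x) c ↔
        (∀ a < k, bitAt x a = bitAt i a) ∧ ∀ a, k + n ≤ a → bitAt x a = false := by
      rw [← hi]
      constructor
      · intro h
        refine ⟨fun a ha => ?_, fun a ha => ?_⟩
        · rw [← bitAt_put_self hρ b x, r1 a ha, h _ (by omega), bitAt_slice, if_pos ha]
        · rcases lt_or_ge a q with haq | haq
          · have := r3 (a - (k + n)) (by omega)
            rw [show k + n + (a - (k + n)) = a by omega] at this
            rw [← bitAt_put_self hρ b x, this, h _ (by omega), hc _ (by omega) (by omega)]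
          · exact bitAt_of_le haq
      · rintro ⟨h1, h2⟩ a ha
        by_cases hr : Ran q ρ a
        · rcases (ran a).1 hr with h | h | h
          · have e : a = ρ (a - oX) := by rw [r1 _ (by omega)]; omega
            rw [e, bitAt_put_self hρ, h1 _ (by omega), bitAt_slice, if_pos (by omega),
              r1 _ (by omega)]
          · omega
          · have e : a = ρ (k + n + (a - oY)) := by rw [r3 _ (by omega)]; omega
            rw [hc a h.1 h.2, e, bitAt_put_self hρ, h2 _ (by omega)]
        · rw [bitAt_put_of_not hr, hb a hr]
    have hsl : slice (put ρ b x) 0 n = slice x k n := slice_congr fun a ha => by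
      rw [zero_add, ← bitAt_put_self hρ b x, r2 a ha]
    by_cases h : Agree (fun a => n ≤ a) (put ρ b x) c
    · rw [if_pos h, if_pos (hiff.1 h), hsl]
    · rw [if_neg h, if_neg fun h' => h (hiff.2 h')]
  · rw [if_neg hb, if_neg]
    · rfl
    · intro h
      refine hb fun a ha => ?_
      rw [← bitAt_put_of_not (b := b) (x := x) ha, h a]
      by_contra hlt
      exact ha ((ran a).2 (by omega))

theorem ap_relo_emb (hq : q = k + n + l) (hX : n ≤ oX) (hY : n ≤ oY)
    (hXY : oX + k ≤ oY ∨ oY + l ≤ oX) (hXw : oX + k ≤ w) (hYw : oY + l ≤ w) {c : Bits w}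
    {i : Bits k} (hi : slice c oX k = i) (hc : ∀ a, oY ≤ a → a < oY + l → bitAt c a = false)
    (gs : List Gate) (φ : Bits n → ℂ) (b : Bits w) :
    ap (reloc (relo k n q oX 0 oY w) gs) (emb c φ) b = open Classical in
      if Agree (fun a => ¬ Ran q (relo k n q oX 0 oY w) a) b c
      then ap gs (inputState q i φ) (pull q (relo k n q oX 0 oY w) b) else 0 := by
  rw [ap_reloc (relo_emb hq hXw (by omega) hYw (by omega) hXY (by omega)),
    fib_emb_relo hq hX hY hXY hXw hYw hi hc]
  split_ifs
  · rfl
  · rw [ap_zero]; rfl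

/-- Projections that have been computed by the circuit on its own wires. -/
theorem conjMask_relo_emb (hq : q = k + n + l) (hX : n ≤ oX) (hY : n ≤ oY)
    (hXY : oX + k ≤ oY ∨ oY + l ≤ oX) (hXw : oX + k ≤ w) (hYw : oY + l ≤ w) {c : Bits w}
    {i : Bits k} (hi : slice c oX k = i) (hc : ∀ a, oY ≤ a → a < oY + l → bitAt c a = false)
    (gs : List Gate) (o : ℕ) (φ φ' : Bits n → ℂ)
    (h : conjMask gs (fun b => bitAt b o = true) (inputState q i φ) = inputState q i φ') :
    conjMask (reloc (relo k n q oX 0 oY w) gs)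
      (fun b => bitAt b (relo k n q oX 0 oY w o) = true) (emb c φ) = emb c φ' := by
  have hρ : Emb q w (relo k n q oX 0 oY w) := relo_emb hq hXw (by omega) hYw (by omega) hXY
    (by omega)
  funext b
  rw [conjMask, inv_reloc, ap_reloc hρ]
  have e : fib q (relo k n q oX 0 oY w) b (mask (fun b => bitAt b (relo k n q oX 0 oY w o) = true)
      (ap (reloc (relo k n q oX 0 oY w) gs) (emb c φ))) =
      mask (fun b => bitAt b o = true) (ap gs (fib q (relo k n q oX 0 oY w) b (emb c φ))) := by
    rw [← fib_ap hρ]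
    funext x
    by_cases hx : bitAt x o = true <;> simp [fib, mask, bitAt_put_self hρ, hx]
  rw [e, fib_emb_relo hq hX hY hXY hXw hYw hi hc, ← fib_pull hρ b (emb c φ'),
    fib_emb_relo hq hX hY hXY hXw hYw hi hc]
  split_ifs
  · exact congrFun h _
  · have : mask (fun b : Bits q => bitAt b o = true) 0 = 0 := mask_eq_zero fun _ _ => rfl
    rw [ap_zero, this, ap_zero]

end

/-- A circuit that does not act on the quantum register, with the classical input `x` on its first
wires. -/
theorem ap_reloc_emb {w n q c₀ : ℕ} {ρ : ℕ → ℕ} (hρ : Emb q w ρ) (hn : ∀ a, Ran q ρ a → n ≤ a)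
    {c : Bits w} {x : Bits c₀} (hx : ∀ a, bitAt c (ρ a) = bitAt x a) (gs : List Gate)
    (φ : Bits n → ℂ) :
    ap (reloc ρ gs) (emb c φ) =
      ∑ h, ap gs (inputState q x fun _ : Bits 0 => 1) h • emb (put ρ c h) φ := by
  classical
  funext b
  have hfib : fib q ρ b (emb c φ) =
      (if Agree (fun a => n ≤ a ∧ ¬ Ran q ρ a) b c then φ (slice b 0 n) else 0) •
        inputState q x fun _ : Bits 0 => 1 := by
    funext y
    rw [fib, emb, Pi.smul_apply, inputState_apply]
    have h1 : Agree (fun a => n ≤ a) (put ρ b y) c ↔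
        Agree (fun a => n ≤ a ∧ ¬ Ran q ρ a) b c ∧
        ((∀ a < c₀, bitAt y a = bitAt x a) ∧ ∀ a, c₀ + 0 ≤ a → bitAt y a = false) := by
      constructor
      · intro h
        have hy : ∀ a, bitAt y a = bitAt x a := fun a => by
          rw [← bitAt_put_self hρ b y]
          by_cases ha : a < q
          · rw [h _ (hn _ ⟨a, ha, rfl⟩), hx]
          · rw [← hx, bitAt_of_le (hρ.out a (by omega)), bitAt_of_le (hρ.out a (by omega))]
        refine ⟨fun a ha => ?_, fun a _ => hy a, fun a ha => ?_⟩
        · rw [← bitAt_put_of_not (b := b) (x := y) ha.2, h a ha.1]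
        · rw [hy, bitAt_of_le (by omega)]
      · rintro ⟨h1, h2, h3⟩ a ha
        by_cases hr : Ran q ρ a
        · obtain ⟨a, -, rfl⟩ := hr
          rw [bitAt_put_self hρ, hx]
          rcases lt_or_ge a c₀ with h | h
          · exact h2 a h
          · rw [h3 a (by omega), bitAt_of_le h]
        · rw [bitAt_put_of_not hr, h1 a ⟨ha, hr⟩]
    have h2 : slice (put ρ b y) 0 n = slice b 0 n := slice_congr fun a ha => by
      refine bitAt_put_of_not fun hr => ?_
      have := hn _ hr
      omega
    by_cases h3 : Agree (fun a => n ≤ a ∧ ¬ Ran q ρ a) b c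
    · by_cases h4 : (∀ a < c₀, bitAt y a = bitAt x a) ∧ ∀ a, c₀ + 0 ≤ a → bitAt y a = false
      · rw [if_pos (h1.2 ⟨h3, h4⟩), if_pos h3, if_pos h4, h2]; simp
      · rw [if_neg (fun h => h4 (h1.1 h).2), if_neg h4]; simp
    · rw [if_neg (fun h => h3 (h1.1 h).1), if_neg h3]; simp
  rw [ap_reloc hρ, hfib, ap_smul, Finset.sum_apply, Finset.sum_eq_single (pull q ρ b)]
  · have : Agree (fun a => n ≤ a) b (put ρ c (pull q ρ b)) ↔
        Agree (fun a => n ≤ a ∧ ¬ Ran q ρ a) b c := by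
      constructor
      · intro h a ha
        rw [h a ha.1, bitAt_put_of_not ha.2]
      · intro h a ha
        by_cases hr : Ran q ρ a
        · obtain ⟨a, -, rfl⟩ := hr
          rw [bitAt_put_self hρ, bitAt_pull hρ]
        · rw [bitAt_put_of_not hr, h a ⟨ha, hr⟩]
    simp only [Pi.smul_apply, smul_eq_mul, emb]
    by_cases h : Agree (fun a => n ≤ a) b (put ρ c (pull q ρ b))
    · rw [if_pos h, if_pos (this.1 h), mul_comm]
    · rw [if_neg h, if_neg fun h' => h (this.2 h')]; simp
  · intro h _ hne
    rw [Pi.smul_apply, emb, if_neg, smul_zero]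
    intro hag
    refine hne ?_
    rw [← pull_put hρ c h]
    refine bits_ext fun a => ?_
    rw [bitAt_pull hρ, bitAt_pull hρ]
    by_cases ha : a < q
    · exact (hag _ (hn _ ⟨a, ha, rfl⟩)).symm
    · rw [bitAt_of_le (hρ.out a (by omega)), bitAt_of_le (hρ.out a (by omega))]
  · simp

end ExtSim

/-! ### The circuit of the extractor -/

namespace ExtSim

/-- The given circuits together with the number of rounds of the extractor. -/
structure Ext extends Desc where
  T : ℕ

namespace Ext

variable (X : Ext)

/-- The position of the index `i`. -/
def oI : ℕ := X.n
/-- The position of the flag that tells whether the state was projected. -/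
def oB : ℕ := X.oI + X.k
/-- The position of the output string. -/
def oS : ℕ := X.oB + 1
/-- The position of the register of the sampler for `i`. -/
def oG : ℕ := X.oS + X.r
/-- The position of the outcome and the ancillas of the measurement for `i`. -/
def oMI : ℕ := X.oG + (X.k + X.sampler.anc)
/-- The position of the register of the sampler for `j`. -/
def oJ : ℕ := X.oMI + (1 + X.meas.anc)
/-- The position of the outcome and the ancillas of the measurement for `j`. -/
def oMJ : ℕ := X.oJ + (X.k + X.sampler.anc)
/-- The position of the output and the ancillas of the first algorithm for `i`. -/
def oAI : ℕ := X.oMJ + (1 + X.meas.anc)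
/-- The position of the output and the ancillas of the first algorithm for `j`. -/
def oAJ : ℕ := X.oAI + (X.m + X.alg0.anc)
/-- The position of the register of the second algorithm. -/
def oZ : ℕ := X.oAJ + (X.m + X.alg0.anc)
/-- The position of the flags of the rounds. -/
def oL : ℕ := X.oZ + (X.k + X.k + (X.m + X.m) + X.r + X.alg1.anc)
/-- The position of the flags of a conjunction. -/
def oC : ℕ := X.oL + (X.T + 1)
/-- The number of wires for `j`. -/
def len : ℕ := X.k + X.sampler.anc + (1 + X.meas.anc)
/-- The number of ancillas. -/
def anc : ℕ := X.k + X.sampler.anc + (1 + X.meas.anc) + (X.k + X.sampler.anc) + (1 + X.meas.anc) +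
  (X.m + X.alg0.anc) + (X.m + X.alg0.anc) + (X.k + X.k + (X.m + X.m) + X.r + X.alg1.anc) +
  (X.T + 1) + (X.len + 1)
/-- The number of wires. The wires are, in this order: the quantum register; the index `i`; the
flag that tells whether the state was projected; the output string; a register for the sampler;
the outcome and ancillas of the measurement for `i`; the same two registers for the index `j`,
from `oJ` to `oAI`; the outputs and ancillas of the first algorithm for `i` and for `j`; the
register of the second algorithm; the flags of the rounds; the flags of a conjunction. -/
def W : ℕ := X.n + X.k + 1 + X.r + X.anc

/-- The positions as a list of equations, for linear arithmetic. -/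
theorem spec : X.oI = X.n ∧ X.oB = X.oI + X.k ∧ X.oS = X.oB + 1 ∧ X.oG = X.oS + X.r ∧
    X.oMI = X.oG + (X.k + X.sampler.anc) ∧ X.oJ = X.oMI + (1 + X.meas.anc) ∧
    X.oMJ = X.oJ + (X.k + X.sampler.anc) ∧ X.oAI = X.oMJ + (1 + X.meas.anc) ∧
    X.oAJ = X.oAI + (X.m + X.alg0.anc) ∧ X.oZ = X.oAJ + (X.m + X.alg0.anc) ∧
    X.oL = X.oZ + (X.k + X.k + (X.m + X.m) + X.r + X.alg1.anc) ∧ X.oC = X.oL + (X.T + 1) ∧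
    X.len = X.k + X.sampler.anc + (1 + X.meas.anc) ∧ X.W = X.oC + (X.len + 1) := by
  refine ⟨rfl, rfl, rfl, rfl, rfl, rfl, rfl, rfl, rfl, rfl, rfl, rfl, rfl, ?_⟩
  simp only [oI, oB, oS, oG, oMI, oJ, oMJ, oAI, oAJ, oZ, oL, oC, W, anc]
  omega

/-- The measurement of the index at `o`, with outcome and ancillas at `o'`. -/
def meaC (o o' : ℕ) : List Gate :=
  reloc (relo X.k X.n (X.k + X.n + 1 + X.meas.anc) o 0 o' X.W) X.meas.gates

/-- The first algorithm for the index at `o`, with output and ancillas at `o'`. -/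
def algC (o o' : ℕ) : List Gate :=
  reloc (relo X.k X.n (X.k + X.n + X.m + X.alg0.anc) o 0 o' X.W) X.alg0.gates

/-- The sampler on the wires from `o` on. -/
def smpC (o : ℕ) : List Gate :=
  reloc (relo (X.k + X.sampler.anc) 0 (X.k + X.sampler.anc) o 0 0 X.W) X.sampler.gates

/-- The second algorithm. -/
def finC : List Gate :=
  reloc (relo (X.k + X.k + (X.m + X.m) + X.r + X.alg1.anc) 0
    (X.k + X.k + (X.m + X.m) + X.r + X.alg1.anc) X.oZ 0 0 X.W) X.alg1.gates

/-- If the flag `t` is set, measure for `j` and set the flag `t + 1` if the measurement fails. So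
this flag tells whether all measurements up to the round `t` have failed. -/
def upd (t : ℕ) : List Gate :=
  X.meaC X.oJ X.oMJ ++ [Gate.CX (X.oL + t) (X.oL + t + 1), Gate.CCX (X.oL + t) X.oMJ (X.oL + t + 1)]
    ++ inv (X.meaC X.oJ X.oMJ)

/-- If the flag is set, reflect about the subspace in which the registers for `j` are zero and the
measurement for `i` succeeds. -/
def refl (t : ℕ) : List Gate :=
  X.meaC X.oI X.oMI ++ (conj (X.oL + t + 1) X.oMI X.oJ X.oC X.len ++
    List.replicate 4 (Gate.T (X.oC + X.len)) ++ inv (conj (X.oL + t + 1) X.oMI X.oJ X.oC X.len)) ++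
    inv (X.meaC X.oI X.oMI)

/-- One round of the alternation. Conjugated by the sampler, the reflection about the subspace in
which the registers for `j` are zero concerns the sampled state. -/
def round (t : ℕ) : List Gate :=
  X.upd t ++ inv (X.smpC X.oJ) ++ X.refl t ++ X.smpC X.oJ

/-- The first `t` rounds. -/
def rounds (t : ℕ) : List Gate := (List.range t).flatMap X.round

/-- Run the first algorithm for `i` and keep its output. -/
def first : List Gate :=
  X.algC X.oI X.oAI ++ cxs X.oAI (X.oZ + (X.k + X.k)) X.m ++ inv (X.algC X.oI X.oAI)

/-- Run the two algorithms for `i` and `j`. -/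
def last : List Gate :=
  cxs X.oI X.oZ X.k ++ cxs X.oJ (X.oZ + X.k) X.k ++ X.algC X.oJ X.oAJ ++
    cxs X.oAJ (X.oZ + (X.k + X.k) + X.m) X.m ++ X.finC

/-- Compute the output string. -/
def comp : List Gate :=
  X.first ++ X.smpC X.oJ ++ [Gate.X X.oL] ++ X.rounds X.T ++ X.last

/-- Sample `i` and measure. -/
def prep : List Gate :=
  X.smpC X.oG ++ cxs X.oG X.oI X.k ++
    (X.meaC X.oI X.oMI ++ [Gate.CX X.oMI X.oB] ++ inv (X.meaC X.oI X.oMI))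

/-- The circuit of the extractor: the string is computed, copied to the output if the state was
projected, and uncomputed, so that the state is restored. -/
def gates : List Gate :=
  X.prep ++ (X.comp ++ ccxs X.oB (X.oZ + (X.k + X.k) + (X.m + X.m)) X.oS X.r ++ inv X.comp)

end Ext

/-! ### Local operators -/

/-- The operator `F` concerns only the wires that satisfy `P`. -/
structure Loc {w : ℕ} (P : ℕ → Prop) (F : (Bits w → ℂ) → Bits w → ℂ) : Prop where
  mask_comm : ∀ p : Bits w → Prop, (∀ b b', Agree (fun a => ¬ P a) b b' → (p b → p b')) →
    ∀ ψ, F (mask p ψ) = mask p (F ψ)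
  comp_comm : ∀ f : Bits w → Bits w, (∀ b, Agree P (f b) b) →
    (∀ b b', Agree (fun a => ¬ P a) b b' → Agree (fun a => ¬ P a) (f b) (f b')) →
    ∀ ψ : Bits w → ℂ, F (fun b => ψ (f b)) = fun b => F ψ (f b)

section Loc

variable {w : ℕ} {P : ℕ → Prop}

theorem Loc.ap {gs : List Gate} (h : On P gs) : Loc (w := w) P (ap gs) where
  mask_comm _ hp ψ := ap_mask h hp ψ
  comp_comm _ hf hf' ψ := ap_comp h hf hf' ψ

theorem Loc.mask' {p : Bits w → Prop} (h : ∀ b b', Agree P b b' → (p b → p b')) :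
    Loc P (ExtSim.mask p) where
  mask_comm q _ ψ := by
    funext b; simp only [ExtSim.mask]; split_ifs <;> rfl
  comp_comm f hf _ ψ := by
    funext b
    by_cases hb : p b
    · simp only [ExtSim.mask, if_pos hb, if_pos (h _ _ (hf b).symm hb)]
    · simp only [ExtSim.mask, if_neg hb, if_neg fun h' => hb (h _ _ (hf b) h')]

theorem Loc.trans {F G : (Bits w → ℂ) → Bits w → ℂ} (hF : Loc P F) (hG : Loc P G) :
    Loc P (fun ψ => F (G ψ)) where
  mask_comm p hp ψ := by rw [hG.mask_comm p hp, hF.mask_comm p hp]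
  comp_comm f hf hf' ψ := by rw [hG.comp_comm f hf hf', hF.comp_comm f hf hf']

theorem Loc.conjMask {gs : List Gate} (h : On P gs) {p : Bits w → Prop}
    (hp : ∀ b b', Agree P b b' → (p b → p b')) : Loc P (conjMask gs p) :=
  (Loc.ap h.inv).trans ((Loc.mask' hp).trans (Loc.ap h))

/-- A local operator does not lead out of a subspace that concerns the other wires. -/
theorem Loc.support {F : (Bits w → ℂ) → Bits w → ℂ} (hF : Loc P F) {p : Bits w → Prop}
    (hp : ∀ b b', Agree (fun a => ¬ P a) b b' → (p b → p b')) {ψ : Bits w → ℂ}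
    (h : mask p ψ = ψ) : mask p (F ψ) = F ψ := by
  rw [← hF.mask_comm p hp, h]

theorem agree_bit {P : ℕ → Prop} {a : ℕ} (ha : P a) {v : Bool} (b b' : Bits w) (h : Agree P b b') :
    bitAt b a = v → bitAt b' a = v := fun h' => by rw [← h a ha, h']

theorem agree_flip {P : ℕ → Prop} {a : ℕ} (ha : ¬ P a) (b : Bits w) : Agree P (flipBit b a) b :=
  fun a' ha' => by
    rw [bitAt_flipBit, if_neg]
    rintro ⟨rfl, -⟩
    exact ha ha'

theorem agree_flip_flip {P : ℕ → Prop} {a : ℕ} (b b' : Bits w) (h : Agree P b b') :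
    Agree P (flipBit b a) (flipBit b' a) := fun a' ha' => by
  simp only [bitAt_flipBit]
  split_ifs with h1
  · rw [← h1.1, h a' ha']
  · exact h a' ha'

end Loc

namespace Ext

variable (X : Ext)

/-- The wires of the quantum register and of the registers for `j`. -/
def PJ (a : ℕ) : Prop := X.W ≤ a ∨ a < X.n ∨ (X.oJ ≤ a ∧ a < X.oAI)

/-- The wires of the quantum register and of the registers for the measurement for `i`. -/
def PI (a : ℕ) : Prop :=
  X.W ≤ a ∨ a < X.n ∨ (X.oI ≤ a ∧ a < X.oI + X.k) ∨ (X.oMI ≤ a ∧ a < X.oJ)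

theorem on_meaC (o o' : ℕ) (P : ℕ → Prop) (h : ∀ a, a = X.W ∨ a < X.n ∨ (o ≤ a ∧ a < o + X.k) ∨
    (o' ≤ a ∧ a < o' + (1 + X.meas.anc)) → P a) : On P (X.meaC o o') := by
  refine on_reloc _ _ fun a => h _ ?_
  have := relo_cases X.k X.n (1 + X.meas.anc) (X.k + X.n + 1 + X.meas.anc) o 0 o' X.W a (by omega)
  omega

theorem on_algC (o o' : ℕ) (P : ℕ → Prop) (h : ∀ a, a = X.W ∨ a < X.n ∨ (o ≤ a ∧ a < o + X.k) ∨
    (o' ≤ a ∧ a < o' + (X.m + X.alg0.anc)) → P a) : On P (X.algC o o') := by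
  refine on_reloc _ _ fun a => h _ ?_
  have := relo_cases X.k X.n (X.m + X.alg0.anc) (X.k + X.n + X.m + X.alg0.anc) o 0 o' X.W a
    (by omega)
  omega

theorem on_smpC (o : ℕ) (P : ℕ → Prop) (h : ∀ a, a = X.W ∨ (o ≤ a ∧ a < o + (X.k + X.sampler.anc)) →
    P a) : On P (X.smpC o) := by
  refine on_reloc _ _ fun a => h _ ?_
  have := relo_cases (X.k + X.sampler.anc) 0 0 (X.k + X.sampler.anc) o 0 0 X.W a (by omega)
  omega

theorem on_finC (P : ℕ → Prop) (h : ∀ a, a = X.W ∨ (X.oZ ≤ a ∧ a < X.oL) → P a) : On P X.finC := by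
  refine on_reloc _ _ fun a => h _ ?_
  have hs := X.spec
  have := relo_cases (X.k + X.k + (X.m + X.m) + X.r + X.alg1.anc) 0 0
    (X.k + X.k + (X.m + X.m) + X.r + X.alg1.anc) X.oZ 0 0 X.W a (by omega)
  omega

theorem on_meaJ : On X.PJ (X.meaC X.oJ X.oMJ) :=
  X.on_meaC _ _ _ fun a h => by have := X.spec; unfold PJ; omega

theorem on_smpJ : On X.PJ (X.smpC X.oJ) :=
  X.on_smpC _ _ fun a h => by have := X.spec; unfold PJ; omega

theorem on_meaI : On X.PI (X.meaC X.oI X.oMI) :=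
  X.on_meaC _ _ _ fun a h => by have := X.spec; unfold PI; omega

/-- The projection to the success of the measurement for `j`. -/
noncomputable def A : (Bits X.W → ℂ) → Bits X.W → ℂ :=
  conjMask (X.meaC X.oJ X.oMJ) fun b => bitAt b X.oMJ = true

/-- The projection to the success of the measurement for `i`. -/
noncomputable def AI : (Bits X.W → ℂ) → Bits X.W → ℂ :=
  conjMask (X.meaC X.oI X.oMI) fun b => bitAt b X.oMI = true

theorem loc_A : Loc X.PJ X.A :=
  Loc.conjMask X.on_meaJ (agree_bit (by have := X.spec; unfold PJ; omega))

theorem loc_AI : Loc X.PI X.AI :=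
  Loc.conjMask X.on_meaI (agree_bit (by have := X.spec; unfold PI; omega))

/-- The measurement for `j`, conditioned on the flag of the round. -/
theorem ap_upd (t : ℕ) (ht : t < X.T) (ψ : Bits X.W → ℂ) :
    ap (X.upd t) ψ = mask (fun b => ¬ bitAt b (X.oL + t) = true) ψ +
      mask (fun b => bitAt b (X.oL + t) = true)
        (X.A ψ + fun b => (ψ - X.A ψ) (flipBit b (X.oL + t + 1))) := by
  have hs := X.spec
  have hP : ∀ a, a = X.oL + t ∨ a = X.oL + t + 1 → ¬ X.PJ a := by
    intro a ha; unfold PJ; omega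
  set U := X.meaC X.oJ X.oMJ with hU
  have mid : ∀ χ : Bits X.W → ℂ, ap [Gate.CX (X.oL + t) (X.oL + t + 1),
      Gate.CCX (X.oL + t) X.oMJ (X.oL + t + 1)] χ =
      mask (fun b => ¬ bitAt b (X.oL + t) = true) χ + mask (fun b => bitAt b (X.oL + t) = true)
        (mask (fun b => bitAt b X.oMJ = true) χ + fun b =>
          (χ - mask (fun b => bitAt b X.oMJ = true) χ) (flipBit b (X.oL + t + 1))) := by
    intro χ
    funext b
    have e1 : bitAt (flipBit b (X.oL + t + 1)) X.oMJ = bitAt b X.oMJ := by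
      rw [bitAt_flipBit, if_neg (by omega)]
    have e2 : bitAt (flipBit b (X.oL + t + 1)) (X.oL + t) = bitAt b (X.oL + t) := by
      rw [bitAt_flipBit, if_neg (by omega)]
    have n1 : X.oL + t ≠ X.oL + t + 1 := by omega
    have n2 : X.oMJ ≠ X.oL + t + 1 := by omega
    simp only [ap_cons, ap_nil, Gate.apply, mask, Pi.add_apply, Pi.sub_apply, e1, e2,
      flipBit_flipBit, n1, n2, ne_eq, not_false_eq_true, true_and]
    by_cases h1 : bitAt b (X.oL + t) = true <;> by_cases h2 : bitAt b X.oMJ = true <;>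
      simp [h1, h2]
  have hl : On X.PJ (inv U) := X.on_meaJ.inv
  have c1 : ∀ χ : Bits X.W → ℂ, ap (inv U) (mask (fun b => bitAt b (X.oL + t) = true) χ) =
      mask (fun b => bitAt b (X.oL + t) = true) (ap (inv U) χ) :=
    ap_mask hl (agree_bit (hP _ (Or.inl rfl)))
  have c2 : ∀ χ : Bits X.W → ℂ, ap (inv U) (mask (fun b => ¬ bitAt b (X.oL + t) = true) χ) =
      mask (fun b => ¬ bitAt b (X.oL + t) = true) (ap (inv U) χ) :=
    ap_mask hl fun b b' h => by rw [h _ (hP _ (Or.inl rfl))]; exact id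
  have c3 : ∀ χ : Bits X.W → ℂ, ap (inv U) (fun b => χ (flipBit b (X.oL + t + 1))) =
      fun b => ap (inv U) χ (flipBit b (X.oL + t + 1)) :=
    ap_comp hl (agree_flip (hP _ (Or.inr rfl))) agree_flip_flip
  rw [upd, ap_append, ap_append, mid, ap_add, c1, c2, ap_add, c3, ap_sub, ap_inv_ap]
  rfl

/-- The conditional reflection. -/
theorem ap_refl (t : ℕ) (ht : t < X.T) (ψ : Bits X.W → ℂ)
    (hψ : mask (fun b => ∀ a, X.oC ≤ a → bitAt b a = false) ψ = ψ) :
    ap (X.refl t) ψ = ψ - (2 : ℂ) • mask (fun b => bitAt b (X.oL + t + 1) = true ∧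
      ∀ a < X.len, bitAt b (X.oJ + a) = false) (X.AI ψ) := by
  have hs := X.spec
  have hP : ∀ a, (X.oL ≤ a ∨ (X.oJ ≤ a ∧ a < X.oAI)) → a < X.W → ¬ X.PI a := by
    intro a ha; unfold PI; omega
  set U := X.meaC X.oI X.oMI with hU
  set χ := ap U ψ with hχ
  have hsup : mask (fun b => ∀ a, X.oC ≤ a → bitAt b a = false) χ = χ := by
    refine (Loc.ap X.on_meaI).support (fun b b' h hb a ha => ?_) hψ
    rcases lt_or_ge a X.W with h' | h'
    · rw [← h a (hP a (by omega) h'), hb a ha]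
    · exact bitAt_of_le h'
  rw [refl, ap_append, ap_append, ap_phase (isPerm_conj _ _ _ _ _)]
  have e : (fun b => (if bitAt (fwd (conj (X.oL + t + 1) X.oMI X.oJ X.oC X.len) b)
      (X.oC + X.len) = true then -1 else 1) * χ b) = χ - (2 : ℂ) •
      mask (fun b => bitAt b (X.oL + t + 1) = true ∧ ∀ a < X.len, bitAt b (X.oJ + a) = false)
        (mask (fun b => bitAt b X.oMI = true) χ) := by
    funext b
    by_cases hb : ∀ a, X.oC ≤ a → bitAt b a = false
    · have := bitAt_fwd_conj (c := X.oL + t + 1) (d := X.oMI) (j := X.oJ) (q := X.oC) (N := X.len)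
        (by omega) (by omega) (by omega) (by omega : X.oC + X.len < X.W) b hb (X.oC + X.len)
      rw [if_pos (by omega), show X.oC + X.len - X.oC = X.len by omega] at this
      simp only [this, decide_eq_true_eq, mask, Pi.sub_apply, Pi.smul_apply, smul_eq_mul]
      by_cases h1 : bitAt b (X.oL + t + 1) = true
      · by_cases h2 : bitAt b X.oMI = true
        · by_cases h3 : ∀ a < X.len, bitAt b (X.oJ + a) = false
          · rw [if_pos ⟨h1, h2, h3⟩, if_pos ⟨h1, h3⟩, if_pos h2]; ring
          · rw [if_neg fun h => h3 h.2.2, if_neg fun h => h3 h.2]; ring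
        · rw [if_neg fun h => h2 h.2.1, if_neg h2, ite_self]; ring
      · rw [if_neg fun h => h1 h.1, if_neg fun h => h1 h.1]; ring
    · have h0 : χ b = 0 := eq_zero_of_mask_eq_self hsup b hb
      simp [mask, h0]
  rw [e, ap_sub, ap_smul, hχ, ap_inv_ap, ap_mask X.on_meaI.inv]
  · rfl
  · rintro b b' h ⟨h1, h2⟩
    refine ⟨?_, fun a ha => ?_⟩
    · rw [← h _ (hP _ (by omega) (by omega)), h1]
    · rw [← h _ (hP _ (by omega) (by omega)), h2 a ha]

end Ext

end ExtSim

/-! ### The rounds of the extractor -/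

namespace ExtSim

section Res

variable {w n : ℕ}

/-- The vector of the first `n` wires when the other wires are as in `c`. -/
noncomputable def res (n : ℕ) (c : Bits w) (χ : Bits w → ℂ) : Bits n → ℂ := fib n (shift 0 n w) c χ

theorem agree_shift {b c : Bits w} :
    Agree (fun a => ¬ Ran n (shift 0 n w) a) b c ↔ Agree (fun a => n ≤ a) b c := by
  simp only [Agree, ran_shift]
  exact ⟨fun h a ha => h a (by omega), fun h a ha => h a (by omega)⟩

theorem put_slice (hn : n ≤ w) {b c : Bits w} (h : Agree (fun a => n ≤ a) b c) :
    put (shift 0 n w) c (slice b 0 n) = b := by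
  rw [← pull_shift (by omega : 0 + n ≤ w)]
  exact put_pull_of_agree (shift_emb (by omega)) (agree_shift.2 h)

theorem agree_put_shift (c : Bits w) (s : Bits n) :
    Agree (fun a => n ≤ a) (put (shift 0 n w) c s) c := agree_shift.1 (agree_put c s)

theorem slice_put (hn : n ≤ w) (c : Bits w) (s : Bits n) :
    slice (put (shift 0 n w) c s) 0 n = s := by
  rw [← pull_shift (by omega : 0 + n ≤ w), pull_put (shift_emb (by omega))]

theorem res_emb (hn : n ≤ w) (c : Bits w) (φ : Bits n → ℂ) : res n c (emb c φ) = φ := by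
  funext s
  rw [res, fib, emb, if_pos (agree_put_shift c s), slice_put hn]

theorem ip_emb_res (hn : n ≤ w) (c : Bits w) (φ : Bits n → ℂ) (χ : Bits w → ℂ) :
    ip (emb c φ) χ = ip φ (res n c χ) := by
  classical
  have h0 : 0 + n ≤ w := by omega
  rw [ip_def, ip_def, ← sum_agree (shift_emb h0) c]
  refine Finset.sum_congr rfl fun b _ => ?_
  by_cases h : Agree (fun a => n ≤ a) b c
  · rw [if_pos (agree_shift.2 h), emb, if_pos h, res, fib, pull_shift h0, put_slice hn h]
  · rw [if_neg fun h' => h (agree_shift.1 h'), emb, if_neg h, star_zero, zero_mul]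

/-- A projection that singles out one configuration of the wires from `n` on. -/
theorem mask_eq_emb_res (hn : n ≤ w) {c : Bits w} {χ : Bits w → ℂ} {p : Bits w → Prop}
    (h1 : ∀ b, Agree (fun a => n ≤ a) b c → p b)
    (h2 : ∀ b, p b → ¬ Agree (fun a => n ≤ a) b c → χ b = 0) : mask p χ = emb c (res n c χ) := by
  funext b
  by_cases h : Agree (fun a => n ≤ a) b c
  · rw [mask, if_pos (h1 b h), emb, if_pos h, res, fib, put_slice hn h]
  · rw [emb, if_neg h, mask]
    split_ifs with hp
    · exact h2 b hp h
    · rfl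

theorem res_add (c : Bits w) (φ χ : Bits w → ℂ) : res n c (φ + χ) = res n c φ + res n c χ := rfl

theorem res_sub (c : Bits w) (φ χ : Bits w → ℂ) : res n c (φ - χ) = res n c φ - res n c χ := rfl

theorem res_smul (c : Bits w) (a : ℂ) (χ : Bits w → ℂ) : res n c (a • χ) = a • res n c χ := rfl

end Res

namespace Ext

variable (X : Ext)

theorem n_le : X.n ≤ X.W := by have := X.spec; omega

/-- The state in which `j` has been sampled and the other wires are as in `c`. -/
noncomputable def iota (c : Bits X.W) (φ : Bits X.n → ℂ) : Bits X.W → ℂ :=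
  ap (X.smpC X.oJ) (emb c φ)

theorem iota_add (c : Bits X.W) (φ φ' : Bits X.n → ℂ) :
    X.iota c (φ + φ') = X.iota c φ + X.iota c φ' := by simp only [iota, emb_add, ap_add]

theorem iota_sub (c : Bits X.W) (φ φ' : Bits X.n → ℂ) :
    X.iota c (φ - φ') = X.iota c φ - X.iota c φ' := by simp only [iota, emb_sub, ap_sub]

theorem iota_smul (c : Bits X.W) (a : ℂ) (φ : Bits X.n → ℂ) :
    X.iota c (a • φ) = a • X.iota c φ := by simp only [iota, emb_smul, ap_smul]

theorem nsq_iota (c : Bits X.W) (φ : Bits X.n → ℂ) : nsq (X.iota c φ) = nsq φ := by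
  rw [iota, nsq_ap, nsq_emb X.n_le]

/-- The average over the sampler of the measurements, as an operator on the quantum register. -/
noncomputable def avg (c : Bits X.W) (φ : Bits X.n → ℂ) : Bits X.n → ℂ :=
  res X.n c (ap (inv (X.smpC X.oJ)) (X.A (X.iota c φ)))

theorem ip_avg (c : Bits X.W) (φ φ' : Bits X.n → ℂ) :
    ip φ (X.avg c φ') = ip (X.iota c φ) (X.A (X.iota c φ')) := by
  rw [avg, ← ip_emb_res X.n_le, ← ip_ap]
  rfl

/-- The registers for `j` are zero. -/
def Clear (c : Bits X.W) : Prop := ∀ a, X.oJ ≤ a → a < X.oAI → bitAt c a = false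

theorem loc_avg : Loc X.PJ fun χ => ap (inv (X.smpC X.oJ)) (X.A (ap (X.smpC X.oJ) χ)) :=
  (Loc.ap X.on_smpJ.inv).trans (X.loc_A.trans (Loc.ap X.on_smpJ))

/-- The average does not depend on the wires that it does not concern. -/
theorem avg_eq {c c' : Bits X.W} (hc : X.Clear c) (hc' : X.Clear c') : X.avg c = X.avg c' := by
  classical
  funext φ
  have hs := X.spec
  let f : Bits X.W → Bits X.W := fun b j =>
    if X.PJ j then b j else xor (b j) (xor (c j) (c' j))
  have hf : ∀ b a, bitAt (f b) a =
      if X.PJ a then bitAt b a else xor (bitAt b a) (xor (bitAt c a) (bitAt c' a)) := by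
    intro b a
    rcases lt_or_ge a X.W with h | h
    · simp [bitAt, h, f]
    · simp [bitAt_of_le h]
  have hf1 : ∀ b, Agree X.PJ (f b) b := fun b a ha => by rw [hf, if_pos ha]
  have hf2 : ∀ b b', Agree (fun a => ¬ X.PJ a) b b' → Agree (fun a => ¬ X.PJ a) (f b) (f b') :=
    fun b b' h a ha => by rw [hf, hf, if_neg ha, if_neg ha, h a ha]
  have hz : ∀ a, X.n ≤ a → X.PJ a → bitAt c a = bitAt c' a := by
    intro a ha hP
    rcases hP with h | h | h
    · rw [bitAt_of_le h, bitAt_of_le h]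
    · omega
    · rw [hc a h.1 h.2, hc' a h.1 h.2]
  have hfc : ∀ b, Agree (fun a => X.n ≤ a) (f b) c ↔ Agree (fun a => X.n ≤ a) b c' := by
    intro b
    refine forall_congr' fun a => forall_congr' fun ha => ?_
    rw [hf]
    split_ifs with hP
    · rw [hz a ha hP]
    · rcases bitAt b a <;> rcases bitAt c a <;> rcases bitAt c' a <;> simp
  have hemb : emb c' φ = fun b => emb c φ (f b) :=
    (emb_comp hfc (fun b _ => slice_congr fun a ha => by
      rw [hf, if_pos (show X.PJ (0 + a) from Or.inr (Or.inl (by omega)))]) φ).symm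
  have hput : ∀ s : Bits X.n, f (put (shift 0 X.n X.W) c' s) = put (shift 0 X.n X.W) c s := by
    intro s
    have hρ : Emb X.n X.W (shift 0 X.n X.W) := shift_emb (by have := X.n_le; omega)
    refine bits_ext fun a => ?_
    rw [hf]
    by_cases hr : Ran X.n (shift 0 X.n X.W) a
    · have := ran_shift.1 hr
      obtain ⟨a, h, rfl⟩ := hr
      rw [if_pos (show X.PJ (shift 0 X.n X.W a) from Or.inr (Or.inl (by omega))), bitAt_put_self
        hρ, bitAt_put_self hρ]
    · have hna : X.n ≤ a := by rw [ran_shift] at hr; omega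
      rw [bitAt_put_of_not hr, bitAt_put_of_not hr]
      split_ifs with hP
      · exact (hz a hna hP).symm
      · rcases bitAt c a <;> rcases bitAt c' a <;> rfl
  funext s
  have := congrFun (X.loc_avg.comp_comm f hf1 hf2 (emb c φ)) (put (shift 0 X.n X.W) c' s)
  rw [← hemb] at this
  simp only [hput] at this
  exact this.symm

/-- The configuration `c` with the flags of the rounds up to `t` set. -/
def lev (c : Bits X.W) (t : ℕ) : Bits X.W :=
  fun j => if X.oL ≤ (j : ℕ) ∧ (j : ℕ) ≤ X.oL + t then true else c j

theorem bitAt_lev (c : Bits X.W) (t a : ℕ) (ha : a < X.W) :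
    bitAt (X.lev c t) a = if X.oL ≤ a ∧ a ≤ X.oL + t then true else bitAt c a := by
  simp [bitAt, ha, lev]

variable {X}

/-- The configurations in which the rounds start. -/
structure Ready (c : Bits X.W) : Prop where
  clear : ∀ a, X.oMI ≤ a → a < X.oAI → bitAt c a = false
  flags : ∀ a, X.oL ≤ a → bitAt c a = false

theorem Ready.clear_lev {c : Bits X.W} (h : Ready c) (t : ℕ) : X.Clear (X.lev c t) := by
  intro a h1 h2
  have hs := X.spec
  rw [bitAt_lev _ _ _ _ (by omega), if_neg (by omega)]
  exact h.clear a (by omega) h2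

variable (X) in
/-- The condition under which the rounds reflect. -/
def Refl (t : ℕ) (b : Bits X.W) : Prop :=
  bitAt b (X.oL + t + 1) = true ∧ ∀ a < X.len, bitAt b (X.oJ + a) = false

/-- On the configurations with clear ancillas, the circuit for `i` projects with `P i`. -/
theorem AI_emb {C : Finset (Bits X.k)} {P : Bits X.k → Matrix (Bits X.n) (Bits X.n) ℂ}
    (hP : ∀ i ∈ C, IsStarProjection (P i)) (hM : X.Measures C P) {i : Bits X.k} (hi : i ∈ C)
    {c : Bits X.W} (hc : slice c X.oI X.k = i)
    (hz : ∀ a, X.oMI ≤ a → a < X.oJ → bitAt c a = false) (φ : Bits X.n → ℂ) :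
    X.AI (emb c φ) = emb c (P i *ᵥ φ) := by
  have hs := X.spec
  have h := conjMask_relo_emb (q := X.k + X.n + 1 + X.meas.anc) (l := 1 + X.meas.anc) (w := X.W)
    (oX := X.oI) (oY := X.oMI) (by omega) (by omega) (by omega) (by omega) (by omega) (by omega)
    hc (fun a h1 h2 => hz a h1 (by omega)) X.meas.gates (X.k + X.n) φ _ (conjMask_meas hP hM hi φ)
  rwa [show relo X.k X.n (X.k + X.n + 1 + X.meas.anc) X.oI 0 X.oMI X.W (X.k + X.n) = X.oMI by
    rw [relo, if_neg (by omega), if_neg (by omega), if_pos (by omega)]; omega] at h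

/-- On the configurations with clear ancillas, the circuit for `j` projects with `P j`. -/
theorem A_emb {C : Finset (Bits X.k)} {P : Bits X.k → Matrix (Bits X.n) (Bits X.n) ℂ}
    (hP : ∀ i ∈ C, IsStarProjection (P i)) (hM : X.Measures C P) {j : Bits X.k} (hj : j ∈ C)
    {c : Bits X.W} (hc : slice c X.oJ X.k = j)
    (hz : ∀ a, X.oMJ ≤ a → a < X.oAI → bitAt c a = false) (φ : Bits X.n → ℂ) :
    X.A (emb c φ) = emb c (P j *ᵥ φ) := by
  have hs := X.spec
  have h := conjMask_relo_emb (q := X.k + X.n + 1 + X.meas.anc) (l := 1 + X.meas.anc) (w := X.W)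
    (oX := X.oJ) (oY := X.oMJ) (by omega) (by omega) (by omega) (by omega) (by omega) (by omega)
    hc (fun a h1 h2 => hz a h1 (by omega)) X.meas.gates (X.k + X.n) φ _ (conjMask_meas hP hM hj φ)
  rwa [show relo X.k X.n (X.k + X.n + 1 + X.meas.anc) X.oJ 0 X.oMJ X.W (X.k + X.n) = X.oMJ by
    rw [relo, if_neg (by omega), if_neg (by omega), if_pos (by omega)]; omega] at h

/-- The operators for `j` do not change the other wires. -/
theorem support_PJ {F : (Bits X.W → ℂ) → Bits X.W → ℂ} (hF : Loc X.PJ F) (c : Bits X.W)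
    (φ : Bits X.n → ℂ) : mask (fun b => Agree (fun a => ¬ X.PJ a) b c) (F (emb c φ)) =
      F (emb c φ) := by
  refine hF.support (fun b b' h h' => h.symm.trans h') ?_
  refine mask_emb_pos (fun b hb a ha => hb a ?_) φ
  by_contra hlt
  exact ha (Or.inr (Or.inl (by omega)))

theorem support_rest (c : Bits X.W) (φ : Bits X.n → ℂ) :
    mask (fun b => Agree (fun a => ¬ X.PJ a) b c) (X.iota c φ - X.A (X.iota c φ)) =
      X.iota c φ - X.A (X.iota c φ) := by
  have h1 : mask (fun b => Agree (fun a => ¬ X.PJ a) b c) (X.A (X.iota c φ)) = X.A (X.iota c φ) :=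
    support_PJ (X.loc_A.trans (Loc.ap X.on_smpJ)) c φ
  have h2 : mask (fun b => Agree (fun a => ¬ X.PJ a) b c) (X.iota c φ) = X.iota c φ :=
    support_PJ (Loc.ap X.on_smpJ) c φ
  rw [mask_sub, h1, h2]

theorem sup_bit {χ : Bits X.W → ℂ} {c : Bits X.W}
    (h : mask (fun b => Agree (fun a => ¬ X.PJ a) b c) χ = χ) {p : Bits X.W → Prop}
    (hp : ∀ b, Agree (fun a => ¬ X.PJ a) b c → p b) : mask p χ = χ :=
  mask_eq_self fun b hb => eq_zero_of_mask_eq_self h b fun h' => hb (hp b h')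

theorem sup_bit_not {χ : Bits X.W → ℂ} {c : Bits X.W}
    (h : mask (fun b => Agree (fun a => ¬ X.PJ a) b c) χ = χ) {p : Bits X.W → Prop}
    (hp : ∀ b, Agree (fun a => ¬ X.PJ a) b c → ¬ p b) : mask p χ = 0 :=
  mask_eq_zero fun b hb => eq_zero_of_mask_eq_self h b fun h' => hp b h' hb

theorem not_PJ {a : ℕ} (h : X.oL ≤ a) (h' : a < X.W) : ¬ X.PJ a := by
  have hs := X.spec
  unfold PJ; omega

/-- What has been found stays untouched in later rounds. -/
theorem round_found {c : Bits X.W} (hc : Ready c) {τ t : ℕ} (hτ : τ ≤ t) (ht : t < X.T)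
    (φ : Bits X.n → ℂ) :
    ap (X.round t) (X.A (X.iota (X.lev c τ) φ)) = X.A (X.iota (X.lev c τ) φ) := by
  have hs := X.spec
  -- the flag `t + 1` is not set, so the round does nothing but sample and undo it
  set ψ := X.A (X.iota (X.lev c τ) φ) with hψ
  have hA : X.A ψ = ψ := conjMask_idem _ _ _
  have hsup : mask (fun b => Agree (fun a => ¬ X.PJ a) b (X.lev c τ)) ψ = ψ :=
    support_PJ (X.loc_A.trans (Loc.ap X.on_smpJ)) _ φ
  have hupd : ap (X.upd t) ψ = ψ := by
    have h0 : (fun b => (ψ - ψ) (flipBit b (X.oL + t + 1))) = 0 := by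
      funext b; simp
    rw [X.ap_upd t ht, hA, h0, add_zero, add_comm]
    exact mask_add_mask_not _ _
  set y := ap (inv (X.smpC X.oJ)) ψ with hy
  have hysup : mask (fun b => Agree (fun a => ¬ X.PJ a) b (X.lev c τ)) y = y :=
    (Loc.ap X.on_smpJ.inv).support (fun b b' h h' => h.symm.trans h') hsup
  have hbit : ∀ b, Agree (fun a => ¬ X.PJ a) b (X.lev c τ) →
      bitAt b (X.oL + t + 1) = false := fun b hb => by
    rw [hb _ (not_PJ (by omega) (by omega)), bitAt_lev _ _ _ _ (by omega), if_neg (by omega),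
      hc.flags _ (by omega)]
  have hch : ∀ b, Agree (fun a => ¬ X.PJ a) b (X.lev c τ) →
      ∀ a, X.oC ≤ a → bitAt b a = false := fun b hb a ha => by
    rcases lt_or_ge a X.W with h | h
    · rw [hb _ (not_PJ (by omega) (by omega)), bitAt_lev _ _ _ _ (by omega), if_neg (by omega),
        hc.flags _ (by omega)]
    · exact bitAt_of_le h
  have hrefl : ap (X.refl t) y = y := by
    rw [X.ap_refl t ht y (sup_bit hysup hch)]
    have h1 : mask (fun b => bitAt b (X.oL + t + 1) = false) (X.AI y) = X.AI y := by
      refine X.loc_AI.support (agree_bit ?_) (sup_bit hysup hbit)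
      unfold PI; omega
    rw [mask_eq_zero fun b hb => eq_zero_of_mask_eq_self h1 b (by simp [hb.1])]
    simp
  rw [round, ap_append, ap_append, ap_append, hupd, hrefl, hy, ap_ap_inv]

/-- What has not been found is kept, and a multiple of a sampled state in the range of `P i` is
subtracted, which is split again into what has been found and what has not. -/
theorem round_rest {C : Finset (Bits X.k)} {P : Bits X.k → Matrix (Bits X.n) (Bits X.n) ℂ}
    (hP : ∀ i ∈ C, IsStarProjection (P i)) (hM : X.Measures C P) {i : Bits X.k} (hi : i ∈ C)
    {c : Bits X.W} (hc : Ready c) (hci : slice c X.oI X.k = i) {t : ℕ} (ht : t < X.T)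
    (u : Bits X.n → ℂ) :
    ap (X.round t) (X.iota (X.lev c t) u - X.A (X.iota (X.lev c t) u)) =
      X.iota (X.lev c (t + 1)) u - X.A (X.iota (X.lev c (t + 1)) u) -
        (2 : ℂ) • X.iota (X.lev c (t + 1)) (P i *ᵥ (u - X.avg c u)) := by
  have hs := X.spec
  set ψ := X.iota (X.lev c t) u - X.A (X.iota (X.lev c t) u) with hψ
  have hA : X.A ψ = 0 := by
    have h := conjMask_idem (X.meaC X.oJ X.oMJ) (fun b => bitAt b X.oMJ = true)
      (X.iota (X.lev c t) u)
    show conjMask _ _ _ = 0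
    rw [hψ, conjMask_sub]
    exact sub_eq_zero.2 h.symm
  have hsup : mask (fun b => Agree (fun a => ¬ X.PJ a) b (X.lev c t)) ψ = ψ :=
    support_rest _ u
  -- updating the flags leads from the configuration `lev c t` to `lev c (t + 1)`
  have hflip : ∀ b, Agree (fun a => X.n ≤ a) (flipBit b (X.oL + t + 1)) (X.lev c t) ↔
      Agree (fun a => X.n ≤ a) b (X.lev c (t + 1)) := by
    intro b
    refine forall_congr' fun a => forall_congr' fun ha => ?_
    rcases lt_or_ge a X.W with h | h
    · rw [bitAt_flipBit, bitAt_lev _ _ _ _ h, bitAt_lev _ _ _ _ h]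
      by_cases h1 : a = X.oL + t + 1
      · subst h1
        rw [if_pos ⟨rfl, h⟩, if_neg (by omega), if_pos (by omega), hc.flags _ (by omega)]
        rcases bitAt b (X.oL + t + 1) <;> simp
      · rw [if_neg (fun h' => h1 h'.1)]
        by_cases h2 : X.oL ≤ a ∧ a ≤ X.oL + t
        · rw [if_pos h2, if_pos (by omega)]
        · rw [if_neg h2, if_neg (by omega)]
    · simp only [bitAt_of_le h]
  have hembf : (fun b => emb (X.lev c t) u (flipBit b (X.oL + t + 1))) = emb (X.lev c (t + 1)) u :=
    emb_comp hflip (fun b _ => slice_congr fun a ha => by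
      rw [bitAt_flipBit, if_neg (by omega)]) u
  have hnP : ¬ X.PJ (X.oL + t + 1) := not_PJ (by omega) (by omega)
  set c' := X.lev c (t + 1) with hc'
  have hiota : (fun b => X.iota (X.lev c t) u (flipBit b (X.oL + t + 1))) = X.iota c' u := by
    rw [iota, iota, ← hembf]
    exact ((Loc.ap X.on_smpJ).comp_comm _ (agree_flip hnP) agree_flip_flip _).symm
  have hAiota : (fun b => X.A (X.iota (X.lev c t) u) (flipBit b (X.oL + t + 1))) =
      X.A (X.iota c' u) := by
    rw [← hiota]
    exact (X.loc_A.comp_comm _ (agree_flip hnP) agree_flip_flip _).symm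
  have hupd : ap (X.upd t) ψ = X.iota c' u - X.A (X.iota c' u) := by
    have h1 : (fun b => (ψ - X.A ψ) (flipBit b (X.oL + t + 1))) =
        X.iota c' u - X.A (X.iota c' u) := by
      rw [hA, sub_zero, ← hAiota, ← hiota]; rfl
    have hb : ∀ b, Agree (fun a => ¬ X.PJ a) b (X.lev c t) → bitAt b (X.oL + t) = true :=
      fun b hb => by
        rw [hb _ (not_PJ (by omega) (by omega)), bitAt_lev _ _ _ _ (by omega), if_pos (by omega)]
    rw [X.ap_upd t ht, h1, hA, zero_add, sup_bit_not hsup fun b h h' => h' (hb b h), zero_add]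
    refine sup_bit (support_rest c' u) fun b h => ?_
    rw [h _ (not_PJ (by omega) (by omega)), bitAt_lev _ _ _ _ (by omega), if_pos (by omega)]
  set y := emb c' u - ap (inv (X.smpC X.oJ)) (X.A (X.iota c' u)) with hy
  have hy1 : ap (inv (X.smpC X.oJ)) (X.iota c' u - X.A (X.iota c' u)) = y := by
    rw [ap_sub, hy, iota, ap_inv_ap]
  have hysup : mask (fun b => Agree (fun a => ¬ X.PJ a) b c') y = y := by
    have h1 : mask (fun b => Agree (fun a => ¬ X.PJ a) b c')
        (ap (inv (X.smpC X.oJ)) (X.A (X.iota c' u))) = _ := support_PJ X.loc_avg _ u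
    have h2 : mask (fun b => Agree (fun a => ¬ X.PJ a) b c') (emb c' u) = _ :=
      support_PJ (F := id) ⟨fun _ _ _ => rfl, fun _ _ _ _ => rfl⟩ _ u
    rw [hy, mask_sub, h1, h2]
    rfl
  have hch : ∀ b, Agree (fun a => ¬ X.PJ a) b c' →
      ∀ a, X.oC ≤ a → bitAt b a = false := fun b hb a ha => by
    rcases lt_or_ge a X.W with h | h
    · rw [hb _ (not_PJ (by omega) (by omega)), bitAt_lev _ _ _ _ (by omega), if_neg (by omega),
        hc.flags _ (by omega)]
    · exact bitAt_of_le h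
  -- the part on which the circuit reflects is the projection to the unsampled state
  have hmask : mask (X.Refl t) y = emb c' (u - X.avg c u) := by
    rw [mask_eq_emb_res X.n_le (c := c')]
    · rw [hy, res_sub, res_emb X.n_le, X.avg_eq (c := c) (c' := c')
        (fun a h1 h2 => hc.clear a (by omega) h2) (hc.clear_lev _)]
      rfl
    · intro b hb
      refine ⟨?_, fun a ha => ?_⟩
      · rw [hb _ (by omega), bitAt_lev _ _ _ _ (by omega), if_pos (by omega)]
      · rw [hb _ (by omega), bitAt_lev _ _ _ _ (by omega), if_neg (by omega),
          hc.clear _ (by omega) (by omega)]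
    · intro b hb hn
      refine eq_zero_of_mask_eq_self hysup b fun h' => hn fun a ha => ?_
      by_cases hPJ : X.PJ a
      · rcases hPJ with h | h | h
        · rw [bitAt_of_le h, bitAt_of_le h]
        · omega
        · have := hb.2 (a - X.oJ) (by omega)
          rw [show X.oJ + (a - X.oJ) = a by omega] at this
          rw [this, bitAt_lev _ _ _ _ (by omega), if_neg (by omega), hc.clear _ (by omega) (by
            omega)]
      · exact h' a hPJ
  have hrefl : ap (X.refl t) y = y - (2 : ℂ) • emb c' (P i *ᵥ (u - X.avg c u)) := by
    rw [X.ap_refl t ht y (sup_bit hysup hch)]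
    congr 2
    have := X.loc_AI.mask_comm (X.Refl t) (fun b b' h hb => by
      refine ⟨?_, fun a ha => ?_⟩
      · rw [← h _ (by unfold PI; omega), hb.1]
      · rw [← h _ (by unfold PI; omega), hb.2 a ha]) y
    refine this.symm.trans ?_
    rw [hmask]
    refine AI_emb hP hM hi ?_ (fun a h1 h2 => ?_) _
    · rw [← hci]
      refine slice_congr fun a ha => ?_
      rw [bitAt_lev _ _ _ _ (by omega), if_neg (by omega)]
    · rw [bitAt_lev _ _ _ _ (by omega), if_neg (by omega), hc.clear _ (by omega) (by omega)]
  rw [round, ap_append, ap_append, ap_append, hupd, hy1, hrefl, ap_sub, ap_smul, hy, ap_sub,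
    ap_ap_inv]
  rfl

end Ext

end ExtSim

/-! ### What the extractor computes -/

namespace ExtSim

section Supp

variable {w : ℕ}

/-- The vector is a superposition of basis vectors that satisfy `p`. -/
def Supp (p : Bits w → Prop) (χ : Bits w → ℂ) : Prop := ∀ b, χ b ≠ 0 → p b

theorem Supp.mask_eq {p : Bits w → Prop} {χ : Bits w → ℂ} (h : Supp p χ) : mask p χ = χ :=
  mask_eq_self fun b hb => by_contra fun h0 => hb (h b h0)

theorem supp_of_mask_eq {p : Bits w → Prop} {χ : Bits w → ℂ} (h : mask p χ = χ) : Supp p χ :=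
  fun b hb => by_contra fun h' => hb (eq_zero_of_mask_eq_self h b h')

theorem Supp.and {p q : Bits w → Prop} {χ : Bits w → ℂ} (hp : Supp p χ) (hq : Supp q χ) :
    Supp (fun b => p b ∧ q b) χ := fun b hb => ⟨hp b hb, hq b hb⟩

theorem Supp.ap_isPerm {gs : List Gate} (hgs : IsPerm gs) {p q : Bits w → Prop} {χ : Bits w → ℂ}
    (h : Supp p χ) (hpq : ∀ b, p (bwd gs b) → q b) : Supp q (ap gs χ) := by
  rw [ExtSim.ap_isPerm hgs]
  exact fun b hb => hpq b (h _ hb)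

theorem supp_emb {n : ℕ} (c : Bits w) (φ : Bits n → ℂ) :
    Supp (fun b => Agree (fun a => n ≤ a) b c) (emb c φ) := fun b hb => by
  by_contra h
  exact hb (by rw [emb, if_neg h])

/-- Circuits do not change the wires that they do not use. -/
theorem Supp.ap_agree {P : ℕ → Prop} {gs : List Gate} (hgs : On P gs) {Q : ℕ → Prop}
    (hQ : ∀ a, Q a → a < w → ¬ P a) {c : Bits w} {χ : Bits w → ℂ}
    (h : Supp (fun b => Agree Q b c) χ) : Supp (fun b => Agree Q b c) (ap gs χ) :=
  supp_of_mask_eq <| (Loc.ap hgs).support (fun b b' hb hbc a ha => by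
    rcases lt_or_ge a w with hw | hw
    · rw [← hb a (hQ a ha hw), hbc a ha]
    · rw [bitAt_of_le hw, bitAt_of_le hw]) h.mask_eq

/-- Add a string to consecutive wires. -/
def xorAt (o : ℕ) {N : ℕ} (x : Bits N) (b : Bits w) : Bits w := fun j =>
  if o ≤ (j : ℕ) ∧ (j : ℕ) < o + N then xor (b j) (bitAt x (j - o)) else b j

theorem bitAt_xorAt {o N : ℕ} (hN : o + N ≤ w) (x : Bits N) (b : Bits w) (a : ℕ) :
    bitAt (xorAt o x b) a =
      if o ≤ a ∧ a < o + N then xor (bitAt b a) (bitAt x (a - o)) else bitAt b a := by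
  rcases lt_or_ge a w with h | h
  · simp [bitAt, h, xorAt]
  · rw [bitAt_of_le h, bitAt_of_le h, if_neg (by omega)]

theorem xorAt_xorAt {o N : ℕ} (hN : o + N ≤ w) (x : Bits N) (b : Bits w) :
    xorAt o x (xorAt o x b) = b := by
  refine bits_ext fun a => ?_
  rw [bitAt_xorAt hN, bitAt_xorAt hN]
  split_ifs
  · rcases bitAt b a <;> rcases bitAt x (a - o) <;> rfl
  · rfl

theorem agree_xorAt {o N : ℕ} (hN : o + N ≤ w) (x : Bits N) {P : ℕ → Prop}
    (hP : ∀ a, P a → a < o ∨ o + N ≤ a) (b : Bits w) : Agree P (xorAt o x b) b := fun a ha => by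
  have := hP a ha
  rw [bitAt_xorAt hN, if_neg (by omega)]

theorem xorAt_congr {o N : ℕ} (hN : o + N ≤ w) (x : Bits N) {P : ℕ → Prop} (b b' : Bits w)
    (h : Agree P b b') : Agree P (xorAt o x b) (xorAt o x b') := fun a ha => by
  rw [bitAt_xorAt hN, bitAt_xorAt hN, h a ha]

theorem emb_xorAt {n o N : ℕ} (hn : n ≤ o) (hN : o + N ≤ w) (x : Bits N) (c : Bits w)
    (φ : Bits n → ℂ) : (fun b => emb c φ (xorAt o x b)) = emb (xorAt o x c) φ := by
  refine emb_comp (fun b => ⟨fun h => ?_, fun h => ?_⟩) (fun b _ => slice_congr fun a ha => ?_) φ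
  · rw [← xorAt_xorAt hN x b]
    exact xorAt_congr hN x _ _ h
  · have := xorAt_congr hN x _ _ h
    rwa [xorAt_xorAt hN] at this
  · rw [bitAt_xorAt hN, if_neg (by omega)]

theorem emb_cxs {n o o' N : ℕ} (hn : n ≤ o) (hn' : n ≤ o') (h : o + N ≤ o' ∨ o' + N ≤ o)
    (hw : o' + N ≤ w) (c : Bits w) (φ : Bits n → ℂ) :
    ap (cxs o o' N) (emb c φ) = emb (bwd (cxs o o' N) c) φ := by
  rw [ap_isPerm (isPerm_cxs o o' N)]
  refine emb_comp (fun b => ⟨fun hb a ha => ?_, fun hb a ha => ?_⟩)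
    (fun b _ => slice_congr fun a ha => ?_) φ
  · rw [bitAt_bwd_cxs h hw, ← hb a ha]
    have e := hb (o + (a - o'))
    rw [bitAt_bwd_cxs h hw]
    split_ifs with h1
    · rw [← e (by omega), bitAt_bwd_cxs h hw, if_neg (by omega)]
      rcases bitAt b a <;> rcases bitAt b (o + (a - o')) <;> rfl
    · rfl
  · have e := hb (o + (a - o'))
    have e' := hb a ha
    rw [bitAt_bwd_cxs h hw] at e' ⊢
    split_ifs at e' ⊢ with h1
    · rw [e', e (by omega), bitAt_bwd_cxs h hw, if_neg (by omega)]
      rcases bitAt c a <;> rcases bitAt c (o + (a - o')) <;> rfl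
    · exact e'
  · rw [bitAt_bwd_cxs h hw, if_neg (by omega)]

/-- Running an embedded circuit on a superposition of basis vectors that all have the same
contents `x` of its wires. -/
theorem ap_reloc_supp {q c₀ : ℕ} {ρ : ℕ → ℕ} (hρ : Emb q w ρ) (x : Bits c₀) (hc : c₀ ≤ q)
    {χ : Bits w → ℂ} (h : Supp (fun b => ∀ a, bitAt b (ρ a) = bitAt x a) χ) (gs : List Gate)
    (b : Bits w) : ∃ a : ℂ, ap (reloc ρ gs) χ b =
      a * ap gs (inputState q x fun _ : Bits 0 => 1) (pull q ρ b) := by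
  let y₀ : Bits q := fun j => bitAt x j
  have hy₀ : ∀ a, bitAt y₀ a = bitAt x a := fun a => by
    rcases lt_or_ge a q with ha | ha
    · simp [bitAt, ha, y₀]
    · rw [bitAt_of_le ha, bitAt_of_le (by omega)]
  refine ⟨χ (put ρ b y₀), ?_⟩
  have : fib q ρ b χ = χ (put ρ b y₀) • inputState q x fun _ : Bits 0 => 1 := by
    funext y
    rw [Pi.smul_apply, inputState_apply, fib]
    by_cases hy : y = y₀
    · subst hy
      rw [if_pos ⟨fun a _ => hy₀ a, fun a ha => by rw [hy₀, bitAt_of_le (by omega)]⟩]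
      simp
    · rw [if_neg]
      · rw [smul_zero]
        by_contra h0
        refine hy (bits_ext fun a => ?_)
        rw [hy₀, ← h _ h0 a, bitAt_put_self hρ]
      · rintro ⟨h1, h2⟩
        refine hy (bits_ext fun a => ?_)
        rw [hy₀]
        rcases lt_or_ge a c₀ with ha | ha
        · exact h1 a ha
        · rw [h2 a (by omega), bitAt_of_le ha]
  rw [ap_reloc hρ, this, ap_smul]
  rfl

end Supp

theorem bitAt_append {m n : ℕ} (x : Bits m) (y : Bits n) (a : ℕ) :
    bitAt (Fin.append x y : Bits (m + n)) a = if a < m then bitAt x a else bitAt y (a - m) := by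
  rcases lt_or_ge a m with h | h
  · rw [if_pos h, bitAt, bitAt, dif_pos h, dif_pos (by omega)]
    exact Fin.append_left x y ⟨a, h⟩
  · rw [if_neg (by omega)]
    rcases lt_or_ge a (m + n) with h' | h'
    · rw [bitAt, bitAt, dif_pos h', dif_pos (by omega)]
      have := Fin.append_right x y ⟨a - m, by omega⟩
      rw [← this]
      congr 1
      exact Fin.ext (by simp; omega)
    · rw [bitAt_of_le h', bitAt_of_le (by omega)]

namespace Ext

variable {X : Ext}

variable (X) in
/-- The position of the output string in the register of the second algorithm. -/
def oR : ℕ := X.oZ + (X.k + X.k + (X.m + X.m))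

/-- The data of the extraction setting for one value of the security parameter. -/
structure Setting (X : Ext) (C : Finset (Bits X.k)) (P : Bits X.k → Matrix (Bits X.n) (Bits X.n) ℂ)
    (S : Finset (Bits X.k × Bits X.k)) (s : Bits X.k → Bits X.m) (t : Bits X.r) : Prop where
  proj : ∀ i ∈ C, IsStarProjection (P i)
  meas : X.Measures C P
  sub : S ⊆ C ×ˢ C
  alg0 : ∀ i ∈ C, ∀ φ : Bits X.n → ℂ, star φ ⬝ᵥ φ = 1 → P i *ᵥ φ = φ → X.prob0 i φ (s i) = 1
  alg1 : ∀ i j, (i, j) ∈ S → X.prob1 i j (s i) (s j) t = 1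

variable {C : Finset (Bits X.k)} {P : Bits X.k → Matrix (Bits X.n) (Bits X.n) ℂ}
  {S : Finset (Bits X.k × Bits X.k)} {s : Bits X.k → Bits X.m} {t : Bits X.r}

theorem supp_algC (hX : Setting X C P S s t) {i : Bits X.k} (hi : i ∈ C) {φ : Bits X.n → ℂ}
    (hφ : P i *ᵥ φ = φ) {c : Bits X.W} {o o' : ℕ} (ho : X.n ≤ o) (ho' : X.n ≤ o')
    (hoo : o + X.k ≤ o' ∨ o' + (X.m + X.alg0.anc) ≤ o) (hw : o + X.k ≤ X.W)
    (hw' : o' + (X.m + X.alg0.anc) ≤ X.W) (hc : slice c o X.k = i)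
    (hz : ∀ a, o' ≤ a → a < o' + (X.m + X.alg0.anc) → bitAt c a = false) :
    Supp (fun b => slice b o' X.m = s i) (ap (X.algC o o') (emb c φ)) := by
  have hq : X.k + X.n + X.m + X.alg0.anc = X.k + X.n + (X.m + X.alg0.anc) := by omega
  intro b hb
  rw [algC, ap_relo_emb hq ho ho' hoo hw hw' hc hz] at hb
  by_contra hne
  refine hb ?_
  split_ifs
  · refine alg0_zero hX.alg0 hi hφ _ ?_
    rw [show slice (pull _ _ b) (X.k + X.n) X.m = slice b o' X.m from slice_congr fun a ha => by
      rw [bitAt_pull (relo_emb hq hw (by omega) hw' (by omega) hoo (by omega)), relo,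
        if_neg (by omega), if_neg (by omega), if_pos (by omega)]
      congr 1; omega]
    exact hne
  · rfl

/-- Running the first algorithm, keeping its output, and undoing the computation. -/
theorem ap_first (hX : Setting X C P S s t) {i : Bits X.k} (hi : i ∈ C) {φ : Bits X.n → ℂ}
    (hφ : P i *ᵥ φ = φ) {c : Bits X.W} (hc : slice c X.oI X.k = i)
    (hz : ∀ a, X.oAI ≤ a → a < X.oAJ → bitAt c a = false) :
    ap X.first (emb c φ) = emb (xorAt (X.oZ + (X.k + X.k)) (s i) c) φ := by
  have hs := X.spec
  have hsupp := supp_algC hX hi hφ (o := X.oI) (o' := X.oAI) (by omega) (by omega) (by omega)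
    (by omega) (by omega) hc fun a h1 h2 => hz a h1 (by omega)
  have hN : X.oZ + (X.k + X.k) + X.m ≤ X.W := by omega
  set U := X.algC X.oI X.oAI
  set χ := ap U (emb c φ) with hχ
  have hcx : ap (cxs X.oAI (X.oZ + (X.k + X.k)) X.m) χ =
      fun b => χ (xorAt (X.oZ + (X.k + X.k)) (s i) b) := by
    rw [ap_isPerm (isPerm_cxs _ _ _)]
    funext b
    have hd : X.oAI + X.m ≤ X.oZ + (X.k + X.k) ∨ X.oZ + (X.k + X.k) + X.m ≤ X.oAI := by omega
    -- on the support, the output of the algorithm is `s i`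
    have key : slice b X.oAI X.m = s i → bwd (cxs X.oAI (X.oZ + (X.k + X.k)) X.m) b =
        xorAt (X.oZ + (X.k + X.k)) (s i) b := fun h => bits_ext fun a => by
      rw [bitAt_bwd_cxs hd hN, bitAt_xorAt hN, ← h]
      split_ifs with h1
      · rw [bitAt_slice, if_pos (by omega)]
      · rfl
    by_cases hb : slice b X.oAI X.m = s i
    · rw [key hb]
    · have z : ∀ b', slice b' X.oAI X.m = slice b X.oAI X.m → χ b' = 0 := fun b' h => by
        by_contra h0
        exact hb (h ▸ hsupp b' h0)
      rw [z _ (slice_congr fun a ha => ?_), z _ (slice_congr fun a ha => ?_)]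
      · rw [bitAt_xorAt hN, if_neg (by omega)]
      · rw [bitAt_bwd_cxs hd hN, if_neg (by omega)]
  have hon : On (fun a => X.W ≤ a ∨ a < X.n ∨ (X.oI ≤ a ∧ a < X.oI + X.k) ∨
      (X.oAI ≤ a ∧ a < X.oAJ)) (inv U) := (X.on_algC _ _ _ fun a h => by omega).inv
  rw [first, ap_append, ap_append, hcx, ap_comp hon
    (agree_xorAt hN (s i) fun a h => by omega) (xorAt_congr hN (s i)), hχ, ap_inv_ap]
  exact emb_xorAt (by omega) hN (s i) c φ

/-- The second algorithm finds the string `t` for pairs in `S`. -/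
theorem supp_last (hX : Setting X C P S s t) {i j : Bits X.k} (hij : (i, j) ∈ S)
    {φ : Bits X.n → ℂ} (hφ : P j *ᵥ φ = φ) {c : Bits X.W} (hc : slice c X.oI X.k = i)
    (hcj : slice c X.oJ X.k = j) (hz : ∀ a, X.oAJ ≤ a → a < X.oZ → bitAt c a = false)
    (hZ : ∀ a, X.oZ ≤ a → a < X.oL → bitAt c a =
      if X.oZ + (X.k + X.k) ≤ a ∧ a < X.oZ + (X.k + X.k) + X.m
      then bitAt (s i) (a - (X.oZ + (X.k + X.k))) else false) :
    Supp (fun b => slice b X.oR X.r = t) (ap X.last (emb c φ)) := by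
  have hs := X.spec
  have hj : j ∈ C := (Finset.mem_product.1 (hX.sub hij)).2
  have hw1 : X.oZ + X.k ≤ X.W := by omega
  have hw2 : X.oZ + X.k + X.k ≤ X.W := by omega
  have hw3 : X.oZ + (X.k + X.k) + X.m + X.m ≤ X.W := by omega
  have hd1 : X.oI + X.k ≤ X.oZ ∨ X.oZ + X.k ≤ X.oI := by omega
  have hd2 : X.oJ + X.k ≤ X.oZ + X.k ∨ X.oZ + X.k + X.k ≤ X.oJ := by omega
  have hd3 : X.oAJ + X.m ≤ X.oZ + (X.k + X.k) + X.m ∨ X.oZ + (X.k + X.k) + X.m + X.m ≤ X.oAJ := by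
    omega
  rw [last, ap_append, ap_append, ap_append, ap_append, emb_cxs (by omega) (by omega) hd1 hw1,
    emb_cxs (by omega) (by omega) hd2 hw2]
  set c₂ := bwd (cxs X.oJ (X.oZ + X.k) X.k) (bwd (cxs X.oI X.oZ X.k) c) with hc₂
  have b2 : ∀ a, bitAt c₂ a = if X.oZ + X.k ≤ a ∧ a < X.oZ + X.k + X.k
      then xor (bitAt c a) (bitAt c (X.oJ + (a - (X.oZ + X.k))))
      else if X.oZ ≤ a ∧ a < X.oZ + X.k then xor (bitAt c a) (bitAt c (X.oI + (a - X.oZ)))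
      else bitAt c a := by
    intro a
    rw [hc₂, bitAt_bwd_cxs hd2 hw2, bitAt_bwd_cxs hd1 hw1, bitAt_bwd_cxs hd1 hw1]
    by_cases h1 : X.oZ + X.k ≤ a ∧ a < X.oZ + X.k + X.k
    · rw [if_pos h1, if_pos h1, if_neg (by omega), if_neg (by omega)]
    · rw [if_neg h1, if_neg h1]
  have hcj' : slice c₂ X.oJ X.k = j := by
    rw [← hcj]
    refine slice_congr fun a ha => ?_
    rw [b2, if_neg (by omega), if_neg (by omega)]
  have hz' : ∀ a, X.oAJ ≤ a → a < X.oAJ + (X.m + X.alg0.anc) → bitAt c₂ a = false := by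
    intro a h1 h2
    rw [b2, if_neg (by omega), if_neg (by omega), hz a h1 (by omega)]
  have hsupp := (supp_algC hX hj hφ (o := X.oJ) (o' := X.oAJ) (by omega) (by omega) (by omega)
    (by omega) (by omega) hcj' hz').and
    (Supp.ap_agree (Q := fun a => X.oZ ≤ a ∧ a < X.oL) (X.on_algC X.oJ X.oAJ
      (fun a => X.W ≤ a ∨ a < X.n ∨ (X.oJ ≤ a ∧ a < X.oZ)) fun a h => by omega)
      (fun a h h' => by omega) (c := c₂)
      fun b hb a ha => supp_emb c₂ φ b hb a (by omega))
  have hZi := slice_eq_iff.1 hc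
  have hZj := slice_eq_iff.1 hcj
  set x : Bits ((X.k + X.k) + (X.m + X.m)) := Fin.append (Fin.append i j) (Fin.append (s i) (s j))
    with hx
  have hρ : Emb (X.k + X.k + (X.m + X.m) + X.r + X.alg1.anc) X.W
      (relo (X.k + X.k + (X.m + X.m) + X.r + X.alg1.anc) 0
        (X.k + X.k + (X.m + X.m) + X.r + X.alg1.anc) X.oZ 0 0 X.W) :=
    relo_emb (n3 := 0) (by omega) (by omega) (by omega) (by omega) (by omega) (by omega) (by omega)
  have hfin := hsupp.ap_isPerm (isPerm_cxs X.oAJ (X.oZ + (X.k + X.k) + X.m) X.m)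
    (q := fun b => ∀ a, bitAt b (relo (X.k + X.k + (X.m + X.m) + X.r + X.alg1.anc) 0
        (X.k + X.k + (X.m + X.m) + X.r + X.alg1.anc) X.oZ 0 0 X.W a) = bitAt x a) (by
    rintro b ⟨h1, h2⟩ a
    have h1' := slice_eq_iff.1 h1
    have h2' : ∀ a, X.oZ ≤ a → a < X.oL → bitAt b a = if X.oZ + (X.k + X.k) + X.m ≤ a ∧
        a < X.oZ + (X.k + X.k) + X.m + X.m then
        xor (bitAt c₂ a) (bitAt b (X.oAJ + (a - (X.oZ + (X.k + X.k) + X.m)))) else bitAt c₂ a := by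
      intro a h3 h4
      rw [← h2 a ⟨h3, h4⟩, bitAt_bwd_cxs hd3 hw3]
      split_ifs with h5
      · rcases bitAt b a <;> rcases bitAt b (X.oAJ + (a - (X.oZ + (X.k + X.k) + X.m))) <;> rfl
      · rfl
    rcases lt_or_ge a (X.k + X.k + (X.m + X.m) + X.r + X.alg1.anc) with ha | ha
    · rw [relo, if_pos ha, h2' _ (by omega) (by omega), b2, hx, bitAt_append, bitAt_append,
        bitAt_append, hZ _ (by omega) (by omega)]
      by_cases a1 : a < X.k
      · rw [if_neg (by omega), if_neg (by omega), if_pos (by omega), if_neg (by omega),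
          if_pos (by omega), if_pos a1, Bool.false_xor, show X.oZ + a - X.oZ = a by omega, hZi a a1]
      · by_cases a2 : a < X.k + X.k
        · rw [if_neg (by omega), if_pos (by omega), if_neg (by omega), if_pos a2, if_neg a1,
            Bool.false_xor, show X.oZ + a - (X.oZ + X.k) = a - X.k by omega, hZj _ (by omega)]
        · rw [if_neg a2]
          by_cases a3 : a - (X.k + X.k) < X.m
          · rw [if_neg (by omega), if_neg (by omega), if_neg (by omega), if_pos (by omega),
              if_pos a3]
            congr 1; omega
          · rw [if_neg a3]
            by_cases a4 : a - (X.k + X.k) - X.m < X.m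
            · have := h1' (a - (X.k + X.k) - X.m) a4
              rw [bitAt_bwd_cxs hd3 hw3, if_neg (by omega)] at this
              rw [if_pos (by omega), if_neg (by omega), if_neg (by omega), if_neg (by omega),
                Bool.false_xor, ← this]
              congr 1; omega
            · rw [if_neg (by omega), if_neg (by omega), if_neg (by omega), if_neg (by omega),
                bitAt_of_le (by omega)]
    · rw [bitAt_of_le (hρ.out a ha), bitAt_of_le (by omega)])
  intro b hb
  obtain ⟨y, hy⟩ := ap_reloc_supp hρ x (by omega) hfin X.alg1.gates b
  rw [finC, hy] at hb
  by_contra hne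
  refine hb ?_
  rw [alg1_zero (hX.alg1 i j hij) _ ?_, mul_zero]
  rw [show slice (pull _ _ b) (X.k + X.k + (X.m + X.m)) X.r = slice b X.oR X.r from
    slice_congr fun a ha => by
      rw [bitAt_pull hρ, relo, if_pos (by omega), oR]
      congr 1; omega]
  exact hne

end Ext

end ExtSim

/-! ### Alternating between the projections and their average -/

namespace ExtSim

section Spectral

variable {ι : Type} [Fintype ι]

/-- A Hermitian matrix is diagonal in suitable orthonormal coordinates. -/
theorem exists_coordinates {x : Matrix ι ι ℂ} (hx : x.IsHermitian) :
    ∃ (V : Matrix ι ι ℂ) (lam : ι → ℝ), (∀ φ φ', ip (V *ᵥ φ) (V *ᵥ φ') = ip φ φ') ∧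
      (∀ φ k, (V *ᵥ (x *ᵥ φ)) k = lam k * (V *ᵥ φ) k) ∧ ∀ y, ∃ φ, V *ᵥ φ = y := by
  classical
  have hU := hx.conjStarAlgAut_star_eigenvectorUnitary
  set U : Matrix ι ι ℂ := (hx.eigenvectorUnitary : Matrix ι ι ℂ) with hUdef
  have h1 : star U * U = 1 := Unitary.coe_star_mul_self _
  have h2 : U * star U = 1 := Unitary.coe_mul_star_self _
  rw [Unitary.conjStarAlgAut_star_apply] at hU
  refine ⟨star U, hx.eigenvalues, fun φ φ' => ?_, fun φ k => ?_, fun y => ⟨U *ᵥ y, ?_⟩⟩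
  · rw [ip_mulVec, mulVec_mulVec, star_eq_conjTranspose, conjTranspose_conjTranspose,
      ← star_eq_conjTranspose, h2, one_mulVec]
  · have : star U * x = diagonal (RCLike.ofReal ∘ hx.eigenvalues) * star U := by
      rw [← hU, Matrix.mul_assoc _ U, h2, Matrix.mul_one]
    rw [mulVec_mulVec, this, ← mulVec_mulVec, mulVec_diagonal]
    rfl
  · rw [mulVec_mulVec, h1, one_mulVec]

theorem nsq_proj_le {P : Matrix ι ι ℂ} (hP : P * P = P) (hP' : Pᴴ = P) (φ : ι → ℂ) :
    nsq (P *ᵥ φ) ≤ nsq φ := by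
  have e : ip φ (P *ᵥ φ) = ip (P *ᵥ φ) (P *ᵥ φ) := by
    rw [ip_mulVec (φ := P *ᵥ φ), hP', mulVec_mulVec, hP, ip_mulVec, hP']
  have h : nrm (P *ᵥ φ) ^ 2 ≤ nrm φ * nrm (P *ᵥ φ) := by
    rw [nrm_sq, nsq_eq_re, ← e]
    exact (Complex.re_le_norm _).trans (norm_ip_le _ _)
  have := nrm_nonneg φ
  rw [← nrm_sq, ← nrm_sq]
  have h2 := nrm_nonneg (P *ᵥ φ)
  have : nrm (P *ᵥ φ) ≤ nrm φ := by
    rcases h2.eq_or_lt with h3 | h3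
    · rw [← h3]; exact this
    · nlinarith
  gcongr

/-- If `0 ≤ M ≤ 1`, then `M ^ 2 ≤ M`. -/
theorem nsq_mulVec_le {M : Matrix ι ι ℂ} (hM : M.IsHermitian) (h0 : ∀ φ, 0 ≤ (ip φ (M *ᵥ φ)).re)
    (h1 : ∀ φ, (ip φ (M *ᵥ φ)).re ≤ nsq φ) (φ : ι → ℂ) :
    nsq (M *ᵥ φ) ≤ (ip φ (M *ᵥ φ)).re := by
  have e1 := h1 (M *ᵥ φ)
  have e2 := h0 (φ - M *ᵥ φ)
  have e3 : ip (M *ᵥ φ) (M *ᵥ φ) = ip φ (M *ᵥ (M *ᵥ φ)) := by rw [ip_mulVec M φ, hM.eq]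
  rw [mulVec_sub, ip_sub_left, ip_sub_right, ip_sub_right, ← e3, Complex.sub_re, Complex.sub_re,
    Complex.sub_re, ← nsq_eq_re] at e2
  linarith

/-- The sequence of unnormalised states that have not been found, for the projection `P` and the
average `M`. -/
def useq (P M : Matrix ι ι ℂ) (v : ι → ℂ) : ℕ → ι → ℂ
  | 0 => P *ᵥ v
  | t + 1 => useq P M v t - (2 : ℂ) • P *ᵥ (useq P M v t - M *ᵥ useq P M v t)

/-- The squared norm of the state that has not been found after `T` rounds, see `Ext.nsq_rest`. -/
noncomputable def failure (P M : Matrix ι ι ℂ) (v : ι → ℂ) (T : ℕ) : ℝ :=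
  (ip (useq P M v T) (useq P M v T - M *ᵥ useq P M v T)).re

theorem pow_mul_one_sub_le {z : ℝ} (h0 : 0 ≤ z) (h1 : z ≤ 1) (T : ℕ) :
    z ^ T * (1 - z) ≤ 1 / (T + 1) := by
  rw [le_div_iff₀ (by positivity)]
  have h : (∑ s ∈ Finset.range (T + 1), z ^ s) * (1 - z) = 1 - z ^ (T + 1) := by
    have := geom_sum_mul z (T + 1); linarith
  have h' : (T + 1 : ℝ) * z ^ T ≤ ∑ s ∈ Finset.range (T + 1), z ^ s := by
    have : ∑ _s ∈ Finset.range (T + 1), z ^ T = (T + 1 : ℝ) * z ^ T := by simp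
    rw [← this]
    refine Finset.sum_le_sum fun s hs => pow_le_pow_of_le_one h0 h1 ?_
    have := Finset.mem_range.1 hs; omega
  have h2 : 0 ≤ z ^ (T + 1) := by positivity
  nlinarith [mul_le_mul_of_nonneg_right h' (sub_nonneg.2 h1)]

/-- If the alternation fails with large probability, then there is a vector `f` in the range of
the projection that has a large inner product with `v` but is nearly orthogonal to the ranges of
most projections that enter the average. -/
theorem exists_witness {P M : Matrix ι ι ℂ} (hP : P * P = P) (hP' : Pᴴ = P) (hM : M.IsHermitian)
    (h0 : ∀ φ, 0 ≤ (ip φ (M *ᵥ φ)).re) (h1 : ∀ φ, (ip φ (M *ᵥ φ)).re ≤ nsq φ) (v : ι → ℂ) (T : ℕ) :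
    ∃ f, P *ᵥ f = f ∧ (ip v f).re = failure P M v T ∧ nsq f ≤ failure P M v T ∧
      (ip f (M *ᵥ f)).re ≤ 1 / (4 * (T + 1)) * failure P M v T := by
  -- In coordinates that diagonalise `P M P` with eigenvalues `lam k`, a round multiplies the `k`-th
  -- coordinate by `2 lam k - 1`. The witness is `(1 - P M) u` for the state `u` after `2 T` rounds.
  set x := P * M * P with hx
  have hxh : x.IsHermitian := by
    rw [hx, IsHermitian, conjTranspose_mul, conjTranspose_mul, hP', hM.eq, Matrix.mul_assoc]
  obtain ⟨V, lam, hV, hVx, hs⟩ := exists_coordinates hxh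
  have hipx : ∀ φ, ip φ (x *ᵥ φ) = ip (P *ᵥ φ) (M *ᵥ (P *ᵥ φ)) := fun φ => by
    rw [hx, ← mulVec_mulVec, ← mulVec_mulVec, ip_mulVec, hP']
  have hnP := nsq_proj_le hP hP'
  have hlam : ∀ k, 0 ≤ lam k ∧ lam k ≤ 1 := by
    classical
    intro k
    obtain ⟨φ, hφ⟩ := hs (Pi.single k 1)
    have e1 : ip φ (x *ᵥ φ) = lam k := by
      rw [← hV, ip_def, Finset.sum_eq_single k]
      · rw [hVx, hφ]; simp
      · intro k' _ hk
        rw [hφ]; simp [hk]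
      · simp
    have e2 : nsq φ = 1 := by
      rw [nsq_eq_re, ← hV, hφ, ip_def, Finset.sum_eq_single k]
      · simp
      · intro k' _ hk
        simp [hk]
      · simp
    have e3 := h0 (P *ᵥ φ)
    have e4 := h1 (P *ᵥ φ)
    rw [← hipx, e1, Complex.ofReal_re] at e3 e4
    exact ⟨e3, by linarith [hnP φ]⟩
  have hPu : ∀ t, P *ᵥ useq P M v t = useq P M v t := fun t => by
    induction t with
    | zero => rw [useq, mulVec_mulVec, hP]
    | succ t ih => rw [useq, mulVec_sub, mulVec_smul, mulVec_mulVec, hP, ih]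
  have hxu : ∀ t, P *ᵥ (M *ᵥ useq P M v t) = x *ᵥ useq P M v t := fun t => by
    rw [hx, ← mulVec_mulVec, ← mulVec_mulVec, hPu]
  set a := V *ᵥ (P *ᵥ v) with ha
  have hVu : ∀ t k, (V *ᵥ useq P M v t) k = ((2 * lam k - 1 : ℝ) : ℂ) ^ t * a k := fun t => by
    induction t with
    | zero => intro k; rw [useq, pow_zero, one_mul]
    | succ t ih =>
      intro k
      rw [useq, mulVec_sub P, hPu, hxu, mulVec_sub, mulVec_smul, mulVec_sub, Pi.sub_apply,
        Pi.smul_apply, Pi.sub_apply, hVx, ih, pow_succ, smul_eq_mul]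
      push_cast; ring
  have hipa : ∀ (g h : ι → ℝ) φ φ', (∀ k, (V *ᵥ φ) k = g k * a k) → (∀ k, (V *ᵥ φ') k = h k * a k) →
      (ip φ φ').re = ∑ k, g k * h k * ‖a k‖ ^ 2 := by
    intro g h φ φ' hg hh
    rw [← hV, ip_def, Complex.re_sum]
    refine Finset.sum_congr rfl fun k _ => ?_
    have : star ((V *ᵥ φ) k) * (V *ᵥ φ') k = ((g k * h k * ‖a k‖ ^ 2 : ℝ) : ℂ) := by
      have e : star (a k) * a k = ((‖a k‖ ^ 2 : ℝ) : ℂ) := by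
        rw [mul_comm, Complex.star_def, Complex.mul_conj, Complex.normSq_eq_norm_sq]
      rw [hg, hh, star_mul', Complex.star_def, Complex.conj_ofReal, ← Complex.star_def,
        Complex.ofReal_mul, ← e]
      push_cast; ring
    rw [this, Complex.ofReal_re]
  set z : ι → ℝ := fun k => (2 * lam k - 1) ^ 2 with hz
  have hz0 : ∀ k, 0 ≤ z k := fun k => sq_nonneg _
  have hz1 : ∀ k, z k ≤ 1 := fun k => by have := hlam k; simp only [hz]; nlinarith
  set f := useq P M v (2 * T) - P *ᵥ (M *ᵥ useq P M v (2 * T)) with hf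
  have hPf : P *ᵥ f = f := by rw [hf, mulVec_sub, hPu, mulVec_mulVec, hP]
  have hVf : ∀ k, (V *ᵥ f) k = (((1 - lam k) * z k ^ T : ℝ) : ℂ) * a k := fun k => by
    rw [hf, hxu, mulVec_sub, Pi.sub_apply, hVx, hVu, pow_mul]
    push_cast [hz]; ring
  have hfail : failure P M v T = ∑ k, (1 - lam k) * z k ^ T * ‖a k‖ ^ 2 := by
    have : failure P M v T = (ip (useq P M v T) (useq P M v T - x *ᵥ useq P M v T)).re := by
      rw [failure, ip_sub_right, ip_sub_right, ← hxu, ip_mulVec P, hP', hPu]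
    rw [this, hipa (fun k => (2 * lam k - 1) ^ T) (fun k => (1 - lam k) * (2 * lam k - 1) ^ T)]
    · refine Finset.sum_congr rfl fun k _ => ?_
      simp only [hz]; rw [← pow_mul, pow_mul']; ring
    · intro k; rw [hVu]; push_cast; rfl
    · intro k; rw [mulVec_sub, Pi.sub_apply, hVx, hVu]; push_cast; ring
  refine ⟨f, hPf, ?_, ?_, ?_⟩
  · have : ip v f = ip (P *ᵥ v) f := by
      conv_lhs => rw [← hPf]
      rw [ip_mulVec, hP']
    rw [this, hfail, hipa (fun _ => 1) (fun k => (1 - lam k) * z k ^ T) _ _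
      (fun k => by rw [Complex.ofReal_one, one_mul]) hVf]
    simp
  · rw [nsq_eq_re, hfail, hipa _ _ _ _ hVf hVf]
    refine Finset.sum_le_sum fun k _ => mul_le_mul_of_nonneg_right ?_ (by positivity)
    have := hlam k
    have h2 : z k ^ T ≤ 1 := pow_le_one₀ (hz0 k) (hz1 k)
    have h3 : 0 ≤ z k ^ T := pow_nonneg (hz0 k) _
    have h4 : (1 - lam k) * z k ^ T ≤ 1 := by nlinarith
    have h5 : 0 ≤ (1 - lam k) * z k ^ T := mul_nonneg (by linarith) h3
    nlinarith
  · have : (ip f (M *ᵥ f)).re = (ip f (x *ᵥ f)).re := by rw [hipx, hPf]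
    rw [this, hfail, Finset.mul_sum,
      hipa _ (fun k => lam k * ((1 - lam k) * z k ^ T)) _ _ hVf fun k => by
        rw [hVx, hVf]; push_cast; ring]
    refine Finset.sum_le_sum fun k _ => ?_
    have := hlam k
    have h2 := pow_mul_one_sub_le (hz0 k) (hz1 k) T
    have h3 : 0 ≤ z k ^ T := pow_nonneg (hz0 k) _
    have h5 : 0 ≤ (1 - lam k) * z k ^ T := mul_nonneg (by linarith) h3
    -- since `1 - z k = 4 lam k (1 - lam k)`, the left-hand side is `z k ^ T (1 - z k) / 4`
    have h6 : lam k * (1 - lam k) * z k ^ T ≤ 1 / (4 * (T + 1)) := by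
      have e : z k ^ T * (1 - z k) = 4 * (lam k * (1 - lam k) * z k ^ T) := by
        simp only [hz]; ring
      have e' : (1 : ℝ) / (4 * (T + 1)) = 1 / (T + 1) / 4 := by field_simp
      rw [e']; linarith
    calc (1 - lam k) * z k ^ T * (lam k * ((1 - lam k) * z k ^ T)) * ‖a k‖ ^ 2
        = (lam k * (1 - lam k) * z k ^ T) * (((1 - lam k) * z k ^ T) * ‖a k‖ ^ 2) := by ring
      _ ≤ _ := mul_le_mul_of_nonneg_right h6 (mul_nonneg h5 (by positivity))

/-- The states do not grow: a round maps `u` to `2 P M u - u`. -/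
theorem nsq_useq_le {P M : Matrix ι ι ℂ} (hP : P * P = P) (hP' : Pᴴ = P) (hM : M.IsHermitian)
    (h0 : ∀ φ, 0 ≤ (ip φ (M *ᵥ φ)).re) (h1 : ∀ φ, (ip φ (M *ᵥ φ)).re ≤ nsq φ) (v : ι → ℂ) (t : ℕ) :
    nsq (useq P M v t) ≤ nsq v := by
  induction t with
  | zero => exact nsq_proj_le hP hP' v
  | succ t ih =>
    refine le_trans ?_ ih
    set u := useq P M v t with hu
    have hPu : P *ᵥ u = u := by
      rw [hu]
      clear ih hu u
      induction t with
      | zero => rw [useq, mulVec_mulVec, hP]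
      | succ t ih => rw [useq, mulVec_sub, mulVec_smul, mulVec_mulVec, hP, ih]
    set y := P *ᵥ (M *ᵥ u) with hy
    have e1 : useq P M v (t + 1) = (2 : ℂ) • y - u := by
      rw [useq, mulVec_sub, ← hu, hPu, ← hy]
      funext b
      simp only [Pi.sub_apply, Pi.smul_apply, smul_eq_mul]
      ring
    have e2 : (ip u y).re = (ip u (M *ᵥ u)).re := by rw [hy, ip_mulVec, hP', hPu]
    have e3 : (ip y u).re = (ip u y).re := by rw [← star_ip, Complex.star_def, Complex.conj_re]
    have e4 : nsq y ≤ (ip u y).re := by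
      rw [e2]
      exact (nsq_proj_le hP hP' _).trans (nsq_mulVec_le hM h0 h1 u)
    have e5 : nsq (useq P M v (t + 1)) = 4 * nsq y - 4 * (ip u y).re + nsq u := by
      rw [nsq_eq_re, e1, ip_sub_left, ip_sub_right, ip_sub_right, ip_smul_left, ip_smul_left,
        ip_smul_right, ip_smul_right, nsq_eq_re, nsq_eq_re]
      simp only [Complex.sub_re, Complex.star_def, map_ofNat, Complex.mul_re, Complex.re_ofNat,
        Complex.im_ofNat, e3]
      ring
    linarith

/-- The Cauchy-Schwarz inequality. -/
theorem sum_sqrt_mul_le {κ : Type*} {C : Finset κ} {f g : κ → ℝ} (hf : ∀ i ∈ C, 0 ≤ f i)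
    (hg : ∀ i ∈ C, 0 ≤ g i) : ∑ i ∈ C, √(f i) * √(g i) ≤ √(∑ i ∈ C, f i) * √(∑ i ∈ C, g i) := by
  rw [← Real.sqrt_mul (Finset.sum_nonneg hf)]
  refine Real.le_sqrt_of_sq_le ((Finset.sum_mul_sq_le_sq_mul_sq C _ _).trans (le_of_eq ?_))
  rw [Finset.sum_congr rfl fun i hi => Real.sq_sqrt (hf i hi),
    Finset.sum_congr rfl fun i hi => Real.sq_sqrt (hg i hi)]

/-- The average failure probability is small. The projections `P i` enter the average `M` with the
weights `p i`. The witnesses for different `i` are nearly orthogonal on average, and a unit vector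
cannot have large inner products with many nearly orthogonal vectors. -/
theorem sum_failure_le {κ : Type*} {C : Finset κ} {p : κ → ℝ} {P : κ → Matrix ι ι ℂ}
    {M : Matrix ι ι ℂ} (hp : ∀ i ∈ C, 0 ≤ p i) (hp1 : ∑ i ∈ C, p i ≤ 1)
    (hP : ∀ i ∈ C, P i * P i = P i) (hP' : ∀ i ∈ C, (P i)ᴴ = P i) (hM : M.IsHermitian)
    (h1 : ∀ φ, (ip φ (M *ᵥ φ)).re ≤ nsq φ)
    (hPM : ∀ φ, ∑ i ∈ C, p i * nsq (P i *ᵥ φ) ≤ (ip φ (M *ᵥ φ)).re) {v : ι → ℂ} (hv : nsq v = 1)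
    (T : ℕ) :
    ∑ i ∈ C, p i * failure (P i) M v T ≤ √(1 / (4 * (T + 1))) := by
  have h0 : ∀ φ, 0 ≤ (ip φ (M *ᵥ φ)).re := fun φ =>
    (Finset.sum_nonneg fun i hi => mul_nonneg (hp i hi) (nsq_nonneg _)).trans (hPM φ)
  have hex : ∀ i, ∃ f, i ∈ C → P i *ᵥ f = f ∧ (ip v f).re = failure (P i) M v T ∧
      nsq f ≤ failure (P i) M v T ∧
      (ip f (M *ᵥ f)).re ≤ 1 / (4 * (T + 1)) * failure (P i) M v T := fun i => by
    by_cases hi : i ∈ C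
    · obtain ⟨f, hf⟩ := exists_witness (hP i hi) (hP' i hi) hM h0 h1 v T
      exact ⟨f, fun _ => hf⟩
    · exact ⟨0, fun h => absurd h hi⟩
  choose f hf using hex
  set κ := (1 : ℝ) / (4 * (T + 1)) with hκ
  have hκ0 : 0 ≤ κ := by positivity
  set w := ∑ i ∈ C, p i * failure (P i) M v T with hw
  have hF0 : ∀ i ∈ C, 0 ≤ failure (P i) M v T := fun i hi => (nsq_nonneg _).trans (hf i hi).2.2.1
  have hw0 : 0 ≤ w := Finset.sum_nonneg fun i hi => mul_nonneg (hp i hi) (hF0 i hi)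
  -- the inner product of `v` with the average witness is the average failure probability
  set y := ∑ i ∈ C, ((p i : ℝ) : ℂ) • f i with hy
  have hvy : w = (ip v y).re := by
    rw [hy, ip_sum_right, Complex.re_sum]
    refine Finset.sum_congr rfl fun i hi => ?_
    rw [ip_smul_right, Complex.re_ofReal_mul, (hf i hi).2.1]
  have hwy : w ≤ nrm y := by
    have := (Complex.re_le_norm _).trans (norm_ip_le v y)
    rwa [← hvy, show nrm v = 1 by rw [nrm, hv, Real.sqrt_one], one_mul] at this
  -- the inner products of `f j` and `f i` are small on average over `j`
  have hin : ∀ i ∈ C, (ip y (f i)).re ≤ √w * √(κ * failure (P i) M v T) := by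
    intro i hi
    have e1 : (ip y (f i)).re ≤ ∑ j ∈ C, √(p j * nsq (f j)) * √(p j * nsq (P j *ᵥ f i)) := by
      rw [hy, ip_sum_left, Complex.re_sum]
      refine Finset.sum_le_sum fun j hj => ?_
      have e2 : ip (f j) (f i) = ip (f j) (P j *ᵥ f i) := by
        rw [ip_mulVec, hP' j hj, (hf j hj).1]
      rw [ip_smul_left, Complex.star_def, Complex.conj_ofReal, Complex.re_ofReal_mul, e2,
        Real.sqrt_mul (hp j hj), Real.sqrt_mul (hp j hj)]
      have := (Complex.re_le_norm _).trans (norm_ip_le (f j) (P j *ᵥ f i))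
      calc p j * (ip (f j) (P j *ᵥ f i)).re ≤ p j * (nrm (f j) * nrm (P j *ᵥ f i)) :=
            mul_le_mul_of_nonneg_left this (hp j hj)
        _ = (√(p j) * √(p j)) * (nrm (f j) * nrm (P j *ᵥ f i)) := by
            rw [Real.mul_self_sqrt (hp j hj)]
        _ = √(p j) * √(nsq (f j)) * (√(p j) * √(nsq (P j *ᵥ f i))) := by
            rw [nrm, nrm]; ring
    refine e1.trans ((sum_sqrt_mul_le (fun j hj => mul_nonneg (hp j hj) (nsq_nonneg _))
      fun j hj => mul_nonneg (hp j hj) (nsq_nonneg _)).trans ?_)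
    · refine mul_le_mul (Real.sqrt_le_sqrt ?_) (Real.sqrt_le_sqrt ?_) (Real.sqrt_nonneg _)
        (Real.sqrt_nonneg _)
      · exact Finset.sum_le_sum fun j hj => mul_le_mul_of_nonneg_left (hf j hj).2.2.1 (hp j hj)
      · exact (hPM _).trans (hf i hi).2.2.2
  have hyy : nsq y ≤ √κ * w := by
    have e1 : nsq y = ∑ i ∈ C, p i * (ip y (f i)).re := by
      rw [nsq_eq_re]
      conv_lhs => rw [hy, ip_sum_right, Complex.re_sum, ← hy]
      refine Finset.sum_congr rfl fun i hi => ?_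
      rw [ip_smul_right, Complex.re_ofReal_mul]
    have e2 : nsq y ≤ √w * √κ * ∑ i ∈ C, √(p i) * √(p i * failure (P i) M v T) := by
      rw [e1, Finset.mul_sum]
      refine Finset.sum_le_sum fun i hi => ?_
      have := mul_le_mul_of_nonneg_left (hin i hi) (hp i hi)
      refine this.trans (le_of_eq ?_)
      rw [Real.sqrt_mul hκ0, Real.sqrt_mul (hp i hi)]
      conv_lhs => rw [← Real.mul_self_sqrt (hp i hi)]
      ring
    have e3 : ∑ i ∈ C, √(p i) * √(p i * failure (P i) M v T) ≤ √w := by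
      refine (sum_sqrt_mul_le hp fun i hi => mul_nonneg (hp i hi) (hF0 i hi)).trans ?_
      calc √(∑ i ∈ C, p i) * √w ≤ 1 * √w :=
            mul_le_mul_of_nonneg_right (Real.sqrt_le_one.2 hp1) (Real.sqrt_nonneg _)
        _ = √w := one_mul _
    calc nsq y ≤ √w * √κ * √w :=
          e2.trans (mul_le_mul_of_nonneg_left e3 (by positivity))
      _ = √κ * (√w * √w) := by ring
      _ = √κ * w := by rw [Real.mul_self_sqrt hw0]
  have hw2 : w * w ≤ √κ * w := by
    have : w ^ 2 ≤ nsq y := by rw [← nrm_sq]; gcongr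
    nlinarith
  rcases hw0.eq_or_lt with h | h
  · rw [← h]; positivity
  · exact le_of_mul_le_mul_right hw2 h

end Spectral

end ExtSim

/-! ### The sampler and the average of the measurements -/

namespace ExtSim

theorem bits_sum_slice {w k : ℕ} (f : Bits k → ℝ) (β : Bits w → ℝ) :
    ∑ h, f (slice h 0 k) * β h = ∑ y, f y * ∑ h, if slice h 0 k = y then β h else 0 := by
  simp only [Finset.mul_sum]
  rw [Finset.sum_comm]
  refine Finset.sum_congr rfl fun h _ => ?_
  rw [Finset.sum_eq_single (slice h 0 k)]
  · rw [if_pos rfl]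
  · intro y _ hy
    rw [if_neg hy.symm, mul_zero]
  · simp

theorem isHermitian_of_ip {ι : Type} [Fintype ι] {M : Matrix ι ι ℂ}
    (h : ∀ φ φ', ip φ (M *ᵥ φ') = ip (M *ᵥ φ) φ') : M.IsHermitian := by
  classical
  refine Matrix.ext_of_mulVec_single fun k => eq_of_ip fun χ => ?_
  rw [ip_mulVec, conjTranspose_conjTranspose, h]

namespace Ext

variable (X : Ext)

/-- The amplitudes of the sampler. -/
noncomputable def beta : Bits (X.k + X.sampler.anc) → ℂ :=
  ap X.sampler.gates (inputState (X.k + X.sampler.anc) (default : Bits 0) fun _ : Bits 0 => 1)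

theorem sampleProb_eq (y : Bits X.k) :
    X.sampleProb y = ∑ h, if slice h 0 X.k = y then ‖X.beta h‖ ^ 2 else 0 := rfl

theorem sum_beta (f : Bits X.k → ℝ) :
    ∑ h, f (slice h 0 X.k) * ‖X.beta h‖ ^ 2 = ∑ y, f y * X.sampleProb y :=
  bits_sum_slice f fun h => ‖X.beta h‖ ^ 2

theorem sampleProb_nonneg (y : Bits X.k) : 0 ≤ X.sampleProb y := by
  rw [sampleProb_eq]
  exact Finset.sum_nonneg fun h _ => by split_ifs <;> positivity

theorem sum_sampleProb : ∑ y, X.sampleProb y = 1 := by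
  have h := X.sum_beta fun _ => 1
  simp only [one_mul] at h
  rw [← h]
  have : nsq X.beta = 1 := by
    rw [beta, nsq_ap, nsq_inputState (by omega)]
    simp [nsq]
  exact this

/-- The configuration `c` with `h` on the wires of the sampler from `o` on. -/
noncomputable def withSample (o : ℕ) (c : Bits X.W) (h : Bits (X.k + X.sampler.anc)) : Bits X.W :=
  put (relo (X.k + X.sampler.anc) 0 (X.k + X.sampler.anc) o 0 0 X.W) c h

theorem bitAt_withSample {o : ℕ} (hw : o + (X.k + X.sampler.anc) ≤ X.W) (c : Bits X.W)
    (h : Bits (X.k + X.sampler.anc)) (a : ℕ) : bitAt (X.withSample o c h) a =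
      if o ≤ a ∧ a < o + (X.k + X.sampler.anc) then bitAt h (a - o) else bitAt c a := by
  have hρ : Emb (X.k + X.sampler.anc) X.W
      (relo (X.k + X.sampler.anc) 0 (X.k + X.sampler.anc) o 0 0 X.W) :=
    relo_emb (n3 := 0) (by omega) (by omega) (by omega) (by omega) (by omega) (by omega) (by omega)
  rw [withSample]
  split_ifs with ha
  · have := bitAt_put_self hρ c h (a - o)
    rwa [relo, if_pos (by omega), show o + (a - o) = a by omega] at this
  · refine bitAt_put_of_not ?_
    rw [ran_relo (n3 := 0) (by omega)]
    omega

theorem withSample_inj {o : ℕ} (hn : X.n ≤ o) (hw : o + (X.k + X.sampler.anc) ≤ X.W) {c : Bits X.W}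
    {h h' : Bits (X.k + X.sampler.anc)}
    (he : Agree (fun a => X.n ≤ a) (X.withSample o c h) (X.withSample o c h')) : h = h' := by
  refine bits_ext fun a => ?_
  rcases lt_or_ge a (X.k + X.sampler.anc) with ha | ha
  · have := he (o + a) (by omega)
    rwa [bitAt_withSample _ hw, bitAt_withSample _ hw, if_pos (by omega), if_pos (by omega),
      show o + a - o = a by omega] at this
  · rw [bitAt_of_le ha, bitAt_of_le ha]

theorem slice_withSample {o : ℕ} (hw : o + (X.k + X.sampler.anc) ≤ X.W) (c : Bits X.W)
    (h : Bits (X.k + X.sampler.anc)) : slice (X.withSample o c h) o X.k = slice h 0 X.k :=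
  slice_congr fun a ha => by
    rw [bitAt_withSample _ hw, if_pos (by omega)]
    congr 1; omega

/-- The sampler writes a superposition of its outcomes. -/
theorem ap_smpC {o : ℕ} (hn : X.n ≤ o) (hw : o + (X.k + X.sampler.anc) ≤ X.W) {c : Bits X.W}
    (hz : ∀ a, o ≤ a → a < o + (X.k + X.sampler.anc) → bitAt c a = false) (φ : Bits X.n → ℂ) :
    ap (X.smpC o) (emb c φ) = ∑ h, X.beta h • emb (X.withSample o c h) φ := by
  refine ap_reloc_emb (c₀ := 0) (relo_emb (n3 := 0) (by omega) (by omega) (by omega) (by omega)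
    (by omega) (by omega) (by omega)) (fun a ha => ?_) (fun a => ?_) _ φ
  · rw [ran_relo (n3 := 0) (by omega)] at ha
    omega
  · rw [bitAt_of_le (Nat.zero_le _), relo]
    split_ifs
    · exact hz _ (by omega) (by omega)
    · omega
    · exact bitAt_of_le le_rfl

theorem nsq_sum_withSample {o : ℕ} (hn : X.n ≤ o) (hw : o + (X.k + X.sampler.anc) ≤ X.W)
    (c : Bits X.W) (s : Finset (Bits (X.k + X.sampler.anc)))
    (φ : Bits (X.k + X.sampler.anc) → Bits X.n → ℂ) :
    nsq (∑ h ∈ s, X.beta h • emb (X.withSample o c h) (φ h)) =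
      ∑ h ∈ s, nsq (φ h) * ‖X.beta h‖ ^ 2 := by
  have h1 := nsq_sum_emb X.n_le s (X.withSample o c)
    (fun h _ h' _ he => X.withSample_inj hn hw he) fun h => X.beta h • φ h
  simp only [emb_smul] at h1
  rw [h1]
  refine Finset.sum_congr rfl fun h _ => ?_
  rw [nsq_smul, mul_comm]

theorem iota_eq {c : Bits X.W} (hc : X.Clear c) (φ : Bits X.n → ℂ) :
    X.iota c φ = ∑ h, X.beta h • emb (X.withSample X.oJ c h) φ := by
  have hs := X.spec
  exact X.ap_smpC (by omega) (by omega) (fun a h1 h2 => hc a h1 (by omega)) φ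

theorem A_sum {κ : Type*} (s : Finset κ) (β : κ → ℂ) (f : κ → Bits X.W → ℂ) :
    X.A (∑ h ∈ s, β h • f h) = ∑ h ∈ s, β h • X.A (f h) := by
  simp only [A, conjMask_sum, conjMask_smul]

theorem clear_zero : X.Clear fun _ => false := fun a _ _ => by simp [bitAt]

/-- The matrix of the average over the sampler of the measurements. -/
noncomputable def M : Matrix (Bits X.n) (Bits X.n) ℂ :=
  LinearMap.toMatrix' {
    toFun := X.avg fun _ => false
    map_add' := fun φ φ' => by
      simp only [avg, iota_add, A, conjMask_add, ap_add, res_add]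
    map_smul' := fun a φ => by
      simp only [avg, iota_smul, A, conjMask_smul, ap_smul, res_smul, RingHom.id_apply] }

theorem M_mulVec {c : Bits X.W} (hc : X.Clear c) (φ : Bits X.n → ℂ) : X.M *ᵥ φ = X.avg c φ := by
  rw [X.avg_eq hc X.clear_zero, M, LinearMap.toMatrix'_mulVec]
  rfl

theorem ip_M {c : Bits X.W} (hc : X.Clear c) (φ φ' : Bits X.n → ℂ) :
    ip φ (X.M *ᵥ φ') = ip (X.A (X.iota c φ)) (X.A (X.iota c φ')) := by
  rw [X.M_mulVec hc, ip_avg, A, ip_conjMask, conjMask_idem]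

theorem re_ip_M {c : Bits X.W} (hc : X.Clear c) (φ : Bits X.n → ℂ) :
    (ip φ (X.M *ᵥ φ)).re = nsq (X.A (X.iota c φ)) := by
  rw [X.ip_M hc, nsq_eq_re]

theorem isHermitian_M : X.M.IsHermitian := isHermitian_of_ip fun φ φ' => by
  rw [X.ip_M X.clear_zero, ← star_ip φ', X.ip_M X.clear_zero, star_ip]

theorem re_ip_M_le (φ : Bits X.n → ℂ) : (ip φ (X.M *ᵥ φ)).re ≤ nsq φ := by
  rw [X.re_ip_M X.clear_zero, ← X.nsq_iota (fun _ => false) φ]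
  exact nsq_conjMask_le _ _ _

/-- What has not been found has the squared norm that `failure` computes. -/
theorem nsq_rest {c : Bits X.W} (hc : X.Clear c) (φ : Bits X.n → ℂ) :
    nsq (X.iota c φ - X.A (X.iota c φ)) = (ip φ (φ - X.M *ᵥ φ)).re := by
  have h := nsq_conjMask_add (gs := X.meaC X.oJ X.oMJ) (p := fun b => bitAt b X.oMJ = true)
    (X.iota c φ)
  rw [X.nsq_iota] at h
  rw [ip_sub_right, Complex.sub_re, X.re_ip_M hc, ← nsq_eq_re]
  change nsq (X.A (X.iota c φ)) + nsq (X.iota c φ - X.A (X.iota c φ)) = nsq φ at h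
  linarith

variable {X}

variable {C : Finset (Bits X.k)} {P : Bits X.k → Matrix (Bits X.n) (Bits X.n) ℂ}
  {S : Finset (Bits X.k × Bits X.k)} {s : Bits X.k → Bits X.m} {t : Bits X.r}

theorem A_withSample (hX : Setting X C P S s t) {c : Bits X.W} (hc : X.Clear c)
    {h : Bits (X.k + X.sampler.anc)} (hh : slice h 0 X.k ∈ C) (φ : Bits X.n → ℂ) :
    X.A (emb (X.withSample X.oJ c h) φ) =
      emb (X.withSample X.oJ c h) (P (slice h 0 X.k) *ᵥ φ) := by
  have hs := X.spec
  refine A_emb hX.proj hX.meas hh (X.slice_withSample (by omega) c h) (fun a h1 h2 => ?_) φ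
  rw [bitAt_withSample _ (by omega), if_neg (by omega)]
  exact hc a (by omega) h2

open Classical in
/-- The average `M` is at least the average over the indices in `C`. -/
theorem sum_nsq_le (hX : Setting X C P S s t) (φ : Bits X.n → ℂ) :
    ∑ j ∈ C, X.sampleProb j * nsq (P j *ᵥ φ) ≤ (ip φ (X.M *ᵥ φ)).re := by
  have hs := X.spec
  set c : Bits X.W := fun _ => false
  have hc : X.Clear c := X.clear_zero
  have hw : X.oJ + (X.k + X.sampler.anc) ≤ X.W := by omega
  set G : Finset (Bits (X.k + X.sampler.anc)) := Finset.univ.filter fun h => slice h 0 X.k ∈ C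
  set G' : Finset (Bits (X.k + X.sampler.anc)) := Finset.univ.filter fun h => ¬ slice h 0 X.k ∈ C
  set y := ∑ h ∈ G, X.beta h • emb (X.withSample X.oJ c h) φ with hy
  set y' := ∑ h ∈ G', X.beta h • emb (X.withSample X.oJ c h) φ with hy'
  have hsum : X.iota c φ = y + y' := by
    rw [X.iota_eq hc]
    exact (Finset.sum_filter_add_sum_filter_not _ _ _).symm
  have hAy : X.A y = ∑ h ∈ G, X.beta h • emb (X.withSample X.oJ c h) (P (slice h 0 X.k) *ᵥ φ) := by
    rw [hy, A_sum]
    refine Finset.sum_congr rfl fun h hh => ?_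
    rw [A_withSample hX hc (Finset.mem_filter.1 hh).2]
  -- The indices outside `C` do not interfere, since the measurement is a projection.
  have horth : ip (X.A y) (X.A y') = 0 := by
    have : ip (X.A y) (X.A y') = ip (X.A y) y' := by
      rw [A, ← ip_conjMask, conjMask_idem]
    rw [this, hAy, hy', ip_sum_left]
    refine Finset.sum_eq_zero fun h hh => ?_
    rw [ip_sum_right]
    refine Finset.sum_eq_zero fun h' hh' => ?_
    rw [ip_smul_left, ip_smul_right, ip_emb_of_ne, mul_zero, mul_zero]
    intro he
    have := X.withSample_inj (by omega) hw he
    rw [this] at hh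
    exact (Finset.mem_filter.1 hh').2 (Finset.mem_filter.1 hh).2
  have hn : nsq (X.A (y + y')) = nsq (X.A y) + nsq (X.A y') := by
    have e : X.A (y + y') = X.A y + X.A y' := conjMask_add _ _ _ _
    rw [e, nsq_eq_re, ip_add_left, ip_add_right, ip_add_right, horth, ← star_ip (X.A y) (X.A y'),
      horth,
      nsq_eq_re, nsq_eq_re]
    simp
  rw [X.re_ip_M hc, hsum, hn, hAy, X.nsq_sum_withSample (by omega) hw]
  have hb := X.sum_beta fun j => if j ∈ C then nsq (P j *ᵥ φ) else 0
  have h1 : ∑ h ∈ G, nsq (P (slice h 0 X.k) *ᵥ φ) * ‖X.beta h‖ ^ 2 =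
      ∑ j ∈ C, X.sampleProb j * nsq (P j *ᵥ φ) := by
    rw [Finset.sum_filter]
    simp only [ite_mul, zero_mul] at hb
    rw [hb, ← Finset.sum_filter, Finset.filter_mem_eq_inter, Finset.univ_inter]
    exact Finset.sum_congr rfl fun j _ => mul_comm _ _
  rw [h1]
  linarith [nsq_nonneg (X.A y')]

/-! ### The error of the computed string -/

variable (X) in
/-- The configurations in which the string is computed for the index `i`. -/
structure Start (i : Bits X.k) (c : Bits X.W) : Prop where
  index : slice c X.oI X.k = i
  zero : ∀ a, X.oMI ≤ a → bitAt c a = false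

variable (X S) in
/-- The probability that the sampled index does not form a pair in `S` with `i`. -/
noncomputable def badProb (i : Bits X.k) : ℝ :=
  open Classical in ∑ j, if (i, j) ∈ S then 0 else X.sampleProb j

theorem badProb_nonneg (i : Bits X.k) : 0 ≤ X.badProb S i :=
  Finset.sum_nonneg fun j _ => by split_ifs; exacts [le_rfl, X.sampleProb_nonneg j]

/-- The computed string differs from `t`. -/
def Wrong (t : Bits X.r) (b : Bits X.W) : Prop := ¬ slice b X.oR X.r = t

open Classical in
/-- If some `j` has been found, the string is wrong only for pairs outside `S`. -/
theorem nsq_wrong_found (hX : Setting X C P S s t) {i : Bits X.k} {c : Bits X.W}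
    (hc : X.Clear c) (hci : slice c X.oI X.k = i)
    (hz : ∀ a, X.oAJ ≤ a → a < X.oZ → bitAt c a = false)
    (hZ : ∀ a, X.oZ ≤ a → a < X.oL → bitAt c a =
      if X.oZ + (X.k + X.k) ≤ a ∧ a < X.oZ + (X.k + X.k) + X.m
      then bitAt (s i) (a - (X.oZ + (X.k + X.k))) else false) (φ : Bits X.n → ℂ) :
    nsq (mask (Wrong t) (ap X.last (X.A (X.iota c φ)))) ≤ X.badProb S i * nsq φ := by
  have hs := X.spec
  have hw : X.oJ + (X.k + X.sampler.anc) ≤ X.W := by omega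
  set F : (Bits X.W → ℂ) → Bits X.W → ℂ := fun χ => mask (Wrong t) (ap X.last (X.A χ)) with hF
  have hFsum : ∀ (G : Finset (Bits (X.k + X.sampler.anc))) (f : _ → Bits X.W → ℂ),
      F (∑ h ∈ G, X.beta h • f h) = ∑ h ∈ G, X.beta h • F (f h) := fun G f => by
    simp only [hF, A_sum, ap_sum, mask_sum, ap_smul, mask_smul]
  have hgood : ∀ h, (i, slice h 0 X.k) ∈ S → F (emb (X.withSample X.oJ c h) φ) = 0 := by
    intro h hh
    have hj : slice h 0 X.k ∈ C := (Finset.mem_product.1 (hX.sub hh)).2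
    simp only [hF]
    rw [A_withSample hX hc hj]
    refine mask_eq_zero fun b hb => ?_
    by_contra h0
    refine hb (supp_last hX hh ?_ ?_ (X.slice_withSample hw c h) (fun a h1 h2 => ?_)
      (fun a h1 h2 => ?_) b h0)
    · rw [mulVec_mulVec, proj_mul (hX.proj _ hj)]
    · rw [← hci]
      refine slice_congr fun a ha => ?_
      rw [bitAt_withSample _ hw, if_neg (by omega)]
    · rw [bitAt_withSample _ hw, if_neg (by omega), hz a h1 h2]
    · rw [bitAt_withSample _ hw, if_neg (by omega), hZ a h1 h2]
  set G : Finset (Bits (X.k + X.sampler.anc)) :=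
    Finset.univ.filter fun h => ¬ (i, slice h 0 X.k) ∈ S with hG
  have hsum : F (X.iota c φ) = F (∑ h ∈ G, X.beta h • emb (X.withSample X.oJ c h) φ) := by
    rw [X.iota_eq hc, hFsum, hFsum, hG, Finset.sum_filter]
    refine Finset.sum_congr rfl fun h _ => ?_
    split_ifs with hh
    · rw [hgood h hh, smul_zero]
    · rfl
  show nsq (F (X.iota c φ)) ≤ _
  rw [hsum]
  refine (nsq_mask_le _ _).trans ?_
  rw [nsq_ap]
  refine (nsq_conjMask_le _ _ _).trans ?_
  rw [X.nsq_sum_withSample (by omega) hw, hG, Finset.sum_filter]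
  have hb := X.sum_beta fun j => if ¬ (i, j) ∈ S then nsq φ else 0
  simp only [ite_mul, zero_mul] at hb
  rw [hb, badProb, Finset.sum_mul]
  refine Finset.sum_le_sum fun j _ => ?_
  by_cases h : (i, j) ∈ S
  · simp [h]
  · simp [h, mul_comm]

/-- The parts of the state that are found in the successive rounds. -/
noncomputable def found (P M : Matrix (Bits X.n) (Bits X.n) ℂ) (v : Bits X.n → ℂ) :
    ℕ → Bits X.n → ℂ
  | 0 => useq P M v 0
  | t + 1 => useq P M v (t + 1) - useq P M v t

/-- The state after `T` rounds: what has been found in each of them, told apart by the flags, and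
what has not been found. -/
theorem ap_rounds (hX : Setting X C P S s t) {i : Bits X.k} (hi : i ∈ C) {c : Bits X.W}
    (hc : Ready c) (hci : slice c X.oI X.k = i) (v : Bits X.n → ℂ) (T : ℕ) (hT : T ≤ X.T) :
    ap (X.rounds T) (X.iota (X.lev c 0) (P i *ᵥ v)) =
      (∑ τ ∈ Finset.range (T + 1), X.A (X.iota (X.lev c τ) (found (P i) X.M v τ))) +
      (X.iota (X.lev c T) (useq (P i) X.M v T) -
        X.A (X.iota (X.lev c T) (useq (P i) X.M v T))) := by
  induction T with
  | zero =>
    rw [Finset.sum_range_one, found, useq, rounds, List.range_zero, List.flatMap_nil, ap_nil]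
    abel
  | succ T ih =>
    have hs := X.spec
    rw [rounds, List.range_succ, List.flatMap_append, ap_append, ← rounds, ih (by omega),
      List.flatMap_singleton, ap_add, ap_sum, round_rest hX.proj hX.meas hi hc hci (by omega),
      Finset.sum_range_succ _ (T + 1)]
    rw [Finset.sum_congr rfl fun τ hτ => round_found hc
      (by have := Finset.mem_range.1 hτ; omega) (by omega) _, add_assoc]
    congr 1
    have hu : found (P i) X.M v (T + 1) =
        - ((2 : ℂ) • (P i *ᵥ (useq (P i) X.M v T - X.avg c (useq (P i) X.M v T)))) := by
      rw [found, useq, X.M_mulVec fun a h1 h2 => hc.clear a (by omega) h2]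
      abel
    have hu' : useq (P i) X.M v (T + 1) = useq (P i) X.M v T + found (P i) X.M v (T + 1) := by
      rw [found]; abel
    rw [hu', iota_add, ← iota_smul, ← neg_neg ((2 : ℂ) • _), ← hu]
    have hn : ∀ φ : Bits X.n → ℂ, X.iota (X.lev c (T + 1)) (-φ) = -X.iota (X.lev c (T + 1)) φ :=
      fun φ => by rw [← zero_sub, iota_sub, ← sub_self φ, iota_sub]; abel
    have ha : ∀ φ χ, X.A (φ + χ) = X.A φ + X.A χ := fun φ χ => conjMask_add _ _ φ χ
    rw [hn, ha]
    abel

/-- The probability that the computed string is wrong. It is computed correctly if some `j` has been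
found, unless the pair is not in `S`, which is bounded for each round separately. -/
theorem nsq_wrong (hX : Setting X C P S s t) {i : Bits X.k} (hi : i ∈ C) {c : Bits X.W}
    (hc : X.Start i c) (v : Bits X.n → ℂ) (hv : nsq v ≤ 1) :
    nsq (mask (Wrong t) (ap X.comp (emb c (P i *ᵥ v)))) ≤
      2 * failure (P i) X.M v X.T + 8 * (X.T + 1) ^ 2 * X.badProb S i := by
  have hs := X.spec
  have hN : X.oZ + (X.k + X.k) + X.m ≤ X.W := by omega
  have hPP := proj_mul (hX.proj i hi)
  have hPs := star_proj (hX.proj i hi)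
  have h0 : ∀ φ, 0 ≤ (ip φ (X.M *ᵥ φ)).re := fun φ => by
    rw [X.re_ip_M X.clear_zero]; exact nsq_nonneg _
  set c₁ := xorAt (X.oZ + (X.k + X.k)) (s i) c with hc₁
  have hb : ∀ a, bitAt c₁ a = if X.oZ + (X.k + X.k) ≤ a ∧ a < X.oZ + (X.k + X.k) + X.m then
      bitAt (s i) (a - (X.oZ + (X.k + X.k))) else bitAt c a := fun a => by
    rw [hc₁, bitAt_xorAt hN]
    split_ifs with h
    · rw [hc.zero a (by omega), Bool.false_xor]
    · rfl
  have hr : Ready c₁ := ⟨fun a h1 h2 => by rw [hb, if_neg (by omega), hc.zero a h1],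
    fun a h1 => by rw [hb, if_neg (by omega), hc.zero a (by omega)]⟩
  have hci : slice c₁ X.oI X.k = i := by
    rw [← hc.index]
    exact slice_congr fun a ha => by rw [hb, if_neg (by omega)]
  have hflip : ap [Gate.X X.oL] (X.iota c₁ (P i *ᵥ v)) = X.iota (X.lev c₁ 0) (P i *ᵥ v) := by
    have hnP : ¬ X.PJ X.oL := not_PJ le_rfl (by omega)
    rw [iota, iota, ap_cons, ap_nil, Gate.apply_X]
    rw [← (Loc.ap X.on_smpJ).comp_comm _ (agree_flip hnP) agree_flip_flip]
    congr 1
    refine emb_comp (fun b => ?_) (fun b _ => slice_congr fun a ha => by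
      rw [bitAt_flipBit, if_neg (by omega)]) _
    refine forall_congr' fun a => forall_congr' fun ha => ?_
    rcases lt_or_ge a X.W with h | h
    · rw [bitAt_flipBit, bitAt_lev _ _ _ _ h]
      by_cases h1 : a = X.oL
      · subst h1
        rw [if_pos ⟨rfl, h⟩, if_pos (by omega), hr.flags _ le_rfl]
        rcases bitAt b X.oL <;> simp
      · rw [if_neg (fun h' => h1 h'.1), if_neg (by omega)]
    · simp only [bitAt_of_le h]
  have hcomp : ap X.comp (emb c (P i *ᵥ v)) = ap X.last (ap (X.rounds X.T)
      (X.iota (X.lev c₁ 0) (P i *ᵥ v))) := by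
    rw [comp, ap_append, ap_append, ap_append, ap_append,
      ap_first hX hi (by rw [mulVec_mulVec, hPP]) hc.index fun a h1 h2 => hc.zero a (by omega),
      ← hflip]
    rfl
  rw [hcomp, ap_rounds hX hi hr hci v X.T le_rfl, ap_add, ap_sum, mask_add, mask_sum]
  -- `rest` is the contribution of what has not been found; the sum has one term for each round
  set rest := mask (Wrong t) (ap X.last (X.iota (X.lev c₁ X.T) (useq (P i) X.M v X.T) -
    X.A (X.iota (X.lev c₁ X.T) (useq (P i) X.M v X.T)))) with hrest
  have hrest' : nsq rest ≤ failure (P i) X.M v X.T := by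
    rw [hrest]
    refine (nsq_mask_le _ _).trans ?_
    rw [nsq_ap, X.nsq_rest (hr.clear_lev _)]
    rfl
  have hu : ∀ τ, nrm (useq (P i) X.M v τ) ≤ 1 := fun τ => by
    have := nsq_useq_le hPP hPs X.isHermitian_M h0 X.re_ip_M_le v τ
    exact Real.sqrt_le_one.2 (this.trans hv)
  have hfound : ∀ τ, nrm (found (P i) X.M v τ) ≤ 2 := fun τ => by
    cases τ with
    | zero => exact (hu 0).trans one_le_two
    | succ τ =>
      refine (nrm_sub_le _ _).trans ?_
      linarith [hu (τ + 1), hu τ]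
  have hp := badProb_nonneg (S := S) (X := X) i
  have hterm : ∀ τ ∈ Finset.range (X.T + 1), nrm (mask (Wrong t)
      (ap X.last (X.A (X.iota (X.lev c₁ τ) (found (P i) X.M v τ))))) ≤ 2 * √(X.badProb S i) := by
    intro τ hτ
    have hτ := Finset.mem_range.1 hτ
    have hlev : ∀ a, a < X.oL → bitAt (X.lev c₁ τ) a = bitAt c₁ a := fun a ha => by
      rw [bitAt_lev _ _ _ _ (by omega), if_neg (by omega)]
    have h := nsq_wrong_found hX (i := i) (hr.clear_lev τ) (by
      rw [← hci]; exact slice_congr fun a ha => hlev _ (by omega)) (fun a h1 h2 => by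
        rw [hlev a (by omega), hb, if_neg (by omega), hc.zero a (by omega)]) (fun a h1 h2 => by
        rw [hlev a h2, hb, hc.zero a (by omega)]) (found (P i) X.M v τ)
    rw [nrm]
    refine (Real.sqrt_le_sqrt h).trans ?_
    rw [Real.sqrt_mul hp, mul_comm]
    exact mul_le_mul_of_nonneg_right (hfound τ) (Real.sqrt_nonneg _)
  have hall : nrm ((∑ τ ∈ Finset.range (X.T + 1), mask (Wrong t)
      (ap X.last (X.A (X.iota (X.lev c₁ τ) (found (P i) X.M v τ))))) + rest) ≤
      (X.T + 1) * (2 * √(X.badProb S i)) + nrm rest := by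
    refine (nrm_add_le _ _).trans (add_le_add ((nrm_sum_le _ _).trans ?_) le_rfl)
    refine (Finset.sum_le_sum hterm).trans (le_of_eq ?_)
    rw [Finset.sum_const, Finset.card_range, nsmul_eq_mul]
    push_cast; rfl
  rw [← nrm_sq]
  have h1 := nrm_sq rest
  have h2 := Real.sq_sqrt hp
  have h3 : nrm ((∑ τ ∈ Finset.range (X.T + 1), mask (Wrong t)
      (ap X.last (X.A (X.iota (X.lev c₁ τ) (found (P i) X.M v τ))))) + rest) ^ 2 ≤
      ((X.T + 1) * (2 * √(X.badProb S i)) + nrm rest) ^ 2 :=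
    pow_le_pow_left₀ (nrm_nonneg _) hall 2
  refine h3.trans ?_
  nlinarith [sq_nonneg ((X.T + 1) * (2 * √(X.badProb S i)) - nrm rest)]

end Ext

end ExtSim

/-! ### The output state of the extractor -/

namespace ExtSim

section

variable {w : ℕ}

theorem on_cxs {P : ℕ → Prop} {o o' N : ℕ} (h : ∀ a < N, P (o + a)) (h' : ∀ a < N, P (o' + a)) :
    On P (cxs o o' N) := by
  intro g hg
  obtain ⟨l, hl, rfl⟩ := List.mem_map.1 hg
  have := List.mem_range.1 hl
  exact ⟨h l this, h' l this⟩

theorem on_conj {P : ℕ → Prop} {c d j q N : ℕ} (hc : P c) (hd : P d) (hj : ∀ a < N, P (j + a))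
    (hq : ∀ a ≤ N, P (q + a)) : On P (conj c d j q N) := by
  intro g hg
  simp only [conj, List.mem_cons, List.mem_flatMap, List.not_mem_nil, or_false,
    List.mem_range] at hg
  rcases hg with rfl | ⟨a, ha, rfl | rfl | rfl⟩
  · exact ⟨hc, hd, hq 0 (Nat.zero_le _)⟩
  · exact hj a ha
  · exact ⟨hq a ha.le, hj a ha, hq (a + 1) ha⟩
  · exact hj a ha

theorem nsq_comp {f : Bits w → Bits w} (hf : ∀ b, f (f b) = b) (χ : Bits w → ℂ) :
    nsq (fun b => χ (f b)) = nsq χ :=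
  (Equiv.mk f f hf hf).sum_comp fun b => ‖χ b‖ ^ 2

theorem nsq_sum_of_ip {ι : Type} {κ : Type*} [Fintype ι] (s : Finset κ) (f : κ → ι → ℂ)
    (h : ∀ i ∈ s, ∀ j ∈ s, i ≠ j → ip (f i) (f j) = 0) :
    nsq (∑ i ∈ s, f i) = ∑ i ∈ s, nsq (f i) := by
  classical
  rw [nsq_eq_re, ip_sum_left, Complex.re_sum]
  refine Finset.sum_congr rfl fun i hi => ?_
  rw [ip_sum_right, Finset.sum_eq_single i (fun j hj hij => h i hi j hj hij.symm)
    fun h => absurd hi h, nsq_eq_re]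

theorem ip_eq_zero_of_supp {p q : Bits w → Prop} {φ χ : Bits w → ℂ} (hφ : Supp p φ) (hχ : Supp q χ)
    (h : ∀ b, p b → ¬ q b) : ip φ χ = 0 := by
  rw [ip_def]
  refine Finset.sum_eq_zero fun b _ => ?_
  by_cases hb : φ b = 0
  · rw [hb, star_zero, zero_mul]
  · rw [show χ b = 0 from by_contra fun h' => h b (hφ b hb) (hχ b h'), mul_zero]

end

namespace Ext

variable (X : Ext)

/-- The wires on which the string is computed. -/
def PC (a : ℕ) : Prop := X.W ≤ a ∨ a < X.oB ∨ X.oMI ≤ a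

theorem on_round (u : ℕ) (hu : u < X.T) : On X.PC (X.round u) := by
  have hs := X.spec
  have h1 : On X.PC (X.meaC X.oJ X.oMJ) := X.on_meaJ.mono fun a h => by
    unfold PJ at h; unfold PC; omega
  have h2 : On X.PC (X.smpC X.oJ) := X.on_smpJ.mono fun a h => by unfold PJ at h; unfold PC; omega
  have h3 : On X.PC (X.meaC X.oI X.oMI) := X.on_meaI.mono fun a h => by
    unfold PI at h; unfold PC; omega
  have h4 : On X.PC (conj (X.oL + u + 1) X.oMI X.oJ X.oC X.len) := by
    refine on_conj ?_ ?_ (fun a ha => ?_) fun a ha => ?_ <;> unfold PC <;> omega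
  refine ((((h1.append ?_).append h1.inv).append h2.inv).append ?_).append h2
  · intro g hg
    simp only [List.mem_cons, List.not_mem_nil, or_false] at hg
    rcases hg with rfl | rfl <;> simp only [Gate.On, PC] <;> omega
  · refine (h3.append ((h4.append ?_).append h4.inv)).append h3.inv
    intro g hg
    rw [List.eq_of_mem_replicate hg]
    simp only [Gate.On, PC]; omega

theorem on_comp : On X.PC X.comp := by
  have hs := X.spec
  have hA1 : On X.PC (X.algC X.oI X.oAI) := X.on_algC _ _ _ fun a h => by unfold PC; omega
  have hA2 : On X.PC (X.algC X.oJ X.oAJ) := X.on_algC _ _ _ fun a h => by unfold PC; omega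
  have h2 : On X.PC (X.smpC X.oJ) := X.on_smpJ.mono fun a h => by unfold PJ at h; unfold PC; omega
  have h3 : On X.PC X.finC := X.on_finC _ fun a h => by unfold PC; omega
  refine ((((((hA1.append (on_cxs ?_ ?_)).append hA1.inv).append h2).append ?_).append
    (On.flatMap fun u hu => X.on_round u (List.mem_range.1 hu))).append
    ((((on_cxs ?_ ?_ |>.append (on_cxs ?_ ?_)).append hA2).append (on_cxs ?_ ?_)).append h3))
  · intro a ha; unfold PC; omega
  · intro a ha; unfold PC; omega
  · intro g hg
    rw [List.mem_singleton.1 hg]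
    simp only [Gate.On, PC]; omega
  all_goals intro a ha; unfold PC; omega

/-- The circuit that computes the string, copies it if the flag is set, and uncomputes it. -/
def copy : List Gate :=
  X.comp ++ ccxs X.oB (X.oZ + (X.k + X.k) + (X.m + X.m)) X.oS X.r ++ inv X.comp

variable {X}

/-- If the string is nearly always `t`, then the circuit acts as if it wrote down `t`, because
uncomputing the string restores the state. -/
theorem nrm_copy_sub_le (t : Bits X.r) {χ : Bits X.W → ℂ}
    (hχ : Supp (fun b => bitAt b X.oB = true) χ) :
    nrm (ap X.copy χ - fun b => χ (xorAt X.oS t b)) ≤ 2 * nrm (mask (Wrong t) (ap X.comp χ)) := by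
  have hs := X.spec
  have hw : X.oS + X.r ≤ X.W := by omega
  have hR : X.oR = X.oZ + (X.k + X.k) + (X.m + X.m) := by rw [oR]; omega
  have hoR : X.oR + X.r ≤ X.oL := by omega
  set Y := ap X.comp χ with hY
  have hYs : Supp (fun b => bitAt b X.oB = true) Y := supp_of_mask_eq <|
    (Loc.ap X.on_comp).support (agree_bit (by unfold PC; omega)) hχ.mask_eq
  set cc := ccxs X.oB (X.oZ + (X.k + X.k) + (X.m + X.m)) X.oS X.r with hcc
  have hperm : ∀ φ : Bits X.W → ℂ, ap cc φ = fun b => φ (bwd cc b) := fun φ =>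
    ap_isPerm (isPerm_ccxs _ _ _ _) φ
  have hbit : ∀ (b : Bits X.W) a, bitAt (bwd cc b) a = if X.oS ≤ a ∧ a < X.oS + X.r then
      xor (bitAt b a) (bitAt b X.oB && bitAt b (X.oR + (a - X.oS))) else bitAt b a := fun b a => by
    rw [hR]
    exact bitAt_bwd_ccxs (by omega) (by omega) hw b a
  have hgood : ap cc (mask (fun b => ¬ Wrong t b) Y) =
      fun b => mask (fun b => ¬ Wrong t b) Y (xorAt X.oS t b) := by
    rw [hperm]
    funext b
    have e1 : slice (bwd cc b) X.oR X.r = slice b X.oR X.r := slice_congr fun a ha => by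
      rw [hbit, if_neg (by omega)]
    have e2 : slice (xorAt X.oS t b) X.oR X.r = slice b X.oR X.r := slice_congr fun a ha => by
      rw [bitAt_xorAt hw, if_neg (by omega)]
    have e3 : bitAt (bwd cc b) X.oB = bitAt b X.oB := by rw [hbit, if_neg (by omega)]
    have e4 : bitAt (xorAt X.oS t b) X.oB = bitAt b X.oB := by
      rw [bitAt_xorAt hw, if_neg (by omega)]
    simp only [mask, Wrong, e1, e2, not_not]
    by_cases h1 : slice b X.oR X.r = t
    · rw [if_pos h1, if_pos h1]
      by_cases h2 : bitAt b X.oB = true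
      · congr 1
        refine bits_ext fun a => ?_
        rw [hbit, bitAt_xorAt hw, h2, Bool.true_and]
        split_ifs with h3
        · rw [slice_eq_iff.1 h1 _ (by omega)]
        · rfl
      · rw [show Y (bwd cc b) = 0 from by_contra fun h => h2 (e3 ▸ hYs _ h),
          show Y (xorAt X.oS t b) = 0 from by_contra fun h => h2 (e4 ▸ hYs _ h)]
    · rw [if_neg h1, if_neg h1]
  have hdiff : (ap cc Y - fun b => Y (xorAt X.oS t b)) = ap cc (mask (Wrong t) Y) -
      fun b => mask (Wrong t) Y (xorAt X.oS t b) := by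
    conv_lhs => rw [← mask_add_mask_not (Wrong t) Y]
    rw [ap_add, hgood]
    funext b
    simp only [Pi.sub_apply, Pi.add_apply]
    ring
  have hinv : ap (inv X.comp) (fun b => Y (xorAt X.oS t b)) = fun b => χ (xorAt X.oS t b) := by
    rw [ap_comp X.on_comp.inv (agree_xorAt hw t fun a h => by unfold PC at h; omega)
      (xorAt_congr hw t), hY, ap_inv_ap]
  rw [copy, ap_append, ap_append, ← hinv, ← ap_sub, nrm_ap, hdiff]
  refine (nrm_sub_le _ _).trans (le_of_eq ?_)
  rw [nrm_ap, nrm, nrm, nsq_comp (xorAt_xorAt hw t)]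
  ring

/-- Nothing is copied if the flag is not set. -/
theorem copy_of_flag {χ : Bits X.W → ℂ} (hχ : Supp (fun b => bitAt b X.oB = false) χ) :
    ap X.copy χ = χ := by
  have hs := X.spec
  set Y := ap X.comp χ with hY
  have hYs : Supp (fun b => bitAt b X.oB = false) Y := supp_of_mask_eq <|
    (Loc.ap X.on_comp).support (agree_bit (by unfold PC; omega)) hχ.mask_eq
  have : ap (ccxs X.oB (X.oZ + (X.k + X.k) + (X.m + X.m)) X.oS X.r) Y = Y := by
    rw [ap_isPerm (isPerm_ccxs _ _ _ _)]
    funext b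
    have hbit := bitAt_bwd_ccxs (c := X.oB) (o := X.oZ + (X.k + X.k) + (X.m + X.m)) (o' := X.oS)
      (N := X.r) (by omega) (by omega) (by omega) b
    by_cases h : bitAt b X.oB = true
    · rw [show Y b = 0 from by_contra fun h' => by simpa [h] using hYs _ h']
      by_contra h'
      have : bitAt (bwd _ b) X.oB = false := hYs _ h'
      rw [hbit, if_neg (by omega), h] at this
      cases this
    · congr 1
      refine bits_ext fun a => ?_
      rw [hbit, Bool.eq_false_of_not_eq_true h]
      split_ifs
      · rw [Bool.false_and, Bool.xor_false]
      · rfl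
  rw [copy, ap_append, ap_append, this, hY, ap_inv_ap]

variable (X)

/-- The configuration after the index has been sampled. -/
def cfg (g : Bits (X.k + X.sampler.anc)) (v : Bool) : Bits X.W := fun j =>
  if X.oI ≤ (j : ℕ) ∧ (j : ℕ) < X.oB then bitAt g (j - X.oI) else
    if (j : ℕ) = X.oB then v else
      if X.oG ≤ (j : ℕ) ∧ (j : ℕ) < X.oMI then bitAt g (j - X.oG) else false

theorem bitAt_cfg (g : Bits (X.k + X.sampler.anc)) (v : Bool) (a : ℕ) : bitAt (X.cfg g v) a =
    if X.oI ≤ a ∧ a < X.oB then bitAt g (a - X.oI) else if a = X.oB then v else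
      if X.oG ≤ a ∧ a < X.oMI then bitAt g (a - X.oG) else false := by
  have hs := X.spec
  rcases lt_or_ge a X.W with h | h
  · simp [bitAt, h, cfg]
  · rw [bitAt_of_le h, if_neg (by omega), if_neg (by omega), if_neg (by omega)]

theorem slice_cfg (g : Bits (X.k + X.sampler.anc)) (v : Bool) :
    slice (X.cfg g v) X.oI X.k = slice g 0 X.k :=
  slice_congr fun a ha => by
    have hs := X.spec
    rw [bitAt_cfg, if_pos (by omega)]
    congr 1; omega

theorem start_cfg (g : Bits (X.k + X.sampler.anc)) (v : Bool) :
    X.Start (slice g 0 X.k) (X.cfg g v) :=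
  ⟨X.slice_cfg g v, fun a ha => by
    have hs := X.spec
    rw [bitAt_cfg, if_neg (by omega), if_neg (by omega), if_neg (by omega)]⟩

/-- The circuit that performs the measurement for `i` and writes the outcome down. -/
def flag : List Gate :=
  X.meaC X.oI X.oMI ++ [Gate.CX X.oMI X.oB] ++ inv (X.meaC X.oI X.oMI)

theorem ap_flag (χ : Bits X.W → ℂ) :
    ap X.flag χ = χ - X.AI χ + fun b => X.AI χ (flipBit b X.oB) := by
  have hs := X.spec
  have mid : ∀ χ : Bits X.W → ℂ, ap [Gate.CX X.oMI X.oB] χ =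
      χ - mask (fun b => bitAt b X.oMI = true) χ +
        fun b => mask (fun b => bitAt b X.oMI = true) χ (flipBit b X.oB) := by
    intro χ
    funext b
    have e1 : bitAt (flipBit b X.oB) X.oMI = bitAt b X.oMI := by
      rw [bitAt_flipBit, if_neg (by omega)]
    have n1 : X.oMI ≠ X.oB := by omega
    simp only [ap_cons, ap_nil, Gate.apply, mask, Pi.add_apply, Pi.sub_apply, e1, n1, ne_eq,
      not_false_eq_true, true_and]
    by_cases h : bitAt b X.oMI = true <;> simp [h]
  have hP : ¬ X.PI X.oB := by unfold PI; omega
  rw [flag, ap_append, ap_append, mid, ap_add, ap_sub, ap_inv_ap,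
    ap_comp X.on_meaI.inv (agree_flip hP) agree_flip_flip]
  rfl

/-- Sampling an index into the registers. -/
theorem ap_sample (φ : Bits X.n → ℂ) :
    ap (X.smpC X.oG ++ cxs X.oG X.oI X.k) (emb (fun _ => false) φ) =
      ∑ g, X.beta g • emb (X.cfg g false) φ := by
  have hs := X.spec
  have hd : X.oG + X.k ≤ X.oI ∨ X.oI + X.k ≤ X.oG := by omega
  have hw : X.oI + X.k ≤ X.W := by omega
  have hz : ∀ a, bitAt (fun _ => false : Bits X.W) a = false := fun a => by simp [bitAt]
  rw [ap_append, X.ap_smpC (by omega) (by omega) fun a _ _ => hz a, ap_sum]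
  refine Finset.sum_congr rfl fun g _ => ?_
  rw [ap_smul, emb_cxs (by omega) (by omega) hd hw]
  congr 2
  refine bits_ext fun a => ?_
  rw [bitAt_bwd_cxs hd hw, bitAt_withSample _ (by omega), bitAt_withSample _ (by omega), bitAt_cfg,
    hz]
  by_cases h1 : X.oI ≤ a ∧ a < X.oB
  · rw [if_pos (by omega), if_neg (by omega), if_pos (by omega), if_pos h1, Bool.false_xor]
    congr 1; omega
  · rw [if_neg (by omega), if_neg h1]
    by_cases h2 : X.oG ≤ a ∧ a < X.oMI
    · rw [if_pos (by omega), if_neg (by omega), if_pos h2]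
    · rw [if_neg (by omega), if_neg h2, ite_self]

/-- The configurations of the ideal output. -/
noncomputable def out (t : Bits X.r) (x : Bits (X.k + X.sampler.anc) × Bool) : Bits X.W :=
  if x.2 = true then xorAt X.oS t (X.cfg x.1 true) else X.cfg x.1 false

variable {X}

theorem bitAt_out (t : Bits X.r) (x : Bits (X.k + X.sampler.anc) × Bool) (a : ℕ)
    (ha : a < X.oS ∨ X.oS + X.r ≤ a) : bitAt (X.out t x) a = bitAt (X.cfg x.1 x.2) a := by
  have hs := X.spec
  obtain ⟨g, v⟩ := x
  rcases v
  · simp [out]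
  · rw [out, if_pos rfl, bitAt_xorAt (by omega), if_neg (by omega)]

theorem out_inj (t : Bits X.r) {x x' : Bits (X.k + X.sampler.anc) × Bool}
    (h : Agree (fun a => X.n ≤ a) (X.out t x) (X.out t x')) : x = x' := by
  have hs := X.spec
  have h' : ∀ a, X.n ≤ a → a < X.oS ∨ X.oS + X.r ≤ a →
      bitAt (X.cfg x.1 x.2) a = bitAt (X.cfg x'.1 x'.2) a := fun a h1 h2 => by
    rw [← bitAt_out t x a h2, ← bitAt_out t x' a h2, h a h1]
  refine Prod.ext (bits_ext fun a => ?_) ?_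
  · rcases lt_or_ge a (X.k + X.sampler.anc) with ha | ha
    · have := h' (X.oG + a) (by omega) (by omega)
      rw [bitAt_cfg, bitAt_cfg, if_neg (by omega), if_neg (by omega), if_pos (by omega),
        if_neg (by omega), if_neg (by omega), if_pos (by omega)] at this
      rwa [show X.oG + a - X.oG = a by omega] at this
    · rw [bitAt_of_le ha, bitAt_of_le ha]
  · have := h' X.oB (by omega) (by omega)
    rwa [bitAt_cfg, bitAt_cfg, if_neg (by omega), if_pos rfl, if_neg (by omega), if_pos rfl] at this

variable {C : Finset (Bits X.k)} {P : Bits X.k → Matrix (Bits X.n) (Bits X.n) ℂ}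
  {S : Finset (Bits X.k × Bits X.k)} {s : Bits X.k → Bits X.m} {t : Bits X.r}

variable (X C) in
open Classical in
/-- The outcomes of the sampler that give an index in `C`. -/
noncomputable def good : Finset (Bits (X.k + X.sampler.anc)) :=
  Finset.univ.filter fun g => slice g 0 X.k ∈ C

variable (P) in
/-- The projected states. -/
noncomputable def part (ψ : Bits X.n → ℂ) (x : Bits (X.k + X.sampler.anc) × Bool) : Bits X.n → ℂ :=
  (if x.2 = true then P (slice x.1 0 X.k) else 1 - P (slice x.1 0 X.k)) *ᵥ ψ

variable (C P) in
/-- The output of the extractor if the sampler and the computation of the string were perfect. -/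
noncomputable def ideal (t : Bits X.r) (ψ : Bits X.n → ℂ) : Bits X.W → ℂ :=
  ∑ x ∈ X.good C ×ˢ (Finset.univ : Finset Bool), emb (X.out t x) (X.beta x.1 • part P ψ x)

theorem sum_good (f : Bits X.k → ℝ) :
    ∑ g ∈ X.good C, f (slice g 0 X.k) * ‖X.beta g‖ ^ 2 = ∑ i ∈ C, X.sampleProb i * f i := by
  classical
  have hb := X.sum_beta fun j => if j ∈ C then f j else 0
  simp only [ite_mul, zero_mul] at hb
  rw [good, Finset.sum_filter, hb, ← Finset.sum_filter, Finset.filter_mem_eq_inter,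
    Finset.univ_inter]
  exact Finset.sum_congr rfl fun j _ => mul_comm _ _

theorem gates_eq : X.gates = (X.smpC X.oG ++ cxs X.oG X.oI X.k) ++ X.flag ++ X.copy := by
  simp only [gates, prep, flag, copy, List.append_assoc]

open Classical in
/-- The distance of the output state from the ideal output state. -/
theorem nrm_gates_sub_le (hX : Setting X C P S s t) {ψ : Bits X.n → ℂ} (hψ : nsq ψ = 1) :
    nrm (ap X.gates (emb (fun _ => false) ψ) - ideal C P t ψ) ≤
      2 * √(∑ i ∈ C, X.sampleProb i *
        (2 * failure (P i) X.M ψ X.T + 8 * (X.T + 1) ^ 2 * X.badProb S i)) +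
      √(1 - ∑ i ∈ C, X.sampleProb i) := by
  have hs := X.spec
  have hw : X.oS + X.r ≤ X.W := by omega
  -- `Y` and `N` are the states with positive and negative outcome, and `B` is the part of the
  -- sampled state with an index outside `C`
  set G := X.good C with hG
  have hGC : ∀ g ∈ G, slice g 0 X.k ∈ C := fun g hg => (Finset.mem_filter.1 hg).2
  set Y := ∑ g ∈ G, X.beta g • emb (X.cfg g true) (P (slice g 0 X.k) *ᵥ ψ) with hY
  set N := ∑ g ∈ G, X.beta g • emb (X.cfg g false) ((1 - P (slice g 0 X.k)) *ᵥ ψ) with hN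
  set B := ∑ g ∈ Finset.univ.filter fun g => ¬ slice g 0 X.k ∈ C,
    X.beta g • emb (X.cfg g false) ψ with hB
  have hflag : ∀ g ∈ G, ap X.flag (emb (X.cfg g false) ψ) =
      emb (X.cfg g true) (P (slice g 0 X.k) *ᵥ ψ) +
        emb (X.cfg g false) ((1 - P (slice g 0 X.k)) *ᵥ ψ) := fun g hg => by
    have hst := X.start_cfg g false
    rw [ap_flag, AI_emb hX.proj hX.meas (hGC g hg) hst.index (fun a h1 _ => hst.zero a h1),
      sub_mulVec, one_mulVec, emb_sub, add_comm]
    congr 1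
    refine emb_comp (fun b => ?_) (fun b _ => slice_congr fun a ha => by
      rw [bitAt_flipBit, if_neg (by omega)]) _
    refine forall_congr' fun a => forall_congr' fun ha => ?_
    rw [bitAt_flipBit, bitAt_cfg, bitAt_cfg]
    by_cases h1 : a = X.oB
    · subst h1
      rw [if_pos ⟨rfl, by omega⟩, if_neg (by omega), if_pos rfl, if_neg (by omega), if_pos rfl]
      rcases bitAt b X.oB <;> simp
    · rw [if_neg (fun h => h1 h.1), if_neg h1, if_neg h1]
  have hprep : ap ((X.smpC X.oG ++ cxs X.oG X.oI X.k) ++ X.flag) (emb (fun _ => false) ψ) =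
      Y + N + ap X.flag B := by
    rw [ap_append, ap_sample, ← Finset.sum_filter_add_sum_filter_not Finset.univ
      (fun g : Bits (X.k + X.sampler.anc) => slice g 0 X.k ∈ C), ap_add, ap_sum, ← hB]
    congr 1
    rw [hY, hN, ← Finset.sum_add_distrib]
    refine Finset.sum_congr rfl fun g hg => ?_
    rw [ap_smul, hflag g hg, smul_add]
  have hY' : Supp (fun b => bitAt b X.oB = true) Y := supp_of_mask_eq <| by
    rw [hY, mask_sum]
    refine Finset.sum_congr rfl fun g _ => ?_
    rw [mask_smul, mask_emb_pos]
    intro b hb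
    rw [hb _ (by omega), bitAt_cfg, if_neg (by omega), if_pos rfl]
  have hN' : Supp (fun b => bitAt b X.oB = false) N := supp_of_mask_eq <| by
    rw [hN, mask_sum]
    refine Finset.sum_congr rfl fun g _ => ?_
    rw [mask_smul, mask_emb_pos]
    intro b hb
    rw [hb _ (by omega), bitAt_cfg, if_neg (by omega), if_pos rfl]
  have hid : ideal C P t ψ = (fun b => Y (xorAt X.oS t b)) + N := by
    rw [ideal, Finset.sum_product, hN]
    have : (fun b => Y (xorAt X.oS t b)) = ∑ g ∈ G, X.beta g •
        emb (X.out t (g, true)) (P (slice g 0 X.k) *ᵥ ψ) := by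
      funext b
      rw [hY, Finset.sum_apply, Finset.sum_apply]
      refine Finset.sum_congr rfl fun g _ => ?_
      rw [Pi.smul_apply, Pi.smul_apply, out, if_pos rfl,
        ← emb_xorAt (by omega : X.n ≤ X.oS) hw]
    rw [this, ← Finset.sum_add_distrib]
    refine Finset.sum_congr rfl fun g _ => ?_
    rw [Fintype.sum_bool, emb_smul, emb_smul, part, if_pos rfl, part, if_neg (by simp)]
    congr 2
  have hdist : ap X.gates (emb (fun _ => false) ψ) - ideal C P t ψ =
      (ap X.copy Y - fun b => Y (xorAt X.oS t b)) + ap X.copy (ap X.flag B) := by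
    rw [gates_eq, ap_append, hprep, ap_add, ap_add, copy_of_flag hN', hid]
    abel
  have hnB : nsq B = 1 - ∑ i ∈ C, X.sampleProb i := by
    have h1 := nsq_sum_emb X.n_le (Finset.univ.filter fun g => ¬ slice g 0 X.k ∈ C)
      (fun g => X.cfg g false) (fun g _ g' _ h => by
        have := out_inj t (x := (g, false)) (x' := (g', false)) (by
          simpa only [out, Bool.false_eq_true, if_false] using h)
        exact congrArg Prod.fst this) fun g => X.beta g • ψ
    simp only [emb_smul, nsq_smul, hψ, mul_one] at h1
    rw [hB, h1]
    have h2 := sum_good (X := X) (C := C) fun _ => 1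
    have h3 := X.sum_beta fun _ => 1
    simp only [one_mul, mul_one] at h2 h3
    rw [X.sum_sampleProb, ← Finset.sum_filter_add_sum_filter_not Finset.univ
      (fun g : Bits (X.k + X.sampler.anc) => slice g 0 X.k ∈ C)] at h3
    rw [← h2, ← h3, good]
    ring
  -- the register of the sampler keeps the contributions of different indices orthogonal
  have hwrong : nsq (mask (Wrong t) (ap X.comp Y)) ≤ ∑ i ∈ C, X.sampleProb i *
      (2 * failure (P i) X.M ψ X.T + 8 * (X.T + 1) ^ 2 * X.badProb S i) := by
    set y := fun g => mask (Wrong t) (ap X.comp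
      (emb (X.cfg g true) (P (slice g 0 X.k) *ᵥ ψ))) with hy
    have e1 : mask (Wrong t) (ap X.comp Y) = ∑ g ∈ G, X.beta g • y g := by
      simp only [hY, ap_sum, mask_sum, ap_smul, mask_smul, hy]
    have hsupp : ∀ g, Supp (fun b => slice b X.oG (X.k + X.sampler.anc) = g) (y g) := by
      intro g
      have h1 : Supp (fun b => slice b X.oG (X.k + X.sampler.anc) = g)
          (ap X.comp (emb (X.cfg g true) (P (slice g 0 X.k) *ᵥ ψ))) := by
        refine supp_of_mask_eq ((Loc.ap X.on_comp).support (fun b b' h hb => ?_) ?_)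
        · rw [← hb]
          refine slice_congr fun a ha => (h _ ?_).symm
          unfold PC; omega
        · refine mask_emb_pos (fun b hb => slice_eq_iff.2 fun a ha => ?_) _
          rw [hb _ (by omega), bitAt_cfg, if_neg (by omega), if_neg (by omega), if_pos (by omega)]
          congr 1; omega
      intro b hb
      refine h1 b fun h => hb ?_
      simp only [hy, mask]
      split_ifs
      · exact h
      · rfl
    rw [e1, nsq_sum_of_ip]
    · rw [← sum_good fun i => 2 * failure (P i) X.M ψ X.T + 8 * (X.T + 1) ^ 2 * X.badProb S i]
      refine Finset.sum_le_sum fun g hg => ?_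
      rw [nsq_smul, mul_comm]
      exact mul_le_mul_of_nonneg_right (nsq_wrong hX (hGC g hg) (X.start_cfg g true) ψ hψ.le)
        (by positivity)
    · intro g _ g' _ hne
      rw [ip_smul_left, ip_smul_right, ip_eq_zero_of_supp (hsupp g) (hsupp g') fun b hb hb' =>
        hne (hb.symm.trans hb'), mul_zero, mul_zero]
  rw [hdist]
  refine (nrm_add_le _ _).trans (add_le_add ((nrm_copy_sub_le t hY').trans ?_) ?_)
  · exact mul_le_mul_of_nonneg_left (Real.sqrt_le_sqrt hwrong) zero_le_two
  · rw [nrm_ap, nrm_ap, nrm, hnB]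

end Ext

end ExtSim

/-! ### Distinguishers -/

namespace ExtSim

theorem sum_comm₄ {A A' B B' R : Type*} [Fintype A] [Fintype A'] [Fintype B] [Fintype B']
    [AddCommMonoid R] (F : A → A' → B → B' → R) :
    ∑ a, ∑ a', ∑ b, ∑ b', F a a' b b' = ∑ b, ∑ b', ∑ a, ∑ a', F a a' b b' :=
  calc _ = ∑ p : A × A', ∑ q : B × B', F p.1 p.2 q.1 q.2 := by simp only [Fintype.sum_prod_type]
    _ = ∑ q : B × B', ∑ p : A × A', F p.1 p.2 q.1 q.2 := Finset.sum_comm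
    _ = _ := by simp only [Fintype.sum_prod_type]

/-- The expectation of an effect. -/
noncomputable def expect {n : ℕ} (E : Matrix (Bits n) (Bits n) ℂ) (φ : Bits n → ℂ) : ℝ :=
  (ip φ (E *ᵥ φ)).re

section Effect

variable {w n : ℕ} {Y : Type}

/-- The operator on all wires that applies to the first `n` wires the effect that `E` prescribes
for the classical value on the other wires. -/
noncomputable def effect (E : Y → Matrix (Bits n) (Bits n) ℂ) (read : Bits w → Y) :
    Matrix (Bits w) (Bits w) ℂ := fun b b' =>
  open Classical in
  if Agree (fun a => n ≤ a) b b' then E (read b) (slice b 0 n) (slice b' 0 n) else 0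

variable {E : Y → Matrix (Bits n) (Bits n) ℂ} {read : Bits w → Y}

theorem effect_emb (hn : n ≤ w)
    (hr : ∀ b b', Agree (fun a => n ≤ a) b b' → read b = read b') (c : Bits w) (φ : Bits n → ℂ) :
    effect E read *ᵥ emb c φ = emb c (E (read c) *ᵥ φ) := by
  classical
  funext b
  have h0 : 0 + n ≤ w := by omega
  rw [mulVec, dotProduct]
  by_cases hb : Agree (fun a => n ≤ a) b c
  · rw [emb, if_pos hb, mulVec, dotProduct, ← sum_agree (shift_emb h0) c]
    refine Finset.sum_congr rfl fun b' _ => ?_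
    by_cases hb' : Agree (fun a => n ≤ a) b' c
    · rw [effect, if_pos (hb.trans hb'.symm), emb, if_pos hb', if_pos (agree_shift.2 hb'),
        pull_shift h0, hr b c hb]
    · rw [emb, if_neg hb', if_neg fun h => hb' (agree_shift.1 h), mul_zero]
  · rw [emb, if_neg hb]
    refine Finset.sum_eq_zero fun b' _ => ?_
    by_cases hb' : Agree (fun a => n ≤ a) b' c
    · rw [effect, if_neg fun h => hb (h.trans hb'), zero_mul]
    · rw [emb, if_neg hb', mul_zero]

open Classical in
/-- Every vector is a superposition over the configurations of the wires from `n` on. -/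
theorem exists_sum_emb (hn : n ≤ w) : ∃ R : Finset (Bits w),
    (∀ c ∈ R, ∀ c' ∈ R, Agree (fun a => n ≤ a) c c' → c = c') ∧
      ∀ Ω : Bits w → ℂ, Ω = ∑ c ∈ R, emb c (res n c Ω) := by
  refine ⟨Finset.univ.filter fun c => slice c 0 n = fun _ => false, fun c hc c' hc' h => ?_,
    fun Ω => ?_⟩
  · have h1 := slice_eq_iff.1 (Finset.mem_filter.1 hc).2
    have h2 := slice_eq_iff.1 (Finset.mem_filter.1 hc').2
    refine bits_ext fun a => ?_
    rcases lt_or_ge a n with ha | ha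
    · have e1 := h1 a ha
      have e2 := h2 a ha
      rw [zero_add] at e1 e2
      rw [e1, e2]
    · exact h a ha
  · funext b
    rw [Finset.sum_apply, Finset.sum_eq_single (put (shift 0 n w) b fun _ => false)]
    · have h := agree_put_shift b fun _ : Fin n => false
      rw [emb, if_pos h.symm, res, fib, put_slice hn h.symm]
    · intro c hc hne
      rw [emb, if_neg]
      intro h
      refine hne (bits_ext fun a => ?_)
      have e0 := slice_eq_iff.1 (Finset.mem_filter.1 hc).2
      have e1 := slice_eq_iff.1 (slice_put hn b fun _ => false)
      have e2 := agree_put_shift b fun _ : Fin n => false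
      rcases lt_or_ge a n with ha | ha
      · have e3 := e0 a ha
        have e4 := e1 a ha
        rw [zero_add] at e3 e4
        rw [e3, e4]
      · rw [e2 a ha, h a ha]
    · intro h
      refine absurd ?_ h
      rw [Finset.mem_filter]
      exact ⟨Finset.mem_univ _, slice_put hn b _⟩

theorem ip_effect_sum (hn : n ≤ w) (hr : ∀ b b', Agree (fun a => n ≤ a) b b' → read b = read b')
    {κ : Type*} (s : Finset κ) (c : κ → Bits w)
    (hc : ∀ h ∈ s, ∀ h' ∈ s, Agree (fun a => n ≤ a) (c h) (c h') → h = h') (φ φ' : κ → Bits n → ℂ) :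
    ip (∑ h ∈ s, emb (c h) (φ h)) (effect E read *ᵥ ∑ h ∈ s, emb (c h) (φ' h)) =
      ∑ h ∈ s, ip (φ h) (E (read (c h)) *ᵥ φ' h) := by
  rw [mulVec_sum]
  simp only [effect_emb hn hr]
  exact ip_sum_emb hn s c hc _ _

theorem isHermitian_effect (hn : n ≤ w)
    (hr : ∀ b b', Agree (fun a => n ≤ a) b b' → read b = read b') (hE : ∀ y, (E y).IsHermitian) :
    (effect E read).IsHermitian := isHermitian_of_ip fun φ φ' => by
  obtain ⟨R, hR, hΩ⟩ := exists_sum_emb (n := n) hn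
  rw [← star_ip φ', hΩ φ, hΩ φ', ip_effect_sum hn hr R _ hR, ip_effect_sum hn hr R _ hR, star_sum]
  refine Finset.sum_congr rfl fun c _ => ?_
  rw [star_ip, ip_mulVec, (hE _).eq]

theorem nsq_le_of_posSemidef {A : Matrix (Bits n) (Bits n) ℂ} (h : A.PosSemidef)
    (h' : (1 - A).PosSemidef) (φ : Bits n → ℂ) : 0 ≤ expect A φ ∧ expect A φ ≤ nsq φ := by
  constructor
  · exact (Complex.le_def.1 (h.dotProduct_mulVec_nonneg φ)).1
  · have := (Complex.le_def.1 (h'.dotProduct_mulVec_nonneg φ)).1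
    rw [sub_mulVec, one_mulVec, dotProduct_sub, Complex.sub_re, Complex.zero_re] at this
    rw [nsq_eq_re]
    exact sub_nonneg.1 this

/-- Effects do not increase the norm. -/
theorem nrm_effect_le (hn : n ≤ w)
    (hr : ∀ b b', Agree (fun a => n ≤ a) b b' → read b = read b')
    (hE : ∀ y, (E y).PosSemidef ∧ (1 - E y).PosSemidef) (Ω : Bits w → ℂ) :
    nrm (effect E read *ᵥ Ω) ≤ nrm Ω := by
  obtain ⟨R, hR, hΩ⟩ := exists_sum_emb (n := n) hn
  have hb : ∀ Ω : Bits w → ℂ, 0 ≤ (ip Ω (effect E read *ᵥ Ω)).re ∧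
      (ip Ω (effect E read *ᵥ Ω)).re ≤ nsq Ω := fun Ω => by
    have h := fun c => nsq_le_of_posSemidef (hE (read c)).1 (hE (read c)).2 (res n c Ω)
    have hn' := nsq_sum_emb hn R (fun c => c) hR fun c => res n c Ω
    rw [← hΩ] at hn'
    rw [hn']
    have : (ip Ω (effect E read *ᵥ Ω)).re = ∑ c ∈ R, expect (E (read c)) (res n c Ω) := by
      conv_lhs => rw [hΩ Ω]
      rw [ip_effect_sum hn hr R _ hR, Complex.re_sum]
      rfl
    rw [this]
    exact ⟨Finset.sum_nonneg fun c _ => (h c).1, Finset.sum_le_sum fun c _ => (h c).2⟩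
  exact Real.sqrt_le_sqrt ((nsq_mulVec_le (isHermitian_effect hn hr fun y => (hE y).1.isHermitian)
    (fun Ω => (hb Ω).1) (fun Ω => (hb Ω).2) Ω).trans (hb Ω).2)

/-- The acceptance probability is the expectation of the effect. -/
theorem sum_trace_cqOutput [Fintype Y] [DecidableEq Y] (Ω : Bits w → ℂ)
    (hr : ∀ b b', Agree (fun a => n ≤ a) b b' → read b = read b') :
    ∑ y, (E y * cqOutput Ω read 0 n y).trace = ip Ω (effect E read *ᵥ Ω) := by
  classical
  have hagree : ∀ b b' : Bits w, (∀ j : Fin w, ¬ (0 ≤ (j : ℕ) ∧ (j : ℕ) < 0 + n) → b j = b' j) ↔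
      Agree (fun a => n ≤ a) b b' := fun b b' => by
    constructor
    · intro h a ha
      rcases lt_or_ge a w with hw | hw
      · have := h ⟨a, hw⟩ (by simp; omega)
        simpa [bitAt, hw] using this
      · rw [bitAt_of_le hw, bitAt_of_le hw]
    · intro h j hj
      have := h j (by omega)
      simpa [bitAt] using this
  have h1 : ∀ y, (E y * cqOutput Ω read 0 n y).trace = ∑ b, ∑ b',
      if read b = y ∧ read b' = y ∧ Agree (fun a => n ≤ a) b b' then
        E y (slice b' 0 n) (slice b 0 n) * (Ω b * star (Ω b')) else 0 := fun y => by
    simp only [trace, diag_apply, mul_apply, cqOutput, Finset.mul_sum]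
    rw [sum_comm₄]
    refine Finset.sum_congr rfl fun b _ => Finset.sum_congr rfl fun b' _ => ?_
    rw [Finset.sum_eq_single (slice b' 0 n), Finset.sum_eq_single (slice b 0 n)]
    · rw [mul_ite, mul_zero]
      by_cases h : read b = y ∧ read b' = y ∧ Agree (fun a => n ≤ a) b b'
      · rw [if_pos h, if_pos ⟨h.1, h.2.1, rfl, rfl, (hagree b b').2 h.2.2⟩]
      · rw [if_neg h, if_neg fun h' => h ⟨h'.1, h'.2.1, (hagree b b').1 h'.2.2.2.2⟩]
    · intro a _ ha
      rw [if_neg fun h => ha h.2.2.1.symm, mul_zero]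
    · simp
    · intro a _ ha
      refine Finset.sum_eq_zero fun a' _ => ?_
      rw [if_neg fun h => ha h.2.2.2.1.symm, mul_zero]
    · simp
  simp only [h1]
  rw [Finset.sum_comm, ip_def]
  simp only [mulVec, dotProduct, Finset.mul_sum]
  rw [Finset.sum_comm (γ := Bits w) (s := Finset.univ) (t := Finset.univ)
    (f := fun b b' => star (Ω b) * (effect E read b b' * Ω b'))]
  refine Finset.sum_congr rfl fun b _ => ?_
  rw [Finset.sum_comm]
  refine Finset.sum_congr rfl fun b' _ => ?_
  rw [effect, Finset.sum_eq_single (read b)]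
  · by_cases h : Agree (fun a => n ≤ a) b b'
    · rw [if_pos ⟨rfl, (hr b b' h).symm, h⟩, if_pos h.symm, hr b b' h]
      ring
    · rw [if_neg fun h' => h h'.2.2, if_neg fun h' => h h'.symm]
      ring
  · intro y _ hy
    rw [if_neg fun h => hy h.1.symm]
  · simp

end Effect

theorem trace_mul_ketbra {n : ℕ} (A : Matrix (Bits n) (Bits n) ℂ) (v : Bits n → ℂ) :
    (A * ketbra v).trace = ip v (A *ᵥ v) := by
  rw [ketbra, mul_vecMulVec, trace_vecMulVec, dotProduct_comm]
  rfl

/-- The contribution of the index `i` to the acceptance probability. -/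
noncomputable def acceptAt {k r n : ℕ} (E : CQ k r n) (P : Bits k → Matrix (Bits n) (Bits n) ℂ)
    (t : Bits r) (ψ : Bits n → ℂ) (i : Bits k) : ℝ :=
  expect (E (i, some t)) (P i *ᵥ ψ) + expect (E (i, none)) ((1 - P i) *ᵥ ψ)

theorem acceptProb_experiment {k r n : ℕ} (E : CQ k r n) (C : Finset (Bits k))
    (P : Bits k → Matrix (Bits n) (Bits n) ℂ) (t : Bits r) (ψ : Bits n → ℂ) :
    acceptProb E (experiment C P t ψ) = ∑ i ∈ C, 1 / (C.card : ℝ) * acceptAt E P t ψ i := by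
  classical
  have hre : ∀ (A : Matrix (Bits n) (Bits n) ℂ) v,
      ((A * ((1 / (C.card : ℂ)) • ketbra v)).trace).re = 1 / (C.card : ℝ) * expect A v := by
    intro A v
    rw [Matrix.mul_smul, trace_smul, trace_mul_ketbra, smul_eq_mul, expect,
      show (1 / (C.card : ℂ)) = ((1 / (C.card : ℝ) : ℝ) : ℂ) by push_cast; rfl,
      Complex.re_ofReal_mul]
  rw [acceptProb, Fintype.sum_prod_type, ← Finset.sum_subset (Finset.subset_univ C)]
  · refine Finset.sum_congr rfl fun i hi => ?_
    rw [Fintype.sum_option, Finset.sum_eq_single t]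
    · simp only [experiment]
      rw [if_pos hi, if_pos ⟨hi, trivial⟩, hre, hre, acceptAt]
      ring
    · intro s _ hs
      simp only [experiment]
      rw [if_neg fun h => hs h.2, Matrix.mul_zero, trace_zero, Complex.zero_re]
    · simp
  · intro i _ hi
    refine Finset.sum_eq_zero fun o _ => ?_
    rcases o with _ | s
    · simp only [experiment]
      rw [if_neg hi, Matrix.mul_zero, trace_zero, Complex.zero_re]
    · simp only [experiment]
      rw [if_neg fun h => hi h.1, Matrix.mul_zero, trace_zero, Complex.zero_re]

theorem nsq_proj_add {n : ℕ} {p : Matrix (Bits n) (Bits n) ℂ} (h : IsStarProjection p)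
    (ψ : Bits n → ℂ) : nsq (p *ᵥ ψ) + nsq ((1 - p) *ᵥ ψ) = nsq ψ := by
  have e1 : ip (p *ᵥ ψ) (p *ᵥ ψ) = ip ψ (p *ᵥ ψ) := by
    rw [ip_mulVec p (p *ᵥ ψ), star_proj h, mulVec_mulVec, proj_mul h, ip_mulVec, star_proj h]
  have e2 : ip (p *ᵥ ψ) ψ = ip ψ (p *ᵥ ψ) := by rw [ip_mulVec p ψ ψ, star_proj h]
  rw [sub_mulVec, one_mulVec, nsq_eq_re, nsq_eq_re, nsq_eq_re, ip_sub_left, ip_sub_right,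
    ip_sub_right, e1, e2, ← Complex.add_re]
  congr 1
  ring

theorem acceptAt_mem {k r n : ℕ} {E : CQ k r n} (hE : IsDistinguisher E)
    {P : Bits k → Matrix (Bits n) (Bits n) ℂ} {i : Bits k} (hP : IsStarProjection (P i))
    (t : Bits r) {ψ : Bits n → ℂ} (hψ : nsq ψ = 1) :
    0 ≤ acceptAt E P t ψ i ∧ acceptAt E P t ψ i ≤ 1 := by
  have h1 := nsq_le_of_posSemidef (hE (i, some t)).1 (hE (i, some t)).2 (P i *ᵥ ψ)
  have h2 := nsq_le_of_posSemidef (hE (i, none)).1 (hE (i, none)).2 ((1 - P i) *ᵥ ψ)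
  have h3 := nsq_proj_add hP ψ
  rw [hψ] at h3
  exact ⟨add_nonneg h1.1 h2.1, by rw [acceptAt]; linarith⟩

namespace Ext

variable {X : Ext}

variable (X) in
/-- The classical part of the output. -/
def read (z : Bits X.W) : Bits X.k × Option (Bits X.r) :=
  (slice z X.n X.k,
    if bitAt z (X.n + X.k) = true then some (slice z (X.n + X.k + 1) X.r) else none)

theorem read_congr (b b' : Bits X.W) (h : Agree (fun a => X.n ≤ a) b b') : X.read b = X.read b' :=
    by
  rw [read, read, h _ (by omega), slice_congr fun a _ => h _ (by omega),
    slice_congr (o := X.n + X.k + 1) fun a _ => h _ (by omega)]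

variable {C : Finset (Bits X.k)} {P : Bits X.k → Matrix (Bits X.n) (Bits X.n) ℂ}
  {S : Finset (Bits X.k × Bits X.k)} {s : Bits X.k → Bits X.m} {t : Bits X.r}

theorem read_out (x : Bits (X.k + X.sampler.anc) × Bool) :
    X.read (X.out t x) = (slice x.1 0 X.k, if x.2 = true then some t else none) := by
  have hs := X.spec
  have h1 : slice (X.out t x) X.n X.k = slice x.1 0 X.k := by
    rw [← X.slice_cfg x.1 x.2]
    exact slice_congr fun a ha => bitAt_out t x _ (by omega)
  have h2 : bitAt (X.out t x) (X.n + X.k) = x.2 := by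
    rw [bitAt_out t x _ (by omega), bitAt_cfg, if_neg (by omega), if_pos (by omega)]
  rw [read, h1, h2]
  congr 1
  split_ifs with h
  · congr 1
    refine slice_eq_iff.2 fun a ha => ?_
    rw [out, if_pos h, bitAt_xorAt (by omega), if_pos (by omega), bitAt_cfg, if_neg (by omega),
      if_neg (by omega), if_neg (by omega), Bool.false_xor]
    congr 1; omega
  · rfl

theorem expect_smul {n : ℕ} (A : Matrix (Bits n) (Bits n) ℂ) (a : ℂ) (φ : Bits n → ℂ) :
    expect A (a • φ) = ‖a‖ ^ 2 * expect A φ := by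
  rw [expect, mulVec_smul, ip_smul_left, ip_smul_right, ← mul_assoc, Complex.star_def, mul_comm _ a,
    Complex.mul_conj, Complex.normSq_eq_norm_sq, Complex.re_ofReal_mul, expect]

/-- The ideal output state is accepted like the experiment with the distribution of the sampler. -/
theorem expect_ideal (E : CQ X.k X.r X.n) (ψ : Bits X.n → ℂ) :
    expect (effect E X.read) (ideal C P t ψ) = ∑ i ∈ C, X.sampleProb i * acceptAt E P t ψ i := by
  rw [expect, ideal, ip_effect_sum X.n_le read_congr _ _ fun x _ x' _ h => out_inj t h,
    Complex.re_sum, Finset.sum_product, ← sum_good]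
  refine Finset.sum_congr rfl fun g _ => ?_
  rw [Fintype.sum_bool, read_out, read_out, part, part]
  change expect _ _ + expect _ _ = _
  rw [expect_smul, expect_smul, acceptAt]
  simp only [if_true, Bool.false_eq_true, if_false]
  ring

theorem nsq_ideal_le (hP : ∀ i ∈ C, IsStarProjection (P i)) {ψ : Bits X.n → ℂ} (hψ : nsq ψ = 1) :
    nsq (ideal C P t ψ) ≤ 1 := by
  rw [ideal, nsq_sum_emb X.n_le _ _ fun x _ x' _ h => out_inj t h, Finset.sum_product]
  have h1 : ∀ g ∈ X.good C, ∑ v, nsq (X.beta g • part P ψ (g, v)) = 1 * ‖X.beta g‖ ^ 2 := by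
    intro g hg
    have hg : slice g 0 X.k ∈ C := by
      classical exact (Finset.mem_filter.1 hg).2
    rw [Fintype.sum_bool, nsq_smul, nsq_smul, part, part]
    simp only [if_true, Bool.false_eq_true, if_false]
    have := nsq_proj_add (hP _ hg) ψ
    rw [← mul_add, this, hψ]
    ring
  rw [Finset.sum_congr rfl h1, sum_good fun _ => 1]
  simp only [mul_one]
  rw [← X.sum_sampleProb]
  exact Finset.sum_le_sum_of_subset_of_nonneg (Finset.subset_univ _)
    fun i _ _ => X.sampleProb_nonneg i

/-- Nearby states are accepted with nearly the same probability. -/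
theorem abs_expect_sub_le {E : CQ X.k X.r X.n} (hE : IsDistinguisher E) {Ω Ω' : Bits X.W → ℂ}
    (hΩ : nsq Ω ≤ 1) (hΩ' : nsq Ω' ≤ 1) :
    |expect (effect E X.read) Ω - expect (effect E X.read) Ω'| ≤ 2 * nrm (Ω - Ω') := by
  have h1 : nrm Ω ≤ 1 := Real.sqrt_le_one.2 hΩ
  have h2 : nrm Ω' ≤ 1 := Real.sqrt_le_one.2 hΩ'
  have e : ip Ω (effect E X.read *ᵥ Ω) - ip Ω' (effect E X.read *ᵥ Ω') =
      ip Ω (effect E X.read *ᵥ (Ω - Ω')) + ip (Ω - Ω') (effect E X.read *ᵥ Ω') := by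
    rw [mulVec_sub, ip_sub_right, ip_sub_left]; ring
  have b : ∀ φ χ : Bits X.W → ℂ, ‖ip φ (effect E X.read *ᵥ χ)‖ ≤ nrm φ * nrm χ := fun φ χ =>
    (norm_ip_le _ _).trans
      (mul_le_mul_of_nonneg_left (nrm_effect_le X.n_le read_congr hE χ) (nrm_nonneg _))
  rw [expect, expect, ← Complex.sub_re, e]
  refine (Complex.abs_re_le_norm _).trans ((norm_add_le _ _).trans ?_)
  have h3 := nrm_nonneg (Ω - Ω')
  nlinarith [b Ω (Ω - Ω'), b (Ω - Ω') Ω', mul_le_mul_of_nonneg_right h1 h3,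
    mul_le_mul_of_nonneg_left h2 h3]

end Ext

end ExtSim

/-! ### Writing down the circuit of the extractor -/

namespace ExtSim

/-- The inverse of a list of gates whose wires are given by expressions. -/
def Emit.inv (l : List Emit) : List Emit :=
  l.reverse.flatMap fun e => match e.1 with
    | .T => List.replicate 7 e
    | _ => [e]

/-- The program that writes down the inverse circuit. -/
def Gen.inv : Gen → Gen
  | emit l => emit (Emit.inv l)
  | seq p q => seq q.inv p.inv
  | loop up x e body => loop (!up) x e body.inv
  | each c rev body => each c (!rev) fun k => Emit.inv (body k)

theorem Emit.map_inv (env : Fin 16 → ℕ) (l : List Emit) :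
    (Emit.inv l).map (Emit.gate env) = ExtSim.inv (l.map (Emit.gate env)) := by
  rw [Emit.inv, ExtSim.inv, ← List.map_reverse, List.map_flatMap, List.flatMap_map]
  congr 1
  funext ⟨k, a, b, c⟩
  cases k <;> rfl

theorem inv_flatMap {α : Type*} (f : α → List Gate) (l : List α) :
    inv (l.flatMap f) = l.reverse.flatMap fun x => inv (f x) := by
  induction l with
  | nil => rfl
  | cons x l ih => rw [List.flatMap_cons, inv_append, ih]; simp

/-- The inverse of a program writes down the inverse circuit. -/
theorem Gen.eval_inv (cs : Fin 4 → List Gate) (G : Gen) : ∀ env : Fin 16 → ℕ,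
    G.inv.eval cs env = ExtSim.inv (G.eval cs env) := by
  induction G with
  | emit l => exact fun env => Emit.map_inv env l
  | seq p q hp hq => intro env; rw [inv, eval, eval, inv_append, hp, hq]
  | loop up x e body ih =>
    intro env
    rw [inv, eval, eval, inv_flatMap]
    simp only [ih]
    cases up <;> simp
  | each c rev body =>
    intro env
    rw [inv, eval, eval, inv_flatMap]
    simp only [Emit.map_inv]
    cases rev <;> simp

namespace Expr

/-- The expression for `if a < b then c else d`. -/
def ite (a b c d : Expr) : Expr :=
  add (mul c (sub (const 1) (sub (const 1) (sub b a)))) (mul d (sub (const 1) (sub b a)))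

theorem eval_ite (env : Fin 16 → ℕ) (a b c d : Expr) : (ite a b c d).eval env =
    if a.eval env < b.eval env then c.eval env else d.eval env := by
  simp only [ite, eval]
  split_ifs with h
  · rw [show 1 - (b.eval env - a.eval env) = 0 by omega]; simp
  · rw [show b.eval env - a.eval env = 0 by omega]; simp

/-- The expression for `relo`. -/
def relo (n1 n2 q o1 o2 o3 w a : Expr) : Expr :=
  ite a n1 (add o1 a) (ite a (add n1 n2) (add o2 (sub a n1))
    (ite a q (add o3 (sub a (add n1 n2))) w))

theorem eval_relo (env : Fin 16 → ℕ) (n1 n2 q o1 o2 o3 w a : Expr) :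
    (relo n1 n2 q o1 o2 o3 w a).eval env = ExtSim.relo (n1.eval env) (n2.eval env) (q.eval env)
      (o1.eval env) (o2.eval env) (o3.eval env) (w.eval env) (a.eval env) := by
  simp only [relo, eval_ite, eval, ExtSim.relo]

/-- The length of an index. -/
def k : Expr := var 6
/-- The number of qubits of the quantum register. -/
def n : Expr := var 7
/-- The length of the output of the first algorithm. -/
def m : Expr := var 8
/-- The length of the output of the second algorithm. -/
def r : Expr := var 9
/-- The number of ancillas of the sampler. -/
def sa : Expr := var 10
/-- The number of ancillas of the measurement. -/
def ma : Expr := var 11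
/-- The number of ancillas of the first algorithm. -/
def a0 : Expr := var 12
/-- The number of ancillas of the second algorithm. -/
def a1 : Expr := var 13
/-- The number of rounds. -/
def T : Expr := mul (const 256) (mul (mul (var 5) (var 5)) (mul (var 5) (var 5)))
def smp : Expr := add k sa
/-- The number of wires for the outcome and the ancillas of the measurement. -/
def mea : Expr := add (const 1) ma
/-- The number of wires for the output and the ancillas of the first algorithm. -/
def alg : Expr := add m a0
/-- The number of wires of the second algorithm. -/
def fin : Expr := add (add (add (add k k) (add m m)) r) a1
/-- The expression for `Ext.oI`. -/
def oI : Expr := n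
/-- The expression for `Ext.oB`. -/
def oB : Expr := add oI k
/-- The expression for `Ext.oS`. -/
def oS : Expr := add oB (const 1)
/-- The expression for `Ext.oG`. -/
def oG : Expr := add oS r
/-- The expression for `Ext.oMI`. -/
def oMI : Expr := add oG smp
/-- The expression for `Ext.oJ`. -/
def oJ : Expr := add oMI mea
/-- The expression for `Ext.oMJ`. -/
def oMJ : Expr := add oJ smp
/-- The expression for `Ext.oAI`. -/
def oAI : Expr := add oMJ mea
/-- The expression for `Ext.oAJ`. -/
def oAJ : Expr := add oAI alg
/-- The expression for `Ext.oZ`. -/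
def oZ : Expr := add oAJ alg
/-- The expression for `Ext.oL`. -/
def oL : Expr := add oZ fin
/-- The expression for `Ext.oC`. -/
def oC : Expr := add oL (add T (const 1))
/-- The expression for `Ext.len`. -/
def len : Expr := add smp mea
/-- The number of ancillas of the extractor. -/
def anc : Expr := add (add (add (add (add (add (add (add smp mea) smp) mea) alg) alg) fin)
  (add T (const 1))) (add len (const 1))
/-- The number of wires of the extractor. -/
def W : Expr := add (add (add (add n k) (const 1)) r) anc
/-- The flag of the current round. -/
def flag : Expr := add oL (var 3)
/-- The flag of the next round. -/
def flag' : Expr := add flag (const 1)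
/-- The position of the first string in the input of the second algorithm. -/
def sZ : Expr := add oZ (add k k)

end Expr

/-- The data of the circuit of the extractor. With `e` at least `1 / ε`, the number of rounds makes
the part of the advantage that is due to the alternation at most `1 / e`. -/
def SEInput.ext (I : SEInput) : Ext where
  toDesc := I.desc
  T := 256 * (I.e * I.e * (I.e * I.e))

/-- The variables hold the parameters and the number `u` of the round; the variable `4` is free for
inner loops. -/
structure Holds (I : SEInput) (u : ℕ) (env : Fin 16 → ℕ) : Prop where
  round : env 3 = u
  e : env 5 = I.e
  k : env 6 = I.desc.k
  n : env 7 = I.desc.n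
  m : env 8 = I.desc.m
  r : env 9 = I.desc.r
  sa : env 10 = I.desc.sampler.anc
  ma : env 11 = I.desc.meas.anc
  a0 : env 12 = I.desc.alg0.anc
  a1 : env 13 = I.desc.alg1.anc

theorem holds_env (I : SEInput) : Holds I 0 I.env := ⟨rfl, rfl, rfl, rfl, rfl, rfl, rfl, rfl, rfl,
    rfl⟩

section Holds

variable {I : SEInput} {u : ℕ} {env : Fin 16 → ℕ}

theorem Holds.update_four (h : Holds I u env) (x : ℕ) : Holds I u (Function.update env 4 x) := by
  obtain ⟨h1, h2, h3, h4, h5, h6, h7, h8, h9, h10⟩ := h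
  constructor <;> simpa

theorem Holds.update_three (h : Holds I u env) (x : ℕ) : Holds I x (Function.update env 3 x) := by
  obtain ⟨h1, h2, h3, h4, h5, h6, h7, h8, h9, h10⟩ := h
  constructor <;> simp [*]

theorem Holds.gate (h : Holds I u env) (g : Gate) : Holds I u (g.env env) := by
  obtain ⟨h1, h2, h3, h4, h5, h6, h7, h8, h9, h10⟩ := h
  constructor <;> simpa [Gate.env]

/-- The expression `a` has the value `v` in the round `u`. -/
def Expr.Is (I : SEInput) (u : ℕ) (a : Expr) (v : ℕ) : Prop := ∀ env, Holds I u env → a.eval env = v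

open ExtSim.Expr

theorem Expr.Is.add {a b : Expr} {v v' : ℕ} (ha : a.Is I u v) (hb : b.Is I u v') :
    (a.add b).Is I u (v + v') := fun env h => by rw [eval, ha env h, hb env h]

theorem is_const (c : ℕ) : (const c).Is I u c := fun _ _ => rfl
theorem is_k : Expr.k.Is I u I.ext.k := fun _ h => h.k
theorem is_n : Expr.n.Is I u I.ext.n := fun _ h => h.n
theorem is_m : Expr.m.Is I u I.ext.m := fun _ h => h.m
theorem is_r : Expr.r.Is I u I.ext.r := fun _ h => h.r
theorem is_sa : Expr.sa.Is I u I.ext.sampler.anc := fun _ h => h.sa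
theorem is_ma : Expr.ma.Is I u I.ext.meas.anc := fun _ h => h.ma
theorem is_a0 : Expr.a0.Is I u I.ext.alg0.anc := fun _ h => h.a0
theorem is_a1 : Expr.a1.Is I u I.ext.alg1.anc := fun _ h => h.a1
theorem is_T : Expr.T.Is I u I.ext.T := fun _ h => by simp only [Expr.T, eval, h.e]; rfl
theorem is_smp : smp.Is I u (I.ext.k + I.ext.sampler.anc) := is_k.add is_sa
theorem is_mea : mea.Is I u (1 + I.ext.meas.anc) := (is_const 1).add is_ma
theorem is_alg : alg.Is I u (I.ext.m + I.ext.alg0.anc) := is_m.add is_a0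
theorem is_fin : Expr.fin.Is I u (I.ext.k + I.ext.k + (I.ext.m + I.ext.m) + I.ext.r +
    I.ext.alg1.anc) :=
  (((is_k.add is_k).add (is_m.add is_m)).add is_r).add is_a1
theorem is_oI : oI.Is I u I.ext.oI := is_n
theorem is_oB : oB.Is I u I.ext.oB := is_oI.add is_k
theorem is_oS : oS.Is I u I.ext.oS := is_oB.add (is_const 1)
theorem is_oG : oG.Is I u I.ext.oG := is_oS.add is_r
theorem is_oMI : oMI.Is I u I.ext.oMI := is_oG.add is_smp
theorem is_oJ : oJ.Is I u I.ext.oJ := is_oMI.add is_mea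
theorem is_oMJ : oMJ.Is I u I.ext.oMJ := is_oJ.add is_smp
theorem is_oAI : oAI.Is I u I.ext.oAI := is_oMJ.add is_mea
theorem is_oAJ : oAJ.Is I u I.ext.oAJ := is_oAI.add is_alg
theorem is_oZ : oZ.Is I u I.ext.oZ := is_oAJ.add is_alg
theorem is_oL : oL.Is I u I.ext.oL := is_oZ.add is_fin
theorem is_oC : oC.Is I u I.ext.oC := is_oL.add (is_T.add (is_const 1))
theorem is_len : len.Is I u I.ext.len := is_smp.add is_mea
theorem is_anc : anc.Is I u I.ext.anc :=
  (((((((is_smp.add is_mea).add is_smp).add is_mea).add is_alg).add is_alg).add is_fin).add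
    (is_T.add (is_const 1))).add (is_len.add (is_const 1))
theorem is_W : W.Is I u I.ext.W := (((is_n.add is_k).add (is_const 1)).add is_r).add is_anc
theorem is_flag : flag.Is I u (I.ext.oL + u) := is_oL.add fun _ h => h.round
theorem is_flag' : flag'.Is I u (I.ext.oL + u + 1) := is_flag.add (is_const 1)
theorem is_sZ : sZ.Is I u (I.ext.oZ + (I.ext.k + I.ext.k)) := is_oZ.add (is_k.add is_k)

end Holds

namespace Gen

/-- The program writes down the circuit `gs` in the round `u`. -/
def Is (I : SEInput) (u : ℕ) (G : Gen) (gs : List Gate) : Prop :=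
  ∀ env, Holds I u env → G.eval I.circs env = gs

variable {I : SEInput} {u : ℕ}

theorem Is.seq {G G' : Gen} {gs gs' : List Gate} (h : G.Is I u gs) (h' : G'.Is I u gs') :
    (G.seq G').Is I u (gs ++ gs') := fun env he => by rw [eval, h env he, h' env he]

theorem Is.inv {G : Gen} {gs : List Gate} (h : G.Is I u gs) : G.inv.Is I u (ExtSim.inv gs) :=
  fun env he => by rw [eval_inv, h env he]

/-- Write down one of the given circuits with its wires renamed. -/
def reloc (c : Fin 4) (n1 n2 q o1 o2 o3 : Expr) : Gen :=
  each c false fun k => [(k, Expr.relo n1 n2 q o1 o2 o3 Expr.W (.var 0),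
    Expr.relo n1 n2 q o1 o2 o3 Expr.W (.var 1), Expr.relo n1 n2 q o1 o2 o3 Expr.W (.var 2))]

theorem is_reloc (c : Fin 4) {n1 n2 q o1 o2 o3 : Expr} {v1 v2 v3 v4 v5 v6 : ℕ} (h1 : n1.Is I u v1)
    (h2 : n2.Is I u v2) (h3 : q.Is I u v3) (h4 : o1.Is I u v4) (h5 : o2.Is I u v5)
    (h6 : o3.Is I u v6) : (reloc c n1 n2 q o1 o2 o3).Is I u
      (ExtSim.reloc (ExtSim.relo v1 v2 v3 v4 v5 v6 I.ext.W) (I.circs c)) := by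
  intro env he
  rw [reloc, eval, ExtSim.reloc, ← List.flatMap_pure_eq_map]
  simp only [Bool.false_eq_true, if_false]
  congr 1
  funext g
  have hg := he.gate g
  rw [List.map_singleton, Emit.gate, Expr.eval_relo, Expr.eval_relo, Expr.eval_relo, h1 _ hg,
    h2 _ hg, h3 _ hg, h4 _ hg, h5 _ hg, h6 _ hg, is_W _ hg]
  cases g <;> rfl

/-- The program for `ExtSim.cxs`. -/
def cxs (o o' N : Expr) : Gen :=
  loop true 4 N (emit [(.CX, .add o (.var 4), .add o' (.var 4), .const 0)])

theorem is_cxs {o o' N : Expr} {v v' v'' : ℕ} (h : o.Is I u v) (h' : o'.Is I u v')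
    (h'' : N.Is I u v'') : (cxs o o' N).Is I u (ExtSim.cxs v v' v'') := by
  intro env he
  rw [cxs, eval, ExtSim.cxs, ← List.flatMap_pure_eq_map, h'' _ he]
  simp only [if_true]
  congr 1
  funext l
  have hl := he.update_four l
  rw [eval, List.map_singleton, Emit.gate]
  simp only [Expr.eval, h _ hl, h' _ hl, Function.update_self]
  rfl

/-- The program for `ExtSim.ccxs`. -/
def ccxs (c o o' N : Expr) : Gen :=
  loop true 4 N (emit [(.CCX, c, .add o (.var 4), .add o' (.var 4))])

theorem is_ccxs {c o o' N : Expr} {w v v' v'' : ℕ} (hc : c.Is I u w) (h : o.Is I u v)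
    (h' : o'.Is I u v') (h'' : N.Is I u v'') :
    (ccxs c o o' N).Is I u (ExtSim.ccxs w v v' v'') := by
  intro env he
  rw [ccxs, eval, ExtSim.ccxs, ← List.flatMap_pure_eq_map, h'' _ he]
  simp only [if_true]
  congr 1
  funext l
  have hl := he.update_four l
  rw [eval, List.map_singleton, Emit.gate]
  simp only [Expr.eval, hc _ hl, h _ hl, h' _ hl, Function.update_self]
  rfl

/-- The program for `ExtSim.conj`. -/
def conj (c d j q N : Expr) : Gen :=
  seq (emit [(.CCX, c, d, q)]) <| loop true 4 N (emit [(.X, .add j (.var 4), .const 0, .const 0),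
    (.CCX, .add q (.var 4), .add j (.var 4), .add (.add q (.var 4)) (.const 1)),
    (.X, .add j (.var 4), .const 0, .const 0)])

theorem is_conj {c d j q N : Expr} {vc vd vj vq vN : ℕ} (hc : c.Is I u vc) (hd : d.Is I u vd)
    (hj : j.Is I u vj) (hq : q.Is I u vq) (hN : N.Is I u vN) :
    (conj c d j q N).Is I u (ExtSim.conj vc vd vj vq vN) := by
  intro env he
  rw [conj, eval, eval, eval, ExtSim.conj, hN _ he]
  simp only [if_true, List.map_singleton, Emit.gate, hc _ he, hd _ he, hq _ he,
    List.singleton_append]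
  congr 2
  funext l
  have hl := he.update_four l
  simp only [eval, List.map_cons, List.map_nil, Emit.gate, Expr.eval, hj _ hl, hq _ hl,
    Function.update_self]
  rfl

theorem is_emit {l : List Emit} {gs : List Gate}
    (h : ∀ env, Holds I u env → l.map (Emit.gate env) = gs) : (emit l).Is I u gs := h

/-- The program for `Ext.meaC`. -/
def meaC (o o' : Expr) : Gen :=
  reloc 1 .k .n (.add (.add (.add .k .n) (.const 1)) .ma) o (.const 0) o'

theorem is_meaC {o o' : Expr} {v v' : ℕ} (h : o.Is I u v) (h' : o'.Is I u v') :
    (meaC o o').Is I u (I.ext.meaC v v') :=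
  is_reloc 1 is_k is_n (((is_k.add is_n).add (is_const 1)).add is_ma) h (is_const 0) h'

/-- The program for `Ext.algC`. -/
def algC (o o' : Expr) : Gen :=
  reloc 2 .k .n (.add (.add (.add .k .n) .m) .a0) o (.const 0) o'

theorem is_algC {o o' : Expr} {v v' : ℕ} (h : o.Is I u v) (h' : o'.Is I u v') :
    (algC o o').Is I u (I.ext.algC v v') :=
  is_reloc 2 is_k is_n (((is_k.add is_n).add is_m).add is_a0) h (is_const 0) h'

/-- The program for `Ext.smpC`. -/
def smpC (o : Expr) : Gen := reloc 0 .smp (.const 0) .smp o (.const 0) (.const 0)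

theorem is_smpC {o : Expr} {v : ℕ} (h : o.Is I u v) : (smpC o).Is I u (I.ext.smpC v) :=
  is_reloc 0 is_smp (is_const 0) is_smp h (is_const 0) (is_const 0)

/-- The program for `Ext.finC`. -/
def finC : Gen := reloc 3 .fin (.const 0) .fin .oZ (.const 0) (.const 0)

theorem is_finC : finC.Is I u I.ext.finC :=
  is_reloc 3 is_fin (is_const 0) is_fin is_oZ (is_const 0) (is_const 0)

/-- The program for `Ext.upd`. -/
def upd : Gen :=
  seq (seq (meaC .oJ .oMJ) (emit [(.CX, .flag, .flag', .const 0), (.CCX, .flag, .oMJ, .flag')]))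
    (meaC .oJ .oMJ).inv

theorem is_upd : upd.Is I u (I.ext.upd u) := by
  refine ((is_meaC is_oJ is_oMJ).seq (is_emit fun env h => ?_)).seq (is_meaC is_oJ is_oMJ).inv
  simp only [List.map_cons, List.map_nil, Emit.gate, is_flag _ h, is_flag' _ h, is_oMJ _ h]
  rfl

/-- The program for `Ext.refl`. -/
def refl : Gen :=
  seq (seq (meaC .oI .oMI) (seq (seq (conj .flag' .oMI .oJ .oC .len)
    (emit (List.replicate 4 (.T, .add .oC .len, .const 0, .const 0))))
      (conj .flag' .oMI .oJ .oC .len).inv)) (meaC .oI .oMI).inv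

theorem is_refl : refl.Is I u (I.ext.refl u) := by
  have h := is_conj (is_flag' (I := I) (u := u)) is_oMI is_oJ is_oC is_len
  refine ((is_meaC is_oI is_oMI).seq ((h.seq (is_emit fun env he => ?_)).seq h.inv)).seq
    (is_meaC is_oI is_oMI).inv
  rw [List.map_replicate, Emit.gate, is_oC.add is_len env he]
  rfl

/-- The program for `Ext.round`. -/
def round : Gen := seq (seq (seq upd (smpC .oJ).inv) refl) (smpC .oJ)

theorem is_round : round.Is I u (I.ext.round u) :=
  ((is_upd.seq (is_smpC is_oJ).inv).seq is_refl).seq (is_smpC is_oJ)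

/-- The program for `Ext.rounds`. -/
def rounds : Gen := loop true 3 .T round

theorem is_rounds : rounds.Is I u (I.ext.rounds I.ext.T) := by
  intro env he
  rw [rounds, eval, is_T _ he, Ext.rounds]
  simp only [if_true]
  congr 1
  funext x
  exact is_round _ (he.update_three x)

/-- The program for `Ext.first`. -/
def first : Gen := seq (seq (algC .oI .oAI) (cxs .oAI .sZ .m)) (algC .oI .oAI).inv

theorem is_first : first.Is I u I.ext.first :=
  ((is_algC is_oI is_oAI).seq (is_cxs is_oAI is_sZ is_m)).seq (is_algC is_oI is_oAI).inv

/-- The program for `Ext.last`. -/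
def last : Gen :=
  seq (seq (seq (seq (cxs .oI .oZ .k) (cxs .oJ (.add .oZ .k) .k)) (algC .oJ .oAJ))
    (cxs .oAJ (.add .sZ .m) .m)) finC

theorem is_last : last.Is I u I.ext.last :=
  ((((is_cxs is_oI is_oZ is_k).seq (is_cxs is_oJ (is_oZ.add is_k) is_k)).seq
    (is_algC is_oJ is_oAJ)).seq (is_cxs is_oAJ (is_sZ.add is_m) is_m)).seq is_finC

/-- The program for `Ext.comp`. -/
def compute : Gen :=
  seq (seq (seq (seq first (smpC .oJ)) (emit [(.X, .oL, .const 0, .const 0)])) rounds) last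

theorem is_compute : compute.Is I u I.ext.comp := by
  refine (((is_first.seq (is_smpC is_oJ)).seq (is_emit fun env h => ?_)).seq is_rounds).seq is_last
  simp only [List.map_cons, List.map_nil, Emit.gate, is_oL _ h]
  rfl

/-- The program for `Ext.prep`. -/
def prep : Gen :=
  seq (seq (smpC .oG) (cxs .oG .oI .k)) (seq (seq (meaC .oI .oMI)
    (emit [(.CX, .oMI, .oB, .const 0)])) (meaC .oI .oMI).inv)

theorem is_prep : prep.Is I u I.ext.prep := by
  refine ((is_smpC is_oG).seq (is_cxs is_oG is_oI is_k)).seq (((is_meaC is_oI is_oMI).seq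
    (is_emit fun env h => ?_)).seq (is_meaC is_oI is_oMI).inv)
  simp only [List.map_cons, List.map_nil, Emit.gate, is_oMI _ h, is_oB _ h]
  rfl

/-- The program that writes down the circuit of the extractor. -/
def gates : Gen :=
  seq prep (seq (seq compute (ccxs .oB (.add .sZ (.add .m .m)) .oS .r)) compute.inv)

theorem is_gates : gates.Is I u I.ext.gates :=
  is_prep.seq ((is_compute.seq (is_ccxs is_oB (is_sZ.add (is_m.add is_m)) is_oS is_r)).seq
    is_compute.inv)

end Gen

/-- The extractor: the map from its classical input to the circuit that acts on the state. -/
def extractor (I : SEInput) : QCircuit := ⟨I.ext.anc, I.ext.gates⟩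

theorem isQPT_extractor : IsQPT SEInput.encode extractor := by
  have h := isQPT_of_gen Expr.anc Gen.gates
  have e : (fun I : SEInput =>
      (⟨Expr.anc.eval I.env, Gen.gates.eval I.circs I.env⟩ : QCircuit)) = extractor := by
    funext I
    rw [is_anc _ (holds_env I), Gen.is_gates _ (holds_env I), extractor]
  rwa [e] at h

end ExtSim

/-! ### The advantage of a distinguisher -/

namespace ExtSim

theorem inputState_eq_emb {w n : ℕ} (φ : Bits n → ℂ) :
    inputState w (default : Bits 0) φ = emb (fun _ => false) φ := by
  funext b
  rw [inputState_apply, emb]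
  have : ((∀ a < 0, bitAt b a = bitAt (default : Bits 0) a) ∧
      ∀ a, 0 + n ≤ a → bitAt b a = false) ↔
      Agree (fun a => n ≤ a) b (fun _ => false) := by
    simp [Agree, bitAt]
  by_cases h : Agree (fun a => n ≤ a) b (fun _ => false)
  · rw [if_pos (this.2 h), if_pos h]
  · rw [if_neg fun h' => h (this.1 h'), if_neg h]

theorem sqrt_add_le {a : ℝ} (ha : 0 ≤ a) (b : ℝ) : √(a + b) ≤ √a + √b := by
  refine Real.sqrt_le_iff.2 ⟨by positivity, ?_⟩
  rcases le_total 0 b with hb | hb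
  · nlinarith [Real.sq_sqrt ha, Real.sq_sqrt hb, Real.sqrt_nonneg a, Real.sqrt_nonneg b,
      mul_nonneg (Real.sqrt_nonneg a) (Real.sqrt_nonneg b)]
  · rw [Real.sqrt_eq_zero_of_nonpos hb, add_zero, Real.sq_sqrt ha]
    linarith

namespace Ext

variable {X : Ext} {C : Finset (Bits X.k)} {P : Bits X.k → Matrix (Bits X.n) (Bits X.n) ℂ}
  {S : Finset (Bits X.k × Bits X.k)} {s : Bits X.k → Bits X.m} {t : Bits X.r}

variable (C) in
open Classical in
/-- The uniform distribution on `C`. -/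
noncomputable def unif (i : Bits X.k) : ℝ := if i ∈ C then 1 / (C.card : ℝ) else 0

theorem sum_unif (hC : C.Nonempty) : ∑ i, unif C i = 1 := by
  classical
  simp only [unif]
  rw [← Finset.sum_filter, Finset.filter_mem_eq_inter, Finset.univ_inter, Finset.sum_const,
    nsmul_eq_mul]
  have : (C.card : ℝ) ≠ 0 := by exact_mod_cast hC.card_pos.ne'
  field_simp

theorem unif_nonneg (i : Bits X.k) : 0 ≤ unif C i := by
  rw [unif]; split_ifs <;> positivity

theorem sampleError_eq : X.sampleError C = ∑ i, |X.sampleProb i - unif C i| := by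
  refine Finset.sum_congr rfl fun i _ => ?_
  by_cases h : i ∈ C
  · simp [unif, h]
  · simp [unif, h]

theorem sampleError_nonneg : 0 ≤ X.sampleError C := Finset.sum_nonneg fun _ _ => abs_nonneg _

/-- Replacing the distribution of the sampler by the uniform one. -/
theorem sum_sampleProb_mul_le (R : Finset (Bits X.k)) (f : Bits X.k → ℝ)
    (hf : ∀ i ∈ R, 0 ≤ f i ∧ f i ≤ 1) :
    |∑ i ∈ R, X.sampleProb i * f i - ∑ i ∈ R, unif C i * f i| ≤ X.sampleError C := by
  rw [← Finset.sum_sub_distrib, sampleError_eq]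
  refine (Finset.abs_sum_le_sum_abs _ _).trans ((Finset.sum_le_sum fun i hi => ?_).trans
    (Finset.sum_le_sum_of_subset_of_nonneg (Finset.subset_univ R) fun i _ _ => abs_nonneg _))
  rw [← sub_mul, abs_mul, abs_of_nonneg (hf i hi).1]
  exact mul_le_of_le_one_right (abs_nonneg _) (hf i hi).2

/-- The probability of sampling an index outside `C`. -/
theorem one_sub_sum_le (hC : C.Nonempty) : 1 - ∑ i ∈ C, X.sampleProb i ≤ X.sampleError C := by
  have h := (abs_le.1 (sum_sampleProb_mul_le (C := C) C (fun _ => 1) fun i _ => by simp)).1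
  simp only [mul_one] at h
  have h1 : ∑ i ∈ C, unif C i = 1 := by
    rw [← sum_unif hC]
    exact Finset.sum_subset (Finset.subset_univ C) fun i _ hi => by rw [unif, if_neg hi]
  linarith

open Classical in
/-- The probability that two independent samples do not form a pair in `S`. The error of the sampler
enters once for each of them. -/
theorem sum_badProb_le (hC : C.Nonempty) (hS : S ⊆ C ×ˢ C) :
    ∑ i ∈ C, X.sampleProb i * X.badProb S i ≤
      1 - (S.card : ℝ) / (C.card : ℝ) ^ 2 + 2 * X.sampleError C := by
  set δ := X.sampleError C with hδ
  have hδ0 : 0 ≤ δ := sampleError_nonneg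
  set β : Bits X.k → ℝ := fun i => ∑ j, unif C j * if (i, j) ∈ S then 0 else 1 with hβ
  have hf : ∀ i j : Bits X.k, (0 : ℝ) ≤ (if (i, j) ∈ S then 0 else 1) ∧
      (if (i, j) ∈ S then (0 : ℝ) else 1) ≤ 1 := fun i j => by split_ifs <;> norm_num
  have hβ01 : ∀ i, 0 ≤ β i ∧ β i ≤ 1 := fun i => by
    constructor
    · exact Finset.sum_nonneg fun j _ => mul_nonneg (unif_nonneg j) (hf i j).1
    · rw [← sum_unif hC]
      exact Finset.sum_le_sum fun j _ => mul_le_of_le_one_right (unif_nonneg j) (hf i j).2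
  have h1 : ∀ i, X.badProb S i ≤ β i + δ := fun i => by
    have h := (abs_le.1 (sum_sampleProb_mul_le (C := C) Finset.univ
      (fun j => if (i, j) ∈ S then (0 : ℝ) else 1) fun j _ => hf i j)).2
    have e : X.badProb S i = ∑ j, X.sampleProb j * if (i, j) ∈ S then (0 : ℝ) else 1 := by
      rw [badProb]
      refine Finset.sum_congr rfl fun j _ => ?_
      split_ifs <;> simp
    rw [e]
    linarith
  have h2 := (abs_le.1 (sum_sampleProb_mul_le (C := C) C β fun i _ => hβ01 i)).2
  have h3 : ∑ i ∈ C, X.sampleProb i ≤ 1 := by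
    rw [← X.sum_sampleProb]
    exact Finset.sum_le_sum_of_subset_of_nonneg (Finset.subset_univ _)
      fun i _ _ => X.sampleProb_nonneg i
  have h4 : ∑ i ∈ C, unif C i * β i = 1 - (S.card : ℝ) / (C.card : ℝ) ^ 2 := by
    have hc : (C.card : ℝ) ≠ 0 := by exact_mod_cast hC.card_pos.ne'
    have e1 : ∀ i ∈ C, unif C i * β i =
        1 / (C.card : ℝ) ^ 2 * ∑ j ∈ C, if (i, j) ∈ S then (0 : ℝ) else 1 := fun i hi => by
      have e2 : β i = ∑ j ∈ C, 1 / (C.card : ℝ) * if (i, j) ∈ S then (0 : ℝ) else 1 := by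
        rw [hβ]
        simp only
        rw [← Finset.sum_subset (Finset.subset_univ C) fun j _ hj => by
          rw [unif, if_neg hj, zero_mul]]
        exact Finset.sum_congr rfl fun j hj => by rw [unif, if_pos hj]
      rw [e2, unif, if_pos hi, ← Finset.mul_sum]
      field_simp
    rw [Finset.sum_congr rfl e1, ← Finset.mul_sum,
      ← Finset.sum_product' C C fun i j => if (i, j) ∈ S then (0 : ℝ) else 1]
    have e3 : ∑ x ∈ C ×ˢ C, (if (x.1, x.2) ∈ S then (0 : ℝ) else 1) =
        (C.card : ℝ) ^ 2 - S.card := by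
      have e4 : ∀ x : Bits X.k × Bits X.k, (if (x.1, x.2) ∈ S then (0 : ℝ) else 1) =
          1 - if x ∈ S then (1 : ℝ) else 0 := fun x => by
        by_cases hx : x ∈ S
        · simp [hx]
        · simp [hx]
      rw [Finset.sum_congr rfl fun x _ => e4 x, Finset.sum_sub_distrib, ← Finset.sum_filter,
        Finset.filter_mem_eq_inter, Finset.inter_eq_right.2 hS]
      simp [Finset.card_product, sq]
    rw [e3]
    field_simp
  calc ∑ i ∈ C, X.sampleProb i * X.badProb S i
      ≤ ∑ i ∈ C, (X.sampleProb i * β i + X.sampleProb i * δ) :=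
        Finset.sum_le_sum fun i _ => by
          rw [← mul_add]
          exact mul_le_mul_of_nonneg_left (h1 i) (X.sampleProb_nonneg i)
    _ = ∑ i ∈ C, X.sampleProb i * β i + (∑ i ∈ C, X.sampleProb i) * δ := by
        rw [Finset.sum_add_distrib, Finset.sum_mul]
    _ ≤ _ := by nlinarith

/-- The advantage of a distinguisher that is due to the given circuits, in terms of the number of
rounds, the density of the complement of `S` and the error of the sampler. -/
noncomputable def defect (T : ℕ) (σ δ : ℝ) : ℝ :=
  4 * √8 * (T + 1) * √(σ + 2 * δ) + 2 * √δ + δ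

theorem nsq_gates {ψ : Bits X.n → ℂ} (hψ : nsq ψ = 1) :
    nsq (ap X.gates (emb (fun _ => false : Bits X.W) ψ)) ≤ 1 := by
  rw [nsq_ap, nsq_emb X.n_le, hψ]

/-- The bound on the advantage, in terms of the number of rounds. -/
theorem nrm_gates_sub_le_defect (hX : Setting X C P S s t) (hC : C.Nonempty) {ψ : Bits X.n → ℂ}
    (hψ : nsq ψ = 1) {e : ℕ} (he : 0 < e) (hT : 256 * e ^ 4 ≤ X.T) :
    2 * nrm (ap X.gates (emb (fun _ => false) ψ) - ideal C P t ψ) + X.sampleError C ≤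
      1 / e + defect X.T (1 - (S.card : ℝ) / (C.card : ℝ) ^ 2) (X.sampleError C) := by
  have h1 := nrm_gates_sub_le hX hψ
  have hp1 : ∑ i ∈ C, X.sampleProb i ≤ 1 := by
    rw [← X.sum_sampleProb]
    exact Finset.sum_le_sum_of_subset_of_nonneg (Finset.subset_univ _)
      fun i _ _ => X.sampleProb_nonneg i
  have h2 := sum_failure_le (C := C) (p := X.sampleProb) (fun i _ => X.sampleProb_nonneg i) hp1
    (fun i hi => proj_mul (hX.proj i hi)) (fun i hi => star_proj (hX.proj i hi)) X.isHermitian_M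
    X.re_ip_M_le (sum_nsq_le hX) hψ X.T
  have h3 := sum_badProb_le (S := S) hC hX.sub
  set δ := X.sampleError C
  set σ := 1 - (S.card : ℝ) / (C.card : ℝ) ^ 2
  have he' : (0 : ℝ) < e := by exact_mod_cast he
  have hT' : (256 : ℝ) * e ^ 4 ≤ X.T := by exact_mod_cast hT
  -- doubled and under a square root, this becomes `1 / (4 e)`, which enters four times
  have h4 : √(1 / (4 * ((X.T : ℝ) + 1))) ≤ 1 / (32 * e ^ 2) := by
    refine Real.sqrt_le_iff.2 ⟨by positivity, ?_⟩
    rw [div_pow, one_pow]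
    refine one_div_le_one_div_of_le (by positivity) ?_
    nlinarith
  have h5 : ∑ i ∈ C, X.sampleProb i *
      (2 * failure (P i) X.M ψ X.T + 8 * (X.T + 1) ^ 2 * X.badProb S i) ≤
      (1 / (4 * e)) ^ 2 + (√8 * (X.T + 1)) ^ 2 * (σ + 2 * δ) := by
    have e1 : ∑ i ∈ C, X.sampleProb i *
        (2 * failure (P i) X.M ψ X.T + 8 * (X.T + 1) ^ 2 * X.badProb S i) =
        2 * ∑ i ∈ C, X.sampleProb i * failure (P i) X.M ψ X.T +
        8 * (X.T + 1) ^ 2 * ∑ i ∈ C, X.sampleProb i * X.badProb S i := by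
      rw [Finset.mul_sum, Finset.mul_sum, ← Finset.sum_add_distrib]
      exact Finset.sum_congr rfl fun i _ => by ring
    have e2 : (1 / (4 * (e : ℝ))) ^ 2 = 2 * (1 / (32 * e ^ 2)) := by field_simp; norm_num
    have e3 : (√8 * ((X.T : ℝ) + 1)) ^ 2 = 8 * (X.T + 1) ^ 2 := by
      rw [mul_pow, Real.sq_sqrt (by norm_num)]
    rw [e1, e2, e3]
    exact add_le_add (by linarith) (mul_le_mul_of_nonneg_left h3 (by positivity))
  have h6 : √(∑ i ∈ C, X.sampleProb i *
      (2 * failure (P i) X.M ψ X.T + 8 * (X.T + 1) ^ 2 * X.badProb S i)) ≤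
      1 / (4 * e) + √8 * (X.T + 1) * √(σ + 2 * δ) := by
    refine (Real.sqrt_le_sqrt h5).trans ((sqrt_add_le (by positivity) _).trans ?_)
    rw [Real.sqrt_sq (by positivity), Real.sqrt_mul (by positivity), Real.sqrt_sq (by positivity)]
  have h7 : √(1 - ∑ i ∈ C, X.sampleProb i) ≤ √δ := Real.sqrt_le_sqrt (one_sub_sum_le hC)
  have h8 : (1 : ℝ) / e = 4 * (1 / (4 * e)) := by field_simp
  rw [defect, h8]
  linarith

theorem nrm_gates_sub_le_two (hP : ∀ i ∈ C, IsStarProjection (P i)) {ψ : Bits X.n → ℂ}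
    (hψ : nsq ψ = 1) :
    nrm (ap X.gates (emb (fun _ => false) ψ) - ideal C P t ψ) ≤ 2 := by
  have h1 : nrm (ap X.gates (emb (fun _ => false : Bits X.W) ψ)) ≤ 1 :=
    Real.sqrt_le_one.2 (nsq_gates hψ)
  have h2 : nrm (ideal C P t ψ) ≤ 1 := Real.sqrt_le_one.2 (nsq_ideal_le hP hψ)
  exact (nrm_sub_le _ _).trans (by linarith)

theorem acceptProb_extractorOutput (I : SEInput) (E : CQ I.ext.k I.ext.r I.ext.n)
    (ψ : Bits I.ext.n → ℂ) :
    acceptProb E (extractorOutput (extractor I) I.ext.k I.ext.r I.ext.n ψ) =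
      expect (effect E I.ext.read) (ap I.ext.gates (emb (fun _ => false) ψ)) := by
  have h := sum_trace_cqOutput (w := I.ext.W) (n := I.ext.n) (E := E) (read := I.ext.read)
    (ap I.ext.gates (emb (fun _ => false) ψ)) read_congr
  rw [expect, ← h, Complex.re_sum, ← inputState_eq_emb]
  rfl

theorem acceptProb_experiment_eq (E : CQ X.k X.r X.n) (ψ : Bits X.n → ℂ) :
    acceptProb E (experiment C P t ψ) = ∑ i ∈ C, unif C i * acceptAt E P t ψ i := by
  rw [acceptProb_experiment]
  exact Finset.sum_congr rfl fun i hi => by rw [unif, if_pos hi]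

/-- The advantage of a distinguisher is at most the distance of the output state from the ideal
output state and the error of the sampler. -/
theorem advantage_le {I : SEInput} {C : Finset (Bits I.ext.k)}
    {P : Bits I.ext.k → Matrix (Bits I.ext.n) (Bits I.ext.n) ℂ} {t : Bits I.ext.r}
    (hP : ∀ i ∈ C, IsStarProjection (P i)) {ψ : Bits I.ext.n → ℂ} (hψ : nsq ψ = 1)
    {E : CQ I.ext.k I.ext.r I.ext.n} (hE : IsDistinguisher E) :
    |acceptProb E (extractorOutput (extractor I) I.ext.k I.ext.r I.ext.n ψ) -
      acceptProb E (experiment C P t ψ)| ≤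
      2 * nrm (ap I.ext.gates (emb (fun _ => false) ψ) - ideal C P t ψ) +
        I.ext.sampleError C := by
  rw [acceptProb_extractorOutput, acceptProb_experiment_eq]
  have h1 := abs_expect_sub_le hE (nsq_gates hψ) (nsq_ideal_le (t := t) hP hψ)
  have h2 := sum_sampleProb_mul_le (C := C) C (acceptAt E P t ψ)
    fun i hi => acceptAt_mem hE (hP i hi) t hψ
  rw [← expect_ideal] at h2
  exact (abs_sub_le _ _ _).trans (add_le_add h1 h2)

end Ext

/-! ### Asymptotics -/

theorem Negligible.add {f g : ℕ → ℝ} (hf : Negligible f) (hg : Negligible g) :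
    Negligible fun l => f l + g l := by
  intro c
  filter_upwards [hf (c + 1), hg (c + 1), eventually_ge_atTop 2] with l h1 h2 h3
  have h3' : (2 : ℝ) ≤ l := by exact_mod_cast h3
  have h4 : 1 / (l : ℝ) ^ (c + 1) ≤ 1 / (l : ℝ) ^ c / 2 := by
    rw [pow_succ, ← div_div]
    exact div_le_div_of_nonneg_left (by positivity) (by norm_num) h3'
  linarith [abs_add_le (f l) (g l)]

theorem Negligible.sqrt {f : ℕ → ℝ} (hf : Negligible f) : Negligible fun l => √(f l) := by
  intro c
  filter_upwards [hf (2 * c), eventually_gt_atTop 0] with l h1 h2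
  rw [abs_of_nonneg (Real.sqrt_nonneg _)]
  have h3 : (0 : ℝ) < l := by exact_mod_cast h2
  rw [Real.sqrt_lt' (by positivity), div_pow, one_pow, ← pow_mul, mul_comm c]
  exact (le_abs_self _).trans_lt h1

/-- Multiplication by a polynomially bounded function. -/
theorem Negligible.poly_mul {f g : ℕ → ℝ} (hg : Negligible g) {K d : ℕ}
    (hf : ∀ᶠ l : ℕ in atTop, |f l| ≤ K * (l : ℝ) ^ d) : Negligible fun l => f l * g l := by
  intro c
  filter_upwards [hg (c + d + 1), hf, eventually_ge_atTop (K + 1)] with l h1 h2 h3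
  have h3' : (K : ℝ) + 1 ≤ l := by exact_mod_cast h3
  have hK : (0 : ℝ) ≤ K := Nat.cast_nonneg K
  have h4 : (0 : ℝ) < l := by linarith
  rw [abs_mul]
  calc |f l| * |g l| ≤ ((l : ℝ) * (l : ℝ) ^ d) * |g l| :=
        mul_le_mul_of_nonneg_right (h2.trans (mul_le_mul_of_nonneg_right (by linarith)
          (by positivity))) (abs_nonneg _)
    _ < ((l : ℝ) * (l : ℝ) ^ d) * (1 / (l : ℝ) ^ (c + d + 1)) :=
        mul_lt_mul_of_pos_left h1 (by positivity)
    _ = 1 / (l : ℝ) ^ c := by field_simp; ring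

theorem Negligible.const_mul {g : ℕ → ℝ} (hg : Negligible g) (K : ℕ) :
    Negligible fun l => K * g l :=
  hg.poly_mul (f := fun _ => (K : ℝ)) (K := K) (d := 0) (Eventually.of_forall fun l => by simp)

theorem Negligible.congr {f g : ℕ → ℝ} (hf : Negligible f) (h : ∀ᶠ l in atTop, f l = g l) :
    Negligible g := fun c => by
  filter_upwards [hf c, h] with l h1 h2
  rwa [← h2]

theorem Noticeable.eventually_pos {ε : ℕ → ℝ} (h : Noticeable ε) : ∀ᶠ l in atTop, 0 < ε l := by
  obtain ⟨c, hc⟩ := h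
  filter_upwards [hc, eventually_gt_atTop 0] with l h1 h2
  have h3 : (0 : ℝ) < l := by exact_mod_cast h2
  exact lt_of_lt_of_le (by positivity) h1

/-- The defect is negligible, since the number of rounds is polynomial for noticeable `ε`. -/
theorem negligible_defect {σ δ ε : ℕ → ℝ} (hσ : Negligible σ) (hδ : Negligible δ)
    (hε : Noticeable ε) : Negligible fun l =>
      Ext.defect (256 * (⌈(ε l)⁻¹⌉₊ * ⌈(ε l)⁻¹⌉₊ * (⌈(ε l)⁻¹⌉₊ * ⌈(ε l)⁻¹⌉₊))) (σ l) (δ l) := by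
  have hsum : Negligible fun l => σ l + 2 * δ l := hσ.add (by exact_mod_cast hδ.const_mul 2)
  have hpoly : ∃ d : ℕ, ∀ᶠ l : ℕ in atTop, |4 * √8 * (((256 * (⌈(ε l)⁻¹⌉₊ * ⌈(ε l)⁻¹⌉₊ *
      (⌈(ε l)⁻¹⌉₊ * ⌈(ε l)⁻¹⌉₊)) : ℕ) : ℝ) + 1)| ≤ (12 * 257 : ℕ) * (l : ℝ) ^ d := by
    obtain ⟨c, hc⟩ := hε
    refine ⟨c * 4, ?_⟩
    filter_upwards [hc, eventually_gt_atTop 0] with l h1 h2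
    have h3 : (0 : ℝ) < l := by exact_mod_cast h2
    have h4 : ⌈(ε l)⁻¹⌉₊ ≤ l ^ c := by
      refine Nat.ceil_le.2 ?_
      rw [Nat.cast_pow]
      rw [inv_le_comm₀ (lt_of_lt_of_le (by positivity) h1) (by positivity), ← one_div]
      exact h1
    have h5 : (⌈(ε l)⁻¹⌉₊ : ℝ) ≤ (l : ℝ) ^ c := by exact_mod_cast h4
    have h6 : √8 ≤ 3 := Real.sqrt_le_iff.2 ⟨by norm_num, by norm_num⟩
    have h7 : (1 : ℝ) ≤ (l : ℝ) ^ (c * 4) := one_le_pow₀ (by exact_mod_cast h2)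
    have h8 : (⌈(ε l)⁻¹⌉₊ : ℝ) ^ 4 ≤ (l : ℝ) ^ (c * 4) := by
      rw [pow_mul]; exact pow_le_pow_left₀ (Nat.cast_nonneg _) h5 4
    rw [abs_of_nonneg (by positivity)]
    push_cast
    have h9 : (256 * ((⌈(ε l)⁻¹⌉₊ : ℝ) * ⌈(ε l)⁻¹⌉₊ * (⌈(ε l)⁻¹⌉₊ * ⌈(ε l)⁻¹⌉₊)) + 1) ≤
        257 * (l : ℝ) ^ (c * 4) := by
      have : (⌈(ε l)⁻¹⌉₊ : ℝ) * ⌈(ε l)⁻¹⌉₊ * (⌈(ε l)⁻¹⌉₊ * ⌈(ε l)⁻¹⌉₊) = (⌈(ε l)⁻¹⌉₊ : ℝ) ^ 4 := by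
        ring
      rw [this]; linarith
    calc _ ≤ 4 * 3 * (257 * (l : ℝ) ^ (c * 4)) :=
          mul_le_mul (by linarith) h9 (by positivity) (by norm_num)
      _ = _ := by ring
  obtain ⟨d, hd⟩ := hpoly
  exact ((hsum.sqrt.poly_mul hd).add (by exact_mod_cast hδ.sqrt.const_mul 2)).add hδ

end ExtSim

open ExtSim

theorem mainTheorem1 :
    ∃ SE : SEInput → QCircuit, IsQPT SEInput.encode SE ∧
      ∀ (D : ℕ → Desc) (C : ∀ l, Finset (Bits (D l).k))
        (P : ∀ l, Bits (D l).k → Matrix (Bits (D l).n) (Bits (D l).n) ℂ)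
        (ψ : ∀ l, Bits (D l).n → ℂ)
        (S : ∀ l, Finset (Bits (D l).k × Bits (D l).k))
        (s : ∀ l, Bits (D l).k → Bits (D l).m)
        (t : ∀ l, Bits (D l).r),
        PolySize D →
        (∀ l, (C l).Nonempty) →
        Negligible (fun l => (D l).sampleError (C l)) →
        (∀ l, ∀ i ∈ C l, IsStarProjection (P l i)) →
        (∀ l, (D l).Measures (C l) (P l)) →
        (∀ l, star (ψ l) ⬝ᵥ ψ l = 1) →
        (∀ l, S l ⊆ C l ×ˢ C l) →
        Negligible (fun l => 1 - ((S l).card : ℝ) / ((C l).card : ℝ) ^ 2) →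
        (∀ l, ∀ i ∈ C l, ∀ φ : Bits (D l).n → ℂ, star φ ⬝ᵥ φ = 1 → P l i *ᵥ φ = φ →
          (D l).prob0 i φ (s l i) = 1) →
        (∀ l, ∀ i j, (i, j) ∈ S l → (D l).prob1 i j (s l i) (s l j) (t l) = 1) →
        ∀ ε : ℕ → ℝ, Noticeable ε →
          StatClose ε
            (fun l => extractorOutput (SE ⟨l, ⌈(ε l)⁻¹⌉₊, D l⟩) (D l).k (D l).r (D l).n (ψ l))
            (fun l => experiment (C l) (P l) (t l) (ψ l)) := by
  refine ⟨extractor, isQPT_extractor, ?_⟩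
  intro D C P ψ S s t _ hC hδ hP hM hψ hS hσ h0 h1 ε hε
  have hsq : ∀ l, nsq (ψ l) = 1 := fun l => by
    rw [nsq_eq_re, ip, hψ l, Complex.one_re]
  have hX : ∀ l, Ext.Setting (SEInput.ext ⟨l, ⌈(ε l)⁻¹⌉₊, D l⟩) (C l) (P l) (S l) (s l) (t l) :=
    fun l => ⟨hP l, hM l, hS l, h0 l, h1 l⟩
  -- Where `ε l` is not positive, a trivial bound on the advantage serves as `ν l`.
  refine ⟨fun l => if 0 < ε l then
      Ext.defect (256 * (⌈(ε l)⁻¹⌉₊ * ⌈(ε l)⁻¹⌉₊ * (⌈(ε l)⁻¹⌉₊ * ⌈(ε l)⁻¹⌉₊)))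
        (1 - ((S l).card : ℝ) / ((C l).card : ℝ) ^ 2) ((D l).sampleError (C l))
      else 4 + (D l).sampleError (C l) - ε l, ?_, ?_⟩
  · refine (negligible_defect hσ hδ hε).congr ?_
    filter_upwards [hε.eventually_pos] with l hl
    rw [if_pos hl]
  · intro l E hE
    have hadv := Ext.advantage_le (I := ⟨l, ⌈(ε l)⁻¹⌉₊, D l⟩) (t := t l) (hP l) (hsq l) hE
    by_cases hl : 0 < ε l
    · have he : 0 < ⌈(ε l)⁻¹⌉₊ := Nat.ceil_pos.2 (inv_pos.2 hl)
      have hle : 1 / (⌈(ε l)⁻¹⌉₊ : ℝ) ≤ ε l := by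
        rw [one_div]
        exact inv_le_of_inv_le₀ hl (Nat.le_ceil _)
      have h := Ext.nrm_gates_sub_le_defect (hX l) (hC l) (hsq l) he
        (by change 256 * ⌈(ε l)⁻¹⌉₊ ^ 4 ≤ 256 * _; exact le_of_eq (by ring))
      exact (hadv.trans (h.trans (add_le_add hle le_rfl))).trans_eq
        (congrArg (ε l + ·) (if_pos hl).symm)
    · refine le_of_le_of_eq ?_ (congrArg (ε l + ·) (if_neg hl).symm)
      refine hadv.trans ?_
      have h := Ext.nrm_gates_sub_le_two (t := t l) (hX l).proj (hsq l)
      change _ + (D l).sampleError (C l) ≤ ε l + (4 + (D l).sampleError (C l) - ε l)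
      linarith
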